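/- Let $N\ge 3$ be odd, let $L,R\ge 0$ be integers, and put $q_0^{1/2}=e^{\pi\sqrt{-1}/N}$, $q_0=e^{2\pi\sqrt{-1}/N}$. Let $v_0,\dots,v_{N-1}$ be the standard basis of $\mathbb C^N$. For a choice of $q^{1/2}\in\mathbb C^\times$ with $q^2\neq1$ put $[m]=\frac{q^m-q^{-m}}{q-q^{-1}}$, $[m]!=\prod_{i=1}^m[i]$, and define operators on $\mathbb C^N$ by $\hat k^{1/2}v_\sigma=(q^{1/2})^{N-1-2\sigma}v_\sigma$, $\hat f v_\sigma=[\sigma+1]v_{\sigma+1}$ (with $\hat fv_{N-1}=0$), $\hat e v_\sigma=[N-\sigma]v_{\sigma-1}$ (with $\hat ev_0=0$), $\hat h v_\sigma=(N-1-2\sigma)v_\sigma$; at $q=q_0$ this is the nilpotent representation of $U_q(\mathfrak{sl}_2)$. With a subscript $i$ they act on the $i$-th factor of $V=(\mathbb C^N)^{\otimes L}$. Let $$\mathcal L_i(z)=\begin{pmatrix}q^{-1/2}(z\hat k_i^{1/2}-z^{-1}\hat k_i^{-1/2})&(q-q^{-1})\hat f_i\\(q-q^{-1})\hat e_i&q^{1/2}(z\hat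 k_i^{-1/2}-z^{-1}\hat k_i^{1/2})\end{pmatrix},\qquad \begin{pmatrix}A(z)&B(z)\\C(z)&D(z)\end{pmatrix}=\mathcal L_L(z)\cdots\mathcal L_1(z),$$ $|0\rangle=v_0\otimes\cdots\otimes v_0$ and, at $q^{1/2}=q_0^{1/2}$, $|R;\{z_i\}\rangle=B(z_1)\cdots B(z_R)|0\rangle$. Let also $A=\hat k^{1/2}\otimes\cdots\otimes\hat k^{1/2}$, $$B_\pm=q^{-\frac{L+1}2}\sum_{i=1}^Lq^{i}\,(\hat k^{\mp1/2})^{\otimes(i-1)}\otimes\hat f\otimes(\hat k^{\pm1/2})^{\otimes(L-i)},\qquad C_\pm=q^{\frac{L+1}2}\sum_{i=1}^Lq^{-i}\,(\hat k^{\pm1/2})^{\otimes(i-1)}\otimes\hat e\otimes(\hat k^{\mp1/2})^{\otimes(L-i)},$$ and consider the operators by which the Chevalley generators of the loop algebra $L(\mathfrak{sl}_2)$ act in the sector $A^2=1$ at $q=q_0$: $$H_1=-H_0=\frac1N\sum_{i=1}^L\hat h_i,\quad E_0=\lim\frac{(B_+)^N}{[N]!},\quad E_1=\lim\frac{(C_+)^N}{[N]!},\quad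 F_0=\lim\frac{(C_-)^N}{[N]!},\quad F_1=\lim\frac{(B_-)^N}{[N]!},$$ where the limits are taken as $q^{1/2}\to q_0^{1/2}$, $q^{1/2}\ne q_0^{1/2}$. A nonzero vector $\Omega$ of this sector is a highest weight vector if $E_1\Omega=F_0\Omega=0$ and $\Omega$ is an eigenvector of $H_1$ and of $(E_1)^k(E_0)^k$ and $(F_0)^k(F_1)^k$ for all $k\ge0$; its polynomial is then $P_{\mathrm D}(\xi)=\sum_{k=0}^n\lambda_k(-\xi)^k$, where $n$ and $\lambda_k$ are the eigenvalues of $H_1$ and $(E_1)^k(E_0)^k/(k!)^2$ on $\Omega$. Let $N\mid L$ and $N\mid R$, write $q=q_0$, and let $z_1,\dots,z_R\in\mathbb C$ be a regular solution of the Bethe equations, that is, the $z_i$ are nonzero, the $z_i^2$ are pairwise distinct, and for every $i$ $$\left(\frac{z_i^2q^{N-1}-1}{z_i^2-q^{N-1}}\right)^L=q^L\prod_{j\ne i}\frac{z_i^2q^2-z_j^2}{z_i^2-z_j^2q^2}$$ with nonzero denominators $z_i^2-q^{N-1}$ and $z_i^2-z_j^2q^2$ ($j\neq i$). Let $F(\xi)=\prod_{i=1}^R(1-\xi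 z_i^2)$ and define $\chi_m$ by $$\frac{(1-x^N)^L}{(1-x)^LF(xq)F(xq^{-1})}=\sum_{m=0}^\infty\chi_mx^m .$$ Then the four limits exist, $n=\frac{L(N-1)-2R}{N}$ is a nonnegative integer, and the Bethe state $|R;\{z_i\}\rangle$ is a highest weight vector with $$H_1|R;\{z_i\}\rangle=\frac{L(N-1)-2R}{N}|R;\{z_i\}\rangle,\qquad\frac{(E_1)^k(E_0)^k}{(k!)^2}|R;\{z_i\}\rangle=(-1)^k\chi_{kN}|R;\{z_i\}\rangle\quad(k\ge0).$$ Its polynomial satisfies $$P_{\mathrm D}(\xi^N)=\sum_{k=0}^{n}\chi_{kN}\xi^{kN}=\frac1N\sum_{j=0}^{N-1}\frac{(1-\xi^N)^L}{(1-\xi q^{2j})^LF(\xi q^{2j-1})F(\xi q^{2j+1})},$$ the first equality for all $\xi\in\mathbb C$ and the second wherever no denominator vanishes. -/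

import Mathlib

open Filter Topology

noncomputable section

namespace NBS

/-! Throughout, `t : ℂ` plays the role of `q^{1/2}`, so `q = t ^ 2`.  The basis vector
`v_{σ 0} ⊗ ⋯ ⊗ v_{σ (L-1)}` of `(ℂ^N)^{⊗ L}` is indexed by the spin configuration
`σ : Fin L → Fin N`, vectors are functions of `σ`, and operators are matrices in this basis. -/

/-- Spin configurations: the index set of the standard basis of `(ℂ^N)^{⊗ L}`. -/
abbrev Conf (N L : ℕ) : Type := Fin L → Fin N

/-- Operators on one copy of `ℂ^N`. -/
abbrev LocOp (N : ℕ) : Type := Matrix (Fin N) (Fin N) ℂ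

/-- Operators on `(ℂ^N)^{⊗ L}`. -/
abbrev Op (N L : ℕ) : Type := Matrix (Conf N L) (Conf N L) ℂ

/-- The tensor product `M 0 ⊗ M 1 ⊗ ⋯ ⊗ M (L-1)` of local operators. -/
def tensorOp {N L : ℕ} (M : Fin L → LocOp N) : Op N L :=
  Matrix.of fun σ σ' => ∏ i, M i (σ i) (σ' i)

/-- The local operator `a` acting on the `i`-th tensor factor. -/
def siteOp {N L : ℕ} (i : Fin L) (a : LocOp N) : Op N L :=
  tensorOp (Function.update (fun _ => 1) i a)

/-- The `q`-integer `[m] = (q^m - q^{-m}) / (q - q⁻¹)`, with `q = t ^ 2`. -/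
def qInt (t : ℂ) (m : ℕ) : ℂ :=
  ((t ^ 2) ^ m - ((t ^ 2) ^ m)⁻¹) / (t ^ 2 - (t ^ 2)⁻¹)

/-- The `q`-factorial `[m]! = [1] [2] ⋯ [m]`. -/
def qFactorial (t : ℂ) (m : ℕ) : ℂ := ∏ i ∈ Finset.Icc 1 m, qInt t i

/-! ### The `N`-dimensional representation of `U_q(sl₂)` -/

/-- `ĥ = diag (N-1, N-3, …, -N+1)`. -/
def hHat (N : ℕ) : LocOp N :=
  Matrix.diagonal fun σ => (N : ℂ) - 1 - 2 * ((σ : ℕ) : ℂ)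

/-- `k̂^{p/2} = q^{p ĥ / 2}` for an integer `p`. -/
def kHalf (N : ℕ) (t : ℂ) (p : ℤ) : LocOp N :=
  Matrix.diagonal fun σ => t ^ (p * ((N : ℤ) - 1 - 2 * ((σ : ℕ) : ℤ)))

/-- `f̂ v_σ = [σ + 1] v_{σ + 1}`, and `f̂ v_{N-1} = 0`. -/
def fHat (N : ℕ) (t : ℂ) : LocOp N :=
  Matrix.of fun τ σ => if (τ : ℕ) = (σ : ℕ) + 1 then qInt t ((σ : ℕ) + 1) else 0

/-- `ê v_σ = [N - σ] v_{σ - 1}`, and `ê v_0 = 0`.  At `q ^ N = 1` one has `[N - σ] = -[σ]`,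
and `k̂`, `ê`, `f̂` become the nilpotent representation
`k̂^{1/2} = -q^{-1/2} Z⁻¹`, `ê = X⁻¹ (Z⁻¹ - Z) / (q - q⁻¹)`, `f̂ = (Z - Z⁻¹) X / (q - q⁻¹)`. -/
def eHat (N : ℕ) (t : ℂ) : LocOp N :=
  Matrix.of fun τ σ => if (τ : ℕ) + 1 = (σ : ℕ) then qInt t (N - (σ : ℕ)) else 0

/-! ### The monodromy matrix -/

/-- The `L`-operator at site `i`. -/
def lOp (N L : ℕ) (t z : ℂ) (i : Fin L) : Matrix (Fin 2) (Fin 2) (Op N L) :=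
  !![siteOp i (t⁻¹ • (z • kHalf N t 1 - z⁻¹ • kHalf N t (-1))),
     siteOp i ((t ^ 2 - (t ^ 2)⁻¹) • fHat N t);
     siteOp i ((t ^ 2 - (t ^ 2)⁻¹) • eHat N t),
     siteOp i (t • (z • kHalf N t (-1) - z⁻¹ • kHalf N t 1))]

/-- The monodromy matrix `𝓛_L(z) ⋯ 𝓛_2(z) 𝓛_1(z)`. -/
def monodromy (N L : ℕ) (t z : ℂ) : Matrix (Fin 2) (Fin 2) (Op N L) :=
  (List.ofFn fun i : Fin L => lOp N L t z i).reverse.prod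

/-- The operator `B(z)`, the upper right entry of the monodromy matrix. -/
def opB (N L : ℕ) (t z : ℂ) : Op N L := monodromy N L t z 0 1

/-- The reference state `|0⟩ = v_0 ⊗ ⋯ ⊗ v_0`. -/
def vac (N L : ℕ) : Conf N L → ℂ := fun σ => if ∀ i, (σ i : ℕ) = 0 then 1 else 0

/-- The Bethe state `|R; {z_i}⟩ = B(z_1) ⋯ B(z_R) |0⟩`. -/
def betheState (N L : ℕ) {R : ℕ} (t : ℂ) (z : Fin R → ℂ) : Conf N L → ℂ :=
  ((List.ofFn fun i => opB N L t (z i)).prod).mulVec (vac N L)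

/-! ### The operators `A`, `B_±`, `C_±` and their divided powers at the root of unity -/

/-- `A = k̂^{1/2} ⊗ ⋯ ⊗ k̂^{1/2}`. -/
def opA (N L : ℕ) (t : ℂ) : Op N L := tensorOp fun _ => kHalf N t 1

/-- The operator `B_+` for `s = 1` and `B_-` for `s = -1`.  The sites here are numbered from `0`,
so that the power of `q^{1/2}` for the `i`-th summand is `2 (i + 1) - (L + 1)`. -/
def bInf (N L : ℕ) (s : ℤ) (t : ℂ) : Op N L :=
  ∑ i : Fin L, t ^ (2 * (((i : ℕ) : ℤ) + 1) - ((L : ℤ) + 1)) •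
    tensorOp fun j : Fin L =>
      if j < i then kHalf N t (-s) else if j = i then fHat N t else kHalf N t s

/-- The operator `C_+` for `s = 1` and `C_-` for `s = -1`. -/
def cInf (N L : ℕ) (s : ℤ) (t : ℂ) : Op N L :=
  ∑ i : Fin L, t ^ (((L : ℤ) + 1) - 2 * (((i : ℕ) : ℤ) + 1)) •
    tensorOp fun j : Fin L =>
      if j < i then kHalf N t s else if j = i then eHat N t else kHalf N t (-s)

/-- The square root `q^{1/2} = exp (π √-1 / N)` of `q = exp (2 π √-1 / N)`. -/
def rootHalf (N : ℕ) : ℂ := Complex.exp (Real.pi * Complex.I / N)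

/-- `q = exp (2 π √-1 / N)`. -/
def rootQ (N : ℕ) : ℂ := Complex.exp (2 * Real.pi * Complex.I / N)

/-- The divided power `X(q)^N / [N]!` of a family of operators, at a generic value of `q`. -/
def divPow (N L : ℕ) (X : ℂ → Op N L) (t : ℂ) : Op N L := (qFactorial t N)⁻¹ • X t ^ N

/-- The limit of `X(q)^N / [N]!` as `q` tends to the root of unity. -/
def divPowLim (N L : ℕ) (X : ℂ → Op N L) : Op N L :=
  limUnder (𝓝[≠] rootHalf N) (divPow N L X)

/-- The limit of `X(q)^N / [N]!` as `q` tends to the root of unity exists. -/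
def HasDivPowLim (N L : ℕ) (X : ℂ → Op N L) : Prop :=
  Tendsto (divPow N L X) (𝓝[≠] rootHalf N) (𝓝 (divPowLim N L X))

/-! ### The operators that represent the Chevalley generators of `L(sl₂)` -/

/-- `Ĥ_1 = H^{(N)} = (1 / N) ∑ ĥ_i`. -/
def hatH1 (N L : ℕ) : Op N L := (N : ℂ)⁻¹ • ∑ i : Fin L, siteOp i (hHat N)

/-- `Ĥ_0 = -Ĥ_1`. -/
def hatH0 (N L : ℕ) : Op N L := -hatH1 N L

/-- `Ê_0 = B_+^{(N)}`. -/
def hatE0 (N L : ℕ) : Op N L := divPowLim N L (bInf N L 1)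

/-- `Ê_1 = C_+^{(N)}`. -/
def hatE1 (N L : ℕ) : Op N L := divPowLim N L (cInf N L 1)

/-- `F̂_0 = C_-^{(N)}`. -/
def hatF0 (N L : ℕ) : Op N L := divPowLim N L (cInf N L (-1))

/-- `F̂_1 = B_-^{(N)}`. -/
def hatF1 (N L : ℕ) : Op N L := divPowLim N L (bInf N L (-1))

/-- `(Ê_1)^k (Ê_0)^k / (k!)^2`. -/
def eePow (N L k : ℕ) : Op N L :=
  (((k.factorial : ℂ) ^ 2)⁻¹) • (hatE1 N L ^ k * hatE0 N L ^ k)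

/-- Highest weight vectors in the sector `A ^ 2 = 1`. -/
structure IsHighestWeightVector (N L : ℕ) (Ω : Conf N L → ℂ) : Prop where
  ne_zero : Ω ≠ 0
  sector : (opA N L (rootHalf N) ^ 2).mulVec Ω = Ω
  e1_eq_zero : (hatE1 N L).mulVec Ω = 0
  f0_eq_zero : (hatF0 N L).mulVec Ω = 0
  h1_eigen : ∃ c : ℂ, (hatH1 N L).mulVec Ω = c • Ω
  ee_eigen : ∀ k : ℕ, ∃ c : ℂ, (hatE1 N L ^ k * hatE0 N L ^ k).mulVec Ω = c • Ω
  ff_eigen : ∀ k : ℕ, ∃ c : ℂ, (hatF0 N L ^ k * hatF1 N L ^ k).mulVec Ω = c • Ω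

/-- `P` is the polynomial `P_D(ξ) = ∑_{k=0}^n λ_k (-ξ)^k` of the vector `Ω`, where `n` and `λ_k`
are the eigenvalues of `Ĥ_1` and `(Ê_1)^k (Ê_0)^k / (k!)^2` on `Ω`. -/
def IsPD (N L : ℕ) (Ω : Conf N L → ℂ) (P : Polynomial ℂ) : Prop :=
  ∃ (n : ℕ) (lam : ℕ → ℂ),
    (hatH1 N L).mulVec Ω = (n : ℂ) • Ω ∧
    (∀ k ≤ n, (eePow N L k).mulVec Ω = lam k • Ω) ∧
    P = ∑ k ∈ Finset.range (n + 1), Polynomial.C (lam k) * (-Polynomial.X) ^ k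

/-! ### Bethe equations -/

/-- Regular solutions of the Bethe equations at `q = exp (2 π √-1 / N)`: the `z_i` are nonzero,
they are distinct as spectral parameters (only `z_i ^ 2` matters, since `B(-z) = ± B(z)`), and
they satisfy the equations, whose denominators do not vanish. -/
structure IsRegularBetheSolution (N L : ℕ) {R : ℕ} (z : Fin R → ℂ) : Prop where
  ne_zero : ∀ i, z i ≠ 0
  distinct : ∀ i j, i ≠ j → z i ^ 2 ≠ z j ^ 2
  denom_left : ∀ i, z i ^ 2 - rootQ N ^ (N - 1) ≠ 0
  denom_right : ∀ i j, i ≠ j → z i ^ 2 - z j ^ 2 * rootQ N ^ 2 ≠ 0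
  bethe : ∀ i,
    ((z i ^ 2 * rootQ N ^ (N - 1) - 1) / (z i ^ 2 - rootQ N ^ (N - 1))) ^ L =
      rootQ N ^ L * ∏ j ∈ Finset.univ.erase i,
        ((z i ^ 2 * rootQ N ^ 2 - z j ^ 2) / (z i ^ 2 - z j ^ 2 * rootQ N ^ 2))

/-- `F(ξ) = ∏ (1 - ξ z_i ^ 2)`. -/
def fFun {R : ℕ} (z : Fin R → ℂ) (ξ : ℂ) : ℂ := ∏ i, (1 - ξ * z i ^ 2)

/-- The power series `F(a x) = ∏ (1 - a z_i ^ 2 x)` in `x`. -/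
def fSeries {R : ℕ} (z : Fin R → ℂ) (a : ℂ) : PowerSeries ℂ :=
  ∏ i, (1 - PowerSeries.C (a * z i ^ 2) * PowerSeries.X)

/-- The coefficient `χ_m` of `x ^ m` in `(1 - x^N)^L / ((1 - x)^L F(x q) F(x q⁻¹))`. -/
def chi (N L : ℕ) {R : ℕ} (z : Fin R → ℂ) (m : ℕ) : ℂ :=
  PowerSeries.coeff m
    ((1 - PowerSeries.X ^ N) ^ L *
      ((1 - PowerSeries.X) ^ L * fSeries z (rootQ N) * fSeries z (rootQ N)⁻¹)⁻¹)

/-- The denominator `(1 - ξ q^{2j})^L F(ξ q^{2j-1}) F(ξ q^{2j+1})`. -/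
def pdDenom (N L : ℕ) {R : ℕ} (z : Fin R → ℂ) (ξ : ℂ) (j : ℕ) : ℂ :=
  (1 - ξ * rootQ N ^ (2 * j)) ^ L *
    fFun z (ξ * rootQ N ^ (2 * (j : ℤ) - 1)) * fFun z (ξ * rootQ N ^ (2 * (j : ℤ) + 1))

end NBS

end

noncomputable section

namespace NBS

open Finset
open Matrix (of_apply mul_apply map_apply diagonal diagonal_apply cons_val' cons_val_zero
  cons_val_one cons_val_fin_one mul_diagonal mulVec_mulVec diagonal_mul diagonal_mul_diagonal
  mulVec_smul smul_mulVec diagonal_one mulVec_diagonal transpose)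
open Function (Injective)
open List (ofFn finRange nodup_cons)
open Module (End Dual)
open Sum (inl inr)
open LinearMap (proj)
open Fin (sum_univ_two)
open Nat (choose_one_right choose_succ_succ')

local notation "M₂" => Matrix (Fin 2) (Fin 2)
local notation "M₂₂" => Matrix (Fin 2 × Fin 2) (Fin 2 × Fin 2)

/-! ### Intertwining relations of two-by-two matrices over a ring -/

section Intertwiners

variable {𝒜 : Type*} [Ring 𝒜]

/-- A `2 × 2` matrix acting on the first auxiliary space. -/
def leg1 (X : M₂ 𝒜) : M₂₂ 𝒜 := Matrix.of fun p r => if p.2 = r.2 then X p.1 r.1 else 0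

/-- A `2 × 2` matrix acting on the second auxiliary space. -/
def leg2 (X : M₂ 𝒜) : M₂₂ 𝒜 := Matrix.of fun p r => if p.1 = r.1 then X p.2 r.2 else 0

lemma leg1_mul (X Y : M₂ 𝒜) : leg1 (X * Y) = leg1 X * leg1 Y := by
  ext ⟨i, k⟩ ⟨j, l⟩
  simp only [leg1, of_apply, mul_apply, Fintype.sum_prod_type, sum_univ_two]
  grind

lemma leg2_mul (X Y : M₂ 𝒜) : leg2 (X * Y) = leg2 X * leg2 Y := by
  ext ⟨i, k⟩ ⟨j, l⟩
  simp only [leg2, of_apply, mul_apply, Fintype.sum_prod_type, sum_univ_two]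
  grind

lemma leg1_mul_leg2_comm (X Y : M₂ 𝒜)
    (h : ∀ i j k l, Commute (X i j) (Y k l)) : leg1 X * leg2 Y = leg2 Y * leg1 X := by
  ext ⟨i, k⟩ ⟨j, l⟩
  simp only [leg1, leg2, of_apply, mul_apply, Fintype.sum_prod_type, sum_univ_two]
  fin_cases i <;> fin_cases j <;> fin_cases k <;> fin_cases l <;> simp [(h _ _ _ _).eq]

variable [Algebra ℂ 𝒜]

/-- `R X₁ Y₂ = Y₂ X₁ R`. -/
def Intertwines (R : M₂₂ ℂ) (X Y : M₂ 𝒜) : Prop :=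
  R.map (algebraMap ℂ 𝒜) * leg1 X * leg2 Y = leg2 Y * leg1 X * R.map (algebraMap ℂ 𝒜)

lemma Intertwines.mul {R : M₂₂ ℂ}
    {X Y X' Y' : M₂ 𝒜} (h : Intertwines R X Y) (h' : Intertwines R X' Y')
    (h₁ : ∀ i j k l, Commute (X' i j) (Y k l)) (h₂ : ∀ i j k l, Commute (X i j) (Y' k l)) :
    Intertwines R (X * X') (Y * Y') := by
  unfold Intertwines at *
  set S : M₂₂ 𝒜 := R.map (algebraMap ℂ 𝒜)
  have e₁ := leg1_mul_leg2_comm X' Y h₁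
  have e₂ := leg1_mul_leg2_comm X Y' h₂
  calc S * leg1 (X * X') * leg2 (Y * Y') = S * leg1 X * (leg1 X' * leg2 Y) * leg2 Y' := by
        rw [leg1_mul, leg2_mul]; simp only [mul_assoc]
    _ = (S * leg1 X * leg2 Y) * leg1 X' * leg2 Y' := by rw [e₁]; simp only [mul_assoc]
    _ = leg2 Y * leg1 X * (S * leg1 X' * leg2 Y') := by rw [h]; simp only [mul_assoc]
    _ = leg2 Y * (leg1 X * leg2 Y') * leg1 X' * S := by rw [h']; simp only [mul_assoc]
    _ = leg2 (Y * Y') * leg1 (X * X') * S := by rw [e₂, leg1_mul, leg2_mul]; simp only [mul_assoc]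

lemma intertwines_one (R : M₂₂ ℂ) : Intertwines R (1 : M₂ 𝒜) 1 := by
  have h1 : leg1 (1 : M₂ 𝒜) = 1 := by
    ext ⟨i, k⟩ ⟨j, l⟩
    fin_cases i <;> fin_cases j <;> fin_cases k <;> fin_cases l <;> simp [leg1]
  have h2 : leg2 (1 : M₂ 𝒜) = 1 := by
    ext ⟨i, k⟩ ⟨j, l⟩
    fin_cases i <;> fin_cases j <;> fin_cases k <;> fin_cases l <;> simp [leg2]
  simp [Intertwines, h1, h2]

lemma intertwines_list_prod {α : Type*} (R : M₂₂ ℂ)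
    (X Y : α → M₂ 𝒜) (h : ∀ a, Intertwines R (X a) (Y a))
    (hc : ∀ a b, a ≠ b → ∀ i j k l, Commute (X a i j) (Y b k l)) (l : List α) (hl : l.Nodup) :
    Intertwines R (l.map X).prod (l.map Y).prod := by
  have key : ∀ (a : α) (l : List α), a ∉ l → ∀ i j k m,
      Commute ((l.map X).prod i j) (Y a k m) ∧ Commute (X a i j) ((l.map Y).prod k m) := by
    intro a l
    induction l with
    | nil =>
      simp_all
    | cons b l ih =>
      intro hb i j k m
      rw [List.mem_cons, not_or] at hb
      simp only [List.map_cons, List.prod_cons, mul_apply, sum_univ_two]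
      constructor
      · refine Commute.add_left ?_ ?_ <;>
          exact (hc _ _ (Ne.symm hb.1) _ _ _ _).mul_left (ih hb.2 _ _ _ _).1
      · refine Commute.add_right ?_ ?_ <;>
          exact (hc _ _ hb.1 _ _ _ _).mul_right (ih hb.2 _ _ _ _).2
  induction l with
  | nil => simpa using intertwines_one R
  | cons a l ih =>
    rw [nodup_cons] at hl
    rw [List.map_cons, List.prod_cons, List.map_cons, List.prod_cons]
    exact (h a).mul (ih hl.2) (fun i j k m => (key a l hl.1 i j k m).1)
      (fun i j k m => (key a l hl.1 i j k m).2)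

/-- A six-vertex matrix. -/
def sixVertex (a a' b b' c c' : ℂ) : M₂₂ ℂ := Matrix.of fun p r =>
    if p = r then (if p.1 = p.2 then (if p.1 = 0 then a else a') else (if p.1 = 0 then b else b'))
    else if p = (0, 1) ∧ r = (1, 0) then c else if p = (1, 0) ∧ r = (0, 1) then c' else 0

/-- The entries of the relation `R X₁ Y₂ = Y₂ X₁ R`. -/
structure SixVertexRel (a a' b b' c c' : ℂ) (X Y : M₂ 𝒜) : Prop where
  r00_00 : a • (X 0 0 * Y 0 0) = a • (Y 0 0 * X 0 0)
  r00_01 : a • (X 0 0 * Y 0 1) = b • (Y 0 1 * X 0 0) + c' • (Y 0 0 * X 0 1)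
  r00_10 : a • (X 0 1 * Y 0 0) = b' • (Y 0 0 * X 0 1) + c • (Y 0 1 * X 0 0)
  r00_11 : a • (X 0 1 * Y 0 1) = a' • (Y 0 1 * X 0 1)
  r01_00 : b • (X 0 0 * Y 1 0) + c • (X 1 0 * Y 0 0) = a • (Y 1 0 * X 0 0)
  r01_01 : b • (X 0 0 * Y 1 1) + c • (X 1 0 * Y 0 1) = b • (Y 1 1 * X 0 0) + c' • (Y 1 0 * X 0 1)
  r01_10 : b • (X 0 1 * Y 1 0) + c • (X 1 1 * Y 0 0) = b' • (Y 1 0 * X 0 1) + c • (Y 1 1 * X 0 0)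
  r01_11 : b • (X 0 1 * Y 1 1) + c • (X 1 1 * Y 0 1) = a' • (Y 1 1 * X 0 1)
  r10_00 : b' • (X 1 0 * Y 0 0) + c' • (X 0 0 * Y 1 0) = a • (Y 0 0 * X 1 0)
  r10_01 : b' • (X 1 0 * Y 0 1) + c' • (X 0 0 * Y 1 1) = b • (Y 0 1 * X 1 0) + c' • (Y 0 0 * X 1 1)
  r10_10 : b' • (X 1 1 * Y 0 0) + c' • (X 0 1 * Y 1 0) = b' • (Y 0 0 * X 1 1) + c • (Y 0 1 * X 1 0)
  r10_11 : b' • (X 1 1 * Y 0 1) + c' • (X 0 1 * Y 1 1) = a' • (Y 0 1 * X 1 1)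
  r11_00 : a' • (X 1 0 * Y 1 0) = a • (Y 1 0 * X 1 0)
  r11_01 : a' • (X 1 0 * Y 1 1) = b • (Y 1 1 * X 1 0) + c' • (Y 1 0 * X 1 1)
  r11_10 : a' • (X 1 1 * Y 1 0) = b' • (Y 1 0 * X 1 1) + c • (Y 1 1 * X 1 0)
  r11_11 : a' • (X 1 1 * Y 1 1) = a' • (Y 1 1 * X 1 1)

lemma intertwines_sixVertex_iff (a a' b b' c c' : ℂ) (X Y : M₂ 𝒜) :
    Intertwines (sixVertex a a' b b' c c') X Y ↔ SixVertexRel a a' b b' c c' X Y := by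
  have e : ∀ i k j l,
      ((sixVertex a a' b b' c c').map (algebraMap ℂ 𝒜) * leg1 X * leg2 Y) (i, k) (j, l) =
        ∑ p, ∑ r, sixVertex a a' b b' c c' (i, k) (p, r) • (X p j * Y r l) ∧
      (leg2 Y * leg1 X * (sixVertex a a' b b' c c').map (algebraMap ℂ 𝒜)) (i, k) (j, l) =
        ∑ p, ∑ r, sixVertex a a' b b' c c' (p, r) (j, l) • (Y k r * X i p) := by
    intro i k j l
    constructor
    · rw [mul_assoc]
      simp only [mul_apply, leg1, leg2, of_apply, Fintype.sum_prod_type,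
        map_apply, Algebra.smul_def, sum_univ_two]
      grind
    · simp only [mul_apply, leg1, leg2, of_apply, Fintype.sum_prod_type,
        map_apply, Algebra.smul_def, sum_univ_two, Algebra.commutes]
      grind
  constructor
  · intro h
    have e' : ∀ i k j l, ∑ p, ∑ r, sixVertex a a' b b' c c' (i, k) (p, r) • (X p j * Y r l) =
        ∑ p, ∑ r, sixVertex a a' b b' c c' (p, r) (j, l) • (Y k r * X i p) := by
      intro i k j l
      rw [← (e i k j l).1, ← (e i k j l).2, h]
    constructor
    · simpa [sixVertex] using e' 0 0 0 0
    · simpa [sixVertex] using e' 0 0 0 1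
    · have := e' 0 0 1 0; simp [sixVertex] at this; rw [this]; abel
    · simpa [sixVertex] using e' 0 0 1 1
    · simpa [sixVertex] using e' 0 1 0 0
    · simpa [sixVertex] using e' 0 1 0 1
    · have := e' 0 1 1 0; simp [sixVertex] at this; rw [this]; abel
    · simpa [sixVertex] using e' 0 1 1 1
    · have := e' 1 0 0 0; simp [sixVertex] at this; rw [← this]; abel
    · have := e' 1 0 0 1; simp [sixVertex] at this; rw [← this]; abel
    · have := e' 1 0 1 0; simp [sixVertex] at this; rw [add_comm, this]; abel
    · have := e' 1 0 1 1; simp [sixVertex] at this; rw [← this]; abel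
    · simpa [sixVertex] using e' 1 1 0 0
    · simpa [sixVertex] using e' 1 1 0 1
    · have := e' 1 1 1 0; simp [sixVertex] at this; rw [this]; abel
    · simpa [sixVertex] using e' 1 1 1 1
  · intro h
    unfold Intertwines
    ext ⟨i, k⟩ ⟨j, l⟩
    rw [(e i k j l).1, (e i k j l).2]
    fin_cases i <;> fin_cases k <;> fin_cases j <;> fin_cases l <;>
      simp [sixVertex, h.r00_00, h.r00_01, h.r00_10, h.r00_11, h.r01_00, h.r01_01, h.r01_10,
        h.r01_11, h.r11_00, h.r11_01, h.r11_10, h.r11_11]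
    · rw [add_comm]
    · rw [add_comm]
    · exact (add_comm _ _).trans h.r10_00
    · exact (add_comm _ _).trans h.r10_01
    · exact (add_comm _ _).trans (h.r10_10.trans (add_comm _ _))
    · exact (add_comm _ _).trans h.r10_11
    · rw [add_comm]

end Intertwiners

/-! ### Site matrices -/

section Site

variable {𝒜 : Type*} [Ring 𝒜] [Algebra ℂ 𝒜]

/-- The relations that make the site matrix below a solution of the intertwining relation. -/
structure SiteRel (t α β : ℂ) (k k' e f : 𝒜) : Prop where
  kk' : k * k' = 1
  k'k : k' * k = 1
  kf : k * f = (t ^ 2)⁻¹ • (f * k)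
  k'f : k' * f = t ^ 2 • (f * k')
  ke : k * e = t ^ 2 • (e * k)
  k'e : k' * e = (t ^ 2)⁻¹ • (e * k')
  ef : e * f = f * e + (t ^ 2 - (t ^ 2)⁻¹)⁻¹ • (β • (k * k) - α • (k' * k'))

/-- The site matrix in the inverse square `s` of the spectral parameter, in the gauge in which it
is a polynomial in `s`. -/
def siteMat (t α β : ℂ) (k k' e f : 𝒜) (s : ℂ) : M₂ 𝒜 :=
  !![t⁻¹ • (k - (s * α) • k'), (t ^ 2 - (t ^ 2)⁻¹) • f;
     (s * (t ^ 2 - (t ^ 2)⁻¹)) • e, t • (k' - (s * β) • k)]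

/-- The lower triangular limit of the site matrix. -/
def siteMatInf (t : ℂ) (k k' e : 𝒜) : M₂ 𝒜 := !![t⁻¹ • k, 0; (t ^ 2 - (t ^ 2)⁻¹) • e, t • k']

lemma SiteRel.sixVertexRel {t α β : ℂ} (ht : t ≠ 0) (ht2 : t ^ 2 - (t ^ 2)⁻¹ ≠ 0)
    {k k' e f : 𝒜} (h : SiteRel t α β k k' e f) (s u : ℂ) :
    SixVertexRel ((t ^ 2)⁻¹ * s - t ^ 2 * u) ((t ^ 2)⁻¹ * s - t ^ 2 * u) (s - u) (s - u)
      (-((t ^ 2 - (t ^ 2)⁻¹) * u)) (-((t ^ 2 - (t ^ 2)⁻¹) * s))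
      (siteMat t α β k k' e f s) (siteMat t α β k k' e f u) := by
  obtain ⟨c, hc⟩ : ∃ c, c = t ^ 2 - (t ^ 2)⁻¹ := ⟨_, rfl⟩
  have ht4 : t ^ 4 - 1 ≠ 0 := by grind
  constructor <;>
    simp only [siteMat, of_apply, cons_val', cons_val_zero,
      cons_val_one, cons_val_fin_one, smul_mul_assoc, mul_smul_comm, mul_sub,
      sub_mul, smul_sub, smul_add, smul_smul, h.kk', h.k'k, h.kf, h.k'f, h.ke, h.k'e, h.ef] <;>
    match_scalars <;> field_simp <;> ring

lemma SiteRel.sixVertexRel_inf {t : ℂ} (ht : t ≠ 0) (ht2 : t ^ 2 - (t ^ 2)⁻¹ ≠ 0)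
    {k k' e f : 𝒜} (h : SiteRel t 1 1 k k' e f) (u : ℂ) :
    SixVertexRel (-(t ^ 2 * u)) (-(t ^ 2 * u)) (-u) (-u) 0 (-(t ^ 2 - (t ^ 2)⁻¹))
      (siteMatInf t k k' e) (siteMat t 1 1 k k' e f u) := by
  have ht4 : t ^ 4 - 1 ≠ 0 := by grind
  constructor <;>
    simp only [siteMat, siteMatInf, of_apply, cons_val', cons_val_zero,
      cons_val_one, cons_val_fin_one, smul_mul_assoc, mul_smul_comm, mul_sub,
      sub_mul, smul_sub, smul_add, smul_smul, h.kk', h.k'k, h.kf, h.k'f, h.ke, h.k'e, h.ef,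
      zero_mul, mul_zero, smul_zero, add_zero, zero_add] <;>
    first
    | done
    | (match_scalars <;> field_simp <;> ring)

lemma SiteRel.map {ℬ : Type*} [Ring ℬ] [Algebra ℂ ℬ] (φ : 𝒜 →ₐ[ℂ] ℬ) {t α β : ℂ}
    {k k' e f : 𝒜} (h : SiteRel t α β k k' e f) : SiteRel t α β (φ k) (φ k') (φ e) (φ f) where
  kk' := by rw [← map_mul, h.kk', map_one]
  k'k := by rw [← map_mul, h.k'k, map_one]
  kf := by rw [← map_mul, h.kf, map_smul, map_mul]
  k'f := by rw [← map_mul, h.k'f, map_smul, map_mul]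
  ke := by rw [← map_mul, h.ke, map_smul, map_mul]
  k'e := by rw [← map_mul, h.k'e, map_smul, map_mul]
  ef := by
    rw [← map_mul, h.ef]
    simp_all

end Site

/-! ### Local operators on tensor products -/

lemma tensorOp_mul {N L : ℕ} (M M' : Fin L → LocOp N) :
    tensorOp M * tensorOp M' = tensorOp fun i => M i * M' i := by
  ext σ τ
  simp only [tensorOp, mul_apply, of_apply, ← prod_mul_distrib]
  rw [prod_univ_sum]
  simp

lemma tensorOp_one {N L : ℕ} : tensorOp (fun _ : Fin L => (1 : LocOp N)) = 1 := by
  ext σ τ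
  simp only [tensorOp, of_apply, Matrix.one_apply]
  by_cases h : σ = τ
  · simp [h]
  · rw [if_neg h]
    obtain ⟨i, hi⟩ := Function.ne_iff.mp h
    exact prod_eq_zero (mem_univ i) (by simp [hi])

lemma siteOp_mul_siteOp {N L : ℕ} (i : Fin L) (a b : LocOp N) :
    siteOp i a * siteOp i b = siteOp i (a * b) := by
  rw [siteOp, siteOp, siteOp, tensorOp_mul]
  congr 1
  ext1 j
  by_cases h : j = i
  · subst h; simp
  · grind

lemma siteOp_one {N L : ℕ} (i : Fin L) : siteOp i (1 : LocOp N) = 1 := by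
  rw [siteOp, Function.update_eq_self_iff.mpr rfl, tensorOp_one]

lemma siteOp_apply {N L : ℕ} (i : Fin L) (a : LocOp N) (σ τ : Conf N L) :
    siteOp i a σ τ = a (σ i) (τ i) * ∏ j ∈ univ.erase i, (1 : LocOp N) (σ j) (τ j) := by
  rw [siteOp, tensorOp, of_apply, ← mul_prod_erase _ _ (mem_univ i), Function.update_self]
  congr 1
  refine prod_congr rfl fun j hj => ?_
  rw [Function.update_of_ne (ne_of_mem_erase hj)]

/-- The embedding of the local operators at site `i`. -/
def siteHom (N : ℕ) {L : ℕ} (i : Fin L) : LocOp N →ₐ[ℂ] Op N L := AlgHom.ofLinearMap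
    { toFun := siteOp i
      map_add' := fun a b => by ext σ τ; simp only [Matrix.add_apply, siteOp_apply, add_mul]
      map_smul' := fun c a => by
        ext σ τ; simp only [Matrix.smul_apply, siteOp_apply, smul_eq_mul, RingHom.id_apply,
          mul_assoc] }
    (siteOp_one i) (fun a b => (siteOp_mul_siteOp i a b).symm)

@[simp] lemma siteHom_apply {N L : ℕ} (i : Fin L) (a : LocOp N) : siteHom N i a = siteOp i a := rfl

lemma siteOp_commute {N L : ℕ} {i j : Fin L} (hij : i ≠ j) (a b : LocOp N) :
    Commute (siteOp i a) (siteOp j b) := by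
  rw [Commute, SemiconjBy, siteOp, siteOp, tensorOp_mul, tensorOp_mul]
  congr 1
  ext1 k
  by_cases h : k = i
  · grind
  · grind

/-- The diagonal operator `q^{-σ}`, with `q = t ^ 2`, times `μ`. -/
def locK (N : ℕ) (t μ : ℂ) : LocOp N := diagonal fun σ => μ * (t ^ 2)⁻¹ ^ (σ : ℕ)

/-- The inverse of `locK`. -/
def locK' (N : ℕ) (t μ : ℂ) : LocOp N := diagonal fun σ => μ⁻¹ * (t ^ 2) ^ (σ : ℕ)

/-- The raising coefficient of a highest weight representation with weights `α`, `β`, `μ`. -/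
def locCoeff (t μ α β : ℂ) (m : ℕ) : ℂ :=
  (β * μ ^ 2 * t ^ 2 * (t ^ 2)⁻¹ ^ m - α * (μ⁻¹) ^ 2 * (t ^ 2)⁻¹ * (t ^ 2) ^ m) /
    (t ^ 2 - (t ^ 2)⁻¹)

/-- The operator `v_σ ↦ locCoeff σ v_{σ - 1}`. -/
def locE (N : ℕ) (t μ α β : ℂ) : LocOp N :=
  Matrix.of fun τ σ => if (τ : ℕ) + 1 = (σ : ℕ) then locCoeff t μ α β σ else 0

lemma siteRel_loc (N : ℕ) {t μ : ℂ} (ht : t ≠ 0) (ht2 : t ^ 2 - (t ^ 2)⁻¹ ≠ 0) (hμ : μ ≠ 0)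
    (α β : ℂ) (htop : locCoeff t μ α β N * qInt t N = 0) :
    SiteRel t α β (locK N t μ) (locK' N t μ) (locE N t μ α β) (fHat N t) where
  kk' := by
    rw [locK, locK', diagonal_mul_diagonal, ← diagonal_one]
    congr 1; ext σ; rw [inv_pow]; field_simp
  k'k := by
    rw [locK, locK', diagonal_mul_diagonal, ← diagonal_one]
    congr 1; ext σ; rw [inv_pow]; field_simp
  kf := by
    ext τ σ
    simp only [locK, fHat, diagonal_mul, Matrix.smul_apply, mul_diagonal, of_apply, smul_eq_mul]
    grind
  k'f := by
    ext τ σ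
    simp only [locK', fHat, diagonal_mul, Matrix.smul_apply, mul_diagonal, of_apply, smul_eq_mul]
    grind
  ke := by
    ext τ σ
    simp only [locK, locE, diagonal_mul, Matrix.smul_apply, mul_diagonal, of_apply, smul_eq_mul]
    split_ifs with h
    · rw [← h]; simp only [inv_pow, pow_succ _ (τ : ℕ)]; field_simp
    · simp
  k'e := by
    ext τ σ
    simp only [locK', locE, diagonal_mul, Matrix.smul_apply, mul_diagonal, of_apply, smul_eq_mul]
    split_ifs with h
    · grind
    · simp
  ef := by
    have key : ∀ n : ℕ, locCoeff t μ α β (n + 1) * qInt t (n + 1) =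
        qInt t n * locCoeff t μ α β n + (t ^ 2 - (t ^ 2)⁻¹)⁻¹ *
          (β * ((μ * (t ^ 2)⁻¹ ^ n) * (μ * (t ^ 2)⁻¹ ^ n)) -
            α * ((μ⁻¹ * (t ^ 2) ^ n) * (μ⁻¹ * (t ^ 2) ^ n))) := by
      intro n
      obtain ⟨u, hu⟩ : ∃ u, u = (t ^ 2) ^ n := ⟨_, rfl⟩
      have hu0 : u ≠ 0 := by rw [hu]; positivity
      have ht4 : t ^ 4 - 1 ≠ 0 := by grind
      simp only [locCoeff, qInt, pow_succ _ n, inv_pow (t ^ 2) n, ← hu]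
      field_simp
      ring
    have hef : ∀ τ σ : Fin N, (locE N t μ α β * fHat N t) τ σ =
        if τ = σ then locCoeff t μ α β (σ + 1) * qInt t (σ + 1) else 0 := by
      intro τ σ
      simp only [mul_apply, locE, fHat, of_apply, mul_ite, mul_zero, ite_mul, zero_mul]
      by_cases hσ : (σ : ℕ) + 1 < N
      · rw [sum_eq_single ⟨σ + 1, hσ⟩]
        · simp [Fin.ext_iff]
        · grind
        · simp
      · have hN : (σ : ℕ) + 1 = N := by omega
        rw [sum_eq_zero, hN, htop, ite_self]
        grind
    have hfe : ∀ τ σ : Fin N, (fHat N t * locE N t μ α β) τ σ =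
        if τ = σ then qInt t σ * locCoeff t μ α β σ else 0 := by
      intro τ σ
      simp only [mul_apply, locE, fHat, of_apply, mul_ite, mul_zero, ite_mul, zero_mul]
      by_cases hσ : (σ : ℕ) = 0
      · rw [sum_eq_zero]
        · simp [hσ, qInt]
        grind
      · rw [sum_eq_single ⟨σ - 1, by omega⟩]
        · grind
        · grind
        · simp
    ext τ σ
    rw [hef, Matrix.add_apply, hfe]
    simp only [locK, locK', diagonal_mul_diagonal, Matrix.smul_apply, Matrix.sub_apply,
      diagonal_apply, smul_eq_mul]
    split_ifs with h
    · grind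
    · simp

/-! ### Exchange systems -/

/-- The coefficient `f` in `A_i B_j = f B_j A_i + g B_i A_j`. -/
def fA (q s u : ℂ) : ℂ := (q⁻¹ * u - q * s) / (u - s)

/-- The coefficient `f` in `D_i B_j = f B_j D_i - g B_i D_j`. -/
def fD (q s u : ℂ) : ℂ := (q * u - q⁻¹ * s) / (u - s)

/-- The coefficient `g` in `A_i B_j = f B_j A_i + g B_i A_j`. -/
def gA (q s u : ℂ) : ℂ := (q - q⁻¹) * s / (u - s)

/-- Operators that satisfy the exchange relations of the monodromy matrix elements at the points
`s i`, with a vacuum and a dual vacuum. -/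
structure ExchangeSystem (ι V : Type*) [AddCommGroup V] [Module ℂ V] (q : ℂ) (s : ι → ℂ) where
  A : ι → End ℂ V
  B : ι → End ℂ V
  C : ι → End ℂ V
  D : ι → End ℂ V
  vac : V
  covac : Dual ℂ V
  a : ι → ℂ
  d : ι → ℂ
  AB : ∀ i j, s i ≠ s j →
    A i * B j = fA q (s i) (s j) • (B j * A i) + gA q (s i) (s j) • (B i * A j)
  DB : ∀ i j, s i ≠ s j →
    D i * B j = fD q (s i) (s j) • (B j * D i) + (-gA q (s i) (s j)) • (B i * D j)
  CA : ∀ i j, s i ≠ s j →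
    C j * A i = fA q (s i) (s j) • (A i * C j) + gA q (s i) (s j) • (A j * C i)
  CD : ∀ i j, s i ≠ s j →
    C j * D i = fD q (s i) (s j) • (D i * C j) + (-gA q (s i) (s j)) • (D j * C i)
  CB : ∀ i j, s i ≠ s j →
    C i * B j = B j * C i + ((q - q⁻¹) / (s i - s j)) • (A i * D j - A j * D i)
  CB' : ∀ i j, s i ≠ s j →
    C i * B j = B j * C i + ((q - q⁻¹) / (s j - s i)) • (D i * A j - D j * A i)
  BB : ∀ i j, B i * B j = B j * B i
  CC : ∀ i j, C i * C j = C j * C i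
  A_vac : ∀ i, A i vac = a i • vac
  D_vac : ∀ i, D i vac = d i • vac
  C_vac : ∀ i, C i vac = 0
  covac_A : ∀ i v, covac (A i v) = a i * covac v
  covac_D : ∀ i v, covac (D i v) = d i * covac v
  covac_B : ∀ i v, covac (B i v) = 0
  covac_vac : covac vac = 1

/-! ### The relations for matrices of operators -/

section Relations

variable {𝒜 : Type*} [Ring 𝒜] [Algebra ℂ 𝒜] (q : ℂ) (T : ℂ → M₂ 𝒜)

/-- The intertwining relation for a family of `2 × 2` matrices. -/
def IsRTT : Prop := ∀ s u, SixVertexRel (q⁻¹ * s - q * u) (q⁻¹ * s - q * u) (s - u) (s - u)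
      (-((q - q⁻¹) * u)) (-((q - q⁻¹) * s)) (T s) (T u)

variable {q T}

lemma IsRTT.AB (h : IsRTT q T) {s u : ℂ} (hsu : s ≠ u) :
    T s 0 0 * T u 0 1 = fA q s u • (T u 0 1 * T s 0 0) + gA q s u • (T s 0 1 * T u 0 0) := by
  have h0 : u - s ≠ 0 := sub_ne_zero.mpr hsu.symm
  have h1 := (h u s).r00_10
  have h2 : (u - s) • (T s 0 0 * T u 0 1) = (q⁻¹ * u - q * s) • (T u 0 1 * T s 0 0) +
      ((q - q⁻¹) * s) • (T s 0 1 * T u 0 0) := by rw [h1]; module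
  rw [fA, gA, div_eq_inv_mul, div_eq_inv_mul, mul_smul, mul_smul, ← smul_add, ← h2, smul_smul,
    inv_mul_cancel₀ h0, one_smul]

lemma IsRTT.DB (h : IsRTT q T) {s u : ℂ} (hsu : s ≠ u) :
    T s 1 1 * T u 0 1 = fD q s u • (T u 0 1 * T s 1 1) + (-gA q s u) • (T s 0 1 * T u 1 1) := by
  have h0 : u - s ≠ 0 := sub_ne_zero.mpr hsu.symm
  have h1 := (h s u).r10_11
  have h2 : (u - s) • (T s 1 1 * T u 0 1) = (q * u - q⁻¹ * s) • (T u 0 1 * T s 1 1) +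
      (-((q - q⁻¹) * s)) • (T s 0 1 * T u 1 1) := by
    have h3 : (q * u - q⁻¹ * s) • (T u 0 1 * T s 1 1) =
      -((q⁻¹ * s - q * u) • (T u 0 1 * T s 1 1)) := by module
    rw [h3, ← h1]; module
  rw [fD, gA, div_eq_inv_mul, div_eq_inv_mul, ← mul_neg, mul_smul, mul_smul, ← smul_add, ← h2,
    smul_smul, inv_mul_cancel₀ h0, one_smul]

lemma IsRTT.CA (h : IsRTT q T) {s u : ℂ} (hsu : s ≠ u) (hs : s ≠ 0) (hu : u ≠ 0) :
    (u⁻¹ • T u 1 0) * T s 0 0 = fA q s u • (T s 0 0 * (u⁻¹ • T u 1 0)) +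
      gA q s u • (T u 0 0 * (s⁻¹ • T s 1 0)) := by
  have h0 : u - s ≠ 0 := sub_ne_zero.mpr hsu.symm
  have h1 := (h u s).r10_00
  have h2 : (u - s) • (T u 1 0 * T s 0 0) = (q⁻¹ * u - q * s) • (T s 0 0 * T u 1 0) +
      ((q - q⁻¹) * u) • (T u 0 0 * T s 1 0) := by rw [← h1]; module
  have h3 : T u 1 0 * T s 0 0 = (u - s)⁻¹ • ((u - s) • (T u 1 0 * T s 0 0)) := by
    rw [smul_smul, inv_mul_cancel₀ h0, one_smul]
  rw [smul_mul_assoc, h3, h2, fA, gA, mul_smul_comm, mul_smul_comm]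
  match_scalars <;> field_simp

lemma IsRTT.CD (h : IsRTT q T) {s u : ℂ} (hsu : s ≠ u) (hs : s ≠ 0) (hu : u ≠ 0) :
    (u⁻¹ • T u 1 0) * T s 1 1 = fD q s u • (T s 1 1 * (u⁻¹ • T u 1 0)) +
      (-gA q s u) • (T u 1 1 * (s⁻¹ • T s 1 0)) := by
  have h0 : u - s ≠ 0 := sub_ne_zero.mpr hsu.symm
  have h1 := (h s u).r11_10
  have h2 : (u - s) • (T u 1 0 * T s 1 1) = (q * u - q⁻¹ * s) • (T s 1 1 * T u 1 0) +
      (-((q - q⁻¹) * u)) • (T u 1 1 * T s 1 0) := by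
    have h3 : (q * u - q⁻¹ * s) • (T s 1 1 * T u 1 0) =
      -((q⁻¹ * s - q * u) • (T s 1 1 * T u 1 0)) := by module
    rw [h3, h1]; module
  have h3 : T u 1 0 * T s 1 1 = (u - s)⁻¹ • ((u - s) • (T u 1 0 * T s 1 1)) := by
    rw [smul_smul, inv_mul_cancel₀ h0, one_smul]
  rw [smul_mul_assoc, h3, h2, fD, gA, mul_smul_comm, mul_smul_comm]
  match_scalars <;> field_simp

lemma IsRTT.CB (h : IsRTT q T) {s u : ℂ} (hsu : s ≠ u) (hs : s ≠ 0) :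
    (s⁻¹ • T s 1 0) * T u 0 1 = T u 0 1 * (s⁻¹ • T s 1 0) +
      ((q - q⁻¹) / (s - u)) • (T s 0 0 * T u 1 1 - T u 0 0 * T s 1 1) := by
  have h0 : s - u ≠ 0 := sub_ne_zero.mpr hsu
  have h1 := (h s u).r10_01
  have h2 : (s - u) • (T s 1 0 * T u 0 1) = (s - u) • (T u 0 1 * T s 1 0) +
      ((q - q⁻¹) * s) • (T s 0 0 * T u 1 1 - T u 0 0 * T s 1 1) := by
    rw [eq_sub_of_add_eq h1]; module
  have h3 : T s 1 0 * T u 0 1 = (s - u)⁻¹ • ((s - u) • (T s 1 0 * T u 0 1)) := by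
    rw [smul_smul, inv_mul_cancel₀ h0, one_smul]
  rw [smul_mul_assoc, h3, h2, mul_smul_comm]
  match_scalars <;> field_simp

lemma IsRTT.CB' (h : IsRTT q T) {s u : ℂ} (hsu : s ≠ u) (hs : s ≠ 0) :
    (s⁻¹ • T s 1 0) * T u 0 1 = T u 0 1 * (s⁻¹ • T s 1 0) +
      ((q - q⁻¹) / (u - s)) • (T s 1 1 * T u 0 0 - T u 1 1 * T s 0 0) := by
  have h0 : u - s ≠ 0 := sub_ne_zero.mpr hsu.symm
  have h1 := (h u s).r01_10
  have h2 : (u - s) • (T s 1 0 * T u 0 1) = (u - s) • (T u 0 1 * T s 1 0) +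
      ((q - q⁻¹) * s) • (T s 1 1 * T u 0 0 - T u 1 1 * T s 0 0) := by
    rw [eq_sub_of_add_eq h1]; module
  have h3 : T s 1 0 * T u 0 1 = (u - s)⁻¹ • ((u - s) • (T s 1 0 * T u 0 1)) := by
    rw [smul_smul, inv_mul_cancel₀ h0, one_smul]
  rw [smul_mul_assoc, h3, h2, mul_smul_comm]
  match_scalars <;> field_simp

lemma IsRTT.comm_aux (hq : q ≠ 0) (hq4 : q ^ 4 ≠ 1) {X : ℂ → 𝒜}
    (h : ∀ s u, (q⁻¹ * s - q * u) • (X s * X u) = (q⁻¹ * s - q * u) • (X u * X s)) (s u : ℂ) :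
    X s * X u = X u * X s := by
  by_cases h1 : q⁻¹ * s - q * u = 0
  · by_cases h2 : q⁻¹ * u - q * s = 0
    · grind
    · exact (smul_right_injective _ h2 (h u s)).symm
  · exact smul_right_injective _ h1 (h s u)

lemma IsRTT.BB (h : IsRTT q T) (hq : q ≠ 0) (hq4 : q ^ 4 ≠ 1) (s u : ℂ) :
    T s 0 1 * T u 0 1 = T u 0 1 * T s 0 1 :=
  IsRTT.comm_aux hq hq4 (X := fun s => T s 0 1) (fun s u => (h s u).r00_11) s u

lemma IsRTT.CC (h : IsRTT q T) (hq : q ≠ 0) (hq4 : q ^ 4 ≠ 1) (s u : ℂ) :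
    T s 1 0 * T u 1 0 = T u 1 0 * T s 1 0 :=
  IsRTT.comm_aux hq hq4 (X := fun s => T s 1 0) (fun s u => (h s u).r11_00) s u

end Relations

/-! ### Triangular action on a vacuum -/

section Vacuum

variable {V : Type*} [AddCommGroup V] [Module ℂ V]

/-- A `2 × 2` matrix of operators that is triangular on `v` and on `ℓ`. -/
structure IsTriangular (v : V) (ℓ : Dual ℂ V) (a d : ℂ)
    (X : M₂ (End ℂ V)) : Prop where
  v00 : X 0 0 v = a • v
  v11 : X 1 1 v = d • v
  v10 : X 1 0 v = 0
  l00 : ∀ w, ℓ (X 0 0 w) = a * ℓ w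
  l11 : ∀ w, ℓ (X 1 1 w) = d * ℓ w
  l01 : ∀ w, ℓ (X 0 1 w) = 0

lemma IsTriangular.mul {v : V} {ℓ : Dual ℂ V} {a d a' d' : ℂ}
    {X Y : M₂ (End ℂ V)} (h : IsTriangular v ℓ a d X)
    (h' : IsTriangular v ℓ a' d' Y) (hc : Commute (X 1 0) (Y 0 1)) :
    IsTriangular v ℓ (a * a') (d * d') (X * Y) := by
  have hc' : ∀ w, X 1 0 (Y 0 1 w) = Y 0 1 (X 1 0 w) := fun w => LinearMap.congr_fun hc.eq w
  constructor <;> intros <;>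
    simp [mul_apply, sum_univ_two, h.v00, h.v11, h.v10, h.l00, h.l11, h.l01, h'.v00,
      h'.v11, h'.v10, h'.l00, h'.l11, h'.l01, hc', smul_smul, mul_comm, mul_assoc]

lemma isTriangular_list_prod {α : Type*} {v : V} {ℓ : Dual ℂ V} {a d : α → ℂ}
    {X : α → M₂ (End ℂ V)} (h : ∀ i, IsTriangular v ℓ (a i) (d i) (X i))
    (hc : ∀ i j, i ≠ j → ∀ m n m' n', Commute (X i m n) (X j m' n')) (l : List α) (hl : l.Nodup) :
    IsTriangular v ℓ (l.map a).prod (l.map d).prod (l.map X).prod := by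
  have key : ∀ (i : α) (l : List α), i ∉ l → ∀ m n m' n',
      Commute (X i m n) ((l.map X).prod m' n') := by
    intro i l
    induction l with
    | nil =>
      simp_all
    | cons b l ih =>
      intro hb m n m' n'
      rw [List.mem_cons, not_or] at hb
      simp only [List.map_cons, List.prod_cons, mul_apply, sum_univ_two]
      refine Commute.add_right ?_ ?_ <;>
        exact (hc _ _ hb.1 _ _ _ _).mul_right (ih hb.2 _ _ _ _)
  induction l with
  | nil => constructor <;> simp
  | cons i l ih =>
    rw [nodup_cons] at hl
    rw [List.map_cons, List.prod_cons, List.map_cons, List.prod_cons, List.map_cons, List.prod_cons]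
    exact (h i).mul (ih hl.2) (key i l hl.1 _ _ _ _)

end Vacuum

/-! ### The action of the exchange operators on off-shell vectors -/

lemma fA_inv (q s u : ℂ) : fA q⁻¹ s u = fD q s u := by rw [fA, fD, inv_inv]

lemma gA_inv (q s u : ℂ) : gA q⁻¹ s u = -gA q s u := by rw [gA, gA, inv_inv]; ring

lemma fA_mul_gA_add {q s u w : ℂ} (h1 : s ≠ u) (h2 : s ≠ w) (h3 : u ≠ w) (hq : q ≠ 0) :
    fA q s u * gA q s w + gA q s u * gA q u w = gA q s w * fA q w u := by
  have e1 : u - s ≠ 0 := sub_ne_zero.mpr h1.symm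
  have e2 : w - s ≠ 0 := sub_ne_zero.mpr h2.symm
  have e3 : w - u ≠ 0 := sub_ne_zero.mpr h3.symm
  have e4 : u - w ≠ 0 := sub_ne_zero.mpr h3
  rw [fA, gA, gA, gA, fA]
  field_simp
  ring

section Action

variable {ι V : Type*} [DecidableEq ι] [AddCommGroup V] [Module ℂ V]

lemma exchange_action {q : ℂ} (hq : q ≠ 0) {s : ι → ℂ} (hs : Injective s)
    {X B : ι → End ℂ V} {x : ι → ℂ} {Ψ : Finset ι → V}
    (hΨ : ∀ I, ∀ i ∉ I, Ψ (insert i I) = B i (Ψ I)) (hB : ∀ i j v, B i (B j v) = B j (B i v))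
    (h0 : ∀ i, X i (Ψ ∅) = x i • Ψ ∅)
    (hXB : ∀ i j, i ≠ j →
      X i * B j = fA q (s i) (s j) • (B j * X i) + gA q (s i) (s j) • (B i * X j))
    (I : Finset ι) : ∀ i ∉ I, X i (Ψ I) = (x i * ∏ k ∈ I, fA q (s i) (s k)) • Ψ I +
      ∑ j ∈ I, (gA q (s i) (s j) * (x j * ∏ k ∈ I.erase j, fA q (s j) (s k))) •
        B i (Ψ (I.erase j)) := by
  induction I using Finset.induction_on with
  | empty => intro i _; simp [h0]
  | insert b I hb ih =>
    intro i hi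
    rw [mem_insert, not_or] at hi
    have e1 : X i (Ψ (insert b I)) = fA q (s i) (s b) • B b (X i (Ψ I)) +
        gA q (s i) (s b) • B i (X b (Ψ I)) := by
      rw [hΨ I b hb]
      exact LinearMap.congr_fun (hXB i b hi.1) (Ψ I)
    have e2 : ∀ j ∈ I, (insert b I).erase j = insert b (I.erase j) := fun j hj =>
      erase_insert_of_ne (fun h => hb (h ▸ hj))
    have e3 : ∀ j ∈ I, b ∉ I.erase j := fun j _ h => hb (mem_of_mem_erase h)
    rw [e1, ih i hi.2, ih b hb, sum_insert hb, erase_insert hb, prod_insert hb]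
    have e4 : ∀ j ∈ I, (gA q (s i) (s j) * (x j * ∏ k ∈ (insert b I).erase j, fA q (s j) (s k))) •
        B i (Ψ ((insert b I).erase j)) =
        fA q (s i) (s b) • B b ((gA q (s i) (s j) * (x j * ∏ k ∈ I.erase j, fA q (s j) (s k))) •
          B i (Ψ (I.erase j))) + gA q (s i) (s b) • B i
          ((gA q (s b) (s j) * (x j * ∏ k ∈ I.erase j, fA q (s j) (s k))) •
            B b (Ψ (I.erase j))) := by
      intro j hj
      rw [e2 j hj, hΨ _ _ (e3 j hj), prod_insert (e3 j hj), map_smul, map_smul, hB b i,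
        smul_smul, smul_smul, ← add_smul]
      congr 1
      have := fA_mul_gA_add (hs.ne hi.1) (hs.ne fun h => hi.2 (h ▸ hj))
        (hs.ne fun h => hb (h ▸ hj)) hq (w := s j)
      linear_combination - (x j * ∏ k ∈ I.erase j, fA q (s j) (s k)) * this
    rw [sum_congr rfl e4, sum_add_distrib]
    simp only [map_add, map_sum, map_smul, smul_add, smul_sum, hΨ I b hb]
    module

end Action

namespace ExchangeSystem

variable {ι V : Type*} [AddCommGroup V] [Module ℂ V] {q : ℂ} {s : ι → ℂ}
  (E : ExchangeSystem ι V q s)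

lemma pairwise_B (I : Set ι) : I.Pairwise (Function.onFun Commute E.B) := fun i _ j _ _ => E.BB i j

lemma pairwise_C (I : Set ι) : I.Pairwise (Function.onFun Commute E.C) := fun i _ j _ _ => E.CC i j

/-- The off-shell vector `∏ B_i |0⟩`. -/
def bvec (I : Finset ι) : V := I.noncommProd E.B (E.pairwise_B I) E.vac

@[simp] lemma bvec_empty : E.bvec ∅ = E.vac := by simp [bvec]

/-- The operator `∏ C_i`. -/
def cop (I : Finset ι) : End ℂ V := I.noncommProd E.C (E.pairwise_C I)

@[simp] lemma cop_empty : E.cop ∅ = 1 := by simp [cop]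

lemma B_comm (i j : ι) (v : V) :
    E.B i (E.B j v) = E.B j (E.B i v) := LinearMap.congr_fun (E.BB i j) v

/-- The dual exchange system, with transposed operators. -/
def dual : ExchangeSystem ι (Dual ℂ V) q s where
  A i := (E.A i).dualMap
  B i := (E.C i).dualMap
  C i := (E.B i).dualMap
  D i := (E.D i).dualMap
  vac := E.covac
  covac := Dual.eval ℂ V E.vac
  a := E.a
  d := E.d
  AB i j h := by
    ext φ v
    have := congrArg φ (LinearMap.congr_fun (E.CA i j h) v)
    simpa using this
  DB i j h := by
    ext φ v
    have := congrArg φ (LinearMap.congr_fun (E.CD i j h) v)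
    simpa using this
  CA i j h := by
    ext φ v
    have := congrArg φ (LinearMap.congr_fun (E.AB i j h) v)
    simpa using this
  CD i j h := by
    ext φ v
    have := congrArg φ (LinearMap.congr_fun (E.DB i j h) v)
    simpa using this
  CB i j h := by
    ext φ v
    have := congrArg φ (LinearMap.congr_fun (E.CB' j i h.symm) v)
    simpa using this
  CB' i j h := by
    ext φ v
    have := congrArg φ (LinearMap.congr_fun (E.CB j i h.symm) v)
    simpa using this
  BB i j := by
    ext φ v
    have := congrArg φ (LinearMap.congr_fun (E.CC j i) v)
    simpa using this
  CC i j := by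
    ext φ v
    have := congrArg φ (LinearMap.congr_fun (E.BB j i) v)
    simpa using this
  A_vac i := by ext v; simp [E.covac_A]
  D_vac i := by ext v; simp [E.covac_D]
  C_vac i := by ext v; simp [E.covac_B]
  covac_A i φ := by simp [E.A_vac]
  covac_D i φ := by simp [E.D_vac]
  covac_B i φ := by simp [E.C_vac]
  covac_vac := by simp [E.covac_vac]

/-! #### Universality of scalar products -/

/-- The span of the off-shell vectors on subsets of `T`. -/
def bspan (T : Finset ι) : Submodule ℂ V := Submodule.span ℂ (E.bvec '' {K | K ⊆ T})

lemma bspan_mono {T T' : Finset ι} (h : T ⊆ T') : E.bspan T ≤ E.bspan T' :=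
  Submodule.span_mono (Set.image_mono fun _ hK => hK.trans h)

lemma bvec_mem_bspan {K T : Finset ι} (h : K ⊆ T) :
    E.bvec K ∈ E.bspan T := Submodule.subset_span ⟨K, h, rfl⟩

lemma map_mem_bspan {T T' : Finset ι} {X : End ℂ V}
    (h : ∀ K ⊆ T, X (E.bvec K) ∈ E.bspan T') {v : V} (hv : v ∈ E.bspan T) :
    X v ∈ E.bspan T' := by
  have : E.bspan T ≤ (E.bspan T').comap X := by
    rw [bspan, Submodule.span_le]
    rintro _ ⟨K, hK, rfl⟩
    exact h K hK
  exact this hv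

variable [DecidableEq ι]

lemma bvec_insert (I : Finset ι) (i : ι) (hi : i ∉ I) : E.bvec (insert i I) = E.B i (E.bvec I) := by
  rw [bvec, noncommProd_insert_of_notMem _ _ _ _ hi]; rfl

lemma cop_insert (I : Finset ι) (i : ι) (hi : i ∉ I) : E.cop (insert i I) = E.C i * E.cop I := by
  rw [cop, noncommProd_insert_of_notMem _ _ _ _ hi]; rfl

lemma cop_insert' (I : Finset ι) (i : ι) (hi : i ∉ I) : E.cop (insert i I) = E.cop I * E.C i := by
  rw [cop, noncommProd_insert_of_notMem' _ _ _ _ hi]; rfl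

lemma dual_bvec_apply (I : Finset ι) (v : V) : E.dual.bvec I v = E.covac (E.cop I v) := by
  induction I using Finset.induction_on generalizing v with
  | empty => simp; rfl
  | insert i I hi ih =>
    rw [bvec_insert _ _ _ hi, cop_insert' _ _ _ hi]
    exact ih (E.C i v)

lemma A_bvec (hq : q ≠ 0) (hs : Injective s) {I : Finset ι} {i : ι} (hi : i ∉ I) :
    E.A i (E.bvec I) = (E.a i * ∏ k ∈ I, fA q (s i) (s k)) • E.bvec I +
      ∑ j ∈ I, (gA q (s i) (s j) * (E.a j * ∏ k ∈ I.erase j, fA q (s j) (s k))) •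
        E.B i (E.bvec (I.erase j)) :=
  exchange_action hq hs E.bvec_insert E.B_comm (by simp [E.A_vac])
    (fun i j hij => E.AB i j (hs.ne hij)) I i hi

lemma D_bvec (hq : q ≠ 0) (hs : Injective s) {I : Finset ι} {i : ι} (hi : i ∉ I) :
    E.D i (E.bvec I) = (E.d i * ∏ k ∈ I, fD q (s i) (s k)) • E.bvec I +
      ∑ j ∈ I, ((-gA q (s i) (s j)) * (E.d j * ∏ k ∈ I.erase j, fD q (s j) (s k))) •
        E.B i (E.bvec (I.erase j)) := by
  have := exchange_action (inv_ne_zero hq) hs E.bvec_insert E.B_comm (X := E.D) (x := E.d)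
    (by simp [E.D_vac]) (fun i j hij => by rw [fA_inv, gA_inv]; exact E.DB i j (hs.ne hij)) I i hi
  simpa only [fA_inv, gA_inv] using this

lemma B_mem_bspan {T : Finset ι} {i : ι} (hi : i ∉ T) {v : V}
    (hv : v ∈ E.bspan T) : E.B i v ∈ E.bspan (insert i T) := by
  refine E.map_mem_bspan (fun K hK => ?_) hv
  rw [← E.bvec_insert K i fun h => hi (hK h)]
  exact E.bvec_mem_bspan (insert_subset_insert i hK)

lemma A_mem_bspan (hq : q ≠ 0) (hs : Injective s)
    {T : Finset ι} {i : ι} (hi : i ∉ T) {v : V} (hv : v ∈ E.bspan T) :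
    E.A i v ∈ E.bspan (insert i T) := by
  refine E.map_mem_bspan (fun K hK => ?_) hv
  have hiK : i ∉ K := fun h => hi (hK h)
  rw [E.A_bvec hq hs hiK]
  refine add_mem (Submodule.smul_mem _ _ (E.bvec_mem_bspan (hK.trans (subset_insert _ _))))
    (Submodule.sum_mem _ fun j _ => Submodule.smul_mem _ _ (E.B_mem_bspan hi
      (E.bvec_mem_bspan ((erase_subset _ _).trans hK))))

lemma D_mem_bspan (hq : q ≠ 0) (hs : Injective s)
    {T : Finset ι} {i : ι} (hi : i ∉ T) {v : V} (hv : v ∈ E.bspan T) :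
    E.D i v ∈ E.bspan (insert i T) := by
  refine E.map_mem_bspan (fun K hK => ?_) hv
  have hiK : i ∉ K := fun h => hi (hK h)
  rw [E.D_bvec hq hs hiK]
  refine add_mem (Submodule.smul_mem _ _ (E.bvec_mem_bspan (hK.trans (subset_insert _ _))))
    (Submodule.sum_mem _ fun j _ => Submodule.smul_mem _ _ (E.B_mem_bspan hi
      (E.bvec_mem_bspan ((erase_subset _ _).trans hK))))

lemma C_bvec_mem_bspan (hq : q ≠ 0) (hs : Injective s)
    {K : Finset ι} {i : ι} (hi : i ∉ K) : E.C i (E.bvec K) ∈ E.bspan (insert i K) := by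
  induction K using Finset.induction_on with
  | empty => simp [E.C_vac]
  | insert j K hj ih =>
    rw [mem_insert, not_or] at hi
    have e : E.C i (E.bvec (insert j K)) = E.B j (E.C i (E.bvec K)) + ((q - q⁻¹) / (s i - s j)) •
        (E.A i (E.D j (E.bvec K)) - E.A j (E.D i (E.bvec K))) := by
      rw [E.bvec_insert K j hj]
      exact LinearMap.congr_fun (E.CB i j (hs.ne hi.1)) (E.bvec K)
    have hK := E.bvec_mem_bspan (subset_refl K)
    have hij : i ∉ insert j K := by simp [hi]
    have hji : j ∉ insert i K := by simp [hj, Ne.symm hi.1]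
    rw [e, insert_comm]
    refine add_mem (E.B_mem_bspan hji (ih hi.2)) (Submodule.smul_mem _ _ (sub_mem ?_ ?_))
    · rw [insert_comm]
      exact E.A_mem_bspan hq hs hij (E.D_mem_bspan hq hs hj hK)
    · exact E.A_mem_bspan hq hs hji (E.D_mem_bspan hq hs hi.2 hK)

lemma cop_mem_bspan (hq : q ≠ 0) (hs : Injective s)
    {T J : Finset ι} (hTJ : Disjoint J T) {v : V} (hv : v ∈ E.bspan T) :
    E.cop J v ∈ E.bspan (J ∪ T) := by
  induction J using Finset.induction_on with
  | empty => simpa using hv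
  | insert j J hj ih =>
    rw [disjoint_insert_left] at hTJ
    rw [E.cop_insert J j hj, insert_union, End.mul_apply]
    refine E.map_mem_bspan (T := J ∪ T) (fun K hK => ?_) (ih hTJ.2)
    have hjK : j ∉ K := fun h => by grind
    exact E.bspan_mono (insert_subset_insert j hK) (E.C_bvec_mem_bspan hq hs hjK)

lemma eq_zero_of_mem_bspan {ℓ : Dual ℂ V}
    (h0 : ℓ E.vac = 0) (hB : ∀ i v, ℓ (E.B i v) = 0) {T : Finset ι} {v : V}
    (hv : v ∈ E.bspan T) : ℓ v = 0 := by
  have : E.bspan T ≤ LinearMap.ker ℓ := by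
    rw [bspan, Submodule.span_le]
    rintro _ ⟨K, -, rfl⟩
    rcases K.eq_empty_or_nonempty with rfl | ⟨i, hi⟩
    · simpa using h0
    · rw [← insert_erase hi, E.bvec_insert _ _ (notMem_erase i K)]
      exact hB _ _
  exact this hv

/-- The direct sum of two exchange systems with the same vacuum eigenvalues. -/
def prod {V' : Type*} [AddCommGroup V'] [Module ℂ V'] (E : ExchangeSystem ι V q s)
    (E' : ExchangeSystem ι V' q s) (ha : E.a = E'.a) (hd : E.d = E'.d) :
    ExchangeSystem ι (V × V') q s where
  A i := (E.A i).prodMap (E'.A i)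
  B i := (E.B i).prodMap (E'.B i)
  C i := (E.C i).prodMap (E'.C i)
  D i := (E.D i).prodMap (E'.D i)
  vac := (E.vac, E'.vac)
  covac := E.covac ∘ₗ LinearMap.fst ℂ V V'
  a := E.a
  d := E.d
  AB i j h := LinearMap.ext fun v => Prod.ext (LinearMap.congr_fun (E.AB i j h) v.1)
    (LinearMap.congr_fun (E'.AB i j h) v.2)
  DB i j h := LinearMap.ext fun v => Prod.ext (LinearMap.congr_fun (E.DB i j h) v.1)
    (LinearMap.congr_fun (E'.DB i j h) v.2)
  CA i j h := LinearMap.ext fun v => Prod.ext (LinearMap.congr_fun (E.CA i j h) v.1)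
    (LinearMap.congr_fun (E'.CA i j h) v.2)
  CD i j h := LinearMap.ext fun v => Prod.ext (LinearMap.congr_fun (E.CD i j h) v.1)
    (LinearMap.congr_fun (E'.CD i j h) v.2)
  CB i j h := LinearMap.ext fun v => Prod.ext (LinearMap.congr_fun (E.CB i j h) v.1)
    (LinearMap.congr_fun (E'.CB i j h) v.2)
  CB' i j h := LinearMap.ext fun v => Prod.ext (LinearMap.congr_fun (E.CB' i j h) v.1)
    (LinearMap.congr_fun (E'.CB' i j h) v.2)
  BB i j := LinearMap.ext fun v => Prod.ext (LinearMap.congr_fun (E.BB i j) v.1)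
    (LinearMap.congr_fun (E'.BB i j) v.2)
  CC i j := LinearMap.ext fun v => Prod.ext (LinearMap.congr_fun (E.CC i j) v.1)
    (LinearMap.congr_fun (E'.CC i j) v.2)
  A_vac i := Prod.ext (E.A_vac i) ((E'.A_vac i).trans (by rw [ha]; rfl))
  D_vac i := Prod.ext (E.D_vac i) ((E'.D_vac i).trans (by rw [hd]; rfl))
  C_vac i := Prod.ext (E.C_vac i) (E'.C_vac i)
  covac_A i v := E.covac_A i v.1
  covac_D i v := E.covac_D i v.1
  covac_B i v := E.covac_B i v.1
  covac_vac := E.covac_vac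

lemma scalar_product_congr {V' : Type*} [AddCommGroup V'] [Module ℂ V']
    (E : ExchangeSystem ι V q s) (E' : ExchangeSystem ι V' q s) (ha : E.a = E'.a)
    (hd : E.d = E'.d) (hq : q ≠ 0) (hs : Injective s) {I J : Finset ι}
    (hIJ : Disjoint J I) :
    E.covac (E.cop J (E.bvec I)) = E'.covac (E'.cop J (E'.bvec I)) := by
  set F := E.prod E' ha hd with hF
  have h1 : ∀ I, F.bvec I = (E.bvec I, E'.bvec I) := by
    intro I
    induction I using Finset.induction_on with
    | empty => simp; rfl
    | insert i I hi ih =>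
      rw [bvec_insert _ _ _ hi, bvec_insert _ _ _ hi, bvec_insert _ _ _ hi, ih]; rfl
  have h2 : ∀ J v, F.cop J v = (E.cop J v.1, E'.cop J v.2) := by
    intro J
    induction J using Finset.induction_on with
    | empty => intro v; simp
    | insert i I hi ih =>
      intro v
      rw [cop_insert _ _ _ hi, cop_insert _ _ _ hi, cop_insert _ _ _ hi, End.mul_apply, ih]; rfl
  set ℓ : Dual ℂ (V × V') := E.covac ∘ₗ LinearMap.fst ℂ V V' - E'.covac ∘ₗ LinearMap.snd ℂ V V'
  have := F.eq_zero_of_mem_bspan (ℓ := ℓ)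
    (by change E.covac E.vac - E'.covac E'.vac = 0; rw [E.covac_vac, E'.covac_vac, sub_self])
    (fun i v => by
      change E.covac (E.B i v.1) - E'.covac (E'.B i v.2) = 0
      rw [E.covac_B, E'.covac_B, sub_self])
    (F.cop_mem_bspan hq hs hIJ (F.bvec_mem_bspan (subset_refl I)))
  rw [h1, h2] at this
  exact sub_eq_zero.mp this

/-! #### Domain wall evaluation -/

lemma C_bvec_of_a_eq_zero (hq : q ≠ 0) (hs : Injective s)
    {p : ι} {I : Finset ι} (hp : p ∉ I) (ha : ∀ i ∈ I, E.a i = 0) :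
    E.C p (E.bvec I) = ∑ j ∈ I, (-((q - q⁻¹) / (s j - s p)) * E.a p * E.d j *
      ∏ k ∈ I.erase j, (fA q (s p) (s k) * fD q (s j) (s k))) • E.bvec (I.erase j) := by
  induction I using Finset.induction_on with
  | empty => simp [E.C_vac]
  | insert i I hi ih =>
    rw [mem_insert, not_or] at hp
    have ha' : ∀ j ∈ I, E.a j = 0 := fun j hj => ha j (mem_insert_of_mem hj)
    have hai : E.a i = 0 := ha i (mem_insert_self i I)
    have hA : ∀ b ∉ I, E.A b (E.bvec I) = (E.a b * ∏ k ∈ I, fA q (s b) (s k)) • E.bvec I := by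
      intro b hb
      rw [E.A_bvec hq hs hb, add_eq_left]
      simp_all
    have e1 : E.C p (E.bvec (insert i I)) = E.B i (E.C p (E.bvec I)) +
        ((q - q⁻¹) / (s i - s p)) • (E.D p (E.A i (E.bvec I)) - E.D i (E.A p (E.bvec I))) := by
      rw [E.bvec_insert I i hi]
      exact LinearMap.congr_fun (E.CB' p i (hs.ne hp.1)) (E.bvec I)
    have e2 : ∀ j ∈ I, (insert i I).erase j = insert i (I.erase j) := fun j hj =>
      erase_insert_of_ne (fun h => hi (h ▸ hj))
    have e3 : ∀ j ∈ I, i ∉ I.erase j := fun j _ h => hi (mem_of_mem_erase h)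
    rw [e1, hA i hi, hA p hp.2, hai, map_smul, map_smul, E.D_bvec hq hs hi, ih hp.2 ha',
      sum_insert hi, erase_insert hi]
    have e4 : ∀ j ∈ I, (-((q - q⁻¹) / (s j - s p)) * E.a p * E.d j *
        ∏ k ∈ (insert i I).erase j, (fA q (s p) (s k) * fD q (s j) (s k))) •
          E.bvec ((insert i I).erase j) =
        E.B i ((-((q - q⁻¹) / (s j - s p)) * E.a p * E.d j *
        ∏ k ∈ I.erase j, (fA q (s p) (s k) * fD q (s j) (s k))) •
          E.bvec (I.erase j)) + (-((q - q⁻¹) / (s i - s p)) * (E.a p * ∏ k ∈ I, fA q (s p) (s k)) *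
          ((-gA q (s i) (s j)) * (E.d j * ∏ k ∈ I.erase j, fD q (s j) (s k)))) •
        E.B i (E.bvec (I.erase j)) := by
      intro j hj
      rw [e2 j hj, E.bvec_insert _ _ (e3 j hj), prod_insert (e3 j hj), map_smul,
        ← add_smul, ← mul_prod_erase I _ hj, prod_mul_distrib]
      congr 1
      have h1 : s j - s i ≠ 0 := sub_ne_zero.mpr (hs.ne fun h => hi (h ▸ hj))
      have h2 : s i - s j ≠ 0 := sub_ne_zero.mpr (hs.ne fun h => hi (h ▸ hj))
      have h3 : s j - s p ≠ 0 := sub_ne_zero.mpr (hs.ne fun h => hp.2 (h ▸ hj))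
      have h4 : s i - s p ≠ 0 := sub_ne_zero.mpr (hs.ne fun h => hp.1 h.symm)
      have key : 1 / (s j - s p) * (fA q (s p) (s i) * fD q (s j) (s i)) =
          1 / (s j - s p) - fA q (s p) (s j) * gA q (s i) (s j) / (s i - s p) := by
        rw [fA, fD, fA, gA]
        field_simp
        ring
      linear_combination -(q - q⁻¹) * E.a p * E.d j * (∏ k ∈ I.erase j, fA q (s p) (s k)) *
        (∏ k ∈ I.erase j, fD q (s j) (s k)) * key
    rw [sum_congr rfl e4, sum_add_distrib, prod_mul_distrib]
    have e5 : ∑ j ∈ I, (-((q - q⁻¹) / (s i - s p)) * (E.a p * ∏ k ∈ I, fA q (s p) (s k)) *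
        ((-gA q (s i) (s j)) * (E.d j * ∏ k ∈ I.erase j, fD q (s j) (s k)))) •
          E.B i (E.bvec (I.erase j)) = (-((q - q⁻¹) / (s i - s p)) *
          (E.a p * ∏ k ∈ I, fA q (s p) (s k))) •
        ∑ j ∈ I, ((-gA q (s i) (s j)) * (E.d j * ∏ k ∈ I.erase j, fD q (s j) (s k))) •
          E.B i (E.bvec (I.erase j)) := by
      rw [smul_sum]
      exact sum_congr rfl fun j _ => by rw [smul_smul]
    rw [e5, map_sum]
    module

end ExchangeSystem

namespace ExchangeSystem

variable {ι V : Type*} [AddCommGroup V] [Module ℂ V] {q : ℂ} {s : ι → ℂ} [DecidableEq ι]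
  (E : ExchangeSystem ι V q s)

lemma dual_covac_cop (I : Finset ι) (φ : Dual ℂ V) :
    E.dual.covac (E.dual.cop I φ) = φ (E.bvec I) := by
  induction I using Finset.induction_on generalizing φ with
  | empty => simp; rfl
  | insert i I hi ih =>
    rw [bvec_insert _ _ _ hi, cop_insert' _ _ _ hi]
    exact ih ((E.B i).dualMap φ)

lemma domainWall_ne_zero (hq : q ≠ 0) (hq2 : q ^ 2 ≠ 1)
    (hs : Injective s) {κ : Type*} [DecidableEq κ] {p w : κ → ι}
    (hp : Injective p) (hw : Injective w) (hpw : ∀ k l, p k ≠ w l)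
    (hsw : ∀ k, s (w k) = q ^ 2 * s (p k))
    (hreg : ∀ k l, k ≠ l → q ^ 2 * s (p l) ≠ s (p k))
    (haw : ∀ k, E.a (w k) = 0) (hap : ∀ k, E.a (p k) ≠ 0) (hdw : ∀ k, E.d (w k) ≠ 0)
    (K : Finset κ) : E.covac (E.cop (K.image p) (E.bvec (K.image w))) ≠ 0 := by
  induction K using Finset.induction_on with
  | empty => simp [E.covac_vac]
  | insert k K hk ih =>
    have h1 : p k ∉ K.image p := fun h => by grind
    have h2 : w k ∉ K.image w := fun h => by grind
    have h3 : p k ∉ insert (w k) (K.image w) := fun h => by grind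
    have hne : s (w k) - s (p k) ≠ 0 := sub_ne_zero.mpr (hs.ne (hpw k k).symm)
    rw [image_insert, image_insert, E.cop_insert' _ _ h1, End.mul_apply,
      E.C_bvec_of_a_eq_zero hq hs h3, sum_eq_single (w k), erase_insert h2, map_smul,
      map_smul]
    · refine smul_ne_zero ?_ ih
      refine mul_ne_zero (mul_ne_zero (mul_ne_zero (neg_ne_zero.mpr (div_ne_zero ?_ hne)) (hap k))
        (hdw k)) (prod_ne_zero_iff.mpr fun i hi => ?_)
      · grind
      · obtain ⟨l, hl, rfl⟩ := mem_image.mp hi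
        have hkl : k ≠ l := fun h => hk (h ▸ hl)
        have h4 : s (w l) - s (p k) ≠ 0 := sub_ne_zero.mpr (hs.ne (hpw k l).symm)
        have h5 : s (w l) - s (w k) ≠ 0 := sub_ne_zero.mpr (hs.ne (hw.ne hkl.symm))
        refine mul_ne_zero (div_ne_zero ?_ h4) (div_ne_zero ?_ h5)
        · grind
        grind
    · intro i hi hik
      have : fA q (s (p k)) (s (w k)) = 0 := by
        rw [fA, hsw k, div_eq_zero_iff]
        grind
      rw [prod_eq_zero (mem_erase.mpr ⟨hik.symm, mem_insert_self _ _⟩),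
        mul_zero, zero_smul]
      grind
    · grind
    grind

end ExchangeSystem

/-! ### The linear system for scalar products with an eigenvector -/

section LinearSystem

variable {ι : Type*} [DecidableEq ι] {q : ℂ} {s : ι → ℂ}

/-- The matrix of the linear system for scalar products. -/
def transferCoeff (q : ℂ) (s a : ι → ℂ) (I : Finset ι) (i j : ι) : ℂ :=
  a j * (∏ k ∈ I.erase j, fA q (s j) (s k)) * ((q - q⁻¹) * s i / (q * s j - q⁻¹ * s i))

lemma transferCoeff_self (hq : q ≠ 0) (hq2 : q ^ 2 ≠ 1) (a : ι → ℂ) (I : Finset ι) {i : ι}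
    (hi : s i ≠ 0) :
    transferCoeff q s a I i i = a i * ∏ k ∈ I.erase i, fA q (s i) (s k) := by
  have h : q ^ 2 - 1 ≠ 0 := sub_ne_zero.mpr hq2
  have e : (q - q⁻¹) * s i / (q * s i - q⁻¹ * s i) = 1 := by
    rw [← sub_mul, div_self]
    grind
  rw [transferCoeff, e, mul_one]

lemma transferCoeff_of_ne (hq : q ≠ 0) (hs : Injective s) (a : ι → ℂ) {I : Finset ι}
    {i j : ι} (hi : i ∈ I) (hij : i ≠ j) (h : q ^ 2 * s j ≠ s i) :
    gA q (s i) (s j) * (a j * ∏ k ∈ (I.erase i).erase j, fA q (s j) (s k)) =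
      transferCoeff q s a I i j := by
  rw [transferCoeff, erase_right_comm,
    ← mul_prod_erase (I.erase j) _ (mem_erase.mpr ⟨hij, hi⟩), fA, gA]
  have h1 : s j - s i ≠ 0 := sub_ne_zero.mpr (hs.ne hij.symm)
  have h2 : s i - s j ≠ 0 := sub_ne_zero.mpr (hs.ne hij)
  have h3 : q ^ 2 * s j - s i ≠ 0 := sub_ne_zero.mpr h
  have h4 : q * s j - q⁻¹ * s i ≠ 0 := by grind
  generalize ∏ k ∈ (I.erase j).erase i, fA q (s j) (s k) = P
  have key : gA q (s i) (s j) = (q⁻¹ * s i - q * s j) / (s i - s j) *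
      ((q - q⁻¹) * s i / (q * s j - q⁻¹ * s i)) := by
    rw [gA, div_mul_div_comm, div_eq_div_iff h1 (mul_ne_zero h2 h4)]; ring
  rw [gA] at key
  linear_combination a j * P * key

lemma sum_nodalWeight_mul_transferCoeff (hq : q ≠ 0) (hq2 : q ^ 2 ≠ 1)
    (hs : Injective s) (a : ι → ℂ) {I : Finset ι} (h0 : ∀ i ∈ I, s i ≠ 0)
    (h2 : ∀ i ∈ I, ∀ j ∈ I, q ^ 2 * s j ≠ s i) {j : ι} (hj : j ∈ I) {ρ : Polynomial ℂ}
    (hρ : ρ.degree < #I) :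
    ∑ i ∈ I, Lagrange.nodalWeight I s i / s i * ρ.eval (s i) * transferCoeff q s a I i j =
      Lagrange.nodalWeight I s j / s j * (q⁻¹ ^ (#I - 1) * a j * ρ.eval (q ^ 2 * s j)) := by
  have hL : ρ.eval (q ^ 2 * s j) = (∏ k ∈ I, (q ^ 2 * s j - s k)) *
      ∑ i ∈ I, Lagrange.nodalWeight I s i * (q ^ 2 * s j - s i)⁻¹ * ρ.eval (s i) := by
    rw [← Lagrange.eval_nodal, ← Lagrange.eval_interpolate_not_at_node _ fun i hi => h2 i hi j hj,
      ← Lagrange.eq_interpolate hs.injOn hρ]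
  have hc : q ^ 2 - 1 ≠ 0 := sub_ne_zero.mpr hq2
  have e1 : ∀ i ∈ I, Lagrange.nodalWeight I s i / s i * ρ.eval (s i) * transferCoeff q s a I i j =
      (a j * (∏ k ∈ I.erase j, fA q (s j) (s k)) * (q ^ 2 - 1)) *
        (Lagrange.nodalWeight I s i * (q ^ 2 * s j - s i)⁻¹ * ρ.eval (s i)) := by
    intro i hi
    have h3 : q ^ 2 * s j - s i ≠ 0 := sub_ne_zero.mpr (h2 i hi j hj)
    have h4 : (q - q⁻¹) * s i / (q * s j - q⁻¹ * s i) = (q ^ 2 - 1) * s i / (q ^ 2 * s j - s i) := by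
      rw [← mul_div_mul_left ((q - q⁻¹) * s i) _ hq]
      congr 1 <;> field_simp
    rw [transferCoeff, h4]
    have := h0 i hi
    field_simp
  have e2 : ∏ k ∈ I.erase j, fA q (s j) (s k) = q⁻¹ ^ (#I - 1) *
      (∏ k ∈ I.erase j, (q ^ 2 * s j - s k)) * Lagrange.nodalWeight I s j := by
    rw [Lagrange.nodalWeight, ← card_erase_of_mem hj, ← prod_const,
      ← prod_mul_distrib, ← prod_mul_distrib]
    refine prod_congr rfl fun k hk => ?_
    have h5 : s k - s j ≠ 0 := sub_ne_zero.mpr (hs.ne (ne_of_mem_erase hk))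
    have h6 : s j - s k ≠ 0 := sub_ne_zero.mpr (hs.ne (ne_of_mem_erase hk).symm)
    rw [fA]
    field_simp
    ring
  rw [sum_congr rfl e1, ← mul_sum, e2, hL, ← mul_prod_erase I _ hj]
  have := h0 j hj
  field_simp

namespace ExchangeSystem

variable {V : Type*} [AddCommGroup V] [Module ℂ V] (E : ExchangeSystem ι V q s)

lemma sum_scalar_product_eq_zero (hq : q ≠ 0) (hq2 : q ^ 2 ≠ 1)
    (hs : Injective s) {I : Finset ι} (h0 : ∀ i ∈ I, s i ≠ 0)
    (h2 : ∀ i ∈ I, ∀ j ∈ I, q ^ 2 * s j ≠ s i) {v : V} {Λ : ι → ℂ}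
    (hv : ∀ i ∈ I, E.A i v + E.D i v = Λ i • v) {ρ : Polynomial ℂ} (hρ : ρ.degree < #I) :
    ∑ i ∈ I, (Lagrange.nodalWeight I s i / s i * E.covac (E.cop (I.erase i) v)) *
      (Λ i * ρ.eval (s i) - q⁻¹ ^ (#I - 1) * E.a i * ρ.eval (q ^ 2 * s i) -
        q ^ (#I - 1) * E.d i * ρ.eval (q⁻¹ ^ 2 * s i)) = 0 := by
  set X : ι → ℂ := fun i => E.covac (E.cop (I.erase i) v) with hX
  have hqi : q⁻¹ ≠ 0 := inv_ne_zero hq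
  have hqi2 : q⁻¹ ^ 2 ≠ 1 := by rw [inv_pow]; exact inv_ne_one.mpr hq2
  have h2' : ∀ i ∈ I, ∀ j ∈ I, q⁻¹ ^ 2 * s j ≠ s i := by grind
  have hB : ∀ i ∈ I, ∀ j ∈ I.erase i, E.dual.B i (E.dual.bvec ((I.erase i).erase j)) v = X j := by
    intro i hi j hj
    rw [← bvec_insert, E.dual_bvec_apply]
    · have : insert i ((I.erase i).erase j) = I.erase j := by
        rw [erase_right_comm, insert_erase]
        grind
      rw [this]
    · simp
  have hA : ∀ i ∈ I, E.covac (E.cop (I.erase i) (E.A i v)) =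
      ∑ j ∈ I, transferCoeff q s E.a I i j * X j := by
    intro i hi
    have := LinearMap.congr_fun (E.dual.A_bvec hq hs (notMem_erase i I)) v
    rw [← add_sum_erase I _ hi, transferCoeff_self hq hq2 _ _ (h0 i hi)]
    simp only [LinearMap.add_apply, LinearMap.smul_apply, LinearMap.sum_apply,
      E.dual_bvec_apply, smul_eq_mul] at this
    rw [← E.dual_bvec_apply]
    refine this.trans (congrArg₂ _ rfl (sum_congr rfl fun j hj => ?_))
    rw [hB i hi j hj]
    congr 1
    exact transferCoeff_of_ne hq hs _ hi (ne_of_mem_erase hj).symm (h2 i hi j (mem_of_mem_erase hj))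
  have hD : ∀ i ∈ I, E.covac (E.cop (I.erase i) (E.D i v)) =
      ∑ j ∈ I, transferCoeff q⁻¹ s E.d I i j * X j := by
    intro i hi
    have := LinearMap.congr_fun (E.dual.D_bvec hq hs (notMem_erase i I)) v
    rw [← add_sum_erase I _ hi, transferCoeff_self hqi hqi2 _ _ (h0 i hi)]
    simp only [LinearMap.add_apply, LinearMap.smul_apply, LinearMap.sum_apply,
      E.dual_bvec_apply, smul_eq_mul] at this
    rw [← E.dual_bvec_apply]
    refine this.trans (congrArg₂ _ ?_ (sum_congr rfl fun j hj => ?_))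
    · simp only [fA_inv]; rfl
    rw [hB i hi j hj, ← transferCoeff_of_ne hqi hs _ hi (ne_of_mem_erase hj).symm
      (h2' i hi j (mem_of_mem_erase hj))]
    simp only [fA_inv, gA_inv]; rfl
  have hE : ∀ i ∈ I, Λ i * X i =
      ∑ j ∈ I, (transferCoeff q s E.a I i j + transferCoeff q⁻¹ s E.d I i j) * X j := by
    intro i hi
    simp only [add_mul, sum_add_distrib]
    rw [← hA i hi, ← hD i hi, ← map_add, ← map_add, hv i hi, map_smul, map_smul, smul_eq_mul]
  have hsum : ∑ i ∈ I, Lagrange.nodalWeight I s i / s i * ρ.eval (s i) * (Λ i * X i) =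
      ∑ j ∈ I, (Lagrange.nodalWeight I s j / s j * (q⁻¹ ^ (#I - 1) * E.a j *
        ρ.eval (q ^ 2 * s j)) + Lagrange.nodalWeight I s j / s j * (q⁻¹⁻¹ ^ (#I - 1) * E.d j *
        ρ.eval (q⁻¹ ^ 2 * s j))) * X j := by
    have e : ∀ i ∈ I, Lagrange.nodalWeight I s i / s i * ρ.eval (s i) * (Λ i * X i) =
        ∑ j ∈ I, (Lagrange.nodalWeight I s i / s i * ρ.eval (s i) * transferCoeff q s E.a I i j +
          Lagrange.nodalWeight I s i / s i * ρ.eval (s i) * transferCoeff q⁻¹ s E.d I i j) *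
            X j := by
      intro i hi
      rw [hE i hi, mul_sum]
      exact sum_congr rfl fun j _ => by ring
    rw [sum_congr rfl e, sum_comm]
    refine sum_congr rfl fun j hj => ?_
    rw [← sum_mul, sum_add_distrib, sum_nodalWeight_mul_transferCoeff hq hq2 hs E.a h0 h2 hj hρ,
      sum_nodalWeight_mul_transferCoeff hqi hqi2 hs E.d h0 h2' hj hρ]
  rw [← sub_eq_zero, ← sum_sub_distrib, inv_inv] at hsum
  rw [← hsum]
  refine sum_congr rfl fun i _ => ?_
  simp only [X]
  ring

/-- If the functionals at the points of `T` are independent, a nonzero scalar product at some set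
of points can be moved to `T`. -/
lemma scalar_product_ne_zero_of_linearIndependent (hq : q ≠ 0)
    (hq2 : q ^ 2 ≠ 1) (hs : Injective s) {R : ℕ} {v : V} {Λ : ι → ℂ} {S T : Finset ι}
    (hS : #S = R) (hT : #T = R)
    (h0 : ∀ i ∈ S ∪ T, s i ≠ 0) (h2 : ∀ i ∈ S ∪ T, ∀ j ∈ S ∪ T, q ^ 2 * s j ≠ s i)
    (hv : ∀ i ∈ S ∪ T, E.A i v + E.D i v = Λ i • v)
    (hind : ∀ c : ι → ℂ, (∀ ρ : Polynomial ℂ, ρ.degree < (R + 1 : ℕ) → ∑ i ∈ T, c i *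
      (Λ i * ρ.eval (s i) - q⁻¹ ^ R * E.a i * ρ.eval (q ^ 2 * s i) -
        q ^ R * E.d i * ρ.eval (q⁻¹ ^ 2 * s i)) = 0) → ∀ i ∈ T, c i = 0)
    (hX : E.covac (E.cop S v) ≠ 0) : E.covac (E.cop T v) ≠ 0 := by
  have key : ∀ n ≤ R, ∃ U ⊆ S ∪ T, #U = R ∧ n ≤ (U ∩ T).card ∧ E.covac (E.cop U v) ≠ 0 := by
    intro n hn
    induction n with
    | zero => exact ⟨S, subset_union_left, hS, Nat.zero_le _, hX⟩
    | succ n ih =>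
      obtain ⟨U, hU, hUR, hUn, hUX⟩ := ih (by omega)
      by_cases hTU : T ⊆ U
      · refine ⟨U, hU, hUR, ?_, hUX⟩
        rw [inter_eq_right.mpr hTU, hT]; exact hn
      obtain ⟨b, hbT, hbU⟩ := not_subset.mp hTU
      have hI : insert b U ⊆ S ∪ T := insert_subset (mem_union_right _ hbT) hU
      have hcard : (insert b U).card = R + 1 := by rw [card_insert_of_notMem hbU, hUR]
      have hrel := fun ρ (hρ : Polynomial.degree ρ < (R + 1 : ℕ)) =>
        E.sum_scalar_product_eq_zero hq hq2 hs (I := insert b U)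
        (fun i hi => h0 i (hI hi)) (fun i hi j hj => h2 i (hI hi) j (hI hj)) (v := v) (Λ := Λ)
        (fun i hi => hv i (hI hi)) (ρ := ρ) (by rwa [hcard])
      simp only [hcard, Nat.add_sub_cancel] at hrel
      obtain ⟨l, hl, hlT, hlX⟩ : ∃ l ∈ insert b U, l ∉ T ∧
          E.covac (E.cop ((insert b U).erase l) v) ≠ 0 := by
        by_contra! hcon
        have hc := hind (fun i => if i ∈ insert b U then
          Lagrange.nodalWeight (insert b U) s i / s i *
            E.covac (E.cop ((insert b U).erase i) v) else 0) (fun ρ hρ => by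
          refine Eq.trans ?_ (hrel ρ hρ)
          simp only [ite_mul, zero_mul]
          rw [← sum_filter]
          refine sum_subset (fun i hi => (mem_filter.mp hi).2) fun i hi hi' => ?_
          have : i ∉ T := fun h => hi' (mem_filter.mpr ⟨h, hi⟩)
          rw [hcon i hi this, mul_zero, zero_mul]) b hbT
        simp only [mem_insert_self, if_true, erase_insert hbU] at hc
        refine hUX ((mul_eq_zero.mp hc).resolve_left ?_)
        exact div_ne_zero (Lagrange.nodalWeight_ne_zero hs.injOn (mem_insert_self b U))
          (h0 b (mem_union_right _ hbT))
      refine ⟨(insert b U).erase l, (erase_subset _ _).trans hI, ?_, ?_, hlX⟩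
      · grind
      · have : insert b (U ∩ T) ⊆ (insert b U).erase l ∩ T := by
          intro i hi
          grind
        refine le_trans ?_ (card_le_card this)
        grind
  obtain ⟨U, hU, hUR, hUn, hUX⟩ := key R le_rfl
  have h3 : U ∩ T = T := eq_of_subset_of_card_le inter_subset_right (by omega)
  have h4 : U = T := (eq_of_subset_of_card_le (inter_eq_right.mp h3) (by omega)).symm
  rwa [h4] at hUX

end ExchangeSystem

end LinearSystem

lemma SixVertexRel.map {𝒜 ℬ : Type*} [Ring 𝒜] [Algebra ℂ 𝒜] [Ring ℬ] [Algebra ℂ ℬ]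
    (φ : 𝒜 →ₐ[ℂ] ℬ) {a a' b b' c c' : ℂ} {X Y : M₂ 𝒜}
    (h : SixVertexRel a a' b b' c c' X Y) : SixVertexRel a a' b b' c c' (X.map φ) (Y.map φ) where
  r00_00 := by simpa using congrArg φ h.r00_00
  r00_01 := by simpa using congrArg φ h.r00_01
  r00_10 := by simpa using congrArg φ h.r00_10
  r00_11 := by simpa using congrArg φ h.r00_11
  r01_00 := by simpa using congrArg φ h.r01_00
  r01_01 := by simpa using congrArg φ h.r01_01
  r01_10 := by simpa using congrArg φ h.r01_10
  r01_11 := by simpa using congrArg φ h.r01_11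
  r10_00 := by simpa using congrArg φ h.r10_00
  r10_01 := by simpa using congrArg φ h.r10_01
  r10_10 := by simpa using congrArg φ h.r10_10
  r10_11 := by simpa using congrArg φ h.r10_11
  r11_00 := by simpa using congrArg φ h.r11_00
  r11_01 := by simpa using congrArg φ h.r11_01
  r11_10 := by simpa using congrArg φ h.r11_10
  r11_11 := by simpa using congrArg φ h.r11_11

/-- The exchange system of a solution of the intertwining relation with a vacuum. -/
def ExchangeSystem.ofRTT {ι V : Type*} [AddCommGroup V] [Module ℂ V] {q : ℂ} (hq : q ≠ 0)
    (hq4 : q ^ 4 ≠ 1) {T : ℂ → M₂ (End ℂ V)} (h : IsRTT q T) {v : V}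
    {ℓ : Dual ℂ V} {a d : ℂ → ℂ} (hT : ∀ x, IsTriangular v ℓ (a x) (d x) (T x))
    (hv : ℓ v = 1) (s : ι → ℂ) (hs : ∀ i, s i ≠ 0) : ExchangeSystem ι V q s where
  A i := T (s i) 0 0
  B i := T (s i) 0 1
  C i := (s i)⁻¹ • T (s i) 1 0
  D i := T (s i) 1 1
  vac := v
  covac := ℓ
  a i := a (s i)
  d i := d (s i)
  AB _ _ hij := h.AB hij
  DB _ _ hij := h.DB hij
  CA i j hij := h.CA hij (hs i) (hs j)
  CD i j hij := h.CD hij (hs i) (hs j)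
  CB i _ hij := h.CB hij (hs i)
  CB' i _ hij := h.CB' hij (hs i)
  BB _ _ := h.BB hq hq4 _ _
  CC i j := by rw [smul_mul_smul_comm, smul_mul_smul_comm, h.CC hq hq4, mul_comm]
  A_vac i := (hT _).v00
  D_vac i := (hT _).v11
  C_vac i := by rw [LinearMap.smul_apply, (hT _).v10, smul_zero]
  covac_A i := (hT _).l00
  covac_D i := (hT _).l11
  covac_B i := (hT _).l01
  covac_vac := hv

namespace ExchangeSystem

variable {ι V : Type*} [DecidableEq ι] [AddCommGroup V] [Module ℂ V] {q : ℂ} {s : ι → ℂ}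

lemma list_prod_B_vac (E : ExchangeSystem ι V q s) {l : List ι} (hl : l.Nodup) :
    (l.map E.B).prod E.vac = E.bvec l.toFinset := by
  induction l with
  | nil => simp
  | cons i l ih =>
    rw [nodup_cons] at hl
    rw [List.map_cons, List.prod_cons, End.mul_apply, ih hl.2, List.toFinset_cons,
      E.bvec_insert _ _ (by simpa using hl.1)]

lemma transfer_bvec (E : ExchangeSystem ι V q s) (hq : q ≠ 0) (hs : Injective s)
    {I : Finset ι} (hI : ∀ j ∈ I, E.a j * ∏ k ∈ I.erase j, fA q (s j) (s k) =
      E.d j * ∏ k ∈ I.erase j, fD q (s j) (s k)) {i : ι} (hi : i ∉ I) :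
    E.A i (E.bvec I) + E.D i (E.bvec I) = (E.a i * ∏ k ∈ I, fA q (s i) (s k) +
      E.d i * ∏ k ∈ I, fD q (s i) (s k)) • E.bvec I := by
  have h : ∑ j ∈ I, ((-gA q (s i) (s j)) * (E.d j * ∏ k ∈ I.erase j, fD q (s j) (s k))) •
        E.B i (E.bvec (I.erase j)) = -∑ j ∈ I, (gA q (s i) (s j) *
        (E.a j * ∏ k ∈ I.erase j, fA q (s j) (s k))) • E.B i (E.bvec (I.erase j)) := by
    rw [← sum_neg_distrib]
    refine sum_congr rfl fun j hj => ?_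
    rw [hI j hj, neg_mul, neg_smul]
  rw [E.A_bvec hq hs hi, E.D_bvec hq hs hi, h, add_smul]
  abel

end ExchangeSystem

/-! ### Chains of sites -/

section Chain

variable (N L : ℕ)

/-- The action of operators on vectors. -/
def opEnd : Op N L ≃ₐ[ℂ] End ℂ (Conf N L → ℂ) := Matrix.toLinAlgEquiv'

lemma opEnd_apply (X : Op N L) (v : Conf N L → ℂ) : opEnd N L X v = X.mulVec v := rfl

/-- The site matrix at site `i`. -/
def chainSite (t μ : ℂ) (α β : Fin L → ℂ) (x : ℂ) (i : Fin L) : M₂ (Op N L) :=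
  siteMat t (α i) (β i) (siteHom N i (locK N t μ)) (siteHom N i (locK' N t μ))
    (siteHom N i (locE N t μ (α i) (β i))) (siteHom N i (fHat N t)) x

/-- The monodromy matrix of a chain in the gauge in which it is a polynomial in `x`. -/
def chainMat (t μ : ℂ) (α β : Fin L → ℂ) (x : ℂ) : M₂ (Op N L) :=
  ((finRange L).reverse.map (chainSite N L t μ α β x)).prod

variable {N L}

lemma siteMat_map {𝒜 ℬ : Type*} [Ring 𝒜] [Algebra ℂ 𝒜] [Ring ℬ] [Algebra ℂ ℬ] (φ : 𝒜 →ₐ[ℂ] ℬ)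
    (t α β : ℂ) (k k' e f : 𝒜) (x : ℂ) :
    (siteMat t α β k k' e f x).map φ = siteMat t α β (φ k) (φ k') (φ e) (φ f) x := by
  ext i j
  fin_cases i <;> fin_cases j <;> simp [siteMat]

lemma chainSite_eq_map (t μ : ℂ) (α β : Fin L → ℂ) (x : ℂ) (i : Fin L) :
    chainSite N L t μ α β x i = (siteMat t (α i) (β i) (locK N t μ) (locK' N t μ)
      (locE N t μ (α i) (β i)) (fHat N t) x).map (siteHom N i) :=
  (siteMat_map (siteHom N i) _ _ _ _ _ _ _ _).symm

lemma map_siteHom_commute {i j : Fin L} (hij : i ≠ j) (X Y : M₂ (LocOp N))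
    (m n m' n' : Fin 2) : Commute (X.map (siteHom N i) m n) (Y.map (siteHom N j) m' n') :=
  siteOp_commute hij _ _

lemma nodup_reverse_finRange : (finRange L).reverse.Nodup :=
  List.nodup_reverse.mpr (List.nodup_finRange L)

lemma isRTT_chainMat {t μ : ℂ} (ht : t ≠ 0) (ht2 : t ^ 2 - (t ^ 2)⁻¹ ≠ 0) (hμ : μ ≠ 0)
    (α β : Fin L → ℂ) (htop : ∀ i, locCoeff t μ (α i) (β i) N * qInt t N = 0) :
    IsRTT (t ^ 2) (chainMat N L t μ α β) := by
  intro x u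
  rw [← intertwines_sixVertex_iff]
  refine intertwines_list_prod _ _ _ (fun i => ?_) (fun i j hij m n m' n' => ?_) _
    nodup_reverse_finRange
  · rw [intertwines_sixVertex_iff]
    exact ((siteRel_loc N ht ht2 hμ (α i) (β i) (htop i)).map (siteHom N i)).sixVertexRel ht ht2 x u
  · rw [chainSite_eq_map, chainSite_eq_map]
    exact map_siteHom_commute hij _ _ _ _ _ _

lemma siteOp_mulVec_vac [NeZero N] {i : Fin L} {a : LocOp N} {c : ℂ}
    (ha : ∀ τ, a τ 0 = if τ = 0 then c else 0) : (siteOp i a).mulVec (vac N L) = c • vac N L := by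
  have hvac : ∀ τ : Conf N L, vac N L τ = if τ = 0 then 1 else 0 := fun τ => by
    simp only [vac, funext_iff, Fin.ext_iff, Pi.zero_apply, Fin.val_zero]
  ext σ
  rw [Matrix.mulVec, dotProduct, sum_eq_single 0]
  · rw [hvac 0, if_pos rfl, mul_one, siteOp_apply, Pi.smul_apply, hvac, smul_eq_mul, Pi.zero_apply,
      ha]
    by_cases h : σ = 0
    · subst h; simp
    · rw [if_neg h, mul_zero]
      by_cases h' : σ i = 0
      · obtain ⟨j, hj⟩ := Function.ne_iff.mp h
        refine mul_eq_zero_of_right _ (prod_eq_zero (i := j) ?_ ?_)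
        · refine mem_erase.mpr ⟨?_, mem_univ _⟩
          rintro rfl; exact hj h'
        · simpa [Matrix.one_apply] using hj
      grind
  · grind
  · simp

lemma siteOp_mulVec_zero [NeZero N] {i : Fin L} {a : LocOp N} {c : ℂ}
    (ha : ∀ τ, a 0 τ = if τ = 0 then c else 0) (v : Conf N L → ℂ) :
    (siteOp i a).mulVec v 0 = c * v 0 := by
  rw [Matrix.mulVec, dotProduct, sum_eq_single 0]
  · rw [siteOp_apply, Pi.zero_apply, ha]; simp
  · intro τ _ hτ
    rw [siteOp_apply, Pi.zero_apply, ha]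
    by_cases h' : τ i = 0
    · obtain ⟨j, hj⟩ := Function.ne_iff.mp hτ
      refine mul_eq_zero_of_left (mul_eq_zero_of_right _ (prod_eq_zero (i := j) ?_ ?_)) _
      · refine mem_erase.mpr ⟨?_, mem_univ _⟩
        rintro rfl; exact hj h'
      · simpa [Matrix.one_apply] using Ne.symm hj
    grind
  · simp

lemma isTriangular_chainSite [NeZero N] (t μ : ℂ) (α β : Fin L → ℂ) (x : ℂ) (i : Fin L) :
    IsTriangular (vac N L) (proj 0) (t⁻¹ * (μ - x * α i * μ⁻¹))
      (t * (μ⁻¹ - x * β i * μ)) ((chainSite N L t μ α β x i).map (opEnd N L)) := by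
  have hk : ∀ τ, locK N t μ τ 0 = if τ = 0 then μ else 0 := fun τ => by
    rw [locK, diagonal_apply]; split_ifs with h <;> simp [h]
  have hk' : ∀ τ, locK' N t μ τ 0 = if τ = 0 then μ⁻¹ else 0 := fun τ => by
    rw [locK', diagonal_apply]; split_ifs with h <;> simp [h]
  have hl : ∀ τ, locK N t μ 0 τ = if τ = 0 then μ else 0 := fun τ => by
    rw [locK, diagonal_apply]; by_cases h : τ = 0 <;> simp [h, Ne.symm]
  have hl' : ∀ τ, locK' N t μ 0 τ = if τ = 0 then μ⁻¹ else 0 := fun τ => by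
    rw [locK', diagonal_apply]; by_cases h : τ = 0 <;> simp [h, Ne.symm]
  have he : ∀ τ, locE N t μ (α i) (β i) τ 0 = if τ = 0 then 0 else 0 := fun τ => by simp [locE]
  have hf : ∀ τ, fHat N t 0 τ = if τ = 0 then 0 else 0 := fun τ => by simp [fHat]
  constructor <;> intros <;>
    simp only [chainSite, siteMat, map_apply, of_apply, cons_val', cons_val_zero, cons_val_one,
      cons_val_fin_one, map_smul, map_sub, siteHom_apply, LinearMap.smul_apply,
      LinearMap.sub_apply, opEnd_apply, LinearMap.proj_apply, siteOp_mulVec_vac hk,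
      siteOp_mulVec_vac hk', siteOp_mulVec_vac he, siteOp_mulVec_zero hl, siteOp_mulVec_zero hl',
      siteOp_mulVec_zero hf, Pi.sub_apply, Pi.smul_apply, smul_eq_mul, zero_smul, smul_zero] <;>
    first | module | ring

lemma map_list_prod_opEnd {α : Type*} (X : α → M₂ (Op N L)) (l : List α) :
    (l.map X).prod.map (opEnd N L) = (l.map fun i => (X i).map (opEnd N L)).prod := by
  have := map_list_prod ((opEnd N L).toRingEquiv.toRingHom.mapMatrix (m := Fin 2)) (l.map X)
  rw [List.map_map] at this
  exact this

lemma isTriangular_chainMat [NeZero N] (t μ : ℂ) (α β : Fin L → ℂ) (x : ℂ) :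
    IsTriangular (vac N L) (proj 0) (∏ i, (t⁻¹ * (μ - x * α i * μ⁻¹)))
      (∏ i, (t * (μ⁻¹ - x * β i * μ))) ((chainMat N L t μ α β x).map (opEnd N L)) := by
  have h := isTriangular_list_prod (isTriangular_chainSite (N := N) t μ α β x)
    (fun i j hij m n m' n' => by
      rw [chainSite_eq_map, chainSite_eq_map]
      exact (map_siteHom_commute hij _ _ m n m' n').map (opEnd N L)) _
    (nodup_reverse_finRange (L := L))
  have e : ∀ g : Fin L → ℂ, ((finRange L).reverse.map g).prod = ∏ i, g i := by
    intro g
    rw [List.map_reverse, List.prod_reverse, ← List.ofFn_eq_map, List.prod_ofFn]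
  rw [e, e] at h
  rwa [chainMat, map_list_prod_opEnd]

lemma vac_zero [NeZero N] : vac N L 0 = 1 := by simp [vac]

/-- The exchange system of a chain. -/
def chainES [NeZero N] {ι : Type*} {t μ : ℂ} (ht : t ≠ 0) (ht2 : t ^ 2 - (t ^ 2)⁻¹ ≠ 0)
    (ht8 : (t ^ 2) ^ 4 ≠ 1) (hμ : μ ≠ 0)
    (α β : Fin L → ℂ) (htop : ∀ i, locCoeff t μ (α i) (β i) N * qInt t N = 0)
    (s : ι → ℂ) (hs : ∀ i, s i ≠ 0) : ExchangeSystem ι (Conf N L → ℂ) (t ^ 2) s :=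
  ExchangeSystem.ofRTT (T := fun x => (chainMat N L t μ α β x).map (opEnd N L))
    (pow_ne_zero 2 ht) ht8
    (fun x u => (isRTT_chainMat ht ht2 hμ α β htop x u).map (opEnd N L).toAlgHom)
    (isTriangular_chainMat t μ α β) vac_zero s hs

end Chain

/-! ### Independence of the functionals of the linear system -/

open Polynomial in
lemma exists_prod_one_sub_mul (M : ℕ) : ∀ p : ℂ[X], p.natDegree ≤ M → p.eval 0 = 1 →
    ∃ α : Fin M → ℂ, ∀ x, p.eval x = ∏ i, (1 - x * α i) := by
  induction M with
  | zero =>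
    intro p hp h0
    obtain ⟨c, rfl⟩ : ∃ c, p = C c := ⟨_, Polynomial.eq_C_of_natDegree_le_zero hp⟩
    exact ⟨Fin.elim0, fun x => by simpa using h0⟩
  | succ M ih =>
    intro p hp h0
    by_cases hd : p.natDegree = 0
    · obtain ⟨c, rfl⟩ : ∃ c, p = C c := ⟨_, Polynomial.eq_C_of_natDegree_eq_zero hd⟩
      exact ⟨0, fun x => by simpa using h0⟩
    · obtain ⟨r, hr⟩ := Complex.exists_root (f := p) (Polynomial.natDegree_pos_iff_degree_pos.mp
        (Nat.pos_of_ne_zero hd))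
      obtain ⟨p', rfl⟩ := Polynomial.dvd_iff_isRoot.mpr hr
      have hr0 : r ≠ 0 := by
        rintro rfl
        rw [hr] at h0
        grind
      have hp' : p' ≠ 0 := by grind
      have hdeg : (C (-r) * p').natDegree ≤ M := by
        rw [Polynomial.natDegree_C_mul (neg_ne_zero.mpr hr0)]
        rw [Polynomial.natDegree_mul (Polynomial.X_sub_C_ne_zero r) hp',
          Polynomial.natDegree_X_sub_C] at hp
        omega
      obtain ⟨α, hα⟩ := ih (C (-r) * p') hdeg (by simpa using h0)
      refine ⟨Fin.cons r⁻¹ α, fun x => ?_⟩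
      rw [Fin.prod_univ_succ]
      simp only [Fin.cons_zero, Fin.cons_succ]
      rw [← hα]
      simp only [Polynomial.eval_mul, Polynomial.eval_sub, Polynomial.eval_X, Polynomial.eval_C]
      grind

lemma exists_prod_eq (P : Finset ℂ) (hP : (0 : ℂ) ∉ P) (f : ℂ → ℂ) :
    ∃ α : Fin #P → ℂ, ∀ x ∈ P, f x = ∏ i, (1 - x * α i) := by
  set g : ℂ → ℂ := Function.update f 0 1
  have hinj : Set.InjOn id ((insert 0 P : Finset ℂ) : Set ℂ) := Function.injective_id.injOn
  set p := Lagrange.interpolate (insert 0 P) id g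
  have hcard : (insert 0 P).card = #P + 1 := card_insert_of_notMem hP
  have hdeg : p.natDegree ≤ #P := by
    have h := Lagrange.degree_interpolate_lt (s := insert 0 P) (v := id) g hinj
    rw [hcard] at h
    exact Polynomial.natDegree_le_iff_degree_le.mpr (Order.le_of_lt_succ (by exact_mod_cast h))
  have hev : ∀ x ∈ insert 0 P, p.eval x = g x := fun x hx =>
    Lagrange.eval_interpolate_at_node (v := id) g hinj hx
  obtain ⟨α, hα⟩ := exists_prod_one_sub_mul #P p hdeg (by
    rw [hev 0 (mem_insert_self _ _)]; simp [g])
  refine ⟨α, fun x hx => ?_⟩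
  rw [← hα, hev x (mem_insert_of_mem hx)]
  exact (Function.update_of_ne (ne_of_mem_of_not_mem hx hP) _ _).symm

section Independence

open Polynomial

/-- The rescaled polynomial `p (c x)`. -/
def dil (c : ℂ) (p : ℂ[X]) : ℂ[X] := p.comp (C c * X)

lemma dil_add (c : ℂ) (p r : ℂ[X]) : dil c (p + r) = dil c p + dil c r := by simp [dil]

lemma dil_smul (c a : ℂ) (p : ℂ[X]) : dil c (a • p) = a • dil c p := by simp [dil]

lemma dil_mul (c : ℂ) (p r : ℂ[X]) : dil c (p * r) = dil c p * dil c r := by simp [dil]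

lemma dil_sub (c : ℂ) (p r : ℂ[X]) : dil c (p - r) = dil c p - dil c r := by simp [dil]

lemma dil_dil (c c' : ℂ) (p : ℂ[X]) : dil c (dil c' p) = dil (c' * c) p := by
  rw [dil, dil, dil, comp_assoc]
  congr 1
  simp [mul_assoc]

lemma eval_dil (c x : ℂ) (p : ℂ[X]) : (dil c p).eval x = p.eval (c * x) := by simp [dil]

lemma coeff_dil (c : ℂ) (p : ℂ[X]) (n : ℕ) : (dil c p).coeff n = p.coeff n * c ^ n := by
  rw [dil, comp_C_mul_X_coeff]

lemma natDegree_dil_le (c : ℂ) (p : ℂ[X]) : (dil c p).natDegree ≤ p.natDegree := by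
  rw [natDegree_le_iff_coeff_eq_zero]
  intro n hn
  rw [coeff_dil, coeff_eq_zero_of_natDegree_lt hn, zero_mul]

/-- The `q`-Wronskian `Q(q² x) ρ(x) - Q(x) ρ(q² x)`. -/
def qWronskian (q : ℂ) (Q ρ : ℂ[X]) : ℂ[X] := dil (q ^ 2) Q * ρ - Q * dil (q ^ 2) ρ

lemma natDegree_qWronskian_lt (q : ℂ) {R : ℕ} {Q ρ : ℂ[X]} (hQ : Q.natDegree ≤ R)
    (hρ : ρ.natDegree ≤ R) (h : qWronskian q Q ρ ≠ 0) : (qWronskian q Q ρ).natDegree < 2 * R := by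
  have h1 : (qWronskian q Q ρ).natDegree ≤ 2 * R := by
    refine (natDegree_sub_le _ _).trans (max_le ?_ ?_)
    · exact natDegree_mul_le.trans (by have := natDegree_dil_le (q ^ 2) Q; omega)
    · exact natDegree_mul_le.trans (by have := natDegree_dil_le (q ^ 2) ρ; omega)
  refine lt_of_le_of_ne h1 fun h2 => ?_
  have h3 : (qWronskian q Q ρ).coeff (R + R) = 0 := by
    rw [qWronskian, coeff_sub, coeff_mul_add_eq_of_natDegree_le ((natDegree_dil_le _ _).trans hQ) hρ,
      coeff_mul_add_eq_of_natDegree_le hQ ((natDegree_dil_le _ _).trans hρ), coeff_dil, coeff_dil]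
    ring
  rw [← two_mul, ← h2] at h3
  exact h (leadingCoeff_eq_zero.mp h3)

lemma pow_dvd_of_qDifference {q : ℂ} {N L : ℕ} (hN3 : 3 ≤ N) (hNodd : Odd N)
    (hq : IsPrimitiveRoot q N) {W : ℂ[X]}
    (h : (1 - C q * X) ^ L * W = (1 - C q⁻¹ * X) ^ L * dil (q⁻¹ ^ 2) W) :
    ∀ l < N - 1, (X - C (q ^ (2 * l + 1))) ^ L ∣ W := by
  have hq0 : q ≠ 0 := hq.ne_zero (by omega)
  have hfac : ∀ c : ℂ, c ≠ 0 → (1 - C c * X : ℂ[X]) = C (-c) * (X - C c⁻¹) := by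
    intro c hc
    rw [mul_sub, ← C_mul, neg_mul, mul_inv_cancel₀ hc]
    simp; ring
  have hcop : ∀ r, r ≠ q⁻¹ → IsCoprime ((X - C r) ^ L) ((1 - C q * X : ℂ[X]) ^ L) := by
    intro r hr
    refine IsCoprime.pow ?_
    rw [hfac q hq0, isCoprime_mul_unit_left_right
      (isUnit_C.mpr (isUnit_iff_ne_zero.mpr (neg_ne_zero.mpr hq0)))]
    exact isCoprime_X_sub_C_of_isUnit_sub (isUnit_iff_ne_zero.mpr (sub_ne_zero.mpr hr))
  have hpow : ∀ l < N - 1, q ^ (2 * l + 1) ≠ q⁻¹ := by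
    intro l hl he
    have h1 : q ^ (2 * (l + 1)) = 1 := by grind
    have h2 : N ∣ l + 1 := (Nat.Coprime.dvd_of_dvd_mul_left
      (Nat.coprime_two_right.mpr hNodd) (hq.dvd_of_pow_eq_one _ h1))
    have := Nat.le_of_dvd (Nat.succ_pos l) h2
    omega
  intro l
  induction l with
  | zero =>
    intro _
    refine (hcop _ (by simpa using hpow 0 (by omega))).dvd_of_dvd_mul_left ?_
    rw [h]
    refine Dvd.dvd.mul_right (pow_dvd_pow_of_dvd ?_ L) _
    rw [hfac q⁻¹ (inv_ne_zero hq0), inv_inv]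
    simp
  | succ l ih =>
    intro hl
    refine (hcop _ (hpow _ hl)).dvd_of_dvd_mul_left ?_
    rw [h]
    refine Dvd.dvd.mul_left ?_ _
    obtain ⟨V, hV⟩ := ih (by omega)
    rw [hV, dil_mul]
    refine Dvd.dvd.mul_right ?_ _
    have : dil (q⁻¹ ^ 2) ((X - C (q ^ (2 * l + 1))) ^ L) =
        (C (q⁻¹ ^ 2) * (X - C (q ^ (2 * (l + 1) + 1)))) ^ L := by
      rw [dil, pow_comp, sub_comp, X_comp, C_comp, mul_sub, ← C_mul]
      congr 4
      rw [show 2 * (l + 1) + 1 = (2 * l + 1) + 2 by ring, pow_add _ _ 2, inv_pow]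
      field_simp
      ring
    rw [this, mul_pow]
    exact Dvd.intro_left _ rfl

lemma qWronskian_eq_zero {q : ℂ} {N L R : ℕ} (hN3 : 3 ≤ N) (hNodd : Odd N)
    (hq : IsPrimitiveRoot q N) (hR : 2 * R ≤ L * (N - 1)) {Q ρ : ℂ[X]}
    (hQ : Q.natDegree ≤ R) (hρ : ρ.natDegree ≤ R)
    (h : (1 - C q * X) ^ L * qWronskian q Q ρ =
      (1 - C q⁻¹ * X) ^ L * dil (q⁻¹ ^ 2) (qWronskian q Q ρ)) : qWronskian q Q ρ = 0 := by
  by_contra hW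
  have h1 := pow_dvd_of_qDifference hN3 hNodd hq h
  have h2 : ∏ l ∈ range (N - 1), (X - C (q ^ (2 * l + 1))) ^ L ∣ qWronskian q Q ρ := by
    refine prod_dvd_of_coprime (fun l hl l' hl' hll' => ?_) fun l hl => h1 l (mem_range.mp hl)
    refine IsCoprime.pow (isCoprime_X_sub_C_of_isUnit_sub
      (isUnit_iff_ne_zero.mpr (sub_ne_zero.mpr fun he => hll' ?_)))
    have hq2 : IsPrimitiveRoot (q ^ 2) N := hq.pow_of_coprime 2 (Nat.coprime_two_left.mpr hNodd)
    have hq0 : q ≠ 0 := hq.ne_zero (by omega)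
    rw [pow_succ, pow_succ, pow_mul, pow_mul] at he
    have hl1 := mem_range.mp (mem_coe.mp hl)
    have hl2 := mem_range.mp (mem_coe.mp hl')
    exact hq2.pow_inj (by omega) (by omega) (mul_right_cancel₀ hq0 he)
  have h3 := natDegree_le_of_dvd h2 hW
  rw [natDegree_prod_of_monic _ _ fun l _ => (monic_X_sub_C _).pow L] at h3
  simp only [natDegree_pow, natDegree_X_sub_C, mul_one, sum_const, card_range, smul_eq_mul] at h3
  have h4 := natDegree_qWronskian_lt q hQ hρ hW
  rw [mul_comm] at h3
  omega

lemma exists_smul_of_qWronskian_eq_zero {q : ℂ} (hq0 : q ≠ 0) {R : ℕ} {x : Fin R → ℂ}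
    (hreg : ∀ i j, q ^ 2 * x i ≠ x j) {ρ : ℂ[X]}
    (hρ : ρ.natDegree ≤ R) (h : qWronskian q (∏ i, (X - C (x i))) ρ = 0) :
    ∃ c : ℂ, ρ = c • ∏ i, (X - C (x i)) := by
  have hmon : (∏ i, (X - C (x i))).Monic := monic_prod_of_monic _ _ fun i _ => monic_X_sub_C _
  have hdeg : (∏ i, (X - C (x i))).natDegree = R := by simp
  have hcop : IsCoprime (∏ i, (X - C (x i))) (dil (q ^ 2) (∏ i, (X - C (x i)))) := by
    rw [dil, Polynomial.prod_comp]
    refine IsCoprime.prod_left fun i _ => IsCoprime.prod_right fun j _ => ?_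
    have e : (X - C (x j)).comp (C (q ^ 2) * X) = C (q ^ 2) * (X - C (q⁻¹ ^ 2 * x j)) := by
      rw [sub_comp, X_comp, C_comp, mul_sub, ← C_mul, ← mul_assoc, ← mul_pow,
        mul_inv_cancel₀ hq0, one_pow, one_mul]
    rw [e, isCoprime_mul_unit_left_right
      (isUnit_C.mpr (isUnit_iff_ne_zero.mpr (pow_ne_zero 2 hq0)))]
    refine isCoprime_X_sub_C_of_isUnit_sub
      (isUnit_iff_ne_zero.mpr (sub_ne_zero.mpr fun he => hreg i j ?_))
    grind
  have hdvd : (∏ i, (X - C (x i))) ∣ ρ := by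
    refine hcop.dvd_of_dvd_mul_left ?_
    rw [qWronskian, sub_eq_zero] at h
    rw [h]
    exact dvd_mul_right _ _
  obtain ⟨V, rfl⟩ := hdvd
  by_cases hV : V = 0
  · exact ⟨0, by simp [hV]⟩
  rw [hmon.natDegree_mul' hV, hdeg] at hρ
  obtain ⟨c, hc⟩ : ∃ c, V = C c := ⟨_, eq_C_of_natDegree_eq_zero (by omega)⟩
  exact ⟨c, by rw [hc, mul_comm, smul_eq_C_mul]⟩

/-- A linear map of large rank to polynomials is detected by evaluations at generic points. -/
lemma exists_independent_evaluations {U : Type*} [AddCommGroup U] [Module ℂ U]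
    [FiniteDimensional ℂ U] {R : ℕ} (hU : Module.finrank ℂ U = R + 1) (G : U →ₗ[ℂ] ℂ[X]) (u : U)
    (hG : ∀ v, G v = 0 → ∃ c : ℂ, v = c • u) (bad : Finset ℂ) {a : ℂ} (ha : a ≠ 0)
    (ha1 : a ≠ 1) (h0 : (0 : ℂ) ∈ bad) :
    ∃ W : Finset ℂ, #W = R ∧ Disjoint W bad ∧ (∀ w ∈ W, ∀ w' ∈ W, a * w ≠ w') ∧
      ∀ c : ℂ → ℂ, (∀ v, ∑ w ∈ W, c w * (G v).eval w = 0) → ∀ w ∈ W, c w = 0 := by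
  suffices h : ∀ n ≤ R, ∃ W : Finset ℂ, #W = n ∧ Disjoint W bad ∧ (∀ w ∈ W, ∀ w' ∈ W, a * w ≠ w') ∧
      ∀ c : ℂ → ℂ, (∀ v, ∑ w ∈ W, c w * (G v).eval w = 0) → ∀ w ∈ W, c w = 0 from h R le_rfl
  intro n hn
  induction n with
  | zero => exact ⟨∅, by simp⟩
  | succ n ih =>
    obtain ⟨W, hW, hWb, hWa, hWi⟩ := ih (by omega)
    set ev : U →ₗ[ℂ] (W → ℂ) := LinearMap.pi fun w => (leval (w : ℂ)) ∘ₗ G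
    have hker : ¬ LinearMap.ker ev ≤ Submodule.span ℂ {u} := by
      intro hle
      have h1 := Submodule.finrank_mono hle
      have h2 : Module.finrank ℂ (Submodule.span ℂ {u}) ≤ 1 := by
        simpa using finrank_span_le_card (R := ℂ) ({u} : Set U)
      have h3 := ev.finrank_range_add_finrank_ker
      have h4 : Module.finrank ℂ (LinearMap.range ev) ≤ n := by
        refine (Submodule.finrank_le _).trans ?_
        simp [hW]
      omega
    obtain ⟨v, hv, hvu⟩ := SetLike.not_le_iff_exists.mp hker
    have hGv : G v ≠ 0 := fun h => hvu (by
      obtain ⟨c, rfl⟩ := hG v h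
      exact Submodule.smul_mem _ _ (Submodule.mem_span_singleton_self u))
    have hvW : ∀ w ∈ W, (G v).eval w = 0 := fun w hw =>
      congrFun (LinearMap.mem_ker.mp hv) ⟨w, hw⟩
    obtain ⟨b, hb⟩ := Infinite.exists_notMem_finset
      (bad ∪ W ∪ W.image (fun w => a * w) ∪ W.image (fun w => a⁻¹ * w) ∪ (G v).roots.toFinset)
    simp only [mem_union, not_or, Multiset.mem_toFinset, mem_image, not_exists,
      not_and, mem_roots hGv, IsRoot.def] at hb
    obtain ⟨⟨⟨⟨hb1, hb2⟩, hb3⟩, hb4⟩, hb5⟩ := hb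
    refine ⟨insert b W, ?_, ?_, ?_, ?_⟩
    · grind
    · grind
    · grind
    · intro c hc
      have hcb : c b = 0 := by
        have := hc v
        rw [sum_insert hb2, sum_eq_zero fun w hw => by rw [hvW w hw, mul_zero], add_zero] at this
        grind
      have hcW := hWi c fun v' => by
        have := hc v'
        grind
      grind

end Independence

/-! ### On-shell vectors do not vanish -/

namespace ExchangeSystem

variable {ι V : Type*} [AddCommGroup V] [Module ℂ V] {q : ℂ} {s : ι → ℂ}

/-- The exchange system at a subfamily of the points. -/
def comap {κ : Type*} (f : κ → ι) (E : ExchangeSystem ι V q s) : ExchangeSystem κ V q (s ∘ f) where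
  A i := E.A (f i)
  B i := E.B (f i)
  C i := E.C (f i)
  D i := E.D (f i)
  vac := E.vac
  covac := E.covac
  a i := E.a (f i)
  d i := E.d (f i)
  AB i j h := E.AB (f i) (f j) h
  DB i j h := E.DB (f i) (f j) h
  CA i j h := E.CA (f i) (f j) h
  CD i j h := E.CD (f i) (f j) h
  CB i j h := E.CB (f i) (f j) h
  CB' i j h := E.CB' (f i) (f j) h
  BB i j := E.BB (f i) (f j)
  CC i j := E.CC (f i) (f j)
  A_vac i := E.A_vac (f i)
  D_vac i := E.D_vac (f i)
  C_vac i := E.C_vac (f i)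
  covac_A i := E.covac_A (f i)
  covac_D i := E.covac_D (f i)
  covac_B i := E.covac_B (f i)
  covac_vac := E.covac_vac

variable [DecidableEq ι]

lemma comap_bvec {κ : Type*} [DecidableEq κ] {f : κ → ι} (hf : Injective f)
    (E : ExchangeSystem ι V q s) (I : Finset κ) : (E.comap f).bvec I = E.bvec (I.image f) := by
  induction I using Finset.induction_on with
  | empty => simp; rfl
  | insert i I hi ih =>
    have hi' : f i ∉ I.image f := fun h => by grind
    rw [bvec_insert _ _ _ hi, image_insert, bvec_insert _ _ _ hi', ih]; rfl

lemma comap_cop {κ : Type*} [DecidableEq κ] {f : κ → ι} (hf : Injective f)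
    (E : ExchangeSystem ι V q s) (I : Finset κ) : (E.comap f).cop I = E.cop (I.image f) := by
  induction I using Finset.induction_on with
  | empty => simp
  | insert i I hi ih =>
    have hi' : f i ∉ I.image f := fun h => by grind
    rw [cop_insert _ _ _ hi, image_insert, cop_insert _ _ _ hi', ih]; rfl

lemma scalar_product_congr_on {V' : Type*} [AddCommGroup V'] [Module ℂ V']
    (E : ExchangeSystem ι V q s) (E' : ExchangeSystem ι V' q s) {I J : Finset ι}
    (ha : ∀ i ∈ I ∪ J, E.a i = E'.a i) (hd : ∀ i ∈ I ∪ J, E.d i = E'.d i) (hq : q ≠ 0)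
    (hs : Injective s) (hIJ : Disjoint J I) :
    E.covac (E.cop J (E.bvec I)) = E'.covac (E'.cop J (E'.bvec I)) := by
  set f : {i // i ∈ I ∪ J} → ι := Subtype.val
  have hf : Injective f := Subtype.val_injective
  have key : ∀ K ⊆ I ∪ J, (K.subtype (· ∈ I ∪ J)).image f = K := by
    intro K hK
    ext i
    simp only [mem_image, mem_subtype, f]
    exact ⟨fun ⟨j, hj, e⟩ => e ▸ hj, fun h => ⟨⟨i, hK h⟩, h, rfl⟩⟩
  have h := (E.comap f).scalar_product_congr (E'.comap f) (funext fun i => ha i i.2)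
    (funext fun i => hd i i.2) hq (hs.comp hf) (I := I.subtype (· ∈ I ∪ J))
    (J := J.subtype (· ∈ I ∪ J)) (by
      rw [disjoint_left]
      intro i hi hi'
      exact disjoint_left.mp hIJ (mem_subtype.mp hi) (mem_subtype.mp hi'))
  rw [comap_bvec hf, comap_bvec hf, comap_cop hf, comap_cop hf, key I subset_union_left,
    key J subset_union_right] at h
  exact h

end ExchangeSystem

/-- Exchange systems with arbitrary vacuum eigenvalues at finitely many points. -/
lemma exists_exchangeSystem {N : ℕ} [NeZero N] {t q : ℂ} (hqt : q = t ^ 2) (ht : t ≠ 0)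
    (hqq : q - q⁻¹ ≠ 0) (hq4 : q ^ 4 ≠ 1) (hqN : q ^ N = 1) {P : Finset ℂ} (hP : (0 : ℂ) ∉ P)
    (f g : ℂ → ℂ) : ∃ E : ExchangeSystem P (Conf N #P → ℂ) q Subtype.val,
      (∀ i : P, E.a i = f i) ∧ ∀ i : P, E.d i = g i := by
  subst hqt
  obtain ⟨α, hα⟩ := exists_prod_eq P hP fun y => t ^ #P * f y
  obtain ⟨β, hβ⟩ := exists_prod_eq P hP fun y => t⁻¹ ^ #P * g y
  have hqInt : qInt t N = 0 := by rw [qInt, hqN]; simp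
  refine ⟨chainES (N := N) (ι := P) (μ := 1) ht hqq hq4 one_ne_zero α β
    (fun i => by rw [hqInt, mul_zero]) Subtype.val fun i h => hP (h ▸ i.2), fun i => ?_,
    fun i => ?_⟩
  · change ∏ j, (t⁻¹ * (1 - i * α j * 1⁻¹)) = _
    simp only [inv_one, mul_one]
    rw [prod_mul_distrib, ← hα i i.2]
    simp only [prod_const, card_univ, Fintype.card_fin, inv_pow]
    rw [inv_mul_cancel_left₀ (pow_ne_zero _ ht)]
  · change ∏ j, (t * (1⁻¹ - i * β j * 1)) = _
    simp only [inv_one, mul_one]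
    rw [prod_mul_distrib, ← hβ i i.2]
    simp only [prod_const, card_univ, Fintype.card_fin, inv_pow]
    rw [mul_inv_cancel_left₀ (pow_ne_zero _ ht)]

section OnShell

open Polynomial

/-- The second order `q`-difference operator of the Baxter equation. -/
def baxterMap (q : ℂ) (L : ℕ) (Q : ℂ[X]) : ℂ[X] →ₗ[ℂ] ℂ[X] where
  toFun ρ := (1 - C q * X) ^ L * qWronskian q Q ρ -
    (1 - C q⁻¹ * X) ^ L * dil (q⁻¹ ^ 2) (qWronskian q Q ρ)
  map_add' ρ ρ' := by simp only [qWronskian, dil_add, dil_sub, dil_mul]; ring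
  map_smul' c ρ := by
    simp only [qWronskian, dil_smul, dil_sub, dil_mul, RingHom.id_apply, smul_sub, mul_smul_comm,
      mul_sub]

lemma eval_baxterMap {q : ℂ} (hq : q ≠ 0) (L : ℕ) (Q ρ : ℂ[X]) (w : ℂ) :
    (baxterMap q L Q ρ).eval w =
      (1 - q * w) ^ L * (Q.eval (q ^ 2 * w) * ρ.eval w - Q.eval w * ρ.eval (q ^ 2 * w)) +
      (1 - q⁻¹ * w) ^ L * (Q.eval (q⁻¹ ^ 2 * w) * ρ.eval w - Q.eval w * ρ.eval (q⁻¹ ^ 2 * w)) := by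
  have h : q ^ 2 * q⁻¹ ^ 2 = 1 := by rw [← mul_pow, mul_inv_cancel₀ hq, one_pow]
  have h' : q ^ 2 * (q⁻¹ ^ 2 * w) = w := by rw [← mul_assoc, h, one_mul]
  simp only [baxterMap, qWronskian, LinearMap.coe_mk, AddHom.coe_mk, eval_sub, eval_mul, eval_pow,
    eval_one, eval_C, eval_X, eval_dil, h']
  ring

lemma prod_fA_eq {q : ℂ} (hq : q ≠ 0) {R : ℕ} {x : Fin R → ℂ} {w : ℂ} (hw : ∀ k, w ≠ x k) :
    (∏ k, fA q w (x k)) * (∏ k, (X - C (x k))).eval w =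
      q⁻¹ ^ R * (∏ k, (X - C (x k))).eval (q ^ 2 * w) := by
  have : q⁻¹ ^ R = ∏ _k : Fin R, q⁻¹ := by simp
  rw [eval_prod, eval_prod, this, ← prod_mul_distrib, ← prod_mul_distrib]
  refine prod_congr rfl fun k _ => ?_
  have h1 : x k - w ≠ 0 := sub_ne_zero.mpr (hw k).symm
  rw [fA]
  simp only [eval_sub, eval_X, eval_C]
  field_simp
  ring

lemma onShell_ne_zero {N L R : ℕ} (hN3 : 3 ≤ N) (hNodd : Odd N) (hR : N ∣ R)
    {t q : ℂ} (hqt : q = t ^ 2) (hq : IsPrimitiveRoot q N) (hLR : 2 * R ≤ L * (N - 1))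
    {V : Type*} [AddCommGroup V] [Module ℂ V] {T : ℂ → M₂ (End ℂ V)}
    (hT : IsRTT q T) {v : V} {ℓ : Dual ℂ V} {a d : ℂ → ℂ}
    (htri : ∀ x, IsTriangular v ℓ (a x) (d x) (T x)) (hv : ℓ v = 1) {κ : ℂ} (hκ : κ ≠ 0)
    (ha : ∀ x, a x = κ * (1 - q * x) ^ L) (hd : ∀ x, d x = κ * (1 - q⁻¹ * x) ^ L)
    {x : Fin R → ℂ} (hx0 : ∀ i, x i ≠ 0) (hx : Injective x)
    (hreg : ∀ i j, i ≠ j → q ^ 2 * x i ≠ x j) (hax : ∀ i, a (x i) ≠ 0)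
    (hbethe : ∀ j, a (x j) * ∏ k ∈ univ.erase j, fA q (x j) (x k) =
      d (x j) * ∏ k ∈ univ.erase j, fD q (x j) (x k)) :
    ((ofFn fun i => T (x i) 0 1).prod) v ≠ 0 := by
  have hN : NeZero N := ⟨by omega⟩
  have hN0 : N ≠ 0 := by omega
  have hq0 : q ≠ 0 := hq.ne_zero hN0
  have ht : t ≠ 0 := by rintro rfl; exact hq0 (by simp [hqt])
  have hq2 : q ^ 2 ≠ 1 := fun h => by
    have := Nat.le_of_dvd (by norm_num) (hq.dvd_of_pow_eq_one 2 h); omega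
  have hq4 : q ^ 4 ≠ 1 := fun h => by
    have h1 := (Nat.Coprime.dvd_of_dvd_mul_left (m := 2) (n := 2)
      (Nat.coprime_two_right.mpr hNodd) (hq.dvd_of_pow_eq_one 4 h))
    have := Nat.le_of_dvd (by norm_num) h1; omega
  have hqq : q - q⁻¹ ≠ 0 := fun h => hq2 (by field_simp at h; linear_combination h)
  have hqR : q ^ R = 1 := (hq.pow_eq_one_iff_dvd R).mpr hR
  have hqR' : q⁻¹ ^ R = 1 := by rw [inv_pow, hqR, inv_one]
  have hreg' : ∀ i j, q ^ 2 * x i ≠ x j := fun i j => by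
    by_cases hij : i = j
    · subst hij
      exact fun h => hq2 (mul_right_cancel₀ (hx0 i) (by rw [h, one_mul]))
    grind
  set Q : ℂ[X] := ∏ k, (X - C (x k)) with hQ
  have hQdeg : Q.natDegree ≤ R := by
    rw [hQ, natDegree_prod_of_monic _ _ fun i _ => monic_X_sub_C _]; simp
  -- generic points with independent functionals
  set bad : Finset ℂ := insert 0 (univ.image x ∪ univ.image (fun i => q ^ 2 * x i) ∪
    univ.image (fun i => q ^ 4 * x i)) with hbad
  obtain ⟨W, hWR, hWb, hWa, hWi⟩ := exists_independent_evaluations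
    (U := degreeLT ℂ (R + 1)) (R := R) (by
      rw [LinearEquiv.finrank_eq (degreeLTEquiv ℂ (R + 1))]; simp)
    ((baxterMap q L Q).comp (degreeLT ℂ (R + 1)).subtype)
    ⟨Q, mem_degreeLT.mpr (lt_of_le_of_lt degree_le_natDegree
      (by exact_mod_cast Nat.lt_succ_of_le hQdeg))⟩ (fun ρ hρ => by
        have hdeg : (ρ : ℂ[X]).natDegree ≤ R := by
          rw [natDegree_le_iff_degree_le]
          exact Order.le_of_lt_succ (by exact_mod_cast mem_degreeLT.mp ρ.2)
        obtain ⟨c, hc⟩ := exists_smul_of_qWronskian_eq_zero hq0 hreg' hdeg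
          (qWronskian_eq_zero hN3 hNodd hq hLR hQdeg hdeg (sub_eq_zero.mp hρ))
        exact ⟨c, Subtype.ext hc⟩)
    bad (pow_ne_zero 2 hq0) hq2 (mem_insert_self _ _)
  have hWx : ∀ w ∈ W, w ≠ 0 ∧ (∀ i, w ≠ x i) ∧ (∀ i, w ≠ q ^ 2 * x i) ∧ ∀ i, w ≠ q ^ 4 * x i := by
    intro w hw
    have := disjoint_left.mp hWb hw
    simp only [hbad, mem_insert, mem_union, mem_image, mem_univ,
      true_and, not_or, not_exists] at this
    exact ⟨this.1, fun i h => this.2.1.1 i h.symm, fun i h => this.2.1.2 i h.symm,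
      fun i h => this.2.2 i h.symm⟩
  -- the set of all points
  set P : Finset ℂ := univ.image x ∪ univ.image (fun i => q ^ 2 * x i) ∪ W with hP
  have hP0 : (0 : ℂ) ∉ P := by
    simp only [hP, mem_union, mem_image, mem_univ, true_and, not_or, not_exists]
    exact ⟨⟨fun i => hx0 i, fun i => mul_ne_zero (pow_ne_zero 2 hq0) (hx0 i)⟩,
      fun h => (hWx 0 h).1 rfl⟩
  have hs : Injective (Subtype.val : P → ℂ) := Subtype.val_injective
  have hs0 : ∀ i : P, (i : ℂ) ≠ 0 := fun i h => hP0 (h ▸ i.2)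
  obtain ⟨p, hpx⟩ : ∃ p : Fin R → P, ∀ i, (p i : ℂ) = x i :=
    ⟨fun i => ⟨x i, by simp [hP]⟩, fun _ => rfl⟩
  obtain ⟨w', hwx⟩ : ∃ p : Fin R → P, ∀ i, (p i : ℂ) = q ^ 2 * x i :=
    ⟨fun i => ⟨q ^ 2 * x i, mem_union_left _ (mem_union_right _
      (mem_image.mpr ⟨i, mem_univ i, rfl⟩))⟩, fun _ => rfl⟩
  have hp : Injective p := fun i j h => hx (by rw [← hpx, ← hpx, h])
  have hw' : Injective w' := fun i j h =>
    hx (mul_left_cancel₀ (pow_ne_zero 2 hq0) (by rw [← hwx, ← hwx, h]))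
  have hpw : ∀ k l, p k ≠ w' l := fun k l h => hreg' l k (by rw [← hwx, ← hpx, h])
  set Z : Finset P := univ.image p with hZ
  set W' : Finset P := univ.image w' with hW'
  set S : Finset P := W.subtype (· ∈ P) with hS
  have hSW : ∀ i : P, i ∈ S ↔ (i : ℂ) ∈ W := fun i => by simp [hS]
  have hSZ : Disjoint S Z := by
    rw [disjoint_left]
    intro i hi hiZ
    obtain ⟨k, -, rfl⟩ := mem_image.mp hiZ
    exact (hWx _ ((hSW _).mp hi)).2.1 k (hpx k)
  have hprodZ : ∀ g : P → ℂ, ∏ k ∈ Z, g k = ∏ k, g (p k) := fun g =>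
    prod_image hp.injOn
  have hprodZ' : ∀ (g : P → ℂ) j, ∏ k ∈ Z.erase (p j), g k =
      ∏ k ∈ univ.erase j, g (p k) := fun g j => by rw [hZ, ← image_erase hp, prod_image hp.injOn]
  -- the homogeneous system
  set E := ExchangeSystem.ofRTT hq0 hq4 hT htri hv (Subtype.val : P → ℂ) hs0 with hE
  have hEZ : ((ofFn fun i => T (x i) 0 1).prod) v = E.bvec Z := by
    have h1 := E.list_prod_B_vac (l := ofFn p) (List.nodup_ofFn.mpr hp)
    have h2 : (ofFn p).toFinset = Z := by ext i; simp [hZ, List.mem_ofFn]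
    have h3 : (fun i => T (x i) 0 1) = E.B ∘ p := by funext i; rw [← hpx]; rfl
    rw [h2, List.map_ofFn] at h1
    rw [h3]
    exact h1
  rw [hEZ]
  intro hzero
  have hEa : ∀ i : P, E.a i = a i := fun _ => rfl
  have hEd : ∀ i : P, E.d i = d i := fun _ => rfl
  clear_value E
  -- an auxiliary inhomogeneous system
  obtain ⟨E', hE'a, hE'd⟩ := exists_exchangeSystem (N := N) hqt ht hqq hq4 hq.pow_eq_one hP0
    (fun y => if ∃ i, y = q ^ 2 * x i then 0 else a y)
    (fun y => if ∃ i, y = q ^ 2 * x i then 1 else d y)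
  have hnot : ∀ i : P, i ∈ Z ∪ S → ¬ ∃ k, (i : ℂ) = q ^ 2 * x k := by
    rintro i hi ⟨k, hk⟩
    rcases mem_union.mp hi with hi | hi
    · obtain ⟨l, -, rfl⟩ := mem_image.mp hi
      exact hreg' k l (by rw [← hk, hpx])
    · exact (hWx _ ((hSW _).mp hi)).2.2.1 k hk
  have hE'a1 : ∀ i ∈ Z ∪ S, E'.a i = a i := fun i hi => by rw [hE'a, if_neg (hnot i hi)]
  have hE'd1 : ∀ i ∈ Z ∪ S, E'.d i = d i := fun i hi => by rw [hE'd, if_neg (hnot i hi)]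
  have hpZ : ∀ k, p k ∈ Z := fun k => mem_image_of_mem p (mem_univ k)
  have hpZS : ∀ k, p k ∈ Z ∪ S := fun k => mem_union_left _ (hpZ k)
  have hne : E'.covac (E'.cop W' (E'.bvec Z)) ≠ 0 := by
    have h := E'.dual.domainWall_ne_zero hq0 hq2 hs hp hw' hpw
      (fun k => by rw [hwx, hpx]) (fun k l hkl => by rw [hpx, hpx]; exact hreg' l k)
      (fun k => (hE'a (w' k)).trans (if_pos ⟨k, hwx k⟩))
      (fun k => by
        have : E'.dual.a (p k) = a (x k) := (hE'a1 _ (hpZS k)).trans (by rw [hpx])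
        rw [this]; exact hax k)
      (fun k => by
        have : E'.dual.d (w' k) = 1 := (hE'd (w' k)).trans (if_pos ⟨k, hwx k⟩)
        rw [this]; exact one_ne_zero) univ
    rwa [ExchangeSystem.dual_covac_cop, ExchangeSystem.dual_bvec_apply] at h
  have hshell : ∀ i ∉ Z, E'.A i (E'.bvec Z) + E'.D i (E'.bvec Z) =
      (E'.a i * ∏ k ∈ Z, fA q i k + E'.d i * ∏ k ∈ Z, fD q i k) • E'.bvec Z := by
    intro i hi
    refine E'.transfer_bvec hq0 hs (fun j hj => ?_) hi
    obtain ⟨k, -, rfl⟩ := mem_image.mp hj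
    rw [hprodZ', hprodZ', hE'a1 _ (hpZS k), hE'd1 _ (hpZS k)]
    simp only [hpx]
    exact hbethe k
  have hSc : #S = R := by
    rw [hS, card_subtype, ← hWR]
    congr 1
    grind
  have hW'c : #W' = R := by rw [hW', card_image_of_injective _ hw']; simp
  refine E'.scalar_product_ne_zero_of_linearIndependent hq0 hq2 hs hW'c hSc
    (fun i _ => hs0 i) ?_ (fun i hi => hshell i ?_) ?_ hne ?_
  · intro i hi j hj he
    rcases mem_union.mp hi with hi | hi <;> rcases mem_union.mp hj with hj | hj
    · obtain ⟨k, -, rfl⟩ := mem_image.mp hi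
      obtain ⟨l, -, rfl⟩ := mem_image.mp hj
      rw [hwx, hwx] at he
      exact hreg' l k (mul_left_cancel₀ (pow_ne_zero 2 hq0) he)
    · obtain ⟨k, -, rfl⟩ := mem_image.mp hi
      rw [hwx] at he
      exact (hWx _ ((hSW _).mp hj)).2.1 k (mul_left_cancel₀ (pow_ne_zero 2 hq0) he)
    · obtain ⟨l, -, rfl⟩ := mem_image.mp hj
      rw [hwx] at he
      exact (hWx _ ((hSW _).mp hi)).2.2.2 l (by rw [← he]; ring)
    · exact hWa _ ((hSW _).mp hj) _ ((hSW _).mp hi) he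
  · intro hiZ
    obtain ⟨k, -, rfl⟩ := mem_image.mp hiZ
    rcases mem_union.mp hi with hi | hi
    · obtain ⟨l, -, h⟩ := mem_image.mp hi
      exact hpw k l h.symm
    · exact disjoint_left.mp hSZ hi hiZ
  · intro c hc
    have hQw : ∀ w ∈ W, Q.eval w ≠ 0 := fun w hw => by
      rw [hQ, eval_prod]
      refine prod_ne_zero_iff.mpr fun k _ => ?_
      simpa [sub_eq_zero] using (hWx w hw).2.1 k
    set c' : ℂ → ℂ := fun y => if h : y ∈ P then c ⟨y, h⟩ * (κ / Q.eval y) else 0 with hc'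
    have hWP : ∀ w ∈ W, w ∈ P := fun w hw => mem_union_right _ hw
    have hmain := hWi c' fun ρ => by
      refine Eq.trans ?_ (hc ρ (mem_degreeLT.mp ρ.2))
      have hsum : ∀ F : ℂ → ℂ, ∑ w ∈ W, F w = ∑ i ∈ S, F (i : ℂ) := by
        intro F
        rw [hS, sum_subtype_eq_sum_filter, filter_true_of_mem hWP]
      rw [hsum]
      refine sum_congr rfl fun i hi => ?_
      have hiW := (hSW i).mp hi
      have hiZS : i ∈ Z ∪ S := mem_union_right _ hi
      have hA := prod_fA_eq hq0 (x := x) (w := i) (hWx _ hiW).2.1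
      have hD := prod_fA_eq (inv_ne_zero hq0) (x := x) (w := i) (hWx _ hiW).2.1
      rw [hqR', one_mul] at hA
      rw [inv_inv, hqR, one_mul] at hD
      simp only [fA_inv] at hD
      rw [hprodZ, hprodZ, hE'a1 i hiZS, hE'd1 i hiZS, ha, hd, hqR, hqR']
      simp only [hpx]
      have hc'i : c' i = c i * (κ / Q.eval (i : ℂ)) := by simp [hc']
      rw [hc'i]
      simp only [LinearMap.comp_apply, Submodule.subtype_apply, eval_baxterMap hq0]
      rw [← hA, ← hD]
      have := hQw _ hiW
      field_simp
      ring
    intro i hi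
    have h1 := hmain i ((hSW i).mp hi)
    simp only [hc', i.2, dif_pos] at h1
    exact (mul_eq_zero.mp h1).resolve_right (div_ne_zero hκ (hQw _ ((hSW i).mp hi)))
  · rw [← E.scalar_product_congr_on E' (fun i hi => by rw [hEa, hE'a1 i hi])
      (fun i hi => by rw [hEd, hE'd1 i hi]) hq0 hs hSZ, hzero, map_zero, map_zero]

end OnShell

/-! ### Sums over splittings -/

/-- The `q`-integer as a function of `q`. -/
def qNum (q : ℂ) (n : ℕ) : ℂ := (q ^ n - (q ^ n)⁻¹) / (q - q⁻¹)

lemma qInt_eq (t : ℂ) (n : ℕ) : qInt t n = qNum (t ^ 2) n := rfl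

lemma qNum_inv (q : ℂ) (n : ℕ) : qNum q⁻¹ n = qNum q n := by
  rw [qNum, qNum, inv_pow, inv_inv, inv_inv, ← neg_sub (q ^ n), ← neg_sub q, neg_div_neg_eq]

lemma qNum_add {q : ℂ} (hq : q ≠ 0) (m n : ℕ) :
    qNum q (m + n) = q ^ m * qNum q n + (q ^ n)⁻¹ * qNum q m := by
  have h1 : q ^ m ≠ 0 := pow_ne_zero m hq
  have h2 : q ^ n ≠ 0 := pow_ne_zero n hq
  simp only [qNum, pow_add, ← mul_div_assoc, ← add_div]
  congr 1
  field_simp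
  ring

section Lagrange

variable {ι : Type*} [DecidableEq ι]

open Polynomial in
lemma sum_prod_fD {q : ℂ} (hqq : q - q⁻¹ ≠ 0) {s : ι → ℂ} (S : Finset ι)
    (hs : Set.InjOn s S) (h0 : ∀ i ∈ S, s i ≠ 0) :
    ∑ j ∈ S, ∏ i ∈ S.erase j, fD q (s i) (s j) = qNum q #S := by
  rcases S.eq_empty_or_nonempty with rfl | hne
  · simp [qNum]
  set P : ℂ[X] := ∏ i ∈ S, (C q * X - C (q⁻¹ * s i)) - C (q⁻¹ ^ #S) * ∏ i ∈ S, (X - C (s i)) with hP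
  have hP0 : P.coeff 0 = 0 := by
    rw [coeff_zero_eq_eval_zero, hP]
    simp only [eval_sub, eval_mul, eval_prod, eval_C, eval_X, mul_zero, zero_sub]
    rw [← prod_const, ← prod_mul_distrib, sub_eq_zero]
    simp
  have hPX : P = X * P.divX := by
    conv_lhs => rw [← P.X_mul_divX_add, hP0]
    simp
  have h1 : (∏ i ∈ S, (C q * X - C (q⁻¹ * s i))).natDegree ≤ #S := by
    refine (natDegree_prod_le _ _).trans ?_
    rw [card_eq_sum_ones]
    refine sum_le_sum fun i _ => ?_
    compute_degree
  have h2 : (∏ i ∈ S, (X - C (s i))).natDegree ≤ #S := by simp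
  have hPdeg : P.natDegree ≤ #S :=
    (natDegree_sub_le _ _).trans (max_le h1 ((natDegree_C_mul_le _ _).trans h2))
  have hc1 : (∏ i ∈ S, (C q * X - C (q⁻¹ * s i))).coeff #S = q ^ #S := by
    have := coeff_prod_of_natDegree_le (s := S) (f := fun i => C q * X - C (q⁻¹ * s i)) (n := 1)
      (fun i _ => by compute_degree)
    rw [mul_one] at this
    rw [this, ← prod_const]
    simp
  have hc2 : (∏ i ∈ S, (X - C (s i))).coeff #S = 1 := by
    have hm : (∏ i ∈ S, (X - C (s i))).Monic := monic_prod_of_monic _ _ fun i _ => monic_X_sub_C _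
    have hd : (∏ i ∈ S, (X - C (s i))).natDegree = #S := by simp
    have := hm.coeff_natDegree
    rwa [hd] at this
  have hlead : P.divX.coeff (#S - 1) = q ^ #S - q⁻¹ ^ #S := by
    rw [coeff_divX, Nat.sub_add_cancel hne.card_pos, hP, coeff_sub, coeff_C_mul, hc1, hc2, mul_one]
  have hdeg : P.divX.degree < #S := by
    refine lt_of_le_of_lt degree_le_natDegree ?_
    rw [natDegree_divX_eq_natDegree_tsub_one]
    have := hne.card_pos
    exact_mod_cast (by omega : P.natDegree - 1 < #S)
  have hmain := Lagrange.coeff_eq_sum hs hdeg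
  rw [hlead] at hmain
  rw [qNum, eq_div_iff hqq, ← inv_pow, hmain, sum_mul]
  refine sum_congr rfl fun j hj => ?_
  have hev : s j * P.divX.eval (s j) = (q - q⁻¹) * s j *
      ∏ i ∈ S.erase j, (q * s j - q⁻¹ * s i) := by
    have e := congrArg (Polynomial.eval (s j)) hPX
    rw [eval_mul, eval_X] at e
    rw [← e, hP]
    simp only [eval_sub, eval_mul, eval_prod, eval_C, eval_X]
    have hz : ∏ i ∈ S, (s j - s i) = 0 := prod_eq_zero hj (sub_self _)
    rw [hz, mul_zero, sub_zero, ← mul_prod_erase S _ hj]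
    ring
  have hev' : P.divX.eval (s j) = (q - q⁻¹) * ∏ i ∈ S.erase j, (q * s j - q⁻¹ * s i) :=
    mul_left_cancel₀ (h0 j hj) (by rw [hev]; ring)
  rw [hev']
  simp only [fD, prod_div_distrib]
  ring

lemma sum_prod_fD_symm {q : ℂ} (hqq : q - q⁻¹ ≠ 0) {s : ι → ℂ} (S : Finset ι)
    (hs : Set.InjOn s S) (h0 : ∀ i ∈ S, s i ≠ 0) :
    ∑ j ∈ S, ∏ i ∈ S.erase j, fD q (s j) (s i) = qNum q #S := by
  rw [← qNum_inv, ← sum_prod_fD (by rw [inv_inv, ← neg_sub]; exact neg_ne_zero.mpr hqq) S hs h0]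
  refine sum_congr rfl fun j _ => prod_congr rfl fun i _ => ?_
  rw [fD, fD, inv_inv, ← neg_sub (q⁻¹ * s j), ← neg_sub (s j), neg_div_neg_eq]

open Polynomial in
lemma sum_mul_prod_sub {s : ι → ℂ} (S : Finset ι) (hs : Set.InjOn s S) {c : ℂ} (hc : c ≠ 1) :
    ∑ j ∈ S, s j * ∏ i ∈ S.erase j, ((s j - c * s i) / (s j - s i)) = ∑ j ∈ S, s j := by
  rcases S.eq_empty_or_nonempty with rfl | hne
  · simp
  have hm : ∀ f : ι → ℂ, (∏ i ∈ S, (X - C (f i))).Monic :=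
    fun f => monic_prod_of_monic _ _ fun i _ => monic_X_sub_C _
  have hd : ∀ f : ι → ℂ, (∏ i ∈ S, (X - C (f i))).degree = (#S : WithBot ℕ) := fun f => by
    rw [degree_prod]; simp
  set P : ℂ[X] := ∏ i ∈ S, (X - C (c * s i)) - ∏ i ∈ S, (X - C (s i)) with hP
  have hdeg : P.degree < #S := by
    have := degree_sub_lt_left ((hd fun i => c * s i).trans (hd s).symm) (hm _).ne_zero
      ((hm _).trans (hm _).symm)
    rwa [hd] at this
  have hmain := Lagrange.coeff_eq_sum hs hdeg
  have h1 : P.coeff (#S - 1) = (1 - c) * ∑ j ∈ S, s j := by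
    rw [hP, coeff_sub, prod_X_sub_C_coeff_card_pred _ _ hne.card_pos,
      prod_X_sub_C_coeff_card_pred _ _ hne.card_pos, ← mul_sum]
    ring
  have hc' : 1 - c ≠ 0 := sub_ne_zero.mpr hc.symm
  rw [h1] at hmain
  refine mul_left_cancel₀ hc' ?_
  rw [hmain, mul_sum]
  refine sum_congr rfl fun j hj => ?_
  have hz : ∏ i ∈ S, (s j - s i) = 0 := prod_eq_zero hj (sub_self _)
  rw [hP]
  simp only [eval_sub, eval_prod, eval_C, eval_X]
  rw [hz, sub_zero, ← mul_prod_erase S _ hj, prod_div_distrib]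
  ring

end Lagrange

section Splitting

variable {ι : Type*} [DecidableEq ι]

/-- The summand of a splitting into `S` and `T`. -/
def splitTerm (q : ℂ) (θ : ι → ι → ℂ) (u v : ι → ℂ) (S T : Finset ι) : ℂ :=
  (-1) ^ #S * (q ^ (#T).choose 2 * q⁻¹ ^ (#S).choose 2) *
    ((∏ i ∈ S, v i) * (∏ i ∈ T, u i) * ∏ i ∈ S, ∏ k ∈ T, θ i k)

/-- The sum over all splittings of `T`. -/
def splitSum (q : ℂ) (θ : ι → ι → ℂ) (u v : ι → ℂ) (T : Finset ι) : ℂ :=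
  ∑ S ∈ T.powerset, splitTerm q θ u v S (T \ S)

/-- The coefficient of the removal of one element. -/
def removalCoeff (q : ℂ) (θ : ι → ι → ℂ) (u v : ι → ℂ) (T : Finset ι) (j : ι) : ℂ :=
  u j * ∏ k ∈ T.erase j, (q * θ k j) - v j * ∏ k ∈ T.erase j, (q⁻¹ * θ j k)

lemma sum_powerset_insert_comm {M : Type*} [AddCommMonoid M] (T : Finset ι) (f : ι → Finset ι → M) :
    ∑ j ∈ T, ∑ S ∈ (T.erase j).powerset, f j (insert j S) = ∑ S ∈ T.powerset, ∑ j ∈ S, f j S := by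
  rw [sum_sigma', sum_sigma']
  refine sum_bij' (fun p _ => ⟨insert p.1 p.2, p.1⟩) (fun p _ => ⟨p.2, p.1.erase p.2⟩)
    ?_ ?_ ?_ ?_ ?_
  · rintro ⟨j, S⟩ h
    simp only [mem_sigma, mem_powerset, mem_insert_self, and_true] at h ⊢
    exact insert_subset h.1 (h.2.trans (erase_subset _ _))
  · rintro ⟨S, j⟩ h
    simp only [mem_sigma, mem_powerset] at h ⊢
    exact ⟨h.1 h.2, erase_subset_erase _ h.1⟩
  · rintro ⟨j, S⟩ h
    simp only [mem_sigma, mem_powerset] at h ⊢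
    rw [erase_insert fun hj => notMem_erase j T (h.2 hj)]
  · rintro ⟨S, j⟩ h
    simp only [mem_sigma, mem_powerset] at h ⊢
    rw [insert_erase h.2]
  · grind

lemma splitTerm_insert_right {q : ℂ} (θ : ι → ι → ℂ) (u v : ι → ℂ) {S T : Finset ι}
    (hST : Disjoint S T) {j : ι} (hj : j ∈ T) :
    (u j * ∏ k ∈ (S ∪ T).erase j, (q * θ k j)) * splitTerm q θ u v S (T.erase j) =
      splitTerm q θ u v S T * (q ^ #S * ∏ k ∈ T.erase j, θ k j) := by
  have hjS : j ∉ S := fun h => disjoint_left.mp hST h hj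
  have h1 : (S ∪ T).erase j = S ∪ T.erase j := by grind
  have h2 : Disjoint S (T.erase j) := hST.mono_right (erase_subset _ _)
  obtain ⟨n, hn⟩ : ∃ n, #T = n + 1 := ⟨#T - 1, by have := card_pos.mpr ⟨j, hj⟩; omega⟩
  have h3 : (T.erase j).card = n := by rw [card_erase_of_mem hj, hn, Nat.add_sub_cancel]
  rw [h1, prod_union h2, prod_mul_distrib, prod_mul_distrib,
    prod_const, prod_const, splitTerm, splitTerm, h3, hn,
    choose_succ_succ' n 1, choose_one_right, pow_add,
    ← mul_prod_erase T u hj]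
  have h4 : ∏ i ∈ S, ∏ k ∈ T, θ i k = (∏ i ∈ S, θ i j) * ∏ i ∈ S, ∏ k ∈ T.erase j, θ i k := by
    rw [← prod_mul_distrib]
    exact prod_congr rfl fun i _ => (mul_prod_erase T _ hj).symm
  rw [h4]
  ring

lemma splitTerm_insert_left {q : ℂ} (θ : ι → ι → ℂ) (u v : ι → ℂ) {S T : Finset ι}
    (hST : Disjoint S T) {j : ι} (hj : j ∈ S) :
    (v j * ∏ k ∈ (S ∪ T).erase j, (q⁻¹ * θ j k)) * splitTerm q θ u v (S.erase j) T =
      -(splitTerm q θ u v S T * (q⁻¹ ^ #T * ∏ k ∈ S.erase j, θ j k)) := by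
  have hjT : j ∉ T := fun h => disjoint_left.mp hST hj h
  have h1 : (S ∪ T).erase j = S.erase j ∪ T := by grind
  have h2 : Disjoint (S.erase j) T := hST.mono_left (erase_subset _ _)
  obtain ⟨n, hn⟩ : ∃ n, #S = n + 1 := ⟨#S - 1, by have := card_pos.mpr ⟨j, hj⟩; omega⟩
  have h3 : (S.erase j).card = n := by rw [card_erase_of_mem hj, hn, Nat.add_sub_cancel]
  rw [h1, prod_union h2, prod_mul_distrib, prod_mul_distrib,
    prod_const, prod_const, splitTerm, splitTerm, h3, hn,
    choose_succ_succ' n 1, choose_one_right, pow_add,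
    ← mul_prod_erase S v hj, ← mul_prod_erase S _ hj]
  ring

lemma qNum_mul_splitSum {q : ℂ} (hq : q ≠ 0) {θ : ι → ι → ℂ} {T : Finset ι}
    (h1 : ∀ S ⊆ T, ∑ j ∈ S, ∏ i ∈ S.erase j, θ i j = qNum q #S)
    (h2 : ∀ S ⊆ T, ∑ j ∈ S, ∏ i ∈ S.erase j, θ j i = qNum q #S) (u v : ι → ℂ) :
    ∑ j ∈ T, removalCoeff q θ u v T j * splitSum q θ u v (T.erase j) =
      qNum q #T * splitSum q θ u v T := by
  have e1 : ∑ j ∈ T, (u j * ∏ k ∈ T.erase j, (q * θ k j)) * splitSum q θ u v (T.erase j) =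
      ∑ S ∈ T.powerset, splitTerm q θ u v S (T \ S) * (q ^ #S * qNum q (T \ S).card) := by
    simp only [splitSum, mul_sum]
    rw [sum_comm' (t' := T.powerset) (s' := fun S => T \ S) (by
      intro j S
      simp only [mem_powerset, Finset.mem_sdiff]
      constructor
      · grind
      · rintro ⟨⟨hj, hjS⟩, hS⟩
        exact ⟨hj, subset_erase.mpr ⟨hS, hjS⟩⟩)]
    refine sum_congr rfl fun S hS => ?_
    rw [← h1 (T \ S) sdiff_subset, mul_sum, mul_sum]
    refine sum_congr rfl fun j hj => ?_
    rw [← splitTerm_insert_right θ u v disjoint_sdiff hj,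
      union_sdiff_of_subset (mem_powerset.mp hS), erase_sdiff_comm]
  have e2 : ∑ j ∈ T, (v j * ∏ k ∈ T.erase j, (q⁻¹ * θ j k)) * splitSum q θ u v (T.erase j) =
      -∑ S ∈ T.powerset, splitTerm q θ u v S (T \ S) * (q⁻¹ ^ (T \ S).card * qNum q #S) := by
    have e3 := sum_powerset_insert_comm T fun j S => (v j * ∏ k ∈ T.erase j, (q⁻¹ * θ j k)) *
      splitTerm q θ u v (S.erase j) (T \ S)
    rw [← sum_neg_distrib]
    refine Eq.trans (sum_congr rfl fun j hj => ?_) (e3.trans (sum_congr rfl fun S hS => ?_))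
    · rw [splitSum, mul_sum]
      refine sum_congr rfl fun S hS => ?_
      have hjS : j ∉ S := fun h => notMem_erase j T (mem_powerset.mp hS h)
      rw [erase_insert hjS, sdiff_insert, erase_sdiff_comm]
    · rw [← h2 S (mem_powerset.mp hS), mul_sum, mul_sum, ← sum_neg_distrib]
      refine sum_congr rfl fun j hj => ?_
      rw [← splitTerm_insert_left θ u v disjoint_sdiff hj,
        union_sdiff_of_subset (mem_powerset.mp hS)]
  simp only [removalCoeff, sub_mul, sum_sub_distrib]
  rw [e1, e2, sub_neg_eq_add, ← sum_add_distrib, splitSum, mul_sum]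
  refine sum_congr rfl fun S hS => ?_
  have hc : #T = #S + (T \ S).card := by
    rw [card_sdiff_of_subset (mem_powerset.mp hS)]
    have := card_le_card (mem_powerset.mp hS)
    omega
  rw [hc, qNum_add hq, inv_pow]
  ring

/-- The iterated removal of elements. -/
lemma iterate_removal {V : Type*} [AddCommGroup V] [Module ℂ V] {q : ℂ} (hq : q ≠ 0)
    {θ : ι → ι → ℂ} {u v : ι → ℂ} {F : ℕ → Finset ι → V} {Ψ : Finset ι → V} {I₀ : Finset ι}
    (h1 : ∀ S ⊆ I₀, ∑ j ∈ S, ∏ i ∈ S.erase j, θ i j = qNum q #S)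
    (h2 : ∀ S ⊆ I₀, ∑ j ∈ S, ∏ i ∈ S.erase j, θ j i = qNum q #S)
    (hF0 : ∀ I, F 0 I = Ψ I)
    (hF : ∀ m, ∀ I ⊆ I₀, F (m + 1) I = ∑ j ∈ I, removalCoeff q θ u v I j • F m (I.erase j))
    (m : ℕ) : ∀ I ⊆ I₀, F m I = (∏ i ∈ Icc 1 m, qNum q i) • ∑ T ∈ I.powersetCard m,
      splitSum q θ (fun i => u i * ∏ k ∈ I \ T, (q * θ k i))
        (fun i => v i * ∏ k ∈ I \ T, (q⁻¹ * θ i k)) T • Ψ (I \ T) := by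
  induction m with
  | zero =>
    intro I _
    simp [hF0, splitSum, splitTerm]
  | succ m ih =>
    intro I hI
    rw [hF m I hI, prod_Icc_succ_top (by omega), mul_smul, smul_sum]
    have e : ∀ j ∈ I, removalCoeff q θ u v I j • F m (I.erase j) =
        (∏ i ∈ Icc 1 m, qNum q i) • ∑ T ∈ (I.erase j).powersetCard m,
          (removalCoeff q θ u v I j * splitSum q θ
            (fun i => u i * ∏ k ∈ I \ insert j T, (q * θ k i))
            (fun i => v i * ∏ k ∈ I \ insert j T, (q⁻¹ * θ i k)) ((insert j T).erase j)) •
            Ψ (I \ insert j T) := by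
      intro j hj
      rw [ih _ ((erase_subset _ _).trans hI), smul_comm, smul_sum]
      refine congrArg _ (sum_congr rfl fun T hT => ?_)
      have hjT : j ∉ T := fun h =>
        notMem_erase j I ((mem_powersetCard.mp hT).1 h)
      have hsd : I.erase j \ T = I \ insert j T := by grind
      rw [erase_insert hjT, smul_smul, hsd]
    rw [sum_congr rfl e, ← smul_sum]
    congr 1
    have key : ∑ j ∈ I, ∑ T ∈ (I.erase j).powersetCard m,
          (removalCoeff q θ u v I j * splitSum q θ
            (fun i => u i * ∏ k ∈ I \ insert j T, (q * θ k i))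
            (fun i => v i * ∏ k ∈ I \ insert j T, (q⁻¹ * θ i k)) ((insert j T).erase j)) •
            Ψ (I \ insert j T) =
        ∑ T ∈ I.powersetCard (m + 1), ∑ j ∈ T,
          (removalCoeff q θ u v I j * splitSum q θ (fun i => u i * ∏ k ∈ I \ T, (q * θ k i))
            (fun i => v i * ∏ k ∈ I \ T, (q⁻¹ * θ i k)) (T.erase j)) • Ψ (I \ T) := by
      rw [sum_sigma', sum_sigma']
      refine sum_bij' (fun p _ => ⟨insert p.1 p.2, p.1⟩) (fun p _ => ⟨p.2, p.1.erase p.2⟩)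
        ?_ ?_ ?_ ?_ ?_
      · rintro ⟨j, S⟩ h
        simp only [mem_sigma, mem_powersetCard, mem_insert_self, and_true] at h ⊢
        refine ⟨insert_subset h.1 (h.2.1.trans (erase_subset _ _)), ?_⟩
        grind
      · rintro ⟨S, j⟩ h
        simp only [mem_sigma, mem_powersetCard] at h ⊢
        grind
      · rintro ⟨j, S⟩ h
        simp only [mem_sigma, mem_powersetCard] at h ⊢
        rw [erase_insert fun hj => notMem_erase j I (h.2.1 hj)]
      · rintro ⟨S, j⟩ h
        simp only [mem_sigma, mem_powersetCard] at h ⊢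
        rw [insert_erase h.2]
      · simp
    rw [key]
    refine sum_congr rfl fun T hT => ?_
    obtain ⟨hTI, hTc⟩ := mem_powersetCard.mp hT
    rw [← sum_smul, smul_smul, ← hTc, ← qNum_mul_splitSum hq
      (fun S hS => h1 S (hS.trans (hTI.trans hI))) (fun S hS => h2 S (hS.trans (hTI.trans hI)))]
    congr 1
    refine sum_congr rfl fun j hj => ?_
    congr 1
    have hsp : I.erase j = T.erase j ∪ (I \ T) := by grind
    have hdis : Disjoint (T.erase j) (I \ T) := disjoint_sdiff.mono_left (erase_subset _ _)
    rw [removalCoeff, removalCoeff, hsp, prod_union hdis, prod_union hdis]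
    ring

end Splitting

/-! ### Vanishing of the sums over splittings on solutions of the Bethe equations -/

section Vanishing

variable {ι : Type*} [DecidableEq ι]

lemma splitSum_linear_of_generic {q : ℂ} (hq : q ≠ 0) (hqq : q - q⁻¹ ≠ 0) {s : ι → ℂ} (β γ : ℂ)
    (T : Finset ι) (hs : Set.InjOn s T) (h0 : ∀ i ∈ T, s i ≠ 0)
    (hgen : ∀ n, 1 ≤ n → n ≤ #T → qNum q n ≠ 0) :
    splitSum q (fun i k => fD q (s k) (s i)) (fun i => 1 - (s i)⁻¹ * γ)
      (fun i => 1 - (s i)⁻¹ * β) T =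
      (∏ i ∈ T, (s i)⁻¹) * ∏ l ∈ range #T, (β * q⁻¹ ^ l - γ * q ^ l) := by
  induction T using strongInduction with
  | H T ih =>
    rcases T.eq_empty_or_nonempty with rfl | hne
    · simp [splitSum, splitTerm]
    have hq2 : q ^ 2 ≠ 1 := fun h => hqq (by field_simp; linear_combination h)
    have hq2' : q⁻¹ ^ 2 ≠ 1 := by rw [inv_pow]; exact inv_ne_one.mpr hq2
    obtain ⟨m, hm⟩ : ∃ m, #T = m + 1 := ⟨#T - 1, by have := hne.card_pos; omega⟩
    refine mul_left_cancel₀ (hgen #T hne.card_pos le_rfl) ?_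
    rw [← qNum_mul_splitSum hq
      (fun S hS => sum_prod_fD_symm hqq S (hs.mono hS) fun i hi => h0 i (hS hi))
      (fun S hS => sum_prod_fD hqq S (hs.mono hS) fun i hi => h0 i (hS hi))]
    have e1 : ∀ j ∈ T, splitSum q (fun i k => fD q (s k) (s i)) (fun i => 1 - (s i)⁻¹ * γ)
        (fun i => 1 - (s i)⁻¹ * β) (T.erase j) =
        ((∏ i ∈ T, (s i)⁻¹) * ∏ l ∈ range m, (β * q⁻¹ ^ l - γ * q ^ l)) * s j := by
      intro j hj
      have hc : (T.erase j).card = m := by rw [card_erase_of_mem hj, hm]; rfl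
      rw [ih (T.erase j) (erase_ssubset hj) (hs.mono (erase_subset _ _))
        (fun i hi => h0 i (mem_of_mem_erase hi)) (fun n h1 h2 => hgen n h1 (by omega)), hc,
        ← mul_prod_erase T _ hj]
      have := h0 j hj
      field_simp
    have e2 : ∀ j ∈ T, removalCoeff q (fun i k => fD q (s k) (s i)) (fun i => 1 - (s i)⁻¹ * γ)
        (fun i => 1 - (s i)⁻¹ * β) T j * s j =
        (s j * ∏ k ∈ T.erase j, ((s j - q ^ 2 * s k) / (s j - s k)) -
          γ * (q ^ m * ∏ k ∈ T.erase j, fD q (s j) (s k))) -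
        (s j * ∏ k ∈ T.erase j, ((s j - q⁻¹ ^ 2 * s k) / (s j - s k)) -
          β * (q⁻¹ ^ m * ∏ k ∈ T.erase j, fD q (s k) (s j))) := by
      intro j hj
      have hc : (T.erase j).card = m := by rw [card_erase_of_mem hj, hm]; rfl
      have h3 : ∏ k ∈ T.erase j, ((s j - q ^ 2 * s k) / (s j - s k)) =
          q ^ m * ∏ k ∈ T.erase j, fD q (s j) (s k) := by
        rw [← hc, ← prod_const, ← prod_mul_distrib]
        refine prod_congr rfl fun k _ => ?_
        rw [fD, ← mul_div_assoc, ← neg_sub (s k) (s j), ← neg_sub (q ^ 2 * s k), neg_div_neg_eq]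
        congr 1
        field_simp
      have h4 : ∏ k ∈ T.erase j, ((s j - q⁻¹ ^ 2 * s k) / (s j - s k)) =
          q⁻¹ ^ m * ∏ k ∈ T.erase j, fD q (s k) (s j) := by
        rw [← hc, ← prod_const, ← prod_mul_distrib]
        refine prod_congr rfl fun k _ => ?_
        rw [fD, ← mul_div_assoc]
        congr 1
        rw [mul_sub, ← mul_assoc, inv_mul_cancel₀ hq]; ring
      rw [h3, h4, removalCoeff, prod_mul_distrib, prod_mul_distrib, prod_const, prod_const, hc]
      have := h0 j hj
      field_simp
    rw [sum_congr rfl fun j hj => by rw [e1 j hj, mul_left_comm, e2 j hj], ← mul_sum]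
    simp only [sum_sub_distrib, ← mul_sum]
    rw [sum_mul_prod_sub T hs hq2, sum_mul_prod_sub T hs hq2', sum_prod_fD hqq T hs h0,
      sum_prod_fD_symm hqq T hs h0, hm, prod_range_succ]
    ring

lemma eventually_qNum_ne_zero {q₀ : ℂ} (hq : q₀ ≠ 0) (M : ℕ) :
    ∀ᶠ q in 𝓝[≠] q₀, q ≠ 0 ∧ q - q⁻¹ ≠ 0 ∧ ∀ n, 1 ≤ n → n ≤ M → qNum q n ≠ 0 := by
  have h1 : ∀ n, 1 ≤ n → ∀ᶠ q in 𝓝[≠] q₀, q ^ (2 * n) ≠ 1 := by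
    intro n hn
    set p : Polynomial ℂ := Polynomial.X ^ (2 * n) - Polynomial.C 1
    have hp : p ≠ 0 := Polynomial.X_pow_sub_C_ne_zero (by omega) 1
    have hfin : (p.roots.toFinset : Set ℂ).Finite := finite_toSet _
    have := (hfin.subset (Set.sdiff_subset (t := {q₀}))).isClosed.isOpen_compl.mem_nhds
      (x := q₀) (by simp)
    filter_upwards [mem_nhdsWithin_of_mem_nhds this, self_mem_nhdsWithin] with q hq1 hq2 h
    refine hq1 ⟨?_, hq2⟩
    simp only [mem_coe, Multiset.mem_toFinset, Polynomial.mem_roots hp, Polynomial.IsRoot,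
      p, Polynomial.eval_sub, Polynomial.eval_pow, Polynomial.eval_X, Polynomial.eval_C, h,
      sub_self]
  have h2 : ∀ᶠ q in 𝓝[≠] q₀, ∀ n ∈ Icc 1 (M + 1), q ^ (2 * n) ≠ 1 :=
    (Filter.eventually_all_finset _).mpr fun n hn => h1 n (mem_Icc.mp hn).1
  filter_upwards [h2, mem_nhdsWithin_of_mem_nhds (isOpen_ne.mem_nhds hq)] with q h3 h4
  have key : ∀ n, 1 ≤ n → n ≤ M + 1 → q ^ n - (q ^ n)⁻¹ ≠ 0 := by
    intro n h5 h6 h7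
    apply h3 n (mem_Icc.mpr ⟨h5, h6⟩)
    rw [mul_comm, pow_mul]
    field_simp at h7
    grind
  have h5 : q - q⁻¹ ≠ 0 := by simpa using key 1 le_rfl (by omega)
  exact ⟨h4, h5, fun n h6 h7 => div_ne_zero (key n h6 (by omega)) h5⟩

lemma continuousAt_splitSum {X : Type*} [TopologicalSpace X] {x₀ : X} {q : X → ℂ}
    {θ : X → ι → ι → ℂ} {u v : X → ι → ℂ} (hq0 : q x₀ ≠ 0) (hq : ContinuousAt q x₀) {T : Finset ι}
    (hθ : ∀ i ∈ T, ∀ k ∈ T, i ≠ k → ContinuousAt (fun x => θ x i k) x₀)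
    (hu : ∀ i ∈ T, ContinuousAt (fun x => u x i) x₀)
    (hv : ∀ i ∈ T, ContinuousAt (fun x => v x i) x₀) :
    ContinuousAt (fun x => splitSum (q x) (θ x) (u x) (v x) T) x₀ := by
  have key : ∀ S ∈ T.powerset, ContinuousAt
      (fun x => splitTerm (q x) (θ x) (u x) (v x) S (T \ S)) x₀ := by
    intro S hS
    rw [mem_powerset] at hS
    have h1 : ContinuousAt (fun x => ∏ i ∈ S, v x i) x₀ :=
      tendsto_finsetProd _ fun i hi => hv i (hS hi)
    have h2 : ContinuousAt (fun x => ∏ i ∈ T \ S, u x i) x₀ :=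
      tendsto_finsetProd _ fun i hi => hu i (Finset.mem_sdiff.mp hi).1
    have h5 : ∀ i ∈ S, ∀ k ∈ T \ S, Tendsto (fun x => θ x i k) (𝓝 x₀) (𝓝 (θ x₀ i k)) := by
      intro i hi k hk
      rw [Finset.mem_sdiff] at hk
      exact hθ i (hS hi) k hk.1 (by rintro rfl; exact hk.2 hi)
    have h3 : Tendsto (fun x => ∏ i ∈ S, ∏ k ∈ T \ S, θ x i k) (𝓝 x₀)
        (𝓝 (∏ i ∈ S, ∏ k ∈ T \ S, θ x₀ i k)) :=
      tendsto_finsetProd S fun i hi => tendsto_finsetProd (T \ S) fun k hk => h5 i hi k hk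
    have h4 : ContinuousAt (fun x => (q x)⁻¹) x₀ := hq.inv₀ hq0
    exact (continuousAt_const.mul ((hq.pow _).mul (h4.pow _))).mul ((h1.mul h2).mul h3)
  exact tendsto_finsetSum _ key

lemma continuousAt_fD {q₀ : ℂ} (hq : q₀ ≠ 0) (s u : ℂ) : ContinuousAt (fun q => fD q s u) q₀ := by
  unfold fD
  fun_prop (disch := assumption)

lemma splitSum_linear {q : ℂ} (hq : q ≠ 0) {s : ι → ℂ} (β γ : ℂ)
    (T : Finset ι) (hs : Set.InjOn s T) (h0 : ∀ i ∈ T, s i ≠ 0) :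
    splitSum q (fun i k => fD q (s k) (s i)) (fun i => 1 - (s i)⁻¹ * γ)
      (fun i => 1 - (s i)⁻¹ * β) T =
      (∏ i ∈ T, (s i)⁻¹) * ∏ l ∈ range #T, (β * q⁻¹ ^ l - γ * q ^ l) := by
  have h1 : ContinuousAt (fun q => splitSum q (fun i k => fD q (s k) (s i))
      (fun i => 1 - (s i)⁻¹ * γ) (fun i => 1 - (s i)⁻¹ * β) T) q :=
    continuousAt_splitSum (x₀ := q) (q := fun p => p) (θ := fun p i k => fD p (s k) (s i))
      (u := fun _ i => 1 - (s i)⁻¹ * γ) (v := fun _ i => 1 - (s i)⁻¹ * β) hq continuousAt_id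
      (fun i _ k _ _ => continuousAt_fD hq _ _) (fun _ _ => continuousAt_const)
      (fun _ _ => continuousAt_const)
  have h2 : Tendsto (fun q => (∏ i ∈ T, (s i)⁻¹) *
      ∏ l ∈ range #T, (β * q⁻¹ ^ l - γ * q ^ l)) (𝓝[≠] q) (𝓝 _) :=
    (tendsto_const_nhds.mul (tendsto_finsetProd _ fun l _ => ((tendsto_const_nhds.mul
      ((tendsto_id.inv₀ hq).pow l)).sub (tendsto_const_nhds.mul
        (tendsto_id.pow l))))).mono_left nhdsWithin_le_nhds
  refine tendsto_nhds_unique ((h1.tendsto.mono_left nhdsWithin_le_nhds).congr' ?_) h2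
  filter_upwards [eventually_qNum_ne_zero hq #T] with q' h
  exact splitSum_linear_of_generic h.1 h.2.1 β γ T hs h0 h.2.2

/-- On a solution of the Bethe equations the sum over splittings of a nonempty subset vanishes. -/
lemma splitSum_bethe_eq_zero {q : ℂ} (hq : q ≠ 0) {s : ι → ℂ} {Z U : Finset ι} (hU : U ⊆ Z)
    (hne : U.Nonempty) (hs : Set.InjOn s Z) (h0 : ∀ i ∈ Z, s i ≠ 0)
    (hreg : ∀ i ∈ Z, ∀ k ∈ Z, i ≠ k → q * s k - q⁻¹ * s i ≠ 0) {u v : ι → ℂ}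
    (hbethe : ∀ i ∈ Z, v i * ∏ k ∈ Z.erase i, (q⁻¹ * fD q (s i) (s k)) =
      q ^ 2 * (u i * ∏ k ∈ Z.erase i, (q * fD q (s k) (s i)))) {σ : ℂ}
    (hσ : ∀ i ∈ U, 1 - σ * (s i)⁻¹ ≠ 0 ∧ 1 - q⁻¹ ^ (2 * (#U - 1)) * σ * (s i)⁻¹ ≠ 0) :
    splitSum q (fun i k => fD q (s i) (s k))
      (fun i => (u i * ∏ k ∈ Z \ U, (q * fD q (s k) (s i))) * (q ^ #U * (1 - σ * (s i)⁻¹)⁻¹))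
      (fun i => (v i * ∏ k ∈ Z \ U, (q⁻¹ * fD q (s i) (s k))) *
        (q⁻¹ ^ #U * (1 - q⁻¹ ^ (2 * (#U - 1)) * σ * (s i)⁻¹)⁻¹)) U = 0 := by
  obtain ⟨j, hj⟩ : ∃ j, #U = j + 1 := ⟨#U - 1, by have := hne.card_pos; omega⟩
  have hj' : #U - 1 = j := by omega
  rw [hj'] at hσ ⊢
  rw [hj]
  set γ : ℂ := q⁻¹ ^ (2 * j) * σ with hγ
  have hθ : ∀ i ∈ U, ∀ k ∈ U, i ≠ k → fD q (s i) (s k) ≠ 0 := fun i hi k hk hik =>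
    div_ne_zero (hreg i (hU hi) k (hU hk) hik)
      (sub_ne_zero.mpr fun h => hik (hs (hU hi) (hU hk) h.symm))
  have hsplit : ∀ i ∈ U, Z.erase i = U.erase i ∪ (Z \ U) := fun i hi => by grind
  have hdis : ∀ i, Disjoint (U.erase i) (Z \ U) := fun i =>
    disjoint_sdiff.mono_left (erase_subset _ _)
  set X : ι → ℂ := fun i => v i * ∏ k ∈ Z.erase i, (q⁻¹ * fD q (s i) (s k)) with hX
  have hcard : ∀ i ∈ U, (U.erase i).card = j := fun i hi => by grind
  have hP : ∀ i ∈ U, ∏ k ∈ U.erase i, fD q (s i) (s k) ≠ 0 := fun i hi =>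
    prod_ne_zero_iff.mpr fun k hk => hθ i hi k (mem_of_mem_erase hk) (ne_of_mem_erase hk).symm
  have hP' : ∀ i ∈ U, ∏ k ∈ U.erase i, fD q (s k) (s i) ≠ 0 := fun i hi =>
    prod_ne_zero_iff.mpr fun k hk => hθ k (mem_of_mem_erase hk) i hi (ne_of_mem_erase hk)
  have hv : ∀ i ∈ U, (v i * ∏ k ∈ Z \ U, (q⁻¹ * fD q (s i) (s k))) *
        (q⁻¹ ^ (j + 1) * (1 - γ * (s i)⁻¹)⁻¹) =
      (q⁻¹ * X i * (1 - γ * (s i)⁻¹)⁻¹ * (1 - σ * (s i)⁻¹)⁻¹) *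
        ((1 - (s i)⁻¹ * σ) * (∏ k ∈ U.erase i, fD q (s i) (s k))⁻¹) := by
    intro i hi
    have h1 : X i = v i * (q⁻¹ ^ j * (∏ k ∈ U.erase i, fD q (s i) (s k)) *
        ∏ k ∈ Z \ U, (q⁻¹ * fD q (s i) (s k))) := by
      rw [hX]; simp only
      rw [hsplit i hi, prod_union (hdis i)]
      simp only [prod_mul_distrib, prod_const, hcard i hi]
    rw [h1, mul_comm (s i)⁻¹ σ]
    generalize ∏ k ∈ Z \ U, (q⁻¹ * fD q (s i) (s k)) = A
    linear_combination (exp := 1) -(v i * A * q⁻¹ ^ (j + 1) * (1 - γ * (s i)⁻¹)⁻¹) *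
      ((∏ k ∈ U.erase i, fD q (s i) (s k)) * (∏ k ∈ U.erase i, fD q (s i) (s k))⁻¹ *
        inv_mul_cancel₀ (hσ i hi).1 + mul_inv_cancel₀ (hP i hi))
  have hu : ∀ i ∈ U, (u i * ∏ k ∈ Z \ U, (q * fD q (s k) (s i))) *
        (q ^ (j + 1) * (1 - σ * (s i)⁻¹)⁻¹) =
      (q⁻¹ * X i * (1 - γ * (s i)⁻¹)⁻¹ * (1 - σ * (s i)⁻¹)⁻¹) *
        ((1 - (s i)⁻¹ * γ) * (∏ k ∈ U.erase i, fD q (s k) (s i))⁻¹) := by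
    intro i hi
    have h1 : X i = q ^ 2 * (u i * (q ^ j * (∏ k ∈ U.erase i, fD q (s k) (s i)) *
        ∏ k ∈ Z \ U, (q * fD q (s k) (s i)))) := by
      rw [hX]; simp only
      rw [hbethe i (hU hi), hsplit i hi, prod_union (hdis i)]
      simp only [prod_mul_distrib, prod_const, hcard i hi]
    rw [h1, mul_comm (s i)⁻¹ γ]
    generalize ∏ k ∈ Z \ U, (q * fD q (s k) (s i)) = A
    linear_combination (exp := 1) -(q⁻¹ * q ^ 2 * u i * A * q ^ j * (1 - σ * (s i)⁻¹)⁻¹) *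
      ((∏ k ∈ U.erase i, fD q (s k) (s i)) * (∏ k ∈ U.erase i, fD q (s k) (s i))⁻¹ *
        inv_mul_cancel₀ (hσ i hi).2 + mul_inv_cancel₀ (hP' i hi)) -
      (q * u i * A * q ^ j * (1 - σ * (s i)⁻¹)⁻¹) * inv_mul_cancel₀ hq
  have hzero := splitSum_linear hq σ γ U (hs.mono hU) fun i hi => h0 i (hU hi)
  have hlast : σ * q⁻¹ ^ j - γ * q ^ j = 0 := by
    have h1 : q⁻¹ ^ j * q ^ j = 1 := by rw [← mul_pow, inv_mul_cancel₀ hq, one_pow]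
    rw [hγ, two_mul, pow_add]
    grind
  rw [hj, prod_range_succ, hlast, mul_zero, mul_zero] at hzero
  set Θ : ℂ := ∏ i ∈ U, ∏ k ∈ U.erase i, fD q (s i) (s k) with hΘ
  have hΘ0 : Θ ≠ 0 := prod_ne_zero_iff.mpr hP
  set Y : ℂ := ∏ i ∈ U, (q⁻¹ * X i * (1 - γ * (s i)⁻¹)⁻¹ * (1 - σ * (s i)⁻¹)⁻¹) with hY
  refine Eq.trans ?_ ((congrArg (fun w => Y * Θ⁻¹ * w) hzero).trans (mul_zero _))
  simp only [splitSum]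
  rw [mul_sum]
  refine sum_congr rfl fun S hS => ?_
  have hSU := mem_powerset.mp hS
  simp only [splitTerm]
  rw [prod_congr rfl fun i hi => hv i (hSU hi),
    prod_congr rfl fun i hi => hu i (Finset.mem_sdiff.mp hi).1]
  simp only [prod_mul_distrib, prod_inv_distrib]
  have hYs : Y = (∏ i ∈ S, (q⁻¹ * X i * (1 - γ * (s i)⁻¹)⁻¹ * (1 - σ * (s i)⁻¹)⁻¹)) *
      ∏ i ∈ U \ S, (q⁻¹ * X i * (1 - γ * (s i)⁻¹)⁻¹ * (1 - σ * (s i)⁻¹)⁻¹) := by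
    rw [mul_comm, prod_sdiff hSU]
  simp only [prod_mul_distrib, prod_inv_distrib] at hYs
  rw [hYs]
  -- the products over pairs
  set P11 : ℂ := ∏ i ∈ S, ∏ k ∈ S.erase i, fD q (s i) (s k) with hP11
  set P22 : ℂ := ∏ i ∈ U \ S, ∏ k ∈ (U \ S).erase i, fD q (s i) (s k) with hP22
  set P12 : ℂ := ∏ i ∈ S, ∏ k ∈ U \ S, fD q (s i) (s k) with hP12
  set P21 : ℂ := ∏ i ∈ S, ∏ k ∈ U \ S, fD q (s k) (s i) with hP21
  have hUS : U = S ∪ (U \ S) := (union_sdiff_of_subset hSU).symm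
  have herase1 : ∀ i ∈ S, U.erase i = S.erase i ∪ (U \ S) := fun i hi => by
    have h2 : i ∉ U \ S := fun h => (Finset.mem_sdiff.mp h).2 hi
    calc U.erase i = (S ∪ (U \ S)).erase i := by rw [← hUS]
      _ = _ := by rw [erase_union_distrib, erase_eq_of_notMem h2]
  have herase2 : ∀ i ∈ U \ S, U.erase i = S ∪ (U \ S).erase i := fun i hi => by
    have h2 : i ∉ S := (Finset.mem_sdiff.mp hi).2
    calc U.erase i = (S ∪ (U \ S)).erase i := by rw [← hUS]
      _ = _ := by rw [erase_union_distrib, erase_eq_of_notMem h2]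
  have hd1 : ∀ i, Disjoint (S.erase i) (U \ S) := fun i =>
    disjoint_sdiff.mono_left (erase_subset _ _)
  have hd2 : ∀ i, Disjoint S ((U \ S).erase i) := fun i =>
    disjoint_sdiff.mono_right (erase_subset _ _)
  have hS1 : ∏ i ∈ S, ∏ k ∈ U.erase i, fD q (s i) (s k) = P11 * P12 := by
    rw [hP11, hP12, ← prod_mul_distrib]
    exact prod_congr rfl fun i hi => by rw [herase1 i hi, prod_union (hd1 i)]
  have hS2 : ∏ i ∈ U \ S, ∏ k ∈ U.erase i, fD q (s i) (s k) = P21 * P22 := by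
    rw [hP21, hP22, Finset.prod_comm, ← prod_mul_distrib]
    exact prod_congr rfl fun i hi => by rw [herase2 i hi, prod_union (hd2 i)]
  have hS3 : ∏ i ∈ U \ S, ∏ k ∈ U.erase i, fD q (s k) (s i) = P12 * P22 := by
    have h22 : P22 = ∏ i ∈ U \ S, ∏ k ∈ (U \ S).erase i, fD q (s k) (s i) := by
      rw [hP22]
      exact Finset.prod_comm' fun i k => by grind
    rw [h22, hP12, Finset.prod_comm, ← prod_mul_distrib]
    exact prod_congr rfl fun i hi => by rw [herase2 i hi, prod_union (hd2 i)]
  have hΘs : Θ = P11 * P12 * (P21 * P22) := by rw [hΘ, ← hS1, ← hS2, mul_comm, prod_sdiff hSU]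
  rw [hS1, hS3]
  rw [hΘs] at hΘ0 ⊢
  have h11 : P11 ≠ 0 := by intro h; simp [h] at hΘ0
  have h12 : P12 ≠ 0 := by intro h; simp [h] at hΘ0
  have h21 : P21 ≠ 0 := by intro h; simp [h] at hΘ0
  have h22 : P22 ≠ 0 := by intro h; simp [h] at hΘ0
  field_simp

end Vanishing

/-! ### The action of the asymptotic raising operator on off-shell vectors -/

/-- An operator `C` with the exchange relations of the leading coefficient of the lower left entry
of the monodromy matrix, together with the leading coefficients of the diagonal entries. -/
structure ExchangeSystem.Raising {ι V : Type*} [AddCommGroup V] [Module ℂ V] {q : ℂ} {s : ι → ℂ}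
    (E : ExchangeSystem ι V q s) (C X₀ X₁ : End ℂ V) (x₀ x₁ : ℂ) : Prop where
  X₀B : ∀ i, X₀ * E.B i = q⁻¹ • (E.B i * X₀)
  X₁B : ∀ i, X₁ * E.B i = q • (E.B i * X₁)
  CB : ∀ i, C * E.B i = E.B i * C + (s i)⁻¹ • (E.A i * X₁ - X₀ * E.D i)
  X₀_vac : X₀ E.vac = x₀ • E.vac
  X₁_vac : X₁ E.vac = x₁ • E.vac
  C_vac : C E.vac = 0

namespace ExchangeSystem

variable {ι V : Type*} [DecidableEq ι] [AddCommGroup V] [Module ℂ V] {q : ℂ} {s : ι → ℂ}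

lemma bvec_eigen (E : ExchangeSystem ι V q s) {Y : End ℂ V} {p y : ℂ}
    (hY : ∀ i, Y * E.B i = p • (E.B i * Y)) (hv : Y E.vac = y • E.vac) (I : Finset ι) :
    Y (E.bvec I) = (y * p ^ #I) • E.bvec I := by
  induction I using Finset.induction_on with
  | empty => simp [hv]
  | insert b I hb ih =>
    rw [E.bvec_insert I b hb, ← End.mul_apply, hY, LinearMap.smul_apply,
      End.mul_apply, ih, map_smul, smul_smul, card_insert_of_notMem hb, pow_succ]
    congr 1; ring

lemma Raising.C_bvec {E : ExchangeSystem ι V q s} {C X₀ X₁ : End ℂ V} {x₀ x₁ : ℂ}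
    (h : E.Raising C X₀ X₁ x₀ x₁) (hq : q ≠ 0) (hs : Injective s) (hs0 : ∀ i, s i ≠ 0)
    (I : Finset ι) : C (E.bvec I) = ∑ j ∈ I, removalCoeff q (fun i k => fD q (s i) (s k))
      (fun i => x₁ * E.a i / s i) (fun i => x₀ * E.d i / s i) I j • E.bvec (I.erase j) := by
  induction I using Finset.induction_on with
  | empty => simp [h.C_vac]
  | insert b I hb ih =>
    have hA : ∀ j, ∀ S : Finset ι, ∏ k ∈ S, (q * fD q (s k) (s j)) =
        q ^ #S * ∏ k ∈ S, fA q (s j) (s k) := fun j S => by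
      rw [prod_mul_distrib, prod_const]
      congr 1
      refine prod_congr rfl fun k _ => ?_
      rw [fD, fA, ← neg_sub (s k) (s j), div_neg, ← neg_div, neg_sub]
    have hD : ∀ j, ∀ S : Finset ι, ∏ k ∈ S, (q⁻¹ * fD q (s j) (s k)) =
        q⁻¹ ^ #S * ∏ k ∈ S, fD q (s j) (s k) := fun j S => by rw [prod_mul_distrib, prod_const]
    have e1 : C (E.bvec (insert b I)) = E.B b (C (E.bvec I)) +
        (s b)⁻¹ • (E.A b (X₁ (E.bvec I)) - X₀ (E.D b (E.bvec I))) := by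
      rw [E.bvec_insert I b hb]
      exact LinearMap.congr_fun (h.CB b) _
    have e2 : ∀ j ∈ I, (insert b I).erase j = insert b (I.erase j) := fun j hj =>
      erase_insert_of_ne (fun h => hb (h ▸ hj))
    have e3 : ∀ j ∈ I, b ∉ I.erase j := fun j _ h => hb (mem_of_mem_erase h)
    have e4 : ∀ j ∈ I, X₀ (E.B b (E.bvec (I.erase j))) =
        (x₀ * q⁻¹ ^ #I) • E.B b (E.bvec (I.erase j)) := fun j hj => by
      rw [← E.bvec_insert _ _ (e3 j hj), E.bvec_eigen h.X₀B h.X₀_vac,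
        card_insert_of_notMem (e3 j hj), card_erase_add_one hj]
    rw [e1, ih, E.bvec_eigen h.X₁B h.X₁_vac, map_smul, E.A_bvec hq hs hb, E.D_bvec hq hs hb,
      map_add, map_smul, E.bvec_eigen h.X₀B h.X₀_vac, map_sum, map_sum, sum_insert hb,
      erase_insert hb]
    have key : ∀ j ∈ I, removalCoeff q (fun i k => fD q (s i) (s k)) (fun i => x₁ * E.a i / s i)
        (fun i => x₀ * E.d i / s i) (insert b I) j =
        removalCoeff q (fun i k => fD q (s i) (s k)) (fun i => x₁ * E.a i / s i)
          (fun i => x₀ * E.d i / s i) I j +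
        (s b)⁻¹ * (x₁ * q ^ #I * (gA q (s b) (s j) * (E.a j * ∏ k ∈ I.erase j, fA q (s j) (s k))) -
          x₀ * q⁻¹ ^ #I * ((-gA q (s b) (s j)) * (E.d j *
          ∏ k ∈ I.erase j, fD q (s j) (s k)))) := by
      intro j hj
      have h0 : b ≠ j := by rintro rfl; exact hb hj
      have h1 : s b - s j ≠ 0 := sub_ne_zero.mpr (hs.ne h0)
      have h2 : s j - s b ≠ 0 := sub_ne_zero.mpr (hs.ne h0.symm)
      obtain ⟨n, hn⟩ : ∃ n, #I = n + 1 := ⟨#I - 1, by have := card_pos.mpr ⟨j, hj⟩; omega⟩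
      have hn' : (I.erase j).card = n := by rw [card_erase_of_mem hj]; omega
      have hj0 := hs0 j
      have hb0 := hs0 b
      rw [removalCoeff, removalCoeff, e2 j hj, prod_insert (e3 j hj),
        prod_insert (e3 j hj), hA, hD, hn', hn]
      generalize ∏ k ∈ I.erase j, fA q (s j) (s k) = P
      generalize ∏ k ∈ I.erase j, fD q (s j) (s k) = Q
      have k1 : q * fD q (s b) (s j) - 1 = q * (s j * (s b)⁻¹ * gA q (s b) (s j)) := by
        rw [fD, gA]; field_simp; ring
      have k2 : q⁻¹ * fD q (s j) (s b) - 1 = - (q⁻¹ * (s j * (s b)⁻¹ * gA q (s b) (s j))) := by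
        have : s b - s j = -(s j - s b) := by ring
        rw [fD, gA, this]; field_simp; ring
      have k3 : x₁ * E.a j / s j * s j = x₁ * E.a j := by field_simp
      have k4 : x₀ * E.d j / s j * s j = x₀ * E.d j := by field_simp
      linear_combination (x₁ * E.a j / s j) * q ^ n * P * k1 - (x₀ * E.d j / s j) * q⁻¹ ^ n * Q * k2
        + q ^ (n + 1) * P * (s b)⁻¹ * gA q (s b) (s j) * k3
        + q⁻¹ ^ (n + 1) * Q * (s b)⁻¹ * gA q (s b) (s j) * k4
    have e7 : removalCoeff q (fun i k => fD q (s i) (s k)) (fun i => x₁ * E.a i / s i)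
        (fun i => x₀ * E.d i / s i) (insert b I) b = x₁ * E.a b / s b *
          (q ^ #I * ∏ k ∈ I, fA q (s b) (s k)) - x₀ * E.d b / s b *
          (q⁻¹ ^ #I * ∏ k ∈ I, fD q (s b) (s k)) := by rw [removalCoeff, erase_insert hb, hA, hD]
    have e8 := sum_congr rfl fun j hj =>
      (congrArg₂ (fun (x : ℂ) (v : V) => x • v) (key j hj) ((congrArg E.bvec (e2 j hj)).trans
        (E.bvec_insert _ _ (e3 j hj)))).trans (add_smul _ _ _)
    rw [e7, e8, sum_add_distrib]
    have e5 : ∑ j ∈ I, X₀ (((-gA q (s b) (s j)) * (E.d j * ∏ k ∈ I.erase j, fD q (s j) (s k))) •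
        E.B b (E.bvec (I.erase j))) = ∑ j ∈ I, (x₀ * q⁻¹ ^ #I * ((-gA q (s b) (s j)) *
          (E.d j * ∏ k ∈ I.erase j, fD q (s j) (s k)))) • E.B b (E.bvec (I.erase j)) :=
      sum_congr rfl fun j hj => by rw [map_smul, e4 j hj, smul_smul, mul_comm]
    rw [e5]
    have e6 : ∑ j ∈ I, ((s b)⁻¹ * (x₁ * q ^ #I * (gA q (s b) (s j) * (E.a j *
          ∏ k ∈ I.erase j, fA q (s j) (s k))) - x₀ * q⁻¹ ^ #I * ((-gA q (s b) (s j)) *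
          (E.d j * ∏ k ∈ I.erase j, fD q (s j) (s k))))) • E.B b (E.bvec (I.erase j)) =
        (s b)⁻¹ • ((x₁ * q ^ #I) • ∑ j ∈ I, (gA q (s b) (s j) * (E.a j *
          ∏ k ∈ I.erase j, fA q (s j) (s k))) • E.B b (E.bvec (I.erase j)) -
          ∑ j ∈ I, (x₀ * q⁻¹ ^ #I * ((-gA q (s b) (s j)) *
          (E.d j * ∏ k ∈ I.erase j, fD q (s j) (s k)))) • E.B b (E.bvec (I.erase j))) := by
      simp only [mul_smul _ (_ - _), sub_smul, smul_sum, sum_sub_distrib, smul_sub, mul_smul]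
    rw [e6]
    simp only [map_smul]
    module

/-- The powers of the raising operator on off-shell vectors. -/
lemma Raising.C_pow_bvec {E : ExchangeSystem ι V q s} {C X₀ X₁ : End ℂ V} {x₀ x₁ : ℂ}
    (h : E.Raising C X₀ X₁ x₀ x₁) (hq : q ≠ 0) (hqq : q - q⁻¹ ≠ 0) (hs : Injective s)
    (hs0 : ∀ i, s i ≠ 0) (m : ℕ) (I : Finset ι) :
    (C ^ m) (E.bvec I) = (∏ i ∈ Icc 1 m, qNum q i) • ∑ T ∈ I.powersetCard m,
      splitSum q (fun i k => fD q (s i) (s k))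
        (fun i => x₁ * E.a i / s i * ∏ k ∈ I \ T, (q * fD q (s k) (s i)))
        (fun i => x₀ * E.d i / s i * ∏ k ∈ I \ T, (q⁻¹ * fD q (s i) (s k))) T • E.bvec (I \ T) :=
  iterate_removal hq (F := fun m I => (C ^ m) (E.bvec I))
    (fun S _ => sum_prod_fD hqq S hs.injOn fun i _ => hs0 i)
    (fun S _ => sum_prod_fD_symm hqq S hs.injOn fun i _ => hs0 i)
    (fun I => rfl) (fun m I _ => by
      rw [pow_succ, End.mul_apply, h.C_bvec hq hs hs0, map_sum]
      simp only [map_smul]) m I subset_rfl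

end ExchangeSystem

/-! ### Sums over splittings for strings -/

section StringSums

lemma fD_string_pair {q : ℂ} (hgen : ∀ n, 1 ≤ n → q ^ n ≠ 1) (hq : q ≠ 0) {s : ℂ} (hs : s ≠ 0)
    (x n : ℕ) : fD q ((q ^ 2)⁻¹ ^ (x + n + 1) * s) ((q ^ 2)⁻¹ ^ x * s) =
      qNum q (n + 2) / qNum q (n + 1) := by
  have h1 : q ^ (2 * (n + 1)) ≠ 1 := hgen _ (by omega)
  have h2 : q ^ 2 ≠ 1 := hgen _ (by omega)
  have h3 : q ^ (2 * (n + 1)) - 1 ≠ 0 := sub_ne_zero.mpr h1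
  have h4 : q ^ 2 - 1 ≠ 0 := sub_ne_zero.mpr h2
  have e1 : ∀ k, qNum q k = (q ^ (2 * k) - 1) / (q ^ k * q⁻¹ * (q ^ 2 - 1)) := by
    intro k; rw [qNum, mul_comm 2 k, pow_mul]; field_simp
  have h5 : (1 : ℂ) - (q ^ 2)⁻¹ ^ (n + 1) ≠ 0 := by
    rw [inv_pow, ← pow_mul]; intro h; apply h3; field_simp at h; linear_combination h
  rw [e1, e1, fD]
  have hk : ∀ k, (q ^ 2)⁻¹ ^ k = (q ^ (2 * k))⁻¹ := fun k => by rw [inv_pow, pow_mul]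
  have e2 : (q ^ 2)⁻¹ ^ x * s - (q ^ 2)⁻¹ ^ (x + n + 1) * s =
      (q ^ 2)⁻¹ ^ x * s * ((q ^ (2 * (n + 1)) - 1) / q ^ (2 * (n + 1))) := by
    rw [add_assoc, pow_add, hk (n + 1)]; field_simp
  have e3 : q * ((q ^ 2)⁻¹ ^ x * s) - q⁻¹ * ((q ^ 2)⁻¹ ^ (x + n + 1) * s) =
      (q ^ 2)⁻¹ ^ x * s * q * ((q ^ (2 * (n + 2)) - 1) / q ^ (2 * (n + 2))) := by
    rw [add_assoc, pow_add, hk (n + 1), show 2 * (n + 2) = 2 * (n + 1) + 2 by ring,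
      pow_add q (2 * (n + 1))]
    field_simp
  rw [e2, e3]
  field_simp
  ring

/-- The `q`-factorial. -/
def qFac (q : ℂ) (n : ℕ) : ℂ := ∏ i ∈ Icc 1 n, qNum q i

lemma qFac_zero (q : ℂ) : qFac q 0 = 1 := by simp [qFac]

lemma qFac_succ (q : ℂ) (n : ℕ) : qFac q (n + 1) = qFac q n * qNum q (n + 1) := by
  rw [qFac, qFac, prod_Icc_succ_top (by omega)]

lemma qNum_ne_zero {q : ℂ} (hgen : ∀ n, 1 ≤ n → q ^ n ≠ 1) (hq : q ≠ 0) {n : ℕ} (hn : 1 ≤ n) :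
    qNum q n ≠ 0 := by
  have key : ∀ k, 1 ≤ k → q ^ k - (q ^ k)⁻¹ ≠ 0 := by
    intro k hk h
    field_simp at h
    exact hgen (k * 2) (by omega) (by rw [pow_mul]; linear_combination h)
  exact div_ne_zero (key n hn) (by simpa using key 1 le_rfl)

lemma qFac_ne_zero {q : ℂ} (hgen : ∀ n, 1 ≤ n → q ^ n ≠ 1) (hq : q ≠ 0) (n : ℕ) : qFac q n ≠ 0 :=
  prod_ne_zero_iff.mpr fun _ hi => qNum_ne_zero hgen hq (mem_Icc.mp hi).1

lemma prod_fD_string {q : ℂ} (hgen : ∀ n, 1 ≤ n → q ^ n ≠ 1) (hq : q ≠ 0) {s : ℂ} (hs : s ≠ 0)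
    (a j p : ℕ) : ∏ l ∈ Ico (a + j) (a + j + p), ∏ k ∈ Ico a (a + j),
      fD q ((q ^ 2)⁻¹ ^ l * s) ((q ^ 2)⁻¹ ^ k * s) = qFac q (j + p) / (qFac q j * qFac q p) := by
  have h1 : ∀ j a i, ∏ k ∈ range j, fD q ((q ^ 2)⁻¹ ^ (a + j + i) * s)
      ((q ^ 2)⁻¹ ^ (a + k) * s) = qNum q (j + i + 1) / qNum q (i + 1) := by
    intro j
    induction j with
    | zero => intro a i; simp [div_self (qNum_ne_zero hgen hq (Nat.le_add_left 1 i))]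
    | succ j ih =>
      intro a i
      have h2 := fD_string_pair hgen hq hs a (j + i)
      rw [prod_range_succ', add_zero, show a + (j + 1) + i = a + (j + i) + 1 by ring, h2,
        show a + (j + i) + 1 = (a + 1) + j + i by ring,
        prod_congr rfl fun k _ => by rw [show a + (k + 1) = a + 1 + k by ring], ih,
        show j + 1 + i + 1 = j + i + 2 by ring]
      have := qNum_ne_zero hgen hq (Nat.le_add_left 1 (j + i))
      field_simp
  have h3 : ∀ p, ∏ i ∈ range p, (qNum q (j + i + 1) / qNum q (i + 1)) =
      qFac q (j + p) / (qFac q j * qFac q p) := by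
    intro p
    induction p with
    | zero => simp [qFac_zero, div_self (qFac_ne_zero hgen hq j)]
    | succ p ih =>
      rw [prod_range_succ, ih, ← add_assoc, qFac_succ, qFac_succ]
      grind
  rw [← h3, prod_Ico_eq_prod_range]
  simp only [add_tsub_cancel_left, prod_Ico_eq_prod_range]
  exact prod_congr rfl fun i _ => h1 j a i

/-- The factors `1 - q² q^{-2l} s / z`. -/
def strFac (q s z : ℂ) (l : ℕ) : ℂ := 1 - q ^ 2 * (q ^ 2)⁻¹ ^ l * s * z⁻¹

lemma strFac_succ {q : ℂ} (hq : q ≠ 0) (s z : ℂ) (l : ℕ) :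
    strFac q s z (l + 1) = 1 - (q ^ 2)⁻¹ ^ l * s * z⁻¹ := by
  rw [strFac, pow_succ' (q ^ 2)⁻¹, ← mul_assoc (q ^ 2), mul_inv_cancel₀ (pow_ne_zero 2 hq), one_mul]

lemma prod_fD_string_right {q s z : ℂ} (hq : q ≠ 0) (hz : z ≠ 0) (hd : ∀ l, strFac q s z l ≠ 0)
    (a p : ℕ) : ∏ l ∈ Ico a (a + p), fD q z ((q ^ 2)⁻¹ ^ l * s) =
      q⁻¹ ^ p * (strFac q s z a / strFac q s z (a + p)) := by
  induction p with
  | zero => simp [div_self (hd a)]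
  | succ p ih =>
    rw [← add_assoc, prod_Ico_succ_top (by omega), ih]
    have h1 : fD q z ((q ^ 2)⁻¹ ^ (a + p) * s) =
        q⁻¹ * (strFac q s z (a + p) / strFac q s z (a + p + 1)) := by
      have h2 := hd (a + p + 1)
      have h3 : (q ^ 2)⁻¹ ^ (a + p) * s - z = -z * strFac q s z (a + p + 1) := by
        rw [strFac_succ hq]; field_simp; ring
      have h4 : z * strFac q s z (a + p) = z - q ^ 2 * (q ^ 2)⁻¹ ^ (a + p) * s := by
        rw [strFac]; field_simp
      rw [fD, h3]
      generalize strFac q s z (a + p) = X at h4 ⊢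
      generalize (q ^ 2)⁻¹ ^ (a + p) = Y at h4 ⊢
      field_simp
      linear_combination -h4
    grind

lemma prod_fD_string_left {q s z : ℂ} (hq : q ≠ 0) (hz : z ≠ 0) (hd : ∀ l, strFac q s z l ≠ 0)
    (a p : ℕ) : ∏ l ∈ Ico a (a + p), fD q ((q ^ 2)⁻¹ ^ l * s) z =
      q ^ p * (strFac q s z (a + p + 1) / strFac q s z (a + 1)) := by
  induction p with
  | zero => simp [div_self (hd (a + 1))]
  | succ p ih =>
    rw [← add_assoc, prod_Ico_succ_top (by omega), ih]
    have h1 : fD q ((q ^ 2)⁻¹ ^ (a + p) * s) z =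
        q * (strFac q s z (a + p + 1 + 1) / strFac q s z (a + p + 1)) := by
      have h2 := hd (a + p + 1)
      have h3 : z - (q ^ 2)⁻¹ ^ (a + p) * s = z * strFac q s z (a + p + 1) := by
        rw [strFac_succ hq]; field_simp
      have h4 : z * strFac q s z (a + p + 1 + 1) = z - (q ^ 2)⁻¹ * (q ^ 2)⁻¹ ^ (a + p) * s := by
        rw [strFac_succ hq, pow_succ']; field_simp
      rw [fD, h3]
      generalize strFac q s z (a + p + 1 + 1) = X at h4 ⊢
      generalize (q ^ 2)⁻¹ ^ (a + p) = Y at h4 ⊢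
      field_simp at h4 ⊢
      linear_combination -h4
    grind

variable {κ : Type*} [DecidableEq κ]

lemma disjSum_sdiff_disjSum (A A' : Finset κ) (B B' : Finset ℕ) :
    A.disjSum B \ A'.disjSum B' = (A \ A').disjSum (B \ B') := by ext x; cases x <;> simp

/-- The splittings of a set that contains a string which contribute to the sum over splittings. -/
lemma sum_splittings_string {V : Type*} [AddCommGroup V] (Z : Finset κ) (m : ℕ)
    (G : Finset (κ ⊕ ℕ) → Finset (κ ⊕ ℕ) → V)
    (hG : ∀ T ⊆ Z.disjSum (range m), ∀ S ⊆ T, ∀ l, l + 1 < m → (inr l ∈ S ∧ inr (l + 1) ∉ S) ∨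
        (inr l ∉ T ∧ inr (l + 1) ∈ T \ S) → G T S = 0) :
    ∑ T ∈ (Z.disjSum (range m)).powersetCard m, ∑ S ∈ T.powerset, G T S =
      ∑ U ∈ Z.powerset with #U ≤ m, ∑ U₁ ∈ U.powerset, ∑ a ∈ range (m - #U + 1),
        G (U.disjSum (range a ∪ Ico (a + #U) m)) (U₁.disjSum (Ico (a + #U) m)) := by
  symm
  simp only [sum_sigma']
  refine sum_of_injOn (fun x : (_ : Finset κ) × (_ : Finset κ) × ℕ =>
    (⟨x.1.disjSum (range x.2.2 ∪ Ico (x.2.2 + x.1.card) m),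
      x.2.1.disjSum (Ico (x.2.2 + x.1.card) m)⟩ :
        (_ : Finset (κ ⊕ ℕ)) × Finset (κ ⊕ ℕ))) ?_ ?_ ?_ ?_
  · rintro ⟨U, U₁, a⟩ h ⟨U', U₁', a'⟩ h' heq
    simp only [coe_sigma, Set.mem_sigma_iff, mem_coe, mem_filter, mem_powerset, mem_range] at h h'
    simp only [Sigma.mk.injEq, heq_eq_eq] at heq
    have e1 := congrArg toLeft heq.1
    have e2 := congrArg toLeft heq.2
    have e3 := congrArg (fun S => (toRight S).card) heq.2
    simp only [toLeft_disjSum, toRight_disjSum, Nat.card_Ico] at e1 e2 e3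
    grind
  · rintro ⟨U, U₁, a⟩ h
    simp only [coe_sigma, Set.mem_sigma_iff, mem_coe, mem_filter,
      mem_powerset, mem_range, mem_powersetCard] at h ⊢
    refine ⟨⟨disjSum_mono h.1.1 ?_, ?_⟩, disjSum_mono h.2.1 subset_union_right⟩
    · grind
    · rw [card_disjSum, card_union_of_disjoint, card_range, Nat.card_Ico]
      · omega
      · rw [disjoint_left]
        grind
  · rintro ⟨T, S⟩ h hne
    simp only [mem_sigma, mem_powersetCard, mem_powerset] at h
    by_contra hG0
    have hY : ∀ l, inr l ∈ T → l < m := fun l hl => by simpa using h.1.1 hl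
    have h1 : ∀ l, l + 1 < m → inr l ∈ S → inr (l + 1) ∈ S := fun l hl h1 => by grind
    have h2 : ∀ l, inr (l + 1) ∈ T \ S → inr l ∈ T \ S := fun l h2 => by grind
    have hlow : ∀ (P : ℕ → Prop) [DecidablePred P], (∀ l, P (l + 1) → P l) → (∃ M, ∀ l, P l → l < M) →
        ∃ a, ∀ l, P l ↔ l < a := by
      intro P _ hP ⟨M, hM⟩
      have hex : ∃ a, ¬ P a := ⟨M, fun h => lt_irrefl _ (hM M h)⟩
      refine ⟨Nat.find hex, fun l => ⟨fun hl => ?_, fun hl => not_not.mp (Nat.find_min hex hl)⟩⟩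
      by_contra h5
      rw [not_lt] at h5
      have : ∀ k, Nat.find hex ≤ k → ¬ P k := fun k hk => by
        induction k, hk using Nat.le_induction with
        | base => exact Nat.find_spec hex
        | succ k _ ih => exact fun h6 => ih (hP k h6)
      exact this l h5 hl
    obtain ⟨a, ha⟩ := hlow (fun l => inr l ∈ T \ S) h2
      ⟨m, fun l hl => hY l (Finset.mem_sdiff.mp hl).1⟩
    obtain ⟨b', hb⟩ := hlow (fun l => l < m ∧ inr l ∉ S)
      (fun l hl => ⟨by omega, fun h3 => hl.2 (h1 l hl.1 h3)⟩) ⟨m, fun l hl => hl.1⟩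
    have hTr : T.toRight = range a ∪ Ico b' m := by
      ext l
      simp only [mem_toRight, mem_union, mem_range, mem_Ico, Finset.mem_sdiff] at *
      grind
    have hSr : S.toRight = Ico b' m := by
      ext l
      simp only [mem_toRight, mem_Ico]
      grind
    have hb'm : b' ≤ m := by grind
    have hcard : T.toLeft.card + (a + (m - b')) = m := by
      have := h.1.2
      rw [← toLeft_disjSum_toRight (u := T), card_disjSum, hTr,
        card_union_of_disjoint, card_range, Nat.card_Ico] at this
      · exact this
      · rw [disjoint_left]
        grind
    have hb'' : a + T.toLeft.card = b' := by omega
    apply hne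
    refine ⟨⟨T.toLeft, S.toLeft, a⟩, ?_, ?_⟩
    · simp only [coe_sigma, Set.mem_sigma_iff, mem_coe, mem_filter, mem_powerset, mem_range]
      refine ⟨⟨fun z hz => ?_, by omega⟩, fun z hz => ?_, by omega⟩
      · simpa using h.1.1 (mem_toLeft.mp hz)
      · exact mem_toLeft.mpr (h.2 (mem_toLeft.mp hz))
    · simp only [hb'']
      rw [← hTr, ← hSr, toLeft_disjSum_toRight, toLeft_disjSum_toRight]
  · intro i _
    rfl

lemma choose_two_add (m n : ℕ) : (m + n).choose 2 = m.choose 2 + n.choose 2 + m * n := by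
  induction n with
  | zero => simp
  | succ n ih => rw [← add_assoc, choose_succ_succ' (m + n), choose_succ_succ' n, ih,
      choose_one_right, choose_one_right]; ring

lemma splitTerm_string {q : ℂ} (hgen : ∀ n, 1 ≤ n → q ^ n ≠ 1) (hq : q ≠ 0) {s : κ → ℂ} {σ : ℂ}
    (hσ : σ ≠ 0) {u v : κ ⊕ ℕ → ℂ} {U U₁ W : Finset κ} (hU₁ : U₁ ⊆ U)
    (hs : ∀ i, s i ≠ 0) (hd : ∀ i l, strFac q σ (s i) l ≠ 0) {a p j : ℕ} (hj : #U = j) :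
    let x : κ ⊕ ℕ → ℂ := Sum.elim s fun l => (q ^ 2)⁻¹ ^ l * σ
    splitTerm q (fun i k => fD q (x i) (x k))
        (fun i => u i * ∏ k ∈ W.disjSum (Ico a (a + j)), (q * fD q (x k) (x i)))
        (fun i => v i * ∏ k ∈ W.disjSum (Ico a (a + j)), (q⁻¹ * fD q (x i) (x k)))
        (U₁.disjSum (Ico (a + j) (a + j + p))) ((U \ U₁).disjSum (range a)) =
      ((-1) ^ p * (q ^ (a.choose 2 + j * a) * q⁻¹ ^ (p.choose 2 + j * p)) *
        (qFac q (a + j + p) / (qFac q p * qFac q j * qFac q a)) *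
        ((∏ l ∈ range a, u (inr l)) * ∏ l ∈ Ico (a + j) (a + j + p), v (inr l))) *
      ((∏ i ∈ W, strFac q σ (s i) 0 * strFac q σ (s i) (a + j + p + 1)) *
        ((∏ i ∈ U₁, strFac q σ (s i) 0) * ∏ i ∈ U \ U₁, strFac q σ (s i) (a + j + p + 1))) *
      (∏ i ∈ W, (strFac q σ (s i) (a + j + 1) * strFac q σ (s i) a)⁻¹) *
      splitTerm q (fun i k => fD q (s i) (s k))
        (fun i => (u (inl i) * ∏ k ∈ W, (q * fD q (s k) (s i))) *
          (q ^ (a + j + p + j) * (strFac q σ (s i) (a + 1))⁻¹))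
        (fun i => (v (inl i) * ∏ k ∈ W, (q⁻¹ * fD q (s i) (s k))) *
          (q⁻¹ ^ (a + j + p + j) * (strFac q σ (s i) (a + j))⁻¹)) U₁ (U \ U₁) := by
  intro x
  have hcard : (U \ U₁).card + #U₁ = j := by rw [card_sdiff_add_card_eq_card hU₁, hj]
  have h0p : ∀ i, ∏ l ∈ range a, fD q (s i) ((q ^ 2)⁻¹ ^ l * σ) =
      q⁻¹ ^ a * (strFac q σ (s i) 0 / strFac q σ (s i) a) := fun i => by
    have := prod_fD_string_right hq (hs i) (hd i) 0 a
    rwa [zero_add, ← range_eq_Ico] at this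
  have hd0 : ∀ (A : Finset κ) (l : ℕ), ∏ i ∈ A, strFac q σ (s i) l ≠ 0 := fun A l =>
    prod_ne_zero_iff.mpr fun i _ => hd i l
  have hf := qFac_ne_zero hgen hq
  have hqi : q⁻¹ * q = 1 := inv_mul_cancel₀ hq
  have hSM := prod_fD_string hgen hq hσ a j p
  have hSP := prod_fD_string hgen hq hσ 0 (a + j) p
  have hMP := prod_fD_string hgen hq hσ 0 a j
  rw [zero_add, prod_congr rfl fun l _ => by
    rw [← range_eq_Ico, ← prod_range_mul_prod_Ico _ (Nat.le_add_right a j)],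
    prod_mul_distrib, hSM] at hSP
  rw [zero_add, ← range_eq_Ico, Finset.prod_comm] at hMP
  have hSP' : ∏ l ∈ Ico (a + j) (a + j + p), ∏ k ∈ range a,
      fD q ((q ^ 2)⁻¹ ^ l * σ) ((q ^ 2)⁻¹ ^ k * σ) =
      (qFac q (a + j + p) * qFac q j) / (qFac q (a + j) * qFac q (j + p)) := by
    rw [eq_div_iff (mul_ne_zero (hf _) (hf _))]
    have := hf j; have := hf p; have := hf (a + j); have := hf (j + p)
    generalize ∏ l ∈ Ico (a + j) (a + j + p), ∏ k ∈ range a,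
      fD q ((q ^ 2)⁻¹ ^ l * σ) ((q ^ 2)⁻¹ ^ k * σ) = X at hSP ⊢
    field_simp at hSP
    linear_combination hSP
  have F2 : ∏ l ∈ Ico (a + j) (a + j + p), ∏ k ∈ W, (q⁻¹ * fD q ((q ^ 2)⁻¹ ^ l * σ) (s k)) =
      ∏ i ∈ W, (strFac q σ (s i) (a + j + p + 1) / strFac q σ (s i) (a + j + 1)) := by
    rw [Finset.prod_comm]
    refine prod_congr rfl fun i _ => ?_
    rw [prod_mul_distrib, prod_const, Nat.card_Ico, add_tsub_cancel_left,
      prod_fD_string_left hq (hs i) (hd i), ← mul_assoc, ← mul_pow, hqi, one_pow, one_mul]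
  have F4 : ∏ l ∈ range a, ∏ k ∈ W, (q * fD q (s k) ((q ^ 2)⁻¹ ^ l * σ)) =
      ∏ i ∈ W, (strFac q σ (s i) 0 / strFac q σ (s i) a) := by
    rw [Finset.prod_comm]
    refine prod_congr rfl fun i _ => ?_
    rw [prod_mul_distrib, prod_const, card_range,
      h0p, ← mul_assoc, ← mul_pow, mul_comm q, hqi, one_pow, one_mul]
  have F1 : ∀ i ∈ U₁, (∏ k ∈ Ico a (a + j), (q⁻¹ * fD q (s i) ((q ^ 2)⁻¹ ^ k * σ))) *
      ∏ l ∈ range a, fD q (s i) ((q ^ 2)⁻¹ ^ l * σ) =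
      q⁻¹ ^ (a + 2 * j) * (strFac q σ (s i) 0 * (strFac q σ (s i) (a + j))⁻¹) := fun i _ => by
    rw [prod_mul_distrib, prod_const, Nat.card_Ico, add_tsub_cancel_left,
      prod_fD_string_right hq (hs i) (hd i), h0p]
    have := hd i a
    generalize q⁻¹ = Q
    field_simp
    ring
  have F3 : ∀ i ∈ U \ U₁, (∏ k ∈ Ico a (a + j), (q * fD q ((q ^ 2)⁻¹ ^ k * σ) (s i))) *
      ∏ l ∈ Ico (a + j) (a + j + p), fD q ((q ^ 2)⁻¹ ^ l * σ) (s i) =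
      q ^ (2 * j + p) * (strFac q σ (s i) (a + j + p + 1) * (strFac q σ (s i) (a + 1))⁻¹) :=
    fun i _ => by
    rw [prod_mul_distrib, prod_const, Nat.card_Ico, add_tsub_cancel_left,
      prod_fD_string_left hq (hs i) (hd i), prod_fD_string_left hq (hs i) (hd i)]
    have := hd i (a + j + 1)
    field_simp
    ring
  have G1 := prod_congr (rfl : U₁ = U₁) F1
  have G3 := prod_congr (rfl : U \ U₁ = U \ U₁) F3
  simp only [prod_mul_distrib (s := U₁), prod_mul_distrib (s := U \ U₁), prod_const] at G1 G3
  rw [Finset.prod_comm (s := U \ U₁) (t := Ico (a + j) (a + j + p))] at G3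
  have hSM' : ∏ l ∈ Ico (a + j) (a + j + p), ∏ k ∈ Ico a (a + j),
      (q⁻¹ * fD q ((q ^ 2)⁻¹ ^ l * σ) ((q ^ 2)⁻¹ ^ k * σ)) =
      (q⁻¹ ^ j) ^ p * (qFac q (j + p) / (qFac q j * qFac q p)) := by
    simp only [prod_mul_distrib, prod_const, Nat.card_Ico, add_tsub_cancel_left, hSM]
  have hMP' : ∏ l ∈ range a, ∏ k ∈ Ico a (a + j),
      (q * fD q ((q ^ 2)⁻¹ ^ k * σ) ((q ^ 2)⁻¹ ^ l * σ)) =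
      (q ^ j) ^ a * (qFac q (a + j) / (qFac q a * qFac q j)) := by
    simp only [prod_mul_distrib, prod_const, Nat.card_Ico, add_tsub_cancel_left, hMP, card_range]
  simp only [splitTerm, card_disjSum, prod_disjSum, x, Sum.elim_inl, Sum.elim_inr,
    Nat.card_Ico, card_range, add_tsub_cancel_left, choose_two_add]
  simp only [prod_mul_distrib (s := U₁), prod_mul_distrib (s := U \ U₁),
    prod_mul_distrib (s := range a),
    prod_mul_distrib (s := W) (f := fun i => strFac q σ (s i) 0),
    prod_mul_distrib (s := W) (f := fun i => strFac q σ (s i) (a + j + 1)),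
    prod_mul_distrib (s := Ico (a + j) (a + j + p)), F2, F4, hSP', hSM', hMP',
    prod_const, prod_div_distrib, prod_inv_distrib] at G1 G3 ⊢
  have := hd0 W (a + j + 1); have := hd0 W a; have := hd0 U₁ (a + j)
  have := hd0 (U \ U₁) (a + 1)
  have := hf j; have := hf p; have := hf (a + j); have := hf (j + p); have := hf a
  generalize q⁻¹ = Q at G1 ⊢
  generalize (∏ i ∈ U₁, ∏ l ∈ range a, fD q (s i) ((q ^ 2)⁻¹ ^ l * σ)) = X1 at G1 ⊢
  generalize (∏ l ∈ Ico (a + j) (a + j + p), ∏ i ∈ U \ U₁,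
    fD q ((q ^ 2)⁻¹ ^ l * σ) (s i)) = X2 at G3 ⊢
  generalize (∏ x ∈ U₁, ∏ k ∈ Ico a (a + j), (Q * fD q (s x) ((q ^ 2)⁻¹ ^ k * σ))) = X3 at G1 ⊢
  generalize (∏ x ∈ U \ U₁, ∏ k ∈ Ico a (a + j), (q * fD q ((q ^ 2)⁻¹ ^ k * σ) (s x))) = X4 at G3 ⊢
  generalize ∏ x ∈ U₁, v (inl x) = V1
  generalize ∏ x ∈ U₁, ∏ y ∈ W, Q * fD q (s x) (s y) = VW
  generalize ∏ x ∈ Ico (a + j) (a + j + p), v (inr x) = VY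
  generalize ∏ x ∈ U \ U₁, u (inl x) = U2
  generalize ∏ x ∈ U \ U₁, ∏ y ∈ W, q * fD q (s y) (s x) = UW
  generalize ∏ x ∈ range a, u (inr x) = UY
  generalize ∏ x ∈ U₁, ∏ y ∈ U \ U₁, fD q (s x) (s y) = Θ
  generalize ∏ x ∈ U₁, strFac q σ (s x) 0 = D1 at G1 ⊢
  generalize (∏ x ∈ U₁, strFac q σ (s x) (a + j))⁻¹ = D2 at G1 ⊢
  generalize ∏ x ∈ U \ U₁, strFac q σ (s x) (a + j + p + 1) = D3 at G3 ⊢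
  generalize (∏ x ∈ U \ U₁, strFac q σ (s x) (a + 1))⁻¹ = D4 at G3 ⊢
  have hT : qFac q (j + p) / (qFac q j * qFac q p) *
      (qFac q (a + j + p) * qFac q j / (qFac q (a + j) * qFac q (j + p))) *
      (qFac q (a + j) / (qFac q a * qFac q j)) =
      qFac q (a + j + p) / (qFac q p * qFac q j * qFac q a) := by field_simp
  rw [← hT]
  generalize qFac q (j + p) / (qFac q j * qFac q p) = T1
  generalize qFac q (a + j + p) * qFac q j / (qFac q (a + j) * qFac q (j + p)) = T2
  generalize qFac q (a + j) / (qFac q a * qFac q j) = T3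
  rw [div_eq_mul_inv, div_eq_mul_inv, mul_inv]
  generalize (∏ x ∈ W, strFac q σ (s x) (a + j + 1))⁻¹ = W1
  generalize (∏ x ∈ W, strFac q σ (s x) a)⁻¹ = W2
  generalize ∏ x ∈ W, strFac q σ (s x) (a + j + p + 1) = W3
  generalize ∏ x ∈ W, strFac q σ (s x) 0 = W4
  refine Eq.trans (b := (-1) ^ (#U₁ + p) *
    (q ^ ((U \ U₁).card.choose 2 + a.choose 2 + (U \ U₁).card * a) *
      Q ^ ((#U₁).choose 2 + p.choose 2 + #U₁ * p)) * V1 * VW * VY * W3 * W1 *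
      ((Q ^ j) ^ p * T1) * U2 * UW * UY * W4 * W2 * ((q ^ j) ^ a * T3) * Θ * T2 * (X3 * X1) *
      (X4 * X2)) (by ring) ?_
  rw [G1, G3]
  ring

end StringSums

/-! ### The `q`-binomial theorem -/

section QBinomial

/-- The symmetric `q`-binomial coefficients. -/
def qBin (q : ℂ) : ℕ → ℕ → ℂ
  | _, 0 => 1
  | 0, _ + 1 => 0
  | n + 1, a + 1 => q⁻¹ ^ (a + 1) * qBin q n (a + 1) + q ^ (n - a) * qBin q n a

lemma qBin_zero_right (q : ℂ) (n : ℕ) : qBin q n 0 = 1 := by cases n <;> rfl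

lemma qBin_succ_succ (q : ℂ) (n a : ℕ) :
    qBin q (n + 1) (a + 1) = q⁻¹ ^ (a + 1) * qBin q n (a + 1) + q ^ (n - a) * qBin q n a := rfl

lemma qBin_eq_zero (q : ℂ) : ∀ {n a : ℕ}, n < a → qBin q n a = 0
  | n, 0, h => absurd h (Nat.not_lt_zero _)
  | 0, a + 1, _ => rfl
  | n + 1, a + 1, h => by
    rw [qBin_succ_succ, qBin_eq_zero q (by omega : n < a + 1),
      qBin_eq_zero q (by omega : n < a), mul_zero, mul_zero, add_zero]

lemma qBin_mul_qFac {q : ℂ} (hq : q ≠ 0) : ∀ a p : ℕ,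
    qBin q (a + p) a * (qFac q a * qFac q p) = qFac q (a + p)
  | 0, p => by simp [qBin_zero_right, qFac_zero]
  | a + 1, 0 => by
    have h := qBin_mul_qFac hq a 0
    rw [add_zero] at h ⊢
    rw [qBin_succ_succ, qBin_eq_zero q (Nat.lt_succ_self a), Nat.sub_self, qFac_succ]
    grind
  | a + 1, p + 1 => by
    have h1 := qBin_mul_qFac hq (a + 1) p
    have h2 := qBin_mul_qFac hq a (p + 1)
    have h3 := qNum_add hq (p + 1) (a + 1)
    rw [show a + 1 + (p + 1) = (a + 1 + p) + 1 by ring, qBin_succ_succ,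
      show a + 1 + p - a = p + 1 by omega]
    rw [show a + (p + 1) = a + 1 + p by ring] at h2
    rw [qFac_succ q (a + 1 + p), show a + 1 + p + 1 = p + 1 + (a + 1) by ring, h3, ← inv_pow]
    have h4 := qFac_succ q a
    have h5 := qFac_succ q p
    grind

/-- The `q`-binomial theorem. -/
lemma sum_qBin {q : ℂ} (hq : q ≠ 0) (x : ℂ) (n : ℕ) :
    ∑ a ∈ range (n + 1), (-1) ^ a * q ^ (a * (n - 1)) * qBin q n a * x ^ a =
      ∏ i ∈ range n, (1 - q ^ (2 * i) * x) := by
  induction n with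
  | zero => simp [qBin_zero_right]
  | succ n ih =>
    rw [prod_range_succ, ← ih, mul_sub, mul_one,
      sum_range_succ' (fun a => (-1) ^ a * q ^ (a * (n + 1 - 1)) * qBin q (n + 1) a * x ^ a)]
    have e1 : ∀ a ∈ range (n + 1),
        (-1) ^ (a + 1) * q ^ ((a + 1) * (n + 1 - 1)) * qBin q (n + 1) (a + 1) * x ^ (a + 1) =
        (-1) ^ (a + 1) * q ^ ((a + 1) * (n - 1)) * qBin q n (a + 1) * x ^ (a + 1) -
        ((-1) ^ a * q ^ (a * (n - 1)) * qBin q n a * x ^ a) * (q ^ (2 * n) * x) := by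
      intro a ha
      rw [mem_range] at ha
      rw [qBin_succ_succ, add_tsub_cancel_right]
      have h1 : q ^ ((a + 1) * n) * (q⁻¹ ^ (a + 1) * qBin q n (a + 1)) =
          q ^ ((a + 1) * (n - 1)) * qBin q n (a + 1) := by
        rcases Nat.eq_zero_or_pos n with rfl | hn
        · rw [qBin_eq_zero q (by omega : 0 < a + 1)]; ring
        · obtain ⟨k, rfl⟩ : ∃ k, n = k + 1 := ⟨n - 1, by omega⟩
          rw [show (a + 1) * (k + 1) = (a + 1) * k + (a + 1) by ring, pow_add, inv_pow,
            add_tsub_cancel_right]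
          field_simp
      have h2 : q ^ ((a + 1) * n) * q ^ (n - a) = q ^ (a * (n - 1)) * q ^ (2 * n) := by
        rw [← pow_add, ← pow_add]
        congr 1
        rcases Nat.eq_zero_or_pos n with rfl | hn
        · simp
        · obtain ⟨k, rfl⟩ : ∃ k, n = k + 1 := ⟨n - 1, by omega⟩
          grind
      linear_combination (-1) ^ (a + 1) * x ^ (a + 1) * h1 +
        (-1) ^ (a + 1) * x ^ (a + 1) * qBin q n a * h2
    rw [sum_congr rfl e1, sum_sub_distrib, ← sum_mul,
      sum_range_succ (fun a => (-1) ^ (a + 1) * q ^ ((a + 1) * (n - 1)) *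
        qBin q n (a + 1) * x ^ (a + 1)) n, qBin_eq_zero q (Nat.lt_succ_self n)]
    simp only [sum_range_succ' (fun a => (-1) ^ a * q ^ (a * (n - 1)) * qBin q n a * x ^ a) n,
      qBin_zero_right]
    ring

lemma sum_qBin_inv_pow {q : ℂ} (hq : q ≠ 0) {n k : ℕ} (hk : k ≤ n) :
    ∑ a ∈ range (n + 1), (-1) ^ a * q ^ (a * (n - 1)) * qBin q n a * ((q ^ 2)⁻¹ ^ k) ^ a =
      if k = n then ∏ l ∈ range n, (1 - (q ^ 2)⁻¹ ^ (l + 1)) else 0 := by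
  rw [sum_qBin hq]
  have h1 : ∀ i k : ℕ, i ≤ k → q ^ (2 * i) * (q ^ 2)⁻¹ ^ k = (q ^ 2)⁻¹ ^ (k - i) := by
    intro i k hik
    obtain ⟨d, rfl⟩ := Nat.exists_eq_add_of_le hik
    rw [add_tsub_cancel_left, pow_add, ← mul_assoc, pow_mul, ← mul_pow,
      mul_inv_cancel₀ (pow_ne_zero 2 hq), one_pow, one_mul]
  split_ifs with h
  · subst h
    rw [← prod_range_reflect]
    refine prod_congr rfl fun i hi => ?_
    rw [mem_range] at hi
    rw [h1 _ _ (by omega), show k - (k - 1 - i) = i + 1 by omega]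
  · refine prod_eq_zero (mem_range.mpr (lt_of_le_of_ne hk h)) ?_
    grind

lemma prod_one_sub_inv_pow {q : ℂ} (hq : q ≠ 0) (hqq : q - q⁻¹ ≠ 0) (n : ℕ) :
    ∏ l ∈ range n, (1 - (q ^ 2)⁻¹ ^ (l + 1)) =
      q⁻¹ ^ (n + 1).choose 2 * (q - q⁻¹) ^ n * qFac q n := by
  induction n with
  | zero => simp [qFac_zero]
  | succ n ih =>
    rw [prod_range_succ, ih, qFac_succ, choose_succ_succ' (n + 1) 1, choose_one_right]
    have h : 1 - (q ^ 2)⁻¹ ^ (n + 1) = q⁻¹ ^ (n + 1) * ((q - q⁻¹) * qNum q (n + 1)) := by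
      rw [qNum, mul_div_cancel₀ _ hqq, inv_pow, inv_pow, ← pow_mul, mul_comm 2, pow_mul]
      field_simp
    rw [h]; ring

end QBinomial

/-! ### Power series expansions -/

section Expansions

open PowerSeries (C X coeff coeff_C coeff_X coeff_mk coeff_monomial coeff_mul coeff_one mk
  monomial monomial_eq_mk)

/-- The function `f` is the sum of the power series `F` near `0`. -/
def Expands (f : ℂ → ℂ) (F : PowerSeries ℂ) : Prop :=
  ∀ᶠ σ in 𝓝 (0 : ℂ), HasSum (fun k => coeff k F * σ ^ k) (f σ)

variable {f g : ℂ → ℂ} {F G : PowerSeries ℂ}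

lemma Expands.hasFPowerSeriesAt (h : Expands f F) : HasFPowerSeriesAt f
    (FormalMultilinearSeries.ofScalars ℂ fun k => coeff k F) 0 := by
  rw [hasFPowerSeriesAt_iff]
  filter_upwards [h] with σ hσ
  simpa [FormalMultilinearSeries.coeff_ofScalars, mul_comm] using hσ

lemma Expands.congr (h : Expands f F) (hfg : f =ᶠ[𝓝 0] g) : Expands g F := by
  filter_upwards [h, hfg] with σ h1 h2
  rwa [← h2]

lemma Expands.eq_zero (h : Expands f F) (hf : f =ᶠ[𝓝 0] 0) : F = 0 := by
  have h1 : HasFPowerSeriesAt (0 : ℂ → ℂ) _ 0 := (h.congr hf).hasFPowerSeriesAt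
  have h2 := h1.eq_zero
  ext k
  have := congrArg (fun p => FormalMultilinearSeries.coeff p k) h2
  rw [FormalMultilinearSeries.coeff_ofScalars] at this
  rw [this, FormalMultilinearSeries.coeff, FormalMultilinearSeries.zero_apply]
  simp

lemma Expands.add (hf : Expands f F) (hg : Expands g G) : Expands (fun σ => f σ + g σ) (F + G) := by
  filter_upwards [hf, hg] with σ h1 h2
  simpa [add_mul] using h1.add h2

lemma Expands.mul (hf : Expands f F) (hg : Expands g G) : Expands (fun σ => f σ * g σ) (F * G) := by
  filter_upwards [hf, hg] with σ h1 h2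
  have e : (fun k => coeff k (F * G) * σ ^ k) = fun k =>
      ∑ p ∈ HasAntidiagonal.antidiagonal k, (coeff p.1 F * σ ^ p.1) *
        (coeff p.2 G * σ ^ p.2) := by
    ext k
    rw [coeff_mul, sum_mul]
    refine sum_congr rfl fun p hp => ?_
    rw [← HasAntidiagonal.mem_antidiagonal.mp hp, pow_add]; ring
  rw [e, ← h1.tsum_eq, ← h2.tsum_eq, tsum_mul_tsum_eq_tsum_sum_antidiagonal_of_summable_norm
    h1.summable.norm h2.summable.norm]
  exact (summable_norm_sum_mul_antidiagonal_of_summable_norm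
    h1.summable.norm h2.summable.norm).of_norm.hasSum

lemma expands_const (c : ℂ) : Expands (fun _ => c) (C c) := by
  refine Eventually.of_forall fun σ => ?_
  convert hasSum_ite_eq (0 : ℕ) c using 1
  ext k
  rw [coeff_C]
  split_ifs with h <;> simp [h]

lemma expands_monomial (n : ℕ) (c : ℂ) :
    Expands (fun σ => c * σ ^ n) (monomial n c) := by
  refine Eventually.of_forall fun σ => ?_
  convert hasSum_ite_eq n (c * σ ^ n) using 1
  ext k
  rw [coeff_monomial]
  split_ifs with h <;> simp [h]

lemma expands_geometric (c : ℂ) :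
    Expands (fun σ => (1 - c * σ)⁻¹) (mk fun k => c ^ k) := by
  have : ∀ᶠ σ in 𝓝 (0 : ℂ), ‖c * σ‖ < 1 := by
    have h : ContinuousAt (fun σ => ‖c * σ‖) 0 := by fun_prop
    exact h.eventually_lt continuousAt_const (by simp)
  filter_upwards [this] with σ hσ
  simpa [coeff_mk, mul_pow] using hasSum_geometric_of_norm_lt_one hσ

/-- The operators `f_t` have expansions near `0` whose coefficients converge along `l`. -/
def ExpandsTo (l : Filter ℂ) (f : ℂ → ℂ → ℂ) (F₀ : PowerSeries ℂ) : Prop := ∃ F : ℂ → PowerSeries ℂ,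
    (∀ k, Tendsto (fun t => coeff k (F t)) l (𝓝 (coeff k F₀))) ∧
    ∀ᶠ t in l, Expands (f t) (F t)

variable {l : Filter ℂ} {φ ψ : ℂ → ℂ → ℂ} {F₀ G₀ : PowerSeries ℂ}

lemma ExpandsTo.congr (h : ExpandsTo l φ F₀) (hfg : ∀ᶠ t in l, φ t =ᶠ[𝓝 0] ψ t) :
    ExpandsTo l ψ F₀ := by
  obtain ⟨F, h1, h2⟩ := h
  exact ⟨F, h1, by filter_upwards [h2, hfg] with t h3 h4 using h3.congr h4⟩

lemma ExpandsTo.add (hf : ExpandsTo l φ F₀) (hg : ExpandsTo l ψ G₀) :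
    ExpandsTo l (fun t σ => φ t σ + ψ t σ) (F₀ + G₀) := by
  obtain ⟨F, h1, h2⟩ := hf
  obtain ⟨G, h3, h4⟩ := hg
  refine ⟨fun t => F t + G t, fun k => ?_, by filter_upwards [h2, h4] with t h5 h6 using h5.add h6⟩
  simpa using (h1 k).add (h3 k)

lemma ExpandsTo.mul (hf : ExpandsTo l φ F₀) (hg : ExpandsTo l ψ G₀) :
    ExpandsTo l (fun t σ => φ t σ * ψ t σ) (F₀ * G₀) := by
  obtain ⟨F, h1, h2⟩ := hf
  obtain ⟨G, h3, h4⟩ := hg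
  refine ⟨fun t => F t * G t, fun k => ?_, by filter_upwards [h2, h4] with t h5 h6 using h5.mul h6⟩
  simp only [coeff_mul]
  exact tendsto_finsetSum _ fun p _ => (h1 p.1).mul (h3 p.2)

lemma expandsTo_of_tendsto {c : ℂ → ℂ} {c₀ : ℂ} (h : Tendsto c l (𝓝 c₀)) :
    ExpandsTo l (fun t _ => c t) (C c₀) := by
  refine ⟨fun t => C (c t), fun k => ?_, Eventually.of_forall fun t => expands_const _⟩
  simp only [coeff_C]
  split_ifs
  · exact h
  · exact tendsto_const_nhds

lemma expandsTo_monomial (n : ℕ) {c : ℂ → ℂ} {c₀ : ℂ} (h : Tendsto c l (𝓝 c₀)) :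
    ExpandsTo l (fun t σ => c t * σ ^ n) (monomial n c₀) := by
  refine ⟨fun t => monomial n (c t), fun k => ?_,
    Eventually.of_forall fun t => expands_monomial _ _⟩
  simp only [coeff_monomial]
  split_ifs
  · exact h
  · exact tendsto_const_nhds

lemma expandsTo_geometric {c : ℂ → ℂ} {c₀ : ℂ} (h : Tendsto c l (𝓝 c₀)) :
    ExpandsTo l (fun t σ => (1 - c t * σ)⁻¹) (mk fun k => c₀ ^ k) :=
  ⟨fun t => mk fun k => c t ^ k, fun k => by
    simpa only [coeff_mk] using h.pow k,
    Eventually.of_forall fun t => expands_geometric _⟩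

lemma expandsTo_linear {c : ℂ → ℂ} {c₀ : ℂ} (h : Tendsto c l (𝓝 c₀)) :
    ExpandsTo l (fun t σ => 1 - c t * σ) (1 - C c₀ * X) := by
  have h1 := (expandsTo_of_tendsto (l := l) (tendsto_const_nhds (x := (1 : ℂ)))).add
    (expandsTo_monomial 1 h.neg)
  have e : C (1 : ℂ) + monomial 1 (-c₀) =
      1 - C c₀ * X := by
    rw [map_one, map_neg, ← sub_eq_add_neg, monomial_eq_mk]
    ext k
    simp [coeff_X, coeff_one]
  rw [e] at h1
  exact h1.congr (Eventually.of_forall fun t => Eventually.of_forall fun σ => by simp only; ring)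

lemma expandsTo_sum {α : Type*} {φ : α → ℂ → ℂ → ℂ} {F : α → PowerSeries ℂ} (A : Finset α)
    (h : ∀ i ∈ A, ExpandsTo l (φ i) (F i)) :
    ExpandsTo l (fun t σ => ∑ i ∈ A, φ i t σ) (∑ i ∈ A, F i) := by
  classical
  induction A using Finset.induction_on with
  | empty => simpa using expandsTo_of_tendsto (l := l) (tendsto_const_nhds (x := (0 : ℂ)))
  | insert a A ha ih =>
    simp only [sum_insert ha]
    exact (h a (mem_insert_self a A)).add (ih fun i hi => h i (mem_insert_of_mem hi))

lemma expandsTo_prod {α : Type*} {φ : α → ℂ → ℂ → ℂ} {F : α → PowerSeries ℂ} (A : Finset α)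
    (h : ∀ i ∈ A, ExpandsTo l (φ i) (F i)) :
    ExpandsTo l (fun t σ => ∏ i ∈ A, φ i t σ) (∏ i ∈ A, F i) := by
  classical
  induction A using Finset.induction_on with
  | empty => simpa using expandsTo_of_tendsto (l := l) (tendsto_const_nhds (x := (1 : ℂ)))
  | insert a A ha ih =>
    simp only [prod_insert ha]
    exact (h a (mem_insert_self a A)).mul (ih fun i hi => h i (mem_insert_of_mem hi))

/-- The top coefficient of a `q`-difference. -/
lemma Expands.tendsto_qDifference (h : Expands f F) {q : ℂ} (hq : q ≠ 0) (hqq : q - q⁻¹ ≠ 0)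
    (n : ℕ) : Tendsto (fun s => (s ^ n)⁻¹ * ∑ a ∈ range (n + 1),
      (-1) ^ a * q ^ (a * (n - 1)) * qBin q n a * f ((q ^ 2)⁻¹ ^ a * s)) (𝓝[≠] 0)
      (𝓝 (q⁻¹ ^ (n + 1).choose 2 * (q - q⁻¹) ^ n * qFac q n * coeff n F)) := by
  have h1 := h.hasFPowerSeriesAt.isBigO_sub_partialSum_pow (n + 1)
  simp only [zero_add, FormalMultilinearSeries.partialSum] at h1
  set P : ℂ → ℂ := fun σ => ∑ k ∈ range (n + 1), coeff k F * σ ^ k with hP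
  have h2 : (fun σ => f σ - P σ) =O[𝓝 0] fun σ => σ ^ (n + 1) := by
    refine (h1.congr_left fun σ => ?_).trans (Asymptotics.isBigO_of_le _ fun σ => by simp)
    simp [hP, FormalMultilinearSeries.ofScalars]
  have h3 : ∀ a : ℕ, Tendsto (fun s => (s ^ n)⁻¹ * (f ((q ^ 2)⁻¹ ^ a * s) - P ((q ^ 2)⁻¹ ^ a * s)))
      (𝓝[≠] 0) (𝓝 0) := by
    intro a
    have hc : Tendsto (fun s : ℂ => (q ^ 2)⁻¹ ^ a * s) (𝓝[≠] 0) (𝓝 0) := by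
      have : Tendsto (fun s : ℂ => (q ^ 2)⁻¹ ^ a * s) (𝓝 0) (𝓝 ((q ^ 2)⁻¹ ^ a * 0)) :=
        tendsto_const_nhds.mul tendsto_id
      rw [mul_zero] at this
      exact this.mono_left nhdsWithin_le_nhds
    have h4 := h2.comp_tendsto hc
    have h5 : (fun s : ℂ => (s ^ n)⁻¹ * ((fun σ => f σ - P σ) ∘ fun s => (q ^ 2)⁻¹ ^ a * s) s)
        =O[𝓝[≠] 0] fun s => (s ^ n)⁻¹ * (s ^ (n + 1)) := by
      refine (Asymptotics.isBigO_refl _ _).mul (h4.trans ?_)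
      simp only [Function.comp_def, mul_pow]
      exact Asymptotics.isBigO_const_mul_self _ _ _
    refine h5.trans_tendsto ?_
    have h6 : Tendsto (fun s : ℂ => s) (𝓝[≠] 0) (𝓝 0) := tendsto_id.mono_left nhdsWithin_le_nhds
    refine h6.congr' ?_
    filter_upwards [self_mem_nhdsWithin] with s hs
    have : s ≠ 0 := hs
    rw [pow_succ]
    field_simp
  have h7 : Tendsto (fun s => (s ^ n)⁻¹ * ∑ a ∈ range (n + 1),
      (-1) ^ a * q ^ (a * (n - 1)) * qBin q n a *
        (f ((q ^ 2)⁻¹ ^ a * s) - P ((q ^ 2)⁻¹ ^ a * s))) (𝓝[≠] 0) (𝓝 0) := by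
    simp only [mul_sum]
    have h0 : ∑ a ∈ range (n + 1),
      (-1) ^ a * q ^ (a * (n - 1)) * qBin q n a * (0 : ℂ) = 0 := by simp
    refine Eq.subst (motive := fun z => Tendsto _ (𝓝[≠] 0) (𝓝 z)) h0 ?_
    refine tendsto_finsetSum _ fun a _ =>
      ((h3 a).const_mul ((-1) ^ a * q ^ (a * (n - 1)) * qBin q n a)).congr fun s => ?_
    exact mul_left_comm _ _ _
  have h8 : ∀ s : ℂ, ∑ a ∈ range (n + 1), (-1) ^ a * q ^ (a * (n - 1)) * qBin q n a *
      P ((q ^ 2)⁻¹ ^ a * s) = s ^ n *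
      (q⁻¹ ^ (n + 1).choose 2 * (q - q⁻¹) ^ n * qFac q n * coeff n F) := by
    intro s
    simp only [hP, mul_sum]
    rw [sum_comm]
    have h9 : ∀ k ∈ range (n + 1), ∑ a ∈ range (n + 1), (-1) ^ a * q ^ (a * (n - 1)) * qBin q n a *
          (coeff k F * ((q ^ 2)⁻¹ ^ a * s) ^ k) =
        if k = n then s ^ n * (q⁻¹ ^ (n + 1).choose 2 * (q - q⁻¹) ^ n * qFac q n *
          coeff n F) else 0 := by
      intro k hk
      have h10 := sum_qBin_inv_pow hq (Nat.lt_succ_iff.mp (mem_range.mp hk))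
      rw [prod_one_sub_inv_pow hq hqq] at h10
      calc _ = (coeff k F * s ^ k) * ∑ a ∈ range (n + 1),
            (-1) ^ a * q ^ (a * (n - 1)) * qBin q n a * ((q ^ 2)⁻¹ ^ k) ^ a := by
            rw [mul_sum]
            refine sum_congr rfl fun a _ => ?_
            rw [mul_pow, ← pow_mul, ← pow_mul, mul_comm a k]; ring
        _ = _ := by grind
    rw [sum_congr rfl h9, sum_ite_eq' , if_pos (by simp)]
  have h11 := h7.add (tendsto_const_nhds (x := q⁻¹ ^ (n + 1).choose 2 * (q - q⁻¹) ^ n * qFac q n *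
    coeff n F))
  rw [zero_add] at h11
  refine h11.congr' ?_
  filter_upwards [self_mem_nhdsWithin] with s hs
  have hs0 : s ≠ 0 := hs
  simp only [mul_sub, sum_sub_distrib, h8]
  rw [inv_mul_cancel_left₀ (pow_ne_zero n hs0), sub_add_cancel]

end Expansions

/-! ### The action of the powers of the raising operator on descendants -/

section Strings

lemma strFac_add (q s z : ℂ) (a l : ℕ) :
    strFac q s z (a + l) = strFac q ((q ^ 2)⁻¹ ^ a * s) z l := by rw [strFac, strFac, pow_add]; ring

lemma prod_inv_string {q s : ℂ} (hq : q ≠ 0) (hs : s ≠ 0) (b p : ℕ) :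
    ∏ l ∈ Ico b (b + p), ((q ^ 2)⁻¹ ^ l * s)⁻¹ = (s ^ p)⁻¹ * q ^ (2 * (b * p + p.choose 2)) := by
  induction p with
  | zero => simp
  | succ p ih =>
    rw [← add_assoc, prod_Ico_succ_top (by omega), ih, choose_succ_succ' p 1,
      choose_one_right, pow_succ s, mul_inv, mul_inv, inv_pow, inv_inv, ← pow_mul]
    ring

lemma prod_weights_string {w : ℕ → ℂ} (hw : ∀ i, w i ≠ 0) (ν a j p : ℕ) :
    (∏ l ∈ range a, w (ν + l)) * ∏ l ∈ Ico (a + j) (a + j + p), w l =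
      ((∏ i ∈ range (a + j + p), w i) / ∏ i ∈ range ν, w i) *
        ((∏ i ∈ range ν, w (a + i)) / ∏ i ∈ range j, w (a + i)) := by
  have h0 : ∀ A : Finset ℕ, ∀ f : ℕ → ℕ, ∏ i ∈ A, w (f i) ≠ 0 := fun A f =>
    prod_ne_zero_iff.mpr fun i _ => hw _
  have h1 := prod_range_mul_prod_Ico w (Nat.le_add_right (a + j) p)
  have h2 := prod_range_add w a j
  have h3 := prod_range_add w a ν
  have h4 := prod_range_add w ν a
  rw [add_comm ν a] at h4
  rw [← h1, h2]
  have e1 := h0 (range ν) id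
  have e2 := h0 (range j) (a + ·)
  have e3 := h0 (range a) id
  simp only [id] at e1 e3
  have h5 := h3.symm.trans h4
  field_simp
  linear_combination -(∏ l ∈ Ico (a + j) (a + j + p), w l) * h5

lemma string_phase {q s : ℂ} (hgen : ∀ n, 1 ≤ n → q ^ n ≠ 1) (hq : q ≠ 0) (hs : s ≠ 0)
    {w : ℂ → ℂ} (hw : ∀ i : ℕ, w ((q ^ 2)⁻¹ ^ i * s) ≠ 0) (ν a j p : ℕ) :
    (-1) ^ p * (q ^ (a.choose 2 + j * a) * q⁻¹ ^ (p.choose 2 + j * p)) *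
      (qFac q (a + j + p) / (qFac q p * qFac q j * qFac q a)) *
      ((∏ l ∈ range a, (w ((q ^ 2)⁻¹ ^ (ν + l) * s) / ((q ^ 2)⁻¹ ^ l * s))) *
        ∏ l ∈ Ico (a + j) (a + j + p), (w ((q ^ 2)⁻¹ ^ l * s) / ((q ^ 2)⁻¹ ^ l * s))) =
    ((-1) ^ (a + p) * q ^ ((a + p).choose 2 + j * (a + p)) *
      (qFac q (a + j + p) / (qFac q j * qFac q (a + p))) *
      ((∏ i ∈ range (a + j + p), w ((q ^ 2)⁻¹ ^ i * s)) / ∏ i ∈ range ν, w ((q ^ 2)⁻¹ ^ i * s))) *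
    ((s ^ (a + p))⁻¹ * ((-1) ^ a * q ^ (a * (a + p - 1)) * qBin q (a + p) a *
      ((∏ i ∈ range ν, w ((q ^ 2)⁻¹ ^ i * ((q ^ 2)⁻¹ ^ a * s))) /
        ∏ i ∈ range j, w ((q ^ 2)⁻¹ ^ i * ((q ^ 2)⁻¹ ^ a * s))))) := by
  have hW := prod_weights_string (w := fun i => w ((q ^ 2)⁻¹ ^ i * s)) hw ν a j p
  have e1 : ∀ i : ℕ, (q ^ 2)⁻¹ ^ (a + i) * s = (q ^ 2)⁻¹ ^ i * ((q ^ 2)⁻¹ ^ a * s) := fun i => by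
    rw [pow_add]; ring
  simp only [e1] at hW
  have hP1 := prod_inv_string hq hs 0 a
  rw [zero_add, zero_mul, zero_add, ← range_eq_Ico] at hP1
  have hP2 := prod_inv_string hq hs (a + j) p
  have hch2 : a * (a + p - 1) = 2 * a.choose 2 + a * p := by
    rcases a with - | a
    · simp
    · have h1 : 2 * (a + 1).choose 2 = (a + 1) * a := by
        rw [Nat.choose_two_right, Nat.mul_div_cancel' (Nat.even_mul_pred_self (a + 1)).two_dvd,
          add_tsub_cancel_right]
      grind
  have hB := qBin_mul_qFac hq a p
  have f1 := qFac_ne_zero hgen hq a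
  have f2 := qFac_ne_zero hgen hq p
  have f3 := qFac_ne_zero hgen hq (a + p)
  have f4 := qFac_ne_zero hgen hq j
  have hB' : qBin q (a + p) a = qFac q (a + p) / (qFac q a * qFac q p) := by grind
  simp only [div_eq_mul_inv (w _), prod_mul_distrib, hP1, hP2]
  rw [hB', choose_two_add, hch2, mul_mul_mul_comm (∏ l ∈ range a, _), hW]
  generalize (∏ i ∈ range (a + j + p), w ((q ^ 2)⁻¹ ^ i * s)) /
        ∏ i ∈ range ν, w ((q ^ 2)⁻¹ ^ i * s) = W1
  generalize (∏ i ∈ range ν, w ((q ^ 2)⁻¹ ^ i * ((q ^ 2)⁻¹ ^ a * s))) /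
        ∏ i ∈ range j, w ((q ^ 2)⁻¹ ^ i * ((q ^ 2)⁻¹ ^ a * s)) = W2
  have h2 : ((-1 : ℂ) ^ a) * (-1) ^ a = 1 := by rw [← mul_pow]; simp
  have h3 : q⁻¹ ^ (p.choose 2 + j * p) * q ^ (p.choose 2 + j * p) = 1 := by
    rw [← mul_pow, inv_mul_cancel₀ hq, one_pow]
  have h4 : qFac q (a + j + p) / (qFac q j * qFac q (a + p)) *
      (qFac q (a + p) / (qFac q a * qFac q p)) =
      qFac q (a + j + p) / (qFac q p * qFac q j * qFac q a) := by field_simp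
  rw [← h4]
  generalize qFac q (a + j + p) / (qFac q j * qFac q (a + p)) = Q1
  generalize qFac q (a + p) / (qFac q a * qFac q p) = Q2
  generalize q⁻¹ ^ (p.choose 2 + j * p) = Y at h3 ⊢
  rw [pow_add s, mul_inv]
  generalize (s ^ a)⁻¹ = s1
  generalize (s ^ p)⁻¹ = s2
  have h5 : q ^ (2 * ((a + j) * p + p.choose 2)) =
      q ^ (p.choose 2 + j * p) * q ^ (p.choose 2 + j * p + 2 * (a * p)) := by
    rw [← pow_add]; congr 1; ring
  rw [h5]
  linear_combination (exp := 1) (-1) ^ p * q ^ (a.choose 2 + j * a) * q ^ (2 * a.choose 2) *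
    q ^ (p.choose 2 + j * p + 2 * (a * p)) * Q1 * Q2 * s1 * s2 * W1 * W2 * h3 -
    (-1) ^ p * q ^ (a.choose 2 + j * a) * q ^ (2 * a.choose 2) *
    q ^ (p.choose 2 + j * p + 2 * (a * p)) * Q1 * Q2 * s1 * s2 * W1 * W2 * h2

variable {κ V : Type*} [DecidableEq κ] [AddCommGroup V] [Module ℂ V]

/-- The operator of a string. -/
def strOp (q : ℂ) (T : ℂ → M₂ (End ℂ V)) (j : ℕ) (s : ℂ) : End ℂ V :=
  ((List.range j).map fun i => T ((q ^ 2)⁻¹ ^ i * s) 0 1).prod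

lemma strOp_succ (q : ℂ) (T : ℂ → M₂ (End ℂ V)) (j : ℕ) (s : ℂ) :
    strOp q T (j + 1) s = T s 0 1 * strOp q T j ((q ^ 2)⁻¹ * s) := by
  rw [strOp, List.range_succ_eq_map, List.map_cons, List.prod_cons, List.map_map, strOp]
  simp only [pow_zero, one_mul, Function.comp_def, pow_succ, mul_assoc]

/-- An operator with the exchange relations of the leading coefficient of the lower left entry of
the monodromy matrix, together with the leading coefficients of the diagonal entries. -/
structure IsRaising (q : ℂ) (T : ℂ → M₂ (End ℂ V)) (v : V)
    (C X₀ X₁ : End ℂ V) (x₀ x₁ : ℂ) : Prop where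
  X₀B : ∀ x, X₀ * T x 0 1 = q⁻¹ • (T x 0 1 * X₀)
  X₁B : ∀ x, X₁ * T x 0 1 = q • (T x 0 1 * X₁)
  CB : ∀ x, x ≠ 0 → C * T x 0 1 = T x 0 1 * C + x⁻¹ • (T x 0 0 * X₁ - X₀ * T x 1 1)
  X₀_vac : X₀ v = x₀ • v
  X₁_vac : X₁ v = x₁ • v
  C_vac : C v = 0

variable {q : ℂ} {T : ℂ → M₂ (End ℂ V)} {v : V} {C X₀ X₁ : End ℂ V} {x₀ x₁ : ℂ}

lemma IsRaising.raising (h : IsRaising q T v C X₀ X₁ x₀ x₁) {hq : q ≠ 0} {hq4 : q ^ 4 ≠ 1}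
    {hT : IsRTT q T} {ℓ : Dual ℂ V} {a d : ℂ → ℂ}
    {htri : ∀ x, IsTriangular v ℓ (a x) (d x) (T x)} {hv : ℓ v = 1} {ι : Type*} {s : ι → ℂ}
    {hs : ∀ i, s i ≠ 0} :
    (ExchangeSystem.ofRTT hq hq4 hT htri hv s hs).Raising C X₀ X₁ x₀ x₁ where
  X₀B i := h.X₀B _
  X₁B i := h.X₁B _
  CB i := h.CB _ (hs i)
  X₀_vac := h.X₀_vac
  X₁_vac := h.X₁_vac
  C_vac := h.C_vac

lemma bvec_disjSum_Ico {hq : q ≠ 0} {hq4 : q ^ 4 ≠ 1} {hT : IsRTT q T} {ℓ : Dual ℂ V} {a d : ℂ → ℂ}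
    {htri : ∀ x, IsTriangular v ℓ (a x) (d x) (T x)} {hv : ℓ v = 1} {s : κ → ℂ} {σ : ℂ}
    (hs : ∀ i, s i ≠ 0)
    (hs' : ∀ i, (Sum.elim s fun l : ℕ => (q ^ 2)⁻¹ ^ l * σ : κ ⊕ ℕ → ℂ) i ≠ 0)
    (W : Finset κ) (b j : ℕ) :
    (ExchangeSystem.ofRTT hq hq4 hT htri hv _ hs').bvec (W.disjSum (Ico b (b + j))) =
      strOp q T j ((q ^ 2)⁻¹ ^ b * σ) ((ExchangeSystem.ofRTT hq hq4 hT htri hv s hs).bvec W) := by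
  induction j generalizing b with
  | zero =>
    have h := (ExchangeSystem.ofRTT hq hq4 hT htri hv _ hs').comap_bvec (f := inl)
      Sum.inl_injective W
    have e : W.disjSum (Ico b (b + 0)) = W.image inl := by ext x; cases x <;> simp
    rw [e, ← h]
    rfl
  | succ j ih =>
    have e : W.disjSum (Ico b (b + (j + 1))) =
        insert (inr b) (W.disjSum (Ico (b + 1) (b + 1 + j))) := by
      ext x
      cases x
      · simp
      · simp only [inr_mem_disjSum, mem_Ico, mem_insert, inr.injEq]
        omega
    have e' : (q ^ 2)⁻¹ ^ (b + 1) * σ = (q ^ 2)⁻¹ * ((q ^ 2)⁻¹ ^ b * σ) := by grind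
    rw [e, ExchangeSystem.bvec_insert _ _ _ (by simp), ih, strOp_succ, End.mul_apply, e']
    rfl

/-- The contribution of a splitting to the action of the raising operator on a descendant. -/
def stringTerm (q : ℂ) (s : κ → ℂ) (w : ℂ → ℂ) (ν m : ℕ) (Z U U₁ : Finset κ) (σ : ℂ) : ℂ :=
  ((∏ i ∈ range ν, w ((q ^ 2)⁻¹ ^ i * σ)) / ∏ i ∈ range #U, w ((q ^ 2)⁻¹ ^ i * σ)) *
  (∏ i ∈ Z \ U, (strFac q σ (s i) (#U + 1) * strFac q σ (s i) 0)⁻¹) *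
  splitTerm q (fun i k => fD q (s i) (s k))
    (fun i => (w ((q ^ 2)⁻¹ ^ ν * s i) / s i * ∏ k ∈ Z \ U, (q * fD q (s k) (s i))) *
      (q ^ (m + #U) * (strFac q σ (s i) 1)⁻¹))
    (fun i => (w (s i) / s i * ∏ k ∈ Z \ U, (q⁻¹ * fD q (s i) (s k))) *
      (q⁻¹ ^ (m + #U) * (strFac q σ (s i) #U)⁻¹)) U₁ (U \ U₁)

/-- The prefactor of the contribution of a splitting, which tends to `1`. -/
def stringFactor (q : ℂ) (s : κ → ℂ) (w : ℂ → ℂ) (ν m : ℕ) (Z U U₁ : Finset κ) (σ : ℂ) : ℂ :=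
  ((∏ i ∈ range m, w ((q ^ 2)⁻¹ ^ i * σ)) / ∏ i ∈ range ν, w ((q ^ 2)⁻¹ ^ i * σ)) *
  ((∏ i ∈ Z \ U, strFac q σ (s i) 0 * strFac q σ (s i) (m + 1)) *
    ((∏ i ∈ U₁, strFac q σ (s i) 0) * ∏ i ∈ U \ U₁, strFac q σ (s i) (m + 1)))

lemma splitTerm_eq_zero_of_left {ι : Type*} {θ : ι → ι → ℂ} {u v : ι → ℂ} {S P : Finset ι} {i : ι}
    (hi : i ∈ S) (h : v i = 0) : splitTerm q θ u v S P = 0 := by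
  rw [splitTerm, prod_eq_zero hi h]; simp

lemma splitTerm_eq_zero_of_right {ι : Type*} {θ : ι → ι → ℂ} {u v : ι → ℂ} {S P : Finset ι}
    {i : ι} (hi : i ∈ P) (h : u i = 0) : splitTerm q θ u v S P = 0 := by
  rw [splitTerm, prod_eq_zero hi h]; simp

lemma splitTerm_eq_zero_of_pair {ι : Type*} {θ : ι → ι → ℂ} {u v : ι → ℂ} {S P : Finset ι}
    {i k : ι} (hi : i ∈ S) (hk : k ∈ P) (h : θ i k = 0) : splitTerm q θ u v S P = 0 := by
  rw [splitTerm, prod_eq_zero (f := fun i => ∏ k ∈ P, θ i k) hi (prod_eq_zero hk h)]; simp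

lemma C_pow_strOp {hq : q ≠ 0} {hq4 : q ^ 4 ≠ 1} (hgen : ∀ n, 1 ≤ n → q ^ n ≠ 1)
    {hT : IsRTT q T} {ℓ : Dual ℂ V} {a d : ℂ → ℂ}
    {htri : ∀ x, IsTriangular v ℓ (a x) (d x) (T x)} {hv : ℓ v = 1} {s : κ → ℂ} {σ : ℂ}
    (h : IsRaising q T v C X₀ X₁ x₀ x₁) (hs : ∀ i, s i ≠ 0) (hinj : Injective s)
    (hσ : σ ≠ 0) (hd : ∀ i l, strFac q σ (s i) l ≠ 0) {w : ℂ → ℂ} {ν : ℕ}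
    (hw : ∀ i : ℕ, w ((q ^ 2)⁻¹ ^ i * σ) ≠ 0) (ha : ∀ x, x₁ * a x = w ((q ^ 2)⁻¹ ^ ν * x))
    (hd' : ∀ x, x₀ * d x = w x) (Z : Finset κ) (m : ℕ) :
    let Ψ := (ExchangeSystem.ofRTT hq hq4 hT htri hv s hs).bvec
    (C ^ m) (strOp q T m σ (Ψ Z)) = qFac q m • ∑ U ∈ Z.powerset with #U ≤ m,
      ∑ U₁ ∈ U.powerset, (((-1) ^ (m - #U) * q ^ ((m - #U).choose 2 + #U * (m - #U)) *
        (qFac q m / (qFac q #U * qFac q (m - #U)))) * stringFactor q s w ν m Z U U₁ σ) •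
        ((σ ^ (m - #U))⁻¹ • ∑ a ∈ range (m - #U + 1),
          ((-1) ^ a * q ^ (a * (m - #U - 1)) * qBin q (m - #U) a) •
          (stringTerm q s w ν m Z U U₁ ((q ^ 2)⁻¹ ^ a * σ) •
            strOp q T #U ((q ^ 2)⁻¹ ^ a * σ) (Ψ (Z \ U)))) := by
  intro Ψ
  set x : κ ⊕ ℕ → ℂ := Sum.elim s fun l => (q ^ 2)⁻¹ ^ l * σ with hx
  have hr0 : (q ^ 2)⁻¹ ≠ 0 := inv_ne_zero (pow_ne_zero 2 hq)
  have hx0 : ∀ i, x i ≠ 0 := by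
    rintro (i | l)
    · exact hs i
    · exact mul_ne_zero (pow_ne_zero _ hr0) hσ
  have hqq : q - q⁻¹ ≠ 0 := fun h => hgen 2 (by norm_num) (by field_simp at h; linear_combination h)
  have hmix : ∀ i l, s i ≠ (q ^ 2)⁻¹ ^ l * σ := fun i l h => by
    apply hd i (l + 1)
    rw [strFac_succ hq, ← h, mul_inv_cancel₀ (hs i), sub_self]
  have hpow : ∀ k l : ℕ, k < l → (q ^ 2)⁻¹ ^ k ≠ (q ^ 2)⁻¹ ^ l := by
    intro k l hkl h
    obtain ⟨e, rfl⟩ := Nat.exists_eq_add_of_lt hkl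
    rw [add_assoc, pow_add] at h
    have h1 := mul_left_cancel₀ (pow_ne_zero k hr0) ((mul_one _).trans h)
    rw [inv_pow, ← pow_mul] at h1
    exact hgen (2 * (e + 1)) (by omega) (inv_eq_one.mp h1.symm)
  have hxinj : Injective x := by
    rintro (i | k) (j | l) hkl
    · grind
    · grind
    · grind
    · grind
  set E := ExchangeSystem.ofRTT hq hq4 hT htri hv x hx0 with hE
  have hbv := bvec_disjSum_Ico (hq := hq) (hq4 := hq4) (hT := hT) (htri := htri) (hv := hv) hs hx0
  have hR : E.Raising C X₀ X₁ x₀ x₁ := h.raising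
  have hθ0 : ∀ l : ℕ, fD q (x (inr l)) (x (inr (l + 1))) = 0 := fun l => by
    simp only [hx, Sum.elim_inr, fD, pow_succ]
    rw [div_eq_zero_iff]
    left
    field_simp
    ring
  have h0 := hR.C_pow_bvec hq hqq hxinj hx0 m (Z.disjSum (range m))
  have hbZ := hbv Z 0 m
  rw [zero_add, ← range_eq_Ico, pow_zero, one_mul] at hbZ
  rw [← hE] at hbZ
  rw [hbZ] at h0
  rw [h0]
  congr 1
  simp only [splitSum, sum_smul]
  rw [sum_splittings_string Z m (fun T' S => splitTerm q (fun i k => fD q (x i) (x k))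
        (fun i => x₁ * E.a i / x i * ∏ k ∈ Z.disjSum (range m) \ T', (q * fD q (x k) (x i)))
        (fun i => x₀ * E.d i / x i * ∏ k ∈ Z.disjSum (range m) \ T', (q⁻¹ * fD q (x i) (x k)))
        S (T' \ S) • E.bvec (Z.disjSum (range m) \ T'))]
  · refine sum_congr rfl fun U hU => sum_congr rfl fun U₁ hU₁ => ?_
    rw [mem_filter, mem_powerset] at hU
    rw [mem_powerset] at hU₁
    rw [smul_sum, smul_sum]
    refine sum_congr rfl fun b hb => ?_
    obtain ⟨j, hj⟩ : ∃ j, #U = j := ⟨_, rfl⟩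
    rw [hj] at hU hb ⊢
    rw [mem_range] at hb
    obtain ⟨p, rfl⟩ : ∃ p, m = b + j + p := ⟨m - j - b, by omega⟩
    have e1 : Z.disjSum (range (b + j + p)) \ U.disjSum (range b ∪ Ico (b + j) (b + j + p)) =
        (Z \ U).disjSum (Ico b (b + j)) := by
      rw [disjSum_sdiff_disjSum]
      congr 1
      ext l
      simp only [Finset.mem_sdiff, mem_union, mem_range, mem_Ico]
      omega
    have e2 : U.disjSum (range b ∪ Ico (b + j) (b + j + p)) \
        U₁.disjSum (Ico (b + j) (b + j + p)) = (U \ U₁).disjSum (range b) := by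
      rw [disjSum_sdiff_disjSum]
      congr 1
      ext l
      simp only [Finset.mem_sdiff, mem_union, mem_range, mem_Ico]
      omega
    rw [e1, e2, hE, hbv, ← hE]
    have h1 := splitTerm_string hgen hq hσ (u := fun i => x₁ * E.a i / x i)
      (v := fun i => x₀ * E.d i / x i) (W := Z \ U) hU₁ hs hd (a := b) (p := p) hj
    have hph := string_phase hgen hq hσ hw ν b j p
    have ea : ∀ i, E.a i = a (x i) := fun _ => rfl
    have ed : ∀ i, E.d i = d (x i) := fun _ => rfl
    have ew : ∀ l : ℕ, (q ^ 2)⁻¹ ^ ν * ((q ^ 2)⁻¹ ^ l * σ) = (q ^ 2)⁻¹ ^ (ν + l) * σ := fun l => by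
      grind
    simp only [ea, ed, ha, hd', hx, Sum.elim_inl, Sum.elim_inr, ew] at h1 ⊢
    rw [hph] at h1
    rw [h1, smul_smul, smul_smul, smul_smul]
    congr 1
    have em : b + j + p - j = b + p := by omega
    simp only [stringTerm, stringFactor, hj, em, ← strFac_add, ← add_assoc, add_zero]
    ring
  · intro T' hT' S hS l hl hcase
    have hl1 : inr (l + 1) ∈ Z.disjSum (range m) := by simpa using hl
    have hl0 : inr l ∈ Z.disjSum (range m) := by simp; omega
    suffices hsuff : splitTerm q (fun i k => fD q (x i) (x k))
        (fun i => x₁ * E.a i / x i * ∏ k ∈ Z.disjSum (range m) \ T', (q * fD q (x k) (x i)))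
        (fun i => x₀ * E.d i / x i *
          ∏ k ∈ Z.disjSum (range m) \ T', (q⁻¹ * fD q (x i) (x k))) S (T' \ S) = 0 by
      rw [hsuff, zero_smul]
    rcases hcase with ⟨hc1, hc2⟩ | ⟨hc1, hc2⟩
    · by_cases hc3 : inr (l + 1) ∈ T'
      · exact splitTerm_eq_zero_of_pair hc1 (Finset.mem_sdiff.mpr ⟨hc3, hc2⟩) (hθ0 l)
      · refine splitTerm_eq_zero_of_left hc1 (mul_eq_zero_of_right _ (prod_eq_zero
          (i := inr (l + 1)) (Finset.mem_sdiff.mpr ⟨hl1, hc3⟩) ?_))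
        rw [hθ0, mul_zero]
    · refine splitTerm_eq_zero_of_right hc2 (mul_eq_zero_of_right _ (prod_eq_zero
          (i := inr l) (Finset.mem_sdiff.mpr ⟨hl0, hc1⟩) ?_))
      rw [hθ0, mul_zero]

lemma eventually_forall_pow_mul {P : ℂ → Prop} (hP : ∀ᶠ x in 𝓝 (0 : ℂ), P x) {r : ℂ}
    (hr : ‖r‖ ≤ 1) : ∀ᶠ x in 𝓝 (0 : ℂ), ∀ i : ℕ, P (r ^ i * x) := by
  obtain ⟨ε, hε, h⟩ := Metric.eventually_nhds_iff.mp hP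
  refine Metric.eventually_nhds_iff.mpr ⟨ε, hε, fun x hx i => h ?_⟩
  rw [dist_zero_right] at hx ⊢
  rw [norm_mul, norm_pow]
  exact (mul_le_of_le_one_left (norm_nonneg x) (pow_le_one₀ (norm_nonneg r) hr)).trans_lt hx

lemma continuousAt_strFac (q z : ℂ) (l : ℕ) : ContinuousAt (fun σ => strFac q σ z l) 0 := by
  unfold strFac
  fun_prop

lemma strFac_zero_left (q z : ℂ) (l : ℕ) : strFac q 0 z l = 1 := by simp [strFac]

lemma tendsto_stringFactor (s : κ → ℂ) {w : ℂ → ℂ} (hw : ContinuousAt w 0)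
    (hw0 : w 0 = 1) (ν m : ℕ) (Z U U₁ : Finset κ) :
    Tendsto (stringFactor q s w ν m Z U U₁) (𝓝 0) (𝓝 1) := by
  have h1 : ∀ i : ℕ, Tendsto (fun σ => w ((q ^ 2)⁻¹ ^ i * σ)) (𝓝 0) (𝓝 1) := fun i => by
    have h2 : Tendsto (fun σ : ℂ => (q ^ 2)⁻¹ ^ i * σ) (𝓝 0) (𝓝 0) := by
      have : ContinuousAt (fun σ : ℂ => (q ^ 2)⁻¹ ^ i * σ) 0 := by fun_prop
      simpa using this.tendsto
    simpa [hw0, Function.comp_def] using hw.tendsto.comp h2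
  have h3 : ∀ i l, Tendsto (fun σ => strFac q σ (s i) l) (𝓝 0) (𝓝 1) := fun i l => by
    simpa [strFac_zero_left] using (continuousAt_strFac q (s i) l).tendsto
  have h4 : ∀ n : ℕ, Tendsto (fun σ => ∏ i ∈ range n, w ((q ^ 2)⁻¹ ^ i * σ)) (𝓝 0) (𝓝 1) :=
    fun n => by simpa using tendsto_finsetProd (range n) fun i _ => h1 i
  have h5 : ∀ (A : Finset κ) (l : ℕ), Tendsto (fun σ => ∏ i ∈ A, strFac q σ (s i) l) (𝓝 0) (𝓝 1) :=
    fun A l => by simpa using tendsto_finsetProd A fun i _ => h3 i l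
  have h6 : Tendsto (fun σ => ∏ i ∈ Z \ U, strFac q σ (s i) 0 * strFac q σ (s i) (m + 1)) (𝓝 0)
      (𝓝 1) := by simpa using tendsto_finsetProd (Z \ U) fun i _ => (h3 i 0).mul (h3 i (m + 1))
  have := ((h4 m).div (h4 ν) one_ne_zero).mul (h6.mul ((h5 U₁ 0).mul (h5 (U \ U₁) (m + 1))))
  simp only [div_one, mul_one] at this
  exact this

/-- The action of the powers of the raising operator on a descendant of an off-shell vector. -/
lemma C_pow_B_pow [Finite κ] {hq : q ≠ 0} {hq4 : q ^ 4 ≠ 1} (hgen : ∀ n, 1 ≤ n → q ^ n ≠ 1)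
    (hq1 : 1 ≤ ‖q‖) {hT : IsRTT q T} {ℓ : Dual ℂ V} {a d : ℂ → ℂ}
    {htri : ∀ x, IsTriangular v ℓ (a x) (d x) (T x)} {hv : ℓ v = 1} {s : κ → ℂ}
    (h : IsRaising q T v C X₀ X₁ x₀ x₁) (hs : ∀ i, s i ≠ 0) (hinj : Injective s)
    {w : ℂ → ℂ} {ν : ℕ} (hw : ContinuousAt w 0) (hw0 : w 0 = 1)
    (ha : ∀ x, x₁ * a x = w ((q ^ 2)⁻¹ ^ ν * x)) (hd : ∀ x, x₀ * d x = w x)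
    (Z : Finset κ) (m : ℕ) (e : Dual ℂ V) {F : Finset κ → Finset κ → PowerSeries ℂ}
    (hF : ∀ U ∈ Z.powerset, #U ≤ m → ∀ U₁ ∈ U.powerset,
      Expands (fun σ => stringTerm q s w ν m Z U U₁ σ * e (strOp q T #U σ
        ((ExchangeSystem.ofRTT hq hq4 hT htri hv s hs).bvec (Z \ U)))) (F U U₁))
    (hcont : Tendsto (fun σ => e ((C ^ m) (strOp q T m σ
      ((ExchangeSystem.ofRTT hq hq4 hT htri hv s hs).bvec Z)))) (𝓝[≠] 0)
      (𝓝 (e ((C ^ m) ((T 0 0 1 ^ m) ((ExchangeSystem.ofRTT hq hq4 hT htri hv s hs).bvec Z)))))) :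
    e ((C ^ m) ((T 0 0 1 ^ m) ((ExchangeSystem.ofRTT hq hq4 hT htri hv s hs).bvec Z))) =
      qFac q m * ∑ U ∈ Z.powerset with #U ≤ m, ∑ U₁ ∈ U.powerset,
        ((-1) ^ (m - #U) * q ^ (#U * (m - #U)) * q⁻¹ ^ (m - #U) *
          (q - q⁻¹) ^ (m - #U) * (qFac q m / qFac q #U)) *
          PowerSeries.coeff (m - #U) (F U U₁) := by
  have hqq : q - q⁻¹ ≠ 0 := fun h => hgen 2 (by norm_num) (by field_simp at h; linear_combination h)
  have hr : ‖(q ^ 2)⁻¹‖ ≤ 1 := by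
    rw [norm_inv, norm_pow]; exact inv_le_one_of_one_le₀ (one_le_pow₀ hq1)
  refine tendsto_nhds_unique hcont (Tendsto.congr' ?_ (Tendsto.const_mul (qFac q m)
    (tendsto_finsetSum _ fun U hU => tendsto_finsetSum _ fun U₁ hU₁ =>
      Eq.subst (motive := fun z => Tendsto _ (𝓝[≠] 0) (𝓝 z)) ?_
        (((((tendsto_stringFactor (q := q) s hw hw0 ν m Z U U₁).mono_left
          nhdsWithin_le_nhds).const_mul ((-1) ^ (m - #U) * q ^ ((m - #U).choose 2 + #U * (m - #U)) *
            (qFac q m / (qFac q #U * qFac q (m - #U)))))).mul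
          ((hF U (mem_filter.mp hU).1 (mem_filter.mp hU).2 U₁
            hU₁).tendsto_qDifference hq hqq (m - #U))))))
  · have h1 : ∀ᶠ σ in 𝓝 (0 : ℂ), ∀ i l, strFac q σ (s i) l ≠ 0 := by
      have h2 : ∀ᶠ σ in 𝓝 (0 : ℂ), ∀ i, strFac q σ (s i) 0 ≠ 0 := by
        rw [eventually_all]
        intro i
        exact (continuousAt_strFac q (s i) 0).eventually_ne (by simp [strFac_zero_left])
      filter_upwards [eventually_forall_pow_mul h2 hr] with σ hσ i l
      have := hσ l i
      rwa [← strFac_add] at this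
    have h3 : ∀ᶠ σ in 𝓝 (0 : ℂ), ∀ i : ℕ, w ((q ^ 2)⁻¹ ^ i * σ) ≠ 0 :=
      eventually_forall_pow_mul (hw.eventually_ne (by simp [hw0])) hr
    filter_upwards [mem_nhdsWithin_of_mem_nhds h1, mem_nhdsWithin_of_mem_nhds h3,
      self_mem_nhdsWithin] with σ hσ1 hσ2 hσ3
    rw [C_pow_strOp hgen h hs hinj hσ3 hσ1 hσ2 ha hd Z m]
    simp
  · have f2 := qFac_ne_zero hgen hq (m - #U)
    rw [choose_succ_succ' (m - #U) 1, choose_one_right, pow_add q, pow_add q⁻¹, mul_one]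
    have h4 : q ^ (m - #U).choose 2 * q⁻¹ ^ (m - #U).choose 2 = 1 := by
      rw [← mul_pow, mul_inv_cancel₀ hq, one_pow]
    have h5 : qFac q m / (qFac q #U * qFac q (m - #U)) * qFac q (m - #U) =
      qFac q m / qFac q #U := by field_simp
    rw [← h5]
    linear_combination ((-1) ^ (m - #U) * q ^ (#U * (m - #U)) *
      (qFac q m / (qFac q #U * qFac q (m - #U))) * q⁻¹ ^ (m - #U) *
      (q - q⁻¹) ^ (m - #U) * qFac q (m - #U) * PowerSeries.coeff (m - #U) (F U U₁)) * h4

end Strings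

/-! ### The homogeneous chain and its asymptotic operators -/

section HomogeneousChain

variable {N L : ℕ}

lemma siteOp_mul_tensorOp (i : Fin L) (a : LocOp N) (M : Fin L → LocOp N) :
    siteOp i a * tensorOp M = tensorOp fun j => if j = i then a * M j else M j := by
  rw [siteOp, tensorOp_mul]
  congr 1
  ext1 j
  by_cases h : j = i
  · subst h; simp
  · grind

lemma list_prod_siteOp (a : Fin L → LocOp N) {l : List (Fin L)} (hl : l.Nodup) :
    (l.map fun i => siteOp i (a i)).prod = tensorOp fun j => if j ∈ l then a j else 1 := by
  induction l with
  | nil => simp [tensorOp_one]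
  | cons i l ih =>
    rw [nodup_cons] at hl
    rw [List.map_cons, List.prod_cons, ih hl.2, siteOp_mul_tensorOp]
    grind

lemma list_sum_tensorOp (a d g : Fin L → LocOp N) (X : List (Fin L) → Op N L) (h0 : X [] = 0)
    (hX : ∀ i l, X (i :: l) = siteOp i (g i) * (l.map fun j => siteOp j (a j)).prod +
      siteOp i (d i) * X l) {l : List (Fin L)} (hl : l.Pairwise (· > ·)) :
    X l = ∑ i ∈ l.toFinset, tensorOp fun j => if j ∈ l then
      (if j < i then a j else if j = i then g j else d j) else 1 := by
  induction l with
  | nil => simp [h0]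
  | cons i l ih =>
    rw [List.pairwise_cons] at hl
    have hi : i ∉ l := fun h => lt_irrefl _ (hl.1 i h)
    have hnd : l.Nodup := hl.2.imp fun h => ne_of_gt h
    rw [hX, ih hl.2, List.toFinset_cons, sum_insert (by simpa using hi),
      list_prod_siteOp a hnd, siteOp_mul_tensorOp, mul_sum]
    congr 1
    · grind
    · refine sum_congr rfl fun k hk => ?_
      rw [List.mem_toFinset] at hk
      rw [siteOp_mul_tensorOp]
      grind

lemma pairwise_reverse_finRange : (finRange L).reverse.Pairwise (· > ·) := by
  rw [List.pairwise_reverse]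
  exact List.pairwise_lt_finRange L

/-- The parameter of the highest weight of the `N`-dimensional representation. -/
def topWeight (N : ℕ) (t : ℂ) : ℂ := t ^ (N - 1)

lemma locK_topWeight [NeZero N] {t : ℂ} (ht : t ≠ 0) : locK N t (topWeight N t) = kHalf N t 1 := by
  rw [locK, kHalf, topWeight]
  congr 1; ext σ
  have hN : 1 ≤ N := Nat.one_le_iff_ne_zero.mpr (NeZero.ne N)
  rw [one_mul, zpow_sub₀ ht, inv_pow, ← pow_mul, div_eq_mul_inv]
  congr 1
  rw [← zpow_natCast]; congr 1; omega

lemma locK'_topWeight [NeZero N] {t : ℂ} (ht : t ≠ 0) :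
    locK' N t (topWeight N t) = kHalf N t (-1) := by
  rw [locK', kHalf, topWeight]
  congr 1; ext σ
  have hN : 1 ≤ N := Nat.one_le_iff_ne_zero.mpr (NeZero.ne N)
  rw [neg_one_mul, neg_sub, zpow_sub₀ ht, ← pow_mul, div_eq_mul_inv, mul_comm]
  congr 1
  rw [← zpow_natCast, Nat.cast_sub hN, Nat.cast_one]

lemma locCoeff_topWeight [NeZero N] {t : ℂ} (ht : t ≠ 0) {m : ℕ} (hm : m ≤ N) :
    locCoeff t (topWeight N t) 1 1 m = qInt t (N - m) := by
  have hN : 1 ≤ N := Nat.one_le_iff_ne_zero.mpr (NeZero.ne N)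
  obtain ⟨p, rfl⟩ := Nat.exists_eq_add_of_le hm
  have h1 : topWeight (m + p) t ^ 2 * t ^ 2 = (t ^ 2) ^ m * (t ^ 2) ^ p := by
    rw [topWeight, ← mul_pow, ← pow_succ, Nat.sub_add_cancel hN, ← pow_mul, ← pow_add, ← pow_mul]
    congr 1; ring
  have h3 : t ^ 2 ≠ 0 := pow_ne_zero 2 ht
  have h4 : (t ^ 2) ^ m ≠ 0 := pow_ne_zero _ h3
  have h5 : (t ^ 2) ^ p ≠ 0 := pow_ne_zero _ h3
  rw [locCoeff, qInt, add_tsub_cancel_left, one_mul, one_mul, h1, inv_pow, inv_pow, ← mul_inv, h1]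
  congr 1
  field_simp

lemma locE_topWeight [NeZero N] {t : ℂ} (ht : t ≠ 0) : locE N t (topWeight N t) 1 1 = eHat N t := by
  ext τ σ
  rw [locE, eHat, of_apply, of_apply, locCoeff_topWeight ht σ.2.le]

variable (N L)

/-- The monodromy matrix of the homogeneous chain. -/
def homMat (t x : ℂ) : M₂ (Op N L) := chainMat N L t (topWeight N t) (fun _ => 1) (fun _ => 1) x

/-- The monodromy matrix of the homogeneous chain, as a matrix of endomorphisms. -/
def homEnd (t x : ℂ) : M₂ (End ℂ (Conf N L → ℂ)) := (homMat N L t x).map (opEnd N L)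

/-- The asymptotic site matrix. -/
def infSite (t : ℂ) (i : Fin L) : M₂ (Op N L) :=
  siteMatInf t (siteHom N i (locK N t (topWeight N t))) (siteHom N i (locK' N t (topWeight N t)))
    (siteHom N i (locE N t (topWeight N t) 1 1))

/-- The asymptotic monodromy matrix. -/
def infMat (t : ℂ) : M₂ (Op N L) := ((finRange L).reverse.map (infSite N L t)).prod

variable {N L}

lemma smul_tensorOp_prod (c : Fin L → ℂ) (M : Fin L → LocOp N) :
    tensorOp (fun j => c j • M j) = (∏ j, c j) • tensorOp M := by
  ext σ τ
  simp [tensorOp, prod_mul_distrib]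

lemma prod_ite_lt_ite_eq (a g d : ℂ) (i : Fin L) :
    ∏ j : Fin L, (if j < i then a else if j = i then g else d) =
      a ^ (i : ℕ) * g * d ^ (L - 1 - i) := by
  obtain ⟨p, hp⟩ := Nat.exists_eq_add_of_lt i.2
  have h1 : ∏ j : Fin L, (if j < i then a else if j = i then g else d) =
      ∏ j ∈ range L, (if j < (i : ℕ) then a else if j = i then g else d) := by
    rw [← Fin.prod_univ_eq_prod_range
      (fun j : ℕ => if j < (i : ℕ) then a else if j = i then g else d)]
    exact prod_congr rfl fun j _ => by simp only [Fin.lt_def, Fin.ext_iff]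
  have h2 : L = i + (p + 1) := hp
  have h3 : L - 1 - i = p := by omega
  rw [h1, h3]
  generalize (i : ℕ) = k at *
  subst h2
  rw [prod_range_add, prod_range_succ']
  have e1 : ∏ j ∈ range k, (if j < k then a else if j = k then g else d) = a ^ k := by
    rw [prod_congr rfl (g := fun _ => a) fun j hj => if_pos (mem_range.mp hj)]
    simp
  have e2 : ∏ j ∈ range p, (if k + (j + 1) < k then a else if k + (j + 1) = k then g
      else d) = d ^ p := by
    rw [prod_congr rfl (g := fun _ => d) fun j hj => by rw [if_neg (by omega), if_neg (by omega)]]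
    simp
  rw [e1, e2]
  simp only [add_zero, lt_irrefl, if_false, if_true]
  ring

lemma list_sum_smul_tensorOp {a d g : ℂ} {A D G : LocOp N} (X : List (Fin L) → Op N L)
    (h0 : X [] = 0) (hX : ∀ i l, X (i :: l) = siteOp i (g • G) *
      (l.map fun j => siteOp j (a • A)).prod + siteOp i (d • D) * X l) :
    X (finRange L).reverse = ∑ i : Fin L, (a ^ (i : ℕ) * g * d ^ (L - 1 - i)) •
      tensorOp fun j => if j < i then A else if j = i then G else D := by
  have e : (finRange L).reverse.toFinset = univ := by ext; simp
  rw [list_sum_tensorOp _ _ _ X h0 hX pairwise_reverse_finRange, e]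
  refine sum_congr rfl fun i _ => ?_
  rw [← prod_ite_lt_ite_eq, ← smul_tensorOp_prod]
  congr 1
  ext1 j
  simp only [List.mem_reverse, List.mem_finRange, if_true]
  split_ifs <;> rfl

lemma infMat_one_zero [NeZero N] {t : ℂ} (ht : t ≠ 0) :
    infMat N L t 1 0 = (t ^ 2 - (t ^ 2)⁻¹) • cInf N L 1 t := by
  have h00 : ∀ l : List (Fin L), (l.map (infSite N L t)).prod 0 0 =
      (l.map fun j => siteOp j (t⁻¹ • kHalf N t 1)).prod ∧ (l.map (infSite N L t)).prod 0 1 = 0 := by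
    intro l
    induction l with
    | nil => simp
    | cons i l ih =>
      simp only [List.map_cons, List.prod_cons, mul_apply, sum_univ_two, ih.1, ih.2]
      constructor
      · rw [← siteHom_apply, map_smul]
        simp [infSite, siteMatInf, locK_topWeight ht]
      · simp [infSite, siteMatInf]
  refine (list_sum_smul_tensorOp (a := t⁻¹) (d := t) (g := t ^ 2 - (t ^ 2)⁻¹) (A := kHalf N t 1)
    (D := kHalf N t (-1)) (G := eHat N t) (fun l => (l.map (infSite N L t)).prod 1 0) (by simp)
    fun i l => ?_).trans ?_
  · simp only [List.map_cons, List.prod_cons, mul_apply, sum_univ_two, (h00 l).1]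
    rw [← siteHom_apply, ← siteHom_apply, map_smul, map_smul]
    simp [infSite, siteMatInf, locK'_topWeight ht, locE_topWeight ht]
  · rw [cInf, smul_sum]
    refine sum_congr rfl fun i _ => ?_
    rw [smul_smul, mul_right_comm, mul_comm]
    congr 2
    rw [inv_pow, ← zpow_natCast, ← zpow_natCast, ← zpow_neg, ← zpow_add₀ ht]
    congr 1; omega

/-- The upper right entry of the monodromy matrix of the homogeneous chain at `0`. -/
lemma homMat_zero_zero_one [NeZero N] {t : ℂ} (ht : t ≠ 0) :
    homMat N L t 0 0 1 = (t ^ 2 - (t ^ 2)⁻¹) • bInf N L 1 t := by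
  set X := chainSite N L t (topWeight N t) (fun _ => 1) (fun _ => 1) 0 with hX
  have h11 : ∀ l : List (Fin L), (l.map X).prod 1 1 =
      (l.map fun j => siteOp j (t • kHalf N t (-1))).prod ∧ (l.map X).prod 1 0 = 0 := by
    intro l
    induction l with
    | nil => simp
    | cons i l ih =>
      simp only [List.map_cons, List.prod_cons, mul_apply, sum_univ_two, ih.1, ih.2]
      constructor
      · rw [← siteHom_apply, map_smul]
        simp [hX, chainSite, siteMat, locK'_topWeight ht]
      · simp [hX, chainSite, siteMat]
  refine (list_sum_smul_tensorOp (a := t) (d := t⁻¹) (g := t ^ 2 - (t ^ 2)⁻¹)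
    (A := kHalf N t (-1)) (D := kHalf N t 1) (G := fHat N t) (fun l => (l.map X).prod 0 1)
    (by simp) fun i l => ?_).trans ?_
  · simp only [List.map_cons, List.prod_cons, mul_apply, sum_univ_two, (h11 l).1]
    rw [← siteHom_apply, ← siteHom_apply, map_smul, map_smul]
    simp [hX, chainSite, siteMat, locK_topWeight ht, add_comm]
  · rw [bInf, smul_sum]
    refine sum_congr rfl fun i _ => ?_
    rw [smul_smul, mul_right_comm, mul_comm]
    congr 2
    rw [inv_pow, ← zpow_natCast, ← zpow_natCast, ← zpow_neg, ← zpow_add₀ ht]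
    congr 1; omega

/-! ### The relations of the homogeneous chain -/

lemma qInt_zero (t : ℂ) : qInt t 0 = 0 := by simp [qInt]

lemma siteRel_homogeneous [NeZero N] {t : ℂ} (ht : t ≠ 0) (ht2 : t ^ 2 - (t ^ 2)⁻¹ ≠ 0) :
    SiteRel t 1 1 (locK N t (topWeight N t)) (locK' N t (topWeight N t))
      (locE N t (topWeight N t) 1 1) (fHat N t) :=
  siteRel_loc N ht ht2 (pow_ne_zero _ ht) 1 1 (by
    have := locCoeff_topWeight (N := N) ht le_rfl
    rw [topWeight] at this
    rw [this, Nat.sub_self, qInt_zero, zero_mul])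

lemma isRTT_homMat [NeZero N] {t : ℂ} (ht : t ≠ 0) (ht2 : t ^ 2 - (t ^ 2)⁻¹ ≠ 0) :
    IsRTT (t ^ 2) (homMat N L t) :=
  isRTT_chainMat ht ht2 (pow_ne_zero _ ht) _ _ fun _ => by
    have := locCoeff_topWeight (N := N) ht le_rfl
    rw [topWeight] at this
    rw [this, Nat.sub_self, qInt_zero, zero_mul]

lemma IsRTT.map {𝒜 ℬ : Type*} [Ring 𝒜] [Algebra ℂ 𝒜] [Ring ℬ] [Algebra ℂ ℬ] (φ : 𝒜 →ₐ[ℂ] ℬ)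
    {q : ℂ} {T : ℂ → M₂ 𝒜} (h : IsRTT q T) :
    IsRTT q fun x => (T x).map φ := fun s u => (h s u).map φ

lemma isRTT_homEnd [NeZero N] {t : ℂ} (ht : t ≠ 0) (ht2 : t ^ 2 - (t ^ 2)⁻¹ ≠ 0) :
    IsRTT (t ^ 2) (homEnd N L t) :=
  (isRTT_homMat ht ht2).map (opEnd N L).toAlgHom

lemma isTriangular_homEnd [NeZero N] (t x : ℂ) : IsTriangular (vac N L) (proj 0)
      ((t⁻¹ * (topWeight N t - x * (topWeight N t)⁻¹)) ^ L)
      ((t * ((topWeight N t)⁻¹ - x * topWeight N t)) ^ L) (homEnd N L t x) := by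
  have h := isTriangular_chainMat (N := N) (L := L) t (topWeight N t) (fun _ => 1) (fun _ => 1) x
  simp only [mul_one, prod_const, card_univ, Fintype.card_fin] at h
  exact h

lemma continuous_homMat (t : ℂ) : Continuous (homMat N L t) := by
  unfold homMat chainMat
  refine continuous_list_prod _ fun i _ => ?_
  refine continuous_matrix fun a b => ?_
  fin_cases a <;> fin_cases b <;> simp [chainSite, siteMat] <;> fun_prop

lemma infSite_eq_map (t : ℂ) (i : Fin L) :
    infSite N L t i = (siteMatInf t (locK N t (topWeight N t)) (locK' N t (topWeight N t))
      (locE N t (topWeight N t) 1 1)).map (siteHom N i) := by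
  refine Matrix.ext fun a b => ?_
  fin_cases a <;> fin_cases b <;> simp [infSite, siteMatInf, -siteHom_apply]

lemma sixVertexRel_infMat [NeZero N] {t : ℂ} (ht : t ≠ 0) (ht2 : t ^ 2 - (t ^ 2)⁻¹ ≠ 0) (u : ℂ) :
    SixVertexRel (-(t ^ 2 * u)) (-(t ^ 2 * u)) (-u) (-u) 0 (-(t ^ 2 - (t ^ 2)⁻¹))
      (infMat N L t) (homMat N L t u) := by
  rw [← intertwines_sixVertex_iff]
  refine intertwines_list_prod _ _ _ (fun i => ?_) (fun i j hij m n m' n' => ?_) _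
    nodup_reverse_finRange
  · rw [intertwines_sixVertex_iff]
    exact ((siteRel_homogeneous ht ht2).map (siteHom N i)).sixVertexRel_inf ht ht2 u
  · rw [chainSite_eq_map, infSite_eq_map]
    exact map_siteHom_commute hij _ _ _ _ _ _

lemma infMat_zero_one (t : ℂ) : infMat N L t 0 1 = 0 := by
  rw [infMat]
  induction (finRange L).reverse with
  | nil => simp
  | cons i l ih =>
    simp [List.map_cons, List.prod_cons, mul_apply, sum_univ_two, ih, infSite, siteMatInf]

lemma eq_of_forall_ne_zero {X Y : ℂ → Op N L} (hX : Continuous X) (hY : Continuous Y)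
    (h : ∀ x, x ≠ 0 → X x = Y x) (x : ℂ) : X x = Y x := by
  have h1 : Dense ({0}ᶜ : Set ℂ) := dense_compl_singleton 0
  exact congrFun (hX.ext_on h1 hY fun x hx => h x hx) x

lemma isTriangular_infMat [NeZero N] (t : ℂ) :
    IsTriangular (vac N L) (proj 0) ((t⁻¹ * topWeight N t) ^ L)
      ((t * (topWeight N t)⁻¹) ^ L) ((infMat N L t).map (opEnd N L)) := by
  have hsite : ∀ i, IsTriangular (vac N L) (proj 0) (t⁻¹ * topWeight N t)
      (t * (topWeight N t)⁻¹) ((infSite N L t i).map (opEnd N L)) := by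
    intro i
    have h0 := isTriangular_chainSite (N := N) t (topWeight N t) (fun _ => 1) (fun _ => 1) 0 i
    have h1 := isTriangular_chainSite (N := N) t (topWeight N t) (fun _ => 1) (fun _ => 1) 1 i
    simp only [zero_mul, sub_zero] at h0
    have e00 : infSite N L t i 0 0 =
        chainSite N L t (topWeight N t) (fun _ => 1) (fun _ => 1) 0 i 0 0 := by
      simp [infSite, siteMatInf, chainSite, siteMat]
    have e11 : infSite N L t i 1 1 =
        chainSite N L t (topWeight N t) (fun _ => 1) (fun _ => 1) 0 i 1 1 := by
      simp [infSite, siteMatInf, chainSite, siteMat]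
    have e10 : infSite N L t i 1 0 =
        chainSite N L t (topWeight N t) (fun _ => 1) (fun _ => 1) 1 i 1 0 := by
      simp [infSite, siteMatInf, chainSite, siteMat]
    have e01 : infSite N L t i 0 1 = 0 := by simp [infSite, siteMatInf]
    constructor
    · rw [map_apply, e00]; exact h0.v00
    · rw [map_apply, e11]; exact h0.v11
    · rw [map_apply, e10]; exact h1.v10
    · rw [map_apply, e00]; exact h0.l00
    · rw [map_apply, e11]; exact h0.l11
    · intro w; rw [map_apply, e01, map_zero]; simp
  have h := isTriangular_list_prod hsite (fun i j hij m n m' n' => by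
      rw [infSite_eq_map, infSite_eq_map]
      exact (map_siteHom_commute hij _ _ m n m' n').map (opEnd N L)) _
    (nodup_reverse_finRange (L := L))
  rw [List.map_const', List.prod_replicate, List.map_const', List.prod_replicate,
    List.length_reverse, List.length_finRange] at h
  rwa [infMat, map_list_prod_opEnd]

lemma isRaising_homEnd [NeZero N] {t : ℂ} (ht : t ≠ 0) (ht2 : t ^ 2 - (t ^ 2)⁻¹ ≠ 0) :
    IsRaising (t ^ 2) (homEnd N L t) (vac N L) (opEnd N L (cInf N L 1 t))
      (opEnd N L (infMat N L t 0 0)) (opEnd N L (infMat N L t 1 1))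
      ((t⁻¹ * topWeight N t) ^ L) ((t * (topWeight N t)⁻¹) ^ L) where
  X₀B x := by
    have hq : t ^ 2 ≠ 0 := pow_ne_zero 2 ht
    have h := eq_of_forall_ne_zero (X := fun x => infMat N L t 0 0 * homMat N L t x 0 1)
      (Y := fun x => (t ^ 2)⁻¹ • (homMat N L t x 0 1 * infMat N L t 0 0))
      (by have := (continuous_homMat (N := N) (L := L) t).matrix_elem 0 1; fun_prop)
      (by have := (continuous_homMat (N := N) (L := L) t).matrix_elem 0 1; fun_prop) (fun x hx => by
        have h1 := (sixVertexRel_infMat (N := N) (L := L) ht ht2 x).r00_01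
        rw [infMat_zero_one, mul_zero, smul_zero, add_zero] at h1
        have h2 := congrArg (fun X => (-(t ^ 2 * x))⁻¹ • X) h1
        simp only [smul_smul] at h2
        rw [inv_mul_cancel₀ (neg_ne_zero.mpr (mul_ne_zero hq hx)), one_smul] at h2
        beta_reduce
        rw [h2]
        congr 1
        field_simp) x
    have := congrArg (opEnd N L) h
    simpa [homEnd] using this
  X₁B x := by
    have h := eq_of_forall_ne_zero (X := fun x => infMat N L t 1 1 * homMat N L t x 0 1)
      (Y := fun x => (t ^ 2) • (homMat N L t x 0 1 * infMat N L t 1 1))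
      (by have := (continuous_homMat (N := N) (L := L) t).matrix_elem 0 1; fun_prop)
      (by have := (continuous_homMat (N := N) (L := L) t).matrix_elem 0 1; fun_prop) (fun x hx => by
        have h1 := (sixVertexRel_infMat (N := N) (L := L) ht ht2 x).r10_11
        rw [infMat_zero_one] at h1
        simp only [zero_mul, smul_zero, add_zero, zero_add] at h1
        have h2 := congrArg (fun X => (-x)⁻¹ • X) h1
        simp only [smul_smul] at h2
        rw [inv_mul_cancel₀ (neg_ne_zero.mpr hx), one_smul] at h2
        beta_reduce
        rw [h2]
        congr 1
        field_simp) x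
    have := congrArg (opEnd N L) h
    simpa [homEnd] using this
  CB x hx := by
    have h1 := (sixVertexRel_infMat (N := N) (L := L) ht ht2 x).r10_01
    rw [infMat_one_zero ht, smul_mul_assoc, mul_smul_comm] at h1
    have h2 : cInf N L 1 t * homMat N L t x 0 1 = homMat N L t x 0 1 * cInf N L 1 t +
        x⁻¹ • (homMat N L t x 0 0 * infMat N L t 1 1 - infMat N L t 0 0 * homMat N L t x 1 1) := by
      apply smul_right_injective _ (mul_ne_zero hx ht2)
      beta_reduce
      rw [smul_add, smul_smul _ x⁻¹, mul_right_comm, mul_inv_cancel₀ hx, one_mul]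
      rw [← sub_eq_zero] at h1 ⊢
      rw [← neg_eq_zero, ← h1]
      module
    have := congrArg (opEnd N L) h2
    simpa [homEnd] using this
  X₀_vac := (isTriangular_infMat t).v00
  X₁_vac := (isTriangular_infMat t).v11
  C_vac := by
    have h := (isTriangular_infMat (N := N) (L := L) t).v10
    rw [map_apply, infMat_one_zero ht, map_smul, LinearMap.smul_apply] at h
    exact (smul_eq_zero.mp h).resolve_left ht2

end HomogeneousChain

/-! ### Powers of a sum of two `q`-commuting families -/

section StringExpansion

variable {𝒜 : Type*} [Ring 𝒜] [Algebra ℂ 𝒜]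

lemma qBin_succ_succ' {q : ℂ} (hq : q ≠ 0) {j n : ℕ} (hn : n < j)
    (hgen : ∀ m, 1 ≤ m → m ≤ j + 1 → qNum q m ≠ 0) :
    q ^ (n + 1) * qBin q j (n + 1) + q⁻¹ ^ (j - n) * qBin q j n = qBin q (j + 1) (n + 1) := by
  obtain ⟨p, rfl⟩ := Nat.exists_eq_add_of_lt hn
  have hF : ∀ m ≤ n + p + 2, qFac q m ≠ 0 := fun m hm =>
    prod_ne_zero_iff.mpr fun i hi => by grind
  have h1 := qBin_mul_qFac hq (n + 1) p
  have h2 := qBin_mul_qFac hq n (p + 1)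
  have h3 := qBin_mul_qFac hq (n + 1) (p + 1)
  have e1 : n + 1 + p = n + p + 1 := by ring
  have e2 : n + (p + 1) = n + p + 1 := by ring
  have e3 : n + 1 + (p + 1) = n + p + 1 + 1 := by ring
  rw [e1] at h1; rw [e2] at h2; rw [e3] at h3
  have h4 : n + p + 1 - n = p + 1 := by omega
  have h5 := qNum_add hq (n + 1) (p + 1)
  rw [e3] at h5
  rw [h4]
  have hX : qFac q (n + 1) * qFac q (p + 1) ≠ 0 := mul_ne_zero (hF _ (by omega)) (hF _ (by omega))
  apply mul_right_cancel₀ hX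
  rw [h3, qFac_succ q (n + p + 1), h5]
  rw [qFac_succ q n] at h1 ⊢
  rw [qFac_succ q p] at h2 ⊢
  rw [inv_pow]
  linear_combination q ^ (n + 1) * qNum q (p + 1) * h1 + (q ^ (p + 1))⁻¹ * qNum q (n + 1) * h2

/-- The product `X(s) X(r s) ⋯ X(r ^ (j - 1) s)`. -/
def geomProd (r : ℂ) (X : ℂ → 𝒜) (j : ℕ) (s : ℂ) : 𝒜 :=
  ((List.range j).map fun i => X (r ^ i * s)).prod

lemma geomProd_succ (r : ℂ) (X : ℂ → 𝒜) (j : ℕ) (s : ℂ) :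
    geomProd r X (j + 1) s = geomProd r X j s * X (r ^ j * s) := by
  rw [geomProd, List.range_succ, List.map_append, List.prod_append, geomProd]
  simp

lemma geomProd_zero (r : ℂ) (X : ℂ → 𝒜) (s : ℂ) : geomProd r X 0 s = 1 := by simp [geomProd]

lemma geomProd_succ' (r : ℂ) (X : ℂ → 𝒜) (j : ℕ) (s : ℂ) :
    geomProd r X (j + 1) s = X s * geomProd r X j (r * s) := by
  rw [geomProd, List.range_succ_eq_map, List.map_cons, List.prod_cons, List.map_map, geomProd]
  simp only [pow_zero, one_mul, Function.comp_def, pow_succ, mul_assoc]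

lemma commute_geomProd {r : ℂ} {X : ℂ → 𝒜} {y : 𝒜} (h : ∀ x, Commute y (X x)) (j : ℕ) (s : ℂ) :
    Commute y (geomProd r X j s) := by
  induction j with
  | zero => rw [geomProd_zero]; exact Commute.one_right y
  | succ j ih => rw [geomProd_succ]; exact ih.mul_right (h _)

/-- The relations between the entries of a site matrix and of the rest of the chain. -/
structure HeadTail (q : ℂ) (k k' f : 𝒜) (B D : ℂ → 𝒜) : Prop where
  kk' : Commute k k'
  kf : k * f = q⁻¹ • (f * k)
  k'f : k' * f = q • (f * k')
  kB : ∀ x, Commute k (B x)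
  k'B : ∀ x, Commute k' (B x)
  fB : ∀ x, Commute f (B x)
  kD : ∀ x, Commute k (D x)
  k'D : ∀ x, Commute k' (D x)
  fD : ∀ x, Commute f (D x)
  DB : ∀ x, D x * B ((q ^ 2)⁻¹ * x) = q • (B x * D ((q ^ 2)⁻¹ * x))

variable {q : ℂ} {k k' f : 𝒜} {B D : ℂ → 𝒜}

lemma HeadTail.geomProd_D_mul_B (h : HeadTail q k k' f B D) (n : ℕ) (s : ℂ) :
    geomProd (q ^ 2)⁻¹ D n s * B ((q ^ 2)⁻¹ ^ n * s) =
      q ^ n • (B s * geomProd (q ^ 2)⁻¹ D n ((q ^ 2)⁻¹ * s)) := by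
  induction n with
  | zero => simp [geomProd_zero]
  | succ n ih =>
    rw [geomProd_succ, mul_assoc, pow_succ' (q ^ 2)⁻¹, mul_assoc (q ^ 2)⁻¹, h.DB, mul_smul_comm,
      ← mul_assoc, ih, geomProd_succ, smul_mul_assoc, smul_smul, mul_assoc, ← pow_succ',
      mul_left_comm ((q ^ 2)⁻¹ ^ n)]

lemma HeadTail.mul_f (h : HeadTail q k k' f B D) (hq : q ≠ 0) (m : ℕ) (s : ℂ) :
    geomProd (q ^ 2)⁻¹ (fun x => k - x • k') m s * f =
      q⁻¹ ^ m • (f * geomProd (q ^ 2)⁻¹ (fun x => k - x • k') m (q ^ 2 * s)) := by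
  have h1 : ∀ x, (k - x • k') * f = q⁻¹ • (f * (k - (q ^ 2 * x) • k')) := by
    intro x
    rw [sub_mul, smul_mul_assoc, h.kf, h.k'f, mul_sub, smul_sub, mul_smul_comm, smul_smul,
      smul_smul]
    grind
  induction m with
  | zero => simp [geomProd_zero]
  | succ m ih =>
    rw [geomProd_succ, mul_assoc, h1, mul_smul_comm, ← mul_assoc, ih, smul_mul_assoc, smul_smul,
      mul_assoc, geomProd_succ, pow_succ' q⁻¹]
    grind

lemma HeadTail.commute_geomProd_A (h : HeadTail q k k' f B D) (x : ℂ) (m : ℕ) (s : ℂ) :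
    Commute (k - x • k') (geomProd (q ^ 2)⁻¹ (fun x => k - x • k') m s) := by
  refine commute_geomProd (fun y => ?_) m s
  have h1 := h.kk'
  refine Commute.sub_left (Commute.sub_right (Commute.refl k) (h1.smul_right _)) ?_
  exact ((h1.symm.sub_right ((Commute.refl k').smul_right _))).smul_left _

/-- A product along a string, with the head of the chain split off. -/
lemma HeadTail.geomProd_eq_sum (h : HeadTail q k k' f B D) (hq : q ≠ 0) (b c : ℂ) (j : ℕ)
    (hgen : ∀ m, 1 ≤ m → m ≤ j → qNum q m ≠ 0) (s : ℂ) :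
    geomProd (q ^ 2)⁻¹ (fun x => (b • (k - x • k')) * B x + (c • f) * D x) j s =
      ∑ n ∈ range (j + 1), (qBin q j n * (c ^ n * b ^ (j - n))) •
        (f ^ n * geomProd (q ^ 2)⁻¹ (fun x => k - x • k') (j - n) s *
          (geomProd (q ^ 2)⁻¹ B (j - n) s * geomProd (q ^ 2)⁻¹ D n ((q ^ 2)⁻¹ ^ (j - n) * s))) := by
  induction j with
  | zero => simp [geomProd_zero, qBin_zero_right]
  | succ j ih =>
    set A : ℂ → 𝒜 := fun x => k - x • k' with hA
    set r : ℂ := (q ^ 2)⁻¹ with hr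
    have hAB : ∀ x y, Commute (A x) (B y) := fun x y =>
      (h.kB y).sub_left ((h.k'B y).smul_left x)
    have hAD : ∀ x y, Commute (A x) (D y) := fun x y =>
      (h.kD y).sub_left ((h.k'D y).smul_left x)
    have hfirst : ∀ n m, (f ^ n * geomProd r A m s * (geomProd r B m s * geomProd r D n (r ^ m * s)))
        * (A (r ^ (n + m) * s) * B (r ^ (n + m) * s)) = q ^ n • (f ^ n * (geomProd r A m s *
          A (r ^ (n + m) * s)) * (geomProd r B (m + 1) s * geomProd r D n (r ^ (m + 1) * s))) := by
      intro n m
      have e1 := h.geomProd_D_mul_B n (r ^ m * s)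
      rw [← mul_assoc, ← mul_assoc, ← pow_add, ← pow_succ'] at e1
      have e2 : Commute (A (r ^ (n + m) * s)) (geomProd r B m s * geomProd r D n (r ^ m * s)) :=
        (commute_geomProd (hAB _) _ _).mul_right (commute_geomProd (hAD _) _ _)
      calc _ = f ^ n * geomProd r A m s * ((geomProd r B m s * geomProd r D n (r ^ m * s)) *
            A (r ^ (n + m) * s)) * B (r ^ (n + m) * s) := by noncomm_ring
        _ = f ^ n * geomProd r A m s * (A (r ^ (n + m) * s) * (geomProd r B m s *
            (geomProd r D n (r ^ m * s) * B (r ^ (n + m) * s)))) := by rw [← e2.eq]; noncomm_ring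
        _ = _ := by
            rw [← hr] at e1
            rw [e1, geomProd_succ r B m]
            simp only [mul_smul_comm, mul_assoc]
    have hsecond : ∀ n m, (f ^ n * geomProd r A m s * (geomProd r B m s *
        geomProd r D n (r ^ m * s))) * (f * D (r ^ (n + m) * s)) =
        q⁻¹ ^ m • (f ^ (n + 1) * geomProd r A m (q ^ 2 * s) *
          (geomProd r B m s * geomProd r D (n + 1) (r ^ m * s))) := by
      intro n m
      have e2 : Commute f (geomProd r B m s * geomProd r D n (r ^ m * s)) :=
        (commute_geomProd h.fB _ _).mul_right (commute_geomProd h.fD _ _)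
      calc _ = f ^ n * geomProd r A m s * ((geomProd r B m s * geomProd r D n (r ^ m * s)) *
            f) * D (r ^ (n + m) * s) := by noncomm_ring
        _ = f ^ n * (geomProd r A m s * f) * (geomProd r B m s * (geomProd r D n (r ^ m * s) *
            D (r ^ (n + m) * s))) := by rw [← e2.eq]; noncomm_ring
        _ = _ := by
            rw [h.mul_f hq, geomProd_succ r D n, ← mul_assoc (r ^ n), ← pow_add, pow_succ f]
            simp only [mul_smul_comm, smul_mul_assoc, mul_assoc]
            rfl
    have hrec : ∀ n p, j = n + 1 + p → (qBin q j (n + 1) * q ^ (n + 1)) • (geomProd r A p s *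
        A (r ^ j * s)) + (qBin q j n * q⁻¹ ^ (p + 1)) • geomProd r A (p + 1) (q ^ 2 * s) =
        qBin q (j + 1) (n + 1) • geomProd r A (p + 1) s := by
      intro n p hj
      have e1 : r * (q ^ 2 * s) = s := by rw [hr, ← mul_assoc, inv_mul_cancel₀ (pow_ne_zero 2 hq), one_mul]
      rw [geomProd_succ' r A p (q ^ 2 * s), e1, (h.commute_geomProd_A (q ^ 2 * s) p s).eq,
        ← mul_smul_comm, ← mul_smul_comm, ← mul_add, geomProd_succ, ← mul_smul_comm]
      congr 1
      have p1 := qBin_succ_succ' hq (j := j) (n := n) (by omega) hgen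
      have p2 := qBin_succ_succ q j n
      have e2 : j - n = p + 1 := by omega
      rw [e2] at p1 p2
      have e3 : (qBin q j (n + 1) * q ^ (n + 1)) * (r ^ j * s) + (qBin q j n * q⁻¹ ^ (p + 1)) *
          (q ^ 2 * s) = qBin q (j + 1) (n + 1) * (r ^ p * s) := by
        rw [p2, hr]
        generalize qBin q j (n + 1) = b1
        generalize qBin q j n = b0
        subst hj
        simp only [pow_add, inv_pow, ← pow_mul]
        field_simp
        ring
      rw [hA]
      simp only [smul_sub, smul_smul]
      rw [← e3, ← p1]
      module
    set first : ℕ → 𝒜 := fun n => (qBin q j n * (c ^ n * b ^ (j + 1 - n)) * q ^ n) • (f ^ n *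
      (geomProd r A (j - n) s * A (r ^ j * s)) * (geomProd r B (j - n + 1) s *
        geomProd r D n (r ^ (j - n + 1) * s))) with hf1
    set second : ℕ → 𝒜 := fun n => (qBin q j n * (c ^ (n + 1) * b ^ (j - n)) * q⁻¹ ^ (j - n)) •
      (f ^ (n + 1) * geomProd r A (j - n) (q ^ 2 * s) *
        (geomProd r B (j - n) s * geomProd r D (n + 1) (r ^ (j - n) * s))) with hf2
    have hsplit : ∀ n ∈ range (j + 1), ((qBin q j n * (c ^ n * b ^ (j - n))) •
        (f ^ n * geomProd r A (j - n) s * (geomProd r B (j - n) s *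
          geomProd r D n (r ^ (j - n) * s)))) * ((b • A (r ^ j * s)) * B (r ^ j * s) +
            (c • f) * D (r ^ j * s)) = first n + second n := by
      intro n hn
      have hnj : n + (j - n) = j := by have := mem_range.mp hn; omega
      have e1 := hfirst n (j - n)
      have e2 := hsecond n (j - n)
      rw [hnj] at e1 e2
      rw [mul_add, smul_mul_assoc b, smul_mul_assoc c, mul_smul_comm, mul_smul_comm,
        smul_mul_assoc, smul_mul_assoc, e1, e2, hf1, hf2]
      have e3 : j + 1 - n = j - n + 1 := by omega
      beta_reduce
      rw [e3]
      simp only [smul_smul]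
      congr 2 <;> ring
    have htarget : ∀ n ∈ range (j + 1), first (n + 1) + second n =
        (qBin q (j + 1) (n + 1) * (c ^ (n + 1) * b ^ (j + 1 - (n + 1)))) •
        (f ^ (n + 1) * geomProd r A (j + 1 - (n + 1)) s * (geomProd r B (j + 1 - (n + 1)) s *
          geomProd r D (n + 1) (r ^ (j + 1 - (n + 1)) * s))) := by
      intro n hn
      rcases (Nat.lt_succ_iff.mp (mem_range.mp hn)).eq_or_lt with hnj | hnj
      · subst hnj
        rw [hf1, hf2]
        beta_reduce
        rw [qBin_eq_zero q (Nat.lt_succ_self n), zero_mul, zero_mul, zero_smul, zero_add,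
          qBin_succ_succ, qBin_eq_zero q (Nat.lt_succ_self n)]
        simp [geomProd_zero]
      · obtain ⟨p, hp⟩ := Nat.exists_eq_add_of_lt hnj
        have hp' : j = n + 1 + p := by omega
        have e1 : j - (n + 1) = p := by omega
        have e2 : j - n = p + 1 := by omega
        have e3 : j + 1 - (n + 1) = p + 1 := by omega
        rw [hf1, hf2]
        beta_reduce
        rw [e1, e2, e3]
        have h1 := congrArg (fun X => (c ^ (n + 1) * b ^ (p + 1)) • (f ^ (n + 1) * X *
          (geomProd r B (p + 1) s * geomProd r D (n + 1) (r ^ (p + 1) * s)))) (hrec n p hp')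
        simp only [mul_add, add_mul, smul_add, mul_smul_comm, smul_mul_assoc, smul_smul] at h1
        grind
    rw [geomProd_succ, ih (fun m h1 h2 => hgen m h1 (by omega)), sum_mul,
      sum_congr rfl hsplit, sum_add_distrib]
    have h0 : first (j + 1) = 0 := by rw [hf1]; simp [qBin_eq_zero q (Nat.lt_succ_self j)]
    have h1 : first 0 = (qBin q (j + 1) 0 * (c ^ 0 * b ^ (j + 1 - 0))) •
        (f ^ 0 * geomProd r A (j + 1 - 0) s * (geomProd r B (j + 1 - 0) s *
          geomProd r D 0 (r ^ (j + 1 - 0) * s))) := by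
      rw [hf1]; simp [qBin_zero_right, geomProd_zero, geomProd_succ]
    conv_rhs => rw [sum_range_succ', ← sum_congr rfl htarget,
      sum_add_distrib, sum_range_succ, h0, ← h1]
    rw [sum_range_succ' first]
    abel

end StringExpansion

/-! ### Convergence of divided powers along strings -/

section DividedPowers

/-- The entries of the matrices `φ t σ` have expansions in `σ` whose coefficients converge
along `l`. -/
def Expandable {n : Type*} (l : Filter ℂ) (φ : ℂ → ℂ → Matrix n n ℂ) : Prop :=
  ∀ a b, ∃ F, ExpandsTo l (fun t σ => φ t σ a b) F

variable {n : Type*} {l : Filter ℂ} {φ ψ : ℂ → ℂ → Matrix n n ℂ}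

lemma Expandable.congr (h : Expandable l φ) (hfg : ∀ᶠ t in l, ∀ σ, φ t σ = ψ t σ) :
    Expandable l ψ := fun a b => by
  obtain ⟨F, hF⟩ := h a b
  exact ⟨F, hF.congr (hfg.mono fun t ht => Eventually.of_forall fun σ => by simp only [ht])⟩

lemma Expandable.add (hφ : Expandable l φ) (hψ : Expandable l ψ) :
    Expandable l fun t σ => φ t σ + ψ t σ := fun a b => by
  obtain ⟨F, hF⟩ := hφ a b
  obtain ⟨G, hG⟩ := hψ a b
  exact ⟨F + G, hF.add hG⟩

lemma expandable_sum {α : Type*} {φ : α → ℂ → ℂ → Matrix n n ℂ} (A : Finset α)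
    (h : ∀ i ∈ A, Expandable l (φ i)) : Expandable l fun t σ => ∑ i ∈ A, φ i t σ := by
  intro a b
  choose! F hF using fun i hi => h i hi a b
  refine ⟨_, (expandsTo_sum A hF).congr (Eventually.of_forall fun t =>
    Eventually.of_forall fun σ => ?_)⟩
  simp only [Matrix.sum_apply]

lemma Expandable.mul [Fintype n] (hφ : Expandable l φ) (hψ : Expandable l ψ) :
    Expandable l fun t σ => φ t σ * ψ t σ := by
  intro a b
  choose F hF using hφ a
  choose G hG using fun k => hψ k b
  exact ⟨_, expandsTo_sum univ fun k _ => (hF k).mul (hG k)⟩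

lemma Expandable.smul (hφ : Expandable l φ) {c : ℂ → ℂ} {c₀ : ℂ} (hc : Tendsto c l (𝓝 c₀)) :
    Expandable l fun t σ => c t • φ t σ := by
  intro a b
  obtain ⟨F, hF⟩ := hφ a b
  exact ⟨_, (expandsTo_of_tendsto hc).mul hF⟩

lemma Expandable.smul_linear (hφ : Expandable l φ) {c : ℂ → ℂ} {c₀ : ℂ}
    (hc : Tendsto c l (𝓝 c₀)) : Expandable l fun t σ => (σ * c t) • φ t σ := by
  intro a b
  obtain ⟨F, hF⟩ := hφ a b
  refine ⟨_, ((expandsTo_monomial 1 hc).mul hF).congr (Eventually.of_forall fun t =>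
    Eventually.of_forall fun σ => ?_)⟩
  simp only [pow_one, Matrix.smul_apply, smul_eq_mul, mul_comm σ]

lemma expandable_of_tendsto {X : ℂ → Matrix n n ℂ} {X₀ : Matrix n n ℂ}
    (h : Tendsto X l (𝓝 X₀)) : Expandable l fun t _ => X t := fun a b =>
  ⟨_, expandsTo_of_tendsto ((continuous_id.matrix_elem a b).tendsto X₀ |>.comp h)⟩

lemma Expandable.dilate (hφ : Expandable l φ) {c : ℂ → ℂ} {c₀ : ℂ} (hc : Tendsto c l (𝓝 c₀)) :
    Expandable l fun t σ => φ t (c t * σ) := by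
  intro a b
  obtain ⟨F, G, h1, h2⟩ := hφ a b
  refine ⟨PowerSeries.rescale c₀ F, fun t => PowerSeries.rescale (c t) (G t), fun k => ?_, ?_⟩
  · simp only [PowerSeries.coeff_rescale]
    exact (hc.pow k).mul (h1 k)
  · filter_upwards [h2] with t ht
    have : Tendsto (fun σ : ℂ => c t * σ) (𝓝 0) (𝓝 0) := by
      have h := (continuous_const_mul (c t)).tendsto (0 : ℂ)
      grind
    filter_upwards [this.eventually ht] with σ hσ
    simpa only [PowerSeries.coeff_rescale, mul_pow, mul_left_comm, mul_assoc] using hσ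

lemma Expandable.geomProd [Fintype n] [DecidableEq n] (hφ : Expandable l φ) {r : ℂ → ℂ} {r₀ : ℂ}
    (hr : Tendsto r l (𝓝 r₀)) (j : ℕ) :
    Expandable l fun t σ => geomProd (r t) (φ t) j σ := by
  induction j with
  | zero =>
    simp only [geomProd_zero]
    exact expandable_of_tendsto tendsto_const_nhds
  | succ j ih =>
    simp only [geomProd_succ]
    exact ih.mul (hφ.dilate (hr.pow j))

/-- A filter along which `q = t ^ 2` tends to a limit through values at which the quantum factorials
do not vanish. -/
structure IsGenericTo (t₀ : ℂ) (l : Filter ℂ) : Prop where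
  le : l ≤ 𝓝 t₀
  ne_zero : t₀ ≠ 0
  sub_ne_zero : t₀ ^ 2 - (t₀ ^ 2)⁻¹ ≠ 0
  ev_ne_zero : ∀ᶠ t in l, t ≠ 0
  ev_sub_ne_zero : ∀ᶠ t : ℂ in l, t ^ 2 - (t ^ 2)⁻¹ ≠ 0
  ev_qNum : ∀ M : ℕ, ∀ᶠ t : ℂ in l, ∀ m, 1 ≤ m → m ≤ M → qNum (t ^ 2) m ≠ 0

variable {t₀ : ℂ} {N L : ℕ}

lemma IsGenericTo.tendsto {α : Type*} [TopologicalSpace α] (h : IsGenericTo t₀ l) {f : ℂ → α}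
    (hf : ContinuousAt f t₀) : Tendsto f l (𝓝 (f t₀)) := hf.tendsto.mono_left h.le

lemma continuousAt_qBin {q₀ : ℂ} (hq : q₀ ≠ 0) : ∀ n a : ℕ, ContinuousAt (fun q => qBin q n a) q₀
  | n, 0 => by simp only [qBin_zero_right]; exact continuousAt_const
  | 0, a + 1 => continuousAt_const
  | n + 1, a + 1 => by
    simp only [qBin_succ_succ]
    exact (((continuousAt_inv₀ hq).pow _).mul (continuousAt_qBin hq n (a + 1))).add
      ((continuousAt_id.pow _).mul (continuousAt_qBin hq n a))

lemma fHat_pow_apply {t : ℂ} (ht : t ≠ 0) (m : ℕ) (τ σ : Fin N)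
    (hgen : ∀ m, 1 ≤ m → m ≤ N → qNum (t ^ 2) m ≠ 0) :
    (fHat N t ^ m) τ σ = if (τ : ℕ) = σ + m then qBin (t ^ 2) τ m * qFac (t ^ 2) m else 0 := by
  have hF : ∀ m ≤ N, qFac (t ^ 2) m ≠ 0 := fun m hm =>
    prod_ne_zero_iff.mpr fun i hi => by grind
  have key : ∀ m (τ σ : Fin N), (fHat N t ^ m) τ σ * qFac (t ^ 2) σ =
      if (τ : ℕ) = σ + m then qFac (t ^ 2) τ else 0 := by
    intro m
    induction m with
    | zero =>
      intro τ σ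
      rw [pow_zero, Matrix.one_apply]
      grind
    | succ m ih =>
      intro τ σ
      rw [pow_succ, mul_apply]
      by_cases hσ : (σ : ℕ) + 1 < N
      · have hf : ∀ b, fHat N t b σ = if (b : ℕ) = σ + 1 then qInt t (σ + 1) else 0 := fun b => rfl
        rw [sum_eq_single ⟨σ + 1, hσ⟩]
        · rw [hf, if_pos rfl, mul_assoc]
          have e : qInt t ((σ : ℕ) + 1) * qFac (t ^ 2) σ = qFac (t ^ 2) (σ + 1) := by
            rw [qFac_succ, ← qInt_eq, mul_comm]
          grind
        · grind
        · simp
      · rw [sum_eq_zero, zero_mul, if_neg (by omega)]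
        intro b _
        rw [fHat, of_apply, if_neg (by omega), mul_zero]
  have h1 := key m τ σ
  have h2 := hF σ σ.2.le
  apply mul_right_cancel₀ h2
  rw [h1]
  split_ifs with h
  · rw [h, add_comm (σ : ℕ), mul_assoc, qBin_mul_qFac (pow_ne_zero 2 ht)]
  · rw [zero_mul]

lemma tendsto_matrix {n m α : Type*} {l : Filter α} {X : α → Matrix n m ℂ} {Y : Matrix n m ℂ}
    (h : ∀ a b, Tendsto (fun t => X t a b) l (𝓝 (Y a b))) : Tendsto X l (𝓝 Y) :=
  tendsto_pi_nhds.mpr fun a => tendsto_pi_nhds.mpr (h a)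

lemma IsGenericTo.tendsto_fHat_pow (h : IsGenericTo t₀ l) (m : ℕ) :
    ∃ X, Tendsto (fun t => (qFac (t ^ 2) m)⁻¹ • fHat N t ^ m) l (𝓝 X) := by
  refine ⟨Matrix.of fun τ σ => if (τ : ℕ) = σ + m then qBin (t₀ ^ 2) τ m else 0, ?_⟩
  refine tendsto_matrix fun τ σ => ?_
  have hc : ContinuousAt (fun t : ℂ => qBin (t ^ 2) τ m) t₀ :=
    ContinuousAt.comp (g := fun q => qBin q τ m) (continuousAt_qBin (pow_ne_zero 2 h.ne_zero) _ _)
      (by fun_prop)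
  have h1 : Tendsto (fun t : ℂ => if (τ : ℕ) = σ + m then qBin (t ^ 2) τ m else 0) l
      (𝓝 (if (τ : ℕ) = σ + m then qBin (t₀ ^ 2) τ m else 0)) := by
    split_ifs
    · exact h.tendsto hc
    · exact tendsto_const_nhds
  refine h1.congr' ?_
  filter_upwards [h.ev_ne_zero, h.ev_qNum (N + m)] with t ht hg
  rw [Matrix.smul_apply, fHat_pow_apply ht m τ σ fun i hi hi' => hg i hi (by omega)]
  have : qFac (t ^ 2) m ≠ 0 := prod_ne_zero_iff.mpr fun i hi => by grind
  split_ifs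
  · rw [smul_eq_mul]; field_simp
  · simp

lemma continuousAt_kHalf {t₀ : ℂ} (h : t₀ ≠ 0) (p : ℤ) : ContinuousAt (fun t => kHalf N t p) t₀ := by
  have h1 : ∀ σ : Fin N, ContinuousAt (fun t : ℂ => t ^ (p * ((N : ℤ) - 1 - 2 * ((σ : ℕ) : ℤ)))) t₀ :=
    fun σ => continuousAt_zpow₀ _ _ (Or.inl h)
  exact (Continuous.matrix_diagonal continuous_id).continuousAt.comp
    (f := fun t (σ : Fin N) => t ^ (p * ((N : ℤ) - 1 - 2 * ((σ : ℕ) : ℤ))))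
    (continuousAt_pi.mpr h1)

lemma Expandable.siteOp {φ : ℂ → ℂ → LocOp N} (h : Expandable l φ) (i : Fin L) :
    Expandable l fun t σ => siteOp i (φ t σ) := by
  intro a b
  obtain ⟨F, hF⟩ := h (a i) (b i)
  refine ⟨_, (hF.mul (expandsTo_of_tendsto (tendsto_const_nhds (x := ∏ j ∈ univ.erase i,
    (1 : LocOp N) (a j) (b j))))).congr (Eventually.of_forall fun t =>
      Eventually.of_forall fun σ => ?_)⟩
  simp only [siteOp_apply]

/-! ### The strings of the homogeneous chain -/

lemma commute_list_prod_entries {𝒜 α : Type*} [Ring 𝒜] {X : α → M₂ 𝒜} {y : 𝒜}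
    {l : List α} (h : ∀ i ∈ l, ∀ a b, Commute y (X i a b)) (a b : Fin 2) :
    Commute y ((l.map X).prod a b) := by
  induction l generalizing a b with
  | nil => rw [List.map_nil, List.prod_nil, Matrix.one_apply]; split_ifs <;> simp
  | cons i l ih =>
    rw [List.map_cons, List.prod_cons, mul_apply]
    exact Commute.sum_right _ _ _ fun k _ => (h i (by simp) a k).mul_right
      (ih (fun j hj => h j (by simp [hj])) k b)

variable (N L)

/-- The site matrix of the homogeneous chain. -/
def homSite (t x : ℂ) (i : Fin L) : M₂ (Op N L) :=
  chainSite N L t (topWeight N t) (fun _ => 1) (fun _ => 1) x i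

/-- The monodromy matrix of a part of the homogeneous chain. -/
def subMat (t : ℂ) (s : List (Fin L)) (x : ℂ) : M₂ (Op N L) := (s.map (homSite N L t x)).prod

variable {N L}

lemma continuous_subMat (t : ℂ) (s : List (Fin L)) : Continuous (subMat N L t s) := by
  refine continuous_list_prod _ fun i _ => ?_
  refine continuous_matrix fun a b => ?_
  fin_cases a <;> fin_cases b <;> simp [homSite, chainSite, siteMat] <;> fun_prop

lemma isRTT_subMat [NeZero N] {t : ℂ} (ht : t ≠ 0) (ht2 : t ^ 2 - (t ^ 2)⁻¹ ≠ 0) {s : List (Fin L)}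
    (hs : s.Nodup) : IsRTT (t ^ 2) (subMat N L t s) := by
  intro x u
  rw [← intertwines_sixVertex_iff]
  refine intertwines_list_prod _ _ _ (fun i => ?_) (fun i j hij m n m' n' => ?_) _ hs
  · rw [intertwines_sixVertex_iff]
    exact ((siteRel_homogeneous ht ht2).map (siteHom N i)).sixVertexRel ht ht2 x u
  · rw [homSite, homSite, chainSite_eq_map, chainSite_eq_map]
    exact map_siteHom_commute hij _ _ _ _ _ _

lemma headTail [NeZero N] {t : ℂ} (ht : t ≠ 0) (ht2 : t ^ 2 - (t ^ 2)⁻¹ ≠ 0) {i : Fin L}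
    {s : List (Fin L)} (hs : (i :: s).Nodup) :
    HeadTail (t ^ 2) (siteHom N i (locK N t (topWeight N t)))
      (siteHom N i (locK' N t (topWeight N t))) (siteHom N i (fHat N t))
      (fun x => subMat N L t s x 0 1) (fun x => subMat N L t s x 1 1) := by
  rw [nodup_cons] at hs
  have hR := (siteRel_homogeneous (N := N) ht ht2).map (siteHom N i)
  have hc : ∀ (X : LocOp N) (x : ℂ) (a b : Fin 2), Commute (siteHom N i X) (subMat N L t s x a b) := by
    intro X x a b
    refine commute_list_prod_entries (fun j hj a b => ?_) a b
    rw [homSite, chainSite_eq_map]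
    exact siteOp_commute (fun h => hs.1 (by rwa [h])) _ _
  refine ⟨?_, hR.kf, hR.k'f, fun x => hc _ _ _ _, fun x => hc _ _ _ _, fun x => hc _ _ _ _,
    fun x => hc _ _ _ _, fun x => hc _ _ _ _, fun x => hc _ _ _ _, ?_⟩
  · exact hR.kk'.trans hR.k'k.symm
  · have hq : t ^ 2 ≠ 0 := pow_ne_zero 2 ht
    set q := t ^ 2 with hqt
    refine eq_of_forall_ne_zero ?_ ?_ fun x hx => ?_
    · have h0 := (continuous_subMat (N := N) t s).matrix_elem 1 1
      have h1 := (continuous_subMat (N := N) t s).matrix_elem 0 1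
      fun_prop
    · have h0 := (continuous_subMat (N := N) t s).matrix_elem 1 1
      have h1 := (continuous_subMat (N := N) t s).matrix_elem 0 1
      fun_prop
    · have h := (isRTT_subMat (N := N) ht ht2 hs.2 x ((q ^ 2)⁻¹ * x)).r10_11
      rw [← hqt] at h
      have e1 : q⁻¹ * x - q * ((q ^ 2)⁻¹ * x) = 0 := by field_simp; ring
      have e2 : x - (q ^ 2)⁻¹ * x ≠ 0 := by grind
      rw [e1, zero_smul] at h
      have e3 : -((q - q⁻¹) * x) = -(q * (x - (q ^ 2)⁻¹ * x)) := by field_simp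
      rw [e3, neg_smul, mul_comm q, mul_smul, ← sub_eq_add_neg, ← smul_sub] at h
      exact sub_eq_zero.mp ((smul_eq_zero.mp h).resolve_left e2)

lemma IsGenericTo.expandable_locK [NeZero N] (h : IsGenericTo t₀ l) (i : Fin L) :
    Expandable l fun t _ => siteHom N i (locK N t (topWeight N t)) := by
  simp only [siteHom_apply]
  refine Expandable.congr (Expandable.siteOp (expandable_of_tendsto
    (h.tendsto (continuousAt_kHalf (N := N) h.ne_zero 1))) i) ?_
  filter_upwards [h.ev_ne_zero] with t ht σ
  rw [locK_topWeight ht]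

lemma IsGenericTo.expandable_locK' [NeZero N] (h : IsGenericTo t₀ l) (i : Fin L) :
    Expandable l fun t _ => siteHom N i (locK' N t (topWeight N t)) := by
  simp only [siteHom_apply]
  refine Expandable.congr (Expandable.siteOp (expandable_of_tendsto
    (h.tendsto (continuousAt_kHalf (N := N) h.ne_zero (-1)))) i) ?_
  filter_upwards [h.ev_ne_zero] with t ht σ
  rw [locK'_topWeight ht]

lemma continuousAt_qInt {t₀ : ℂ} (h : t₀ ≠ 0) (h2 : t₀ ^ 2 - (t₀ ^ 2)⁻¹ ≠ 0) (m : ℕ) :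
    ContinuousAt (fun t => qInt t m) t₀ := by
  have h3 : t₀ ^ 2 ≠ 0 := pow_ne_zero 2 h
  have h4 : (t₀ ^ 2) ^ m ≠ 0 := pow_ne_zero m h3
  unfold qInt
  fun_prop (disch := assumption)

lemma continuousAt_eHat {t₀ : ℂ} (h : t₀ ≠ 0) (h2 : t₀ ^ 2 - (t₀ ^ 2)⁻¹ ≠ 0) :
    ContinuousAt (fun t => eHat N t) t₀ := by
  refine tendsto_matrix fun τ σ => ?_
  simp only [eHat, of_apply]
  split_ifs
  · exact continuousAt_qInt h h2 _
  · exact tendsto_const_nhds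

lemma continuousAt_fHat {t₀ : ℂ} (h : t₀ ≠ 0) (h2 : t₀ ^ 2 - (t₀ ^ 2)⁻¹ ≠ 0) :
    ContinuousAt (fun t => fHat N t) t₀ := by
  refine tendsto_matrix fun τ σ => ?_
  simp only [fHat, of_apply]
  split_ifs
  · exact continuousAt_qInt h h2 _
  · exact tendsto_const_nhds

lemma IsGenericTo.tendsto_sub (h : IsGenericTo t₀ l) :
    Tendsto (fun t : ℂ => t ^ 2 - (t ^ 2)⁻¹) l (𝓝 (t₀ ^ 2 - (t₀ ^ 2)⁻¹)) := by
  have h3 : t₀ ^ 2 ≠ 0 := pow_ne_zero 2 h.ne_zero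
  exact h.tendsto (f := fun t : ℂ => t ^ 2 - (t ^ 2)⁻¹) (by fun_prop (disch := assumption))

lemma IsGenericTo.tendsto_id (h : IsGenericTo t₀ l) : Tendsto (fun t : ℂ => t) l (𝓝 t₀) :=
  h.tendsto continuousAt_id

lemma IsGenericTo.expandable_homSite [NeZero N] (h : IsGenericTo t₀ l) (i : Fin L) (a b : Fin 2) :
    Expandable l fun t σ => homSite N L t σ i a b := by
  have hk := h.expandable_locK (N := N) i
  have hk' := h.expandable_locK' (N := N) i
  have hinv : Tendsto (fun t : ℂ => t⁻¹) l (𝓝 t₀⁻¹) := h.tendsto (continuousAt_inv₀ h.ne_zero)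
  have hneg : Tendsto (fun _ : ℂ => (-1 : ℂ)) l (𝓝 (-1)) := tendsto_const_nhds
  fin_cases a <;> fin_cases b
  · exact ((hk.add (hk'.smul_linear hneg)).smul hinv).congr (Eventually.of_forall fun t σ => by
      simp [homSite, chainSite, siteMat, sub_eq_add_neg])
  · exact (((expandable_of_tendsto (h.tendsto (continuousAt_fHat (N := N) h.ne_zero
      h.sub_ne_zero))).siteOp i).smul h.tendsto_sub).congr (Eventually.of_forall fun t σ => by
      simp [homSite, chainSite, siteMat])
  · refine (((expandable_of_tendsto (h.tendsto (continuousAt_eHat (N := N) h.ne_zero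
      h.sub_ne_zero))).siteOp i).smul_linear h.tendsto_sub).congr ?_
    filter_upwards [h.ev_ne_zero] with t ht σ
    simp [homSite, chainSite, siteMat, locE_topWeight ht]
  · exact ((hk'.add (hk.smul_linear hneg)).smul h.tendsto_id).congr (Eventually.of_forall fun t σ => by
      simp [homSite, chainSite, siteMat, sub_eq_add_neg])

lemma expandable_one {n : Type*} [Fintype n] [DecidableEq n] {l : Filter ℂ} :
    Expandable l fun _ _ => (1 : Matrix n n ℂ) := expandable_of_tendsto tendsto_const_nhds

lemma expandable_zero {n : Type*} {l : Filter ℂ} :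
    Expandable l fun _ _ => (0 : Matrix n n ℂ) := expandable_of_tendsto tendsto_const_nhds

lemma IsGenericTo.expandable_subMat [NeZero N] (h : IsGenericTo t₀ l) (s : List (Fin L))
    (a b : Fin 2) : Expandable l fun t σ => subMat N L t s σ a b := by
  induction s generalizing a b with
  | nil =>
    simp only [subMat, List.map_nil, List.prod_nil, Matrix.one_apply]
    split_ifs
    · exact expandable_one
    · exact expandable_zero
  | cons i s ih =>
    simp only [subMat, List.map_cons, List.prod_cons, mul_apply]
    exact expandable_sum _ fun k _ => (h.expandable_homSite i a k).mul (ih k b)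

/-- The divided powers along strings of the upper right entry of the monodromy matrix. -/
lemma IsGenericTo.expandable_string [NeZero N] (h : IsGenericTo t₀ l) {s : List (Fin L)}
    (hs : s.Nodup) (j : ℕ) : Expandable l fun t σ => (qFac (t ^ 2) j)⁻¹ •
      geomProd ((t ^ 2) ^ 2)⁻¹ (fun x => subMat N L t s x 0 1) j σ := by
  have hr : Tendsto (fun t : ℂ => ((t ^ 2) ^ 2)⁻¹) l (𝓝 ((t₀ ^ 2) ^ 2)⁻¹) := by
    have h3 : (t₀ ^ 2) ^ 2 ≠ 0 := pow_ne_zero 2 (pow_ne_zero 2 h.ne_zero)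
    exact h.tendsto (f := fun t : ℂ => ((t ^ 2) ^ 2)⁻¹) (by fun_prop (disch := assumption))
  have hinv : Tendsto (fun t : ℂ => t⁻¹) l (𝓝 t₀⁻¹) := h.tendsto (continuousAt_inv₀ h.ne_zero)
  have hneg : Tendsto (fun _ : ℂ => (-1 : ℂ)) l (𝓝 (-1)) := tendsto_const_nhds
  induction s generalizing j with
  | nil =>
    cases j with
    | zero => simpa [geomProd_zero, qFac_zero] using expandable_one
    | succ j => simpa [geomProd_succ, subMat] using expandable_zero
  | cons i s ih =>
    have hA := ((h.expandable_locK (N := N) i).add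
      ((h.expandable_locK' (N := N) i).smul_linear hneg)).geomProd hr
    have hD := (h.expandable_subMat (N := N) s 1 1).geomProd hr
    have hf : ∀ m, Expandable l fun t _ => siteHom N i ((qFac (t ^ 2) m)⁻¹ • fHat N t ^ m) := by
      intro m
      obtain ⟨X, hX⟩ := h.tendsto_fHat_pow (N := N) m
      exact (expandable_of_tendsto hX).siteOp i
    refine (expandable_sum (range (j + 1)) fun n _ => ((((hf n).mul (hA (j - n))).mul
      ((ih (nodup_cons.mp hs).2 (j - n)).mul ((hD n).dilate (hr.pow (j - n))))).smul
      ((h.tendsto_sub.pow n).mul (hinv.pow (j - n))))).congr ?_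
    filter_upwards [h.ev_ne_zero, h.ev_sub_ne_zero, h.ev_qNum j] with t ht ht2 hq σ
    have hF : ∀ m ≤ j, qFac (t ^ 2) m ≠ 0 := fun m hm =>
      prod_ne_zero_iff.mpr fun i hi => by grind
    have e := (headTail (N := N) ht ht2 hs).geomProd_eq_sum (pow_ne_zero 2 ht) t⁻¹
      (t ^ 2 - (t ^ 2)⁻¹) j hq σ
    have e2 : (fun x => subMat N L t (i :: s) x 0 1) = fun x =>
        (t⁻¹ • (siteHom N i (locK N t (topWeight N t)) -
          x • siteHom N i (locK' N t (topWeight N t)))) * subMat N L t s x 0 1 +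
        ((t ^ 2 - (t ^ 2)⁻¹) • siteHom N i (fHat N t)) * subMat N L t s x 1 1 := by
      ext1 x
      simp [subMat, mul_apply, sum_univ_two, homSite, chainSite, siteMat, -siteHom_apply]
    rw [e2, e, smul_sum]
    refine sum_congr rfl fun n hn => ?_
    have hnj : n + (j - n) = j := by have := mem_range.mp hn; omega
    have e3 := qBin_mul_qFac (pow_ne_zero 2 ht) n (j - n)
    rw [hnj] at e3
    simp only [map_smul, map_pow, smul_mul_assoc, mul_smul_comm, smul_smul, mul_neg, mul_one,
      neg_smul, ← sub_eq_add_neg]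
    grind

end DividedPowers

/-! ### Divided powers on solutions of the Bethe equations -/

section OnShell

lemma ExpandsTo.mono {l l' : Filter ℂ} {φ : ℂ → ℂ → ℂ} {F : PowerSeries ℂ} (h : ExpandsTo l φ F)
    (hl : l' ≤ l) : ExpandsTo l' φ F := by
  obtain ⟨G, h1, h2⟩ := h
  exact ⟨G, fun k => (h1 k).mono_left hl, hl h2⟩

lemma ExpandsTo.expands {t₀ : ℂ} {φ : ℂ → ℂ → ℂ} {F : PowerSeries ℂ}
    (h : ExpandsTo (𝓝 t₀) φ F) : Expands (φ t₀) F := by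
  obtain ⟨G, h1, h2⟩ := h
  have : G t₀ = F := by
    ext k
    exact eq_of_tendsto_nhds (f := fun t => PowerSeries.coeff k (G t)) (h1 k)
  exact this ▸ h2.self_of_nhds

lemma Expands.sum {α : Type*} {f : α → ℂ → ℂ} {F : α → PowerSeries ℂ} (A : Finset α)
    (h : ∀ i ∈ A, Expands (f i) (F i)) : Expands (fun σ => ∑ i ∈ A, f i σ) (∑ i ∈ A, F i) := by
  classical
  induction A using Finset.induction_on with
  | empty => simpa using expands_const 0
  | insert a A ha ih =>
    simp only [sum_insert ha]
    exact (h a (mem_insert_self a A)).add (ih fun i hi => h i (mem_insert_of_mem hi))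

/-- The weight function of the homogeneous chain. -/
def chainWeight (N L : ℕ) (t x : ℂ) : ℂ := (1 - (t ^ 2) ^ (N - 1) * x) ^ L

variable {N L R : ℕ} {t₀ : ℂ}

lemma exists_expandsTo_linear_pow {l : Filter ℂ} {c : ℂ → ℂ} {c₀ : ℂ} (h : Tendsto c l (𝓝 c₀))
    (L : ℕ) : ∃ F, ExpandsTo l (fun t σ => (1 - c t * σ) ^ L) F := by
  have := expandsTo_prod (range L) fun _ _ => expandsTo_linear h
  simp only [prod_const, card_range] at this
  exact ⟨_, this⟩

lemma exists_expandsTo_geometric_pow {l : Filter ℂ} {c : ℂ → ℂ} {c₀ : ℂ} (h : Tendsto c l (𝓝 c₀))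
    (L : ℕ) : ∃ F, ExpandsTo l (fun t σ => ((1 - c t * σ) ^ L)⁻¹) F := by
  have := expandsTo_prod (range L) fun _ _ => expandsTo_geometric h
  simp only [prod_const, card_range, ← inv_pow] at this ⊢
  exact ⟨_, this⟩

lemma exists_expandsTo_stringTerm (ht : t₀ ≠ 0) (s : Fin R → ℂ) (m : ℕ) (Z U U₁ : Finset (Fin R)) :
    ∃ F, ExpandsTo (𝓝 t₀)
      (fun t σ => stringTerm (t ^ 2) s (chainWeight N L t) (N - 1) m Z U U₁ σ) F := by
  have hq : t₀ ^ 2 ≠ 0 := pow_ne_zero 2 ht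
  have hq2 : (t₀ ^ 2) ^ 2 ≠ 0 := pow_ne_zero 2 hq
  have hcw : ∀ i : ℕ, Tendsto (fun t : ℂ => (t ^ 2) ^ (N - 1) * ((t ^ 2) ^ 2)⁻¹ ^ i) (𝓝 t₀)
      (𝓝 ((t₀ ^ 2) ^ (N - 1) * ((t₀ ^ 2) ^ 2)⁻¹ ^ i)) := fun i =>
    ContinuousAt.tendsto (f := fun t : ℂ => (t ^ 2) ^ (N - 1) * ((t ^ 2) ^ 2)⁻¹ ^ i)
      (by fun_prop (disch := assumption))
  have hcs : ∀ i l : ℕ, ∀ z : ℂ, Tendsto (fun t : ℂ => (t ^ 2) ^ 2 * ((t ^ 2) ^ 2)⁻¹ ^ l * z⁻¹)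
      (𝓝 t₀) (𝓝 ((t₀ ^ 2) ^ 2 * ((t₀ ^ 2) ^ 2)⁻¹ ^ l * z⁻¹)) := fun i l z =>
    ContinuousAt.tendsto (f := fun t : ℂ => (t ^ 2) ^ 2 * ((t ^ 2) ^ 2)⁻¹ ^ l * z⁻¹)
      (by fun_prop (disch := assumption))
  have hs : ∀ (l : ℕ) (z : ℂ), ExpandsTo (𝓝 t₀) (fun t σ => (strFac (t ^ 2) σ z l)⁻¹) _ :=
    fun l z => (expandsTo_geometric (hcs 0 l z)).congr (Eventually.of_forall fun t =>
      Eventually.of_forall fun σ => by simp only [strFac]; congr 2; ring)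
  choose Fw hFw using fun i => exists_expandsTo_linear_pow (hcw i) L
  choose Fg hFg using fun i => exists_expandsTo_geometric_pow (hcw i) L
  have h1 := expandsTo_prod (range (N - 1)) fun i _ => hFw i
  have h2 := expandsTo_prod (range #U) fun i _ => hFg i
  have h3 := expandsTo_prod (Z \ U) fun i _ => (hs (#U + 1) (s i)).mul (hs 0 (s i))
  have hc : ∀ f : ℂ → ℂ, ContinuousAt f t₀ → ExpandsTo (𝓝 t₀) (fun t _ => f t) _ :=
    fun f hf => expandsTo_of_tendsto hf.tendsto
  have hfD : ∀ a b : ℂ, ContinuousAt (fun t : ℂ => fD (t ^ 2) a b) t₀ := fun a b =>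
    ContinuousAt.comp (g := fun q => fD q a b) (continuousAt_fD hq a b) (by fun_prop)
  have hu := expandsTo_prod (U \ U₁) fun i _ => (hc (fun t => (chainWeight N L t
      (((t ^ 2) ^ 2)⁻¹ ^ (N - 1) * s i) / s i * ∏ k ∈ Z \ U, (t ^ 2 * fD (t ^ 2) (s k) (s i))) *
      (t ^ 2) ^ (m + #U)) (by
        unfold chainWeight
        fun_prop (disch := assumption))).mul (hs 1 (s i))
  have hv := expandsTo_prod U₁ fun i _ => (hc (fun t => (chainWeight N L t
      (s i) / s i * ∏ k ∈ Z \ U, ((t ^ 2)⁻¹ * fD (t ^ 2) (s i) (s k))) *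
      (t ^ 2)⁻¹ ^ (m + #U)) (by
        unfold chainWeight
        fun_prop (disch := assumption))).mul (hs #U (s i))
  have hk := hc (fun t => (-1) ^ #U₁ * ((t ^ 2) ^ (U \ U₁).card.choose 2 *
      (t ^ 2)⁻¹ ^ (#U₁).choose 2) * ∏ i ∈ U₁, ∏ k ∈ U \ U₁, fD (t ^ 2) (s i) (s k)) (by
        fun_prop (disch := assumption))
  refine ⟨_, (((h1.mul h2).mul h3).mul ((hv.mul hu).mul hk)).congr
    (Eventually.of_forall fun t => Eventually.of_forall fun σ => ?_)⟩
  simp only [stringTerm, splitTerm, chainWeight, mul_assoc, prod_inv_distrib, div_eq_mul_inv,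
    mul_inv]
  ring

/-- Regular solutions of the Bethe equations in the inverse squares of the spectral parameters. -/
structure IsBetheRoots (N L : ℕ) (t : ℂ) (s : Fin R → ℂ) : Prop where
  ne_zero : ∀ i, s i ≠ 0
  injective : Injective s
  regular : ∀ i k, i ≠ k → t ^ 2 * s k - (t ^ 2)⁻¹ * s i ≠ 0
  bethe : ∀ i, chainWeight N L t (s i) / s i *
      ∏ k ∈ univ.erase i, ((t ^ 2)⁻¹ * fD (t ^ 2) (s i) (s k)) =
    (t ^ 2) ^ 2 * (chainWeight N L t (((t ^ 2) ^ 2)⁻¹ ^ (N - 1) * s i) / s i *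
      ∏ k ∈ univ.erase i, (t ^ 2 * fD (t ^ 2) (s k) (s i)))

lemma eventually_strFac_ne_zero (q z : ℂ) (l : ℕ) : ∀ᶠ σ in 𝓝 (0 : ℂ), strFac q σ z l ≠ 0 :=
  (continuousAt_strFac q z l).eventually_ne (by rw [strFac_zero_left]; exact one_ne_zero)

/-- On a solution of the Bethe equations the nontrivial contributions cancel. -/
lemma IsBetheRoots.sum_stringTerm_eq_zero {s : Fin R → ℂ} (hs : IsBetheRoots N L t₀ s)
    (ht : t₀ ≠ 0) {m : ℕ} (hm : (t₀ ^ 2) ^ m = 1) {U : Finset (Fin R)} (hU : U.Nonempty) :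
    ∀ᶠ σ in 𝓝 (0 : ℂ), ∑ U₁ ∈ U.powerset,
      stringTerm (t₀ ^ 2) s (chainWeight N L t₀) (N - 1) m univ U U₁ σ = 0 := by
  have hq : t₀ ^ 2 ≠ 0 := pow_ne_zero 2 ht
  have h1 : ∀ l, ∀ᶠ σ in 𝓝 (0 : ℂ), ∀ i, strFac (t₀ ^ 2) σ (s i) l ≠ 0 := fun l => by
    rw [eventually_all]; exact fun i => eventually_strFac_ne_zero _ _ _
  obtain ⟨j, hj⟩ : ∃ j, #U = j + 1 := ⟨#U - 1, by have := hU.card_pos; omega⟩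
  filter_upwards [h1 1, h1 (j + 1)] with σ hσ1 hσ2
  simp only [stringTerm]
  rw [← mul_sum]
  apply mul_eq_zero_of_right
  have e1 : ∀ i, strFac (t₀ ^ 2) σ (s i) 1 = 1 - σ * (s i)⁻¹ := fun i => by
    rw [strFac_succ hq, pow_zero, one_mul]
  have e2 : ∀ i, strFac (t₀ ^ 2) σ (s i) (j + 1) =
      1 - (t₀ ^ 2)⁻¹ ^ (2 * (j + 1 - 1)) * σ * (s i)⁻¹ := fun i => by
    rw [strFac_succ hq, ← inv_pow, ← pow_mul]; rfl
  have h := splitSum_bethe_eq_zero (Z := univ) hq (subset_univ U) hU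
    hs.injective.injOn (fun i _ => hs.ne_zero i) (fun i _ k _ hik => hs.regular i k hik)
    (fun i _ => hs.bethe i) (σ := σ) (fun i _ => by
      rw [hj]; exact ⟨by rw [← e1]; exact hσ1 i, by rw [← e2]; exact hσ2 i⟩)
  rw [splitSum, hj] at h
  rw [← h, hj]
  refine sum_congr rfl fun U₁ _ => ?_
  have hm' : (t₀ ^ 2)⁻¹ ^ m = 1 := by rw [inv_pow, hm, inv_one]
  simp only [e1, e2, pow_add _ m, hm, hm', one_mul]

/-- The off-shell Bethe vector of the homogeneous chain. -/
def offShell (N L : ℕ) (t : ℂ) (s : Fin R → ℂ) (W : Finset (Fin R)) : Conf N L → ℂ :=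
  ((W.toList.map fun i => homMat N L t (s i) 0 1).prod).mulVec (vac N L)

lemma opEnd_list_prod (l : List (Op N L)) : opEnd N L l.prod = (l.map (opEnd N L)).prod :=
  map_list_prod _ _

lemma bvec_eq_offShell [NeZero N] {t : ℂ} {hq : t ^ 2 ≠ 0} {hq4 : (t ^ 2) ^ 4 ≠ 1}
    {hT : IsRTT (t ^ 2) (homEnd N L t)} {ℓ : Dual ℂ (Conf N L → ℂ)} {a d : ℂ → ℂ}
    {htri : ∀ x, IsTriangular (vac N L) ℓ (a x) (d x) (homEnd N L t x)} {hv : ℓ (vac N L) = 1}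
    {s : Fin R → ℂ} {hs : ∀ i, s i ≠ 0} (W : Finset (Fin R)) :
    (ExchangeSystem.ofRTT hq hq4 hT htri hv s hs).bvec W = offShell N L t s W := by
  have h := (ExchangeSystem.ofRTT hq hq4 hT htri hv s hs).list_prod_B_vac W.nodup_toList
  rw [toList_toFinset] at h
  rw [← h, offShell, ← opEnd_apply, opEnd_list_prod, List.map_map]
  rfl

lemma continuousAt_homSite [NeZero N] (ht : t₀ ≠ 0) (h2 : t₀ ^ 2 - (t₀ ^ 2)⁻¹ ≠ 0) (x : ℂ)
    (i : Fin L) : ContinuousAt (fun t => homSite N L t x i) t₀ := by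
  have h0 : t₀ ^ 2 ≠ 0 := pow_ne_zero 2 ht
  have h1 : t₀ ^ (N - 1) ≠ 0 := pow_ne_zero _ ht
  have hc : Continuous (siteHom N i) := (siteHom N i).toLinearMap.continuous_of_finiteDimensional
  have hk : ContinuousAt (fun t => locK N t (topWeight N t)) t₀ := by
    refine tendsto_matrix fun a b => ?_
    simp only [locK, topWeight, diagonal_apply]
    split_ifs
    · exact ContinuousAt.tendsto (f := fun t : ℂ => t ^ (N - 1) * (t ^ 2)⁻¹ ^ (a : ℕ))
        (by fun_prop (disch := assumption))
    · exact tendsto_const_nhds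
  have hk' : ContinuousAt (fun t => locK' N t (topWeight N t)) t₀ := by
    refine tendsto_matrix fun a b => ?_
    simp only [locK', topWeight, diagonal_apply]
    split_ifs
    · exact ContinuousAt.tendsto (f := fun t : ℂ => (t ^ (N - 1))⁻¹ * (t ^ 2) ^ (a : ℕ))
        (by fun_prop (disch := assumption))
    · exact tendsto_const_nhds
  have he : ContinuousAt (fun t => locE N t (topWeight N t) 1 1) t₀ :=
    (continuousAt_eHat ht h2).congr (by
      filter_upwards [eventually_ne_nhds ht] with t h using (locE_topWeight h).symm)
  have hk2 := hc.continuousAt.comp hk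
  have hk2' := hc.continuousAt.comp hk'
  have he2 := hc.continuousAt.comp he
  have hf2 := hc.continuousAt.comp (continuousAt_fHat (N := N) ht h2)
  simp only [Function.comp_def] at hk2 hk2' he2 hf2
  refine tendsto_pi_nhds.mpr fun a => tendsto_pi_nhds.mpr fun b => ?_
  fin_cases a <;> fin_cases b <;>
    simp only [homSite, chainSite, siteMat, Fin.zero_eta, Fin.mk_one, of_apply,
      cons_val', cons_val_zero, cons_val_one, cons_val_fin_one]
  · exact ContinuousAt.tendsto (f := fun t : ℂ => t⁻¹ • (siteHom N i (locK N t (topWeight N t)) -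
      (x * 1) • siteHom N i (locK' N t (topWeight N t)))) (by fun_prop (disch := assumption))
  · exact ContinuousAt.tendsto (f := fun t : ℂ => (t ^ 2 - (t ^ 2)⁻¹) • siteHom N i (fHat N t))
      (by fun_prop (disch := assumption))
  · exact ContinuousAt.tendsto (f := fun t : ℂ => (x * (t ^ 2 - (t ^ 2)⁻¹)) •
      siteHom N i (locE N t (topWeight N t) 1 1)) (by fun_prop (disch := assumption))
  · exact ContinuousAt.tendsto (f := fun t : ℂ => t • (siteHom N i (locK' N t (topWeight N t)) -
      (x * 1) • siteHom N i (locK N t (topWeight N t)))) (by fun_prop (disch := assumption))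

lemma continuousAt_homMat [NeZero N] (ht : t₀ ≠ 0) (h2 : t₀ ^ 2 - (t₀ ^ 2)⁻¹ ≠ 0) (x : ℂ) :
    ContinuousAt (fun t => homMat N L t x) t₀ :=
  tendsto_list_prod _ fun i _ => continuousAt_homSite ht h2 x i

lemma continuousAt_offShell [NeZero N] (ht : t₀ ≠ 0) (h2 : t₀ ^ 2 - (t₀ ^ 2)⁻¹ ≠ 0)
    (s : Fin R → ℂ) (W : Finset (Fin R)) : ContinuousAt (fun t => offShell N L t s W) t₀ := by
  have h : ContinuousAt (fun t => (W.toList.map fun i => homMat N L t (s i) 0 1).prod) t₀ :=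
    tendsto_list_prod _ fun i _ => ((continuous_id.matrix_elem 0 1).tendsto _).comp
      (continuousAt_homMat ht h2 (s i))
  exact (Continuous.matrix_mulVec continuous_id continuous_const).continuousAt.comp h

end OnShell

section DividedLimit

open PowerSeries (C coeff coeff_mul coeff_C_mul coeff_mul_C)

variable {N L R : ℕ} {t₀ : ℂ} {l : Filter ℂ}

lemma ExpandsTo.tendsto_zero {l : Filter ℂ} {φ : ℂ → ℂ → ℂ} {F : PowerSeries ℂ}
    (h : ExpandsTo l φ F) : Tendsto (fun t => φ t 0) l (𝓝 (coeff 0 F)) := by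
  obtain ⟨G, h1, h2⟩ := h
  refine (h1 0).congr' (h2.mono fun t ht => ?_)
  have h3 := ht.self_of_nhds
  have h4 := hasSum_single (f := fun k => coeff k (G t) * (0 : ℂ) ^ k) 0
    (fun k hk => by simp [hk])
  simpa using h4.unique h3

lemma homMat_eq_subMat (t x : ℂ) : homMat N L t x = subMat N L t (finRange L).reverse x := rfl

lemma geomProd_apply_zero {𝒜 : Type*} [Ring 𝒜] [Algebra ℂ 𝒜] (r : ℂ) (X : ℂ → 𝒜) (j : ℕ) :
    geomProd r X j 0 = X 0 ^ j := by
  induction j with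
  | zero => rw [geomProd_zero, pow_zero]
  | succ j ih => rw [geomProd_succ, ih, mul_zero, pow_succ]

/-- The divided powers of `B_+` converge. -/
lemma IsGenericTo.exists_tendsto_bInf [NeZero N] (h : IsGenericTo t₀ l) (j : ℕ) :
    ∃ X, Tendsto (fun t => (qFac (t ^ 2) j)⁻¹ • bInf N L 1 t ^ j) l (𝓝 X) := by
  choose F hF using h.expandable_string (N := N) (nodup_reverse_finRange (L := L)) j
  have h1 : Tendsto (fun t => (qFac (t ^ 2) j)⁻¹ • homMat N L t 0 0 1 ^ j) l
      (𝓝 (Matrix.of fun a b => coeff 0 (F a b))) := by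
    refine tendsto_matrix fun a b => (hF a b).tendsto_zero.congr fun t => ?_
    beta_reduce
    rw [geomProd_apply_zero, homMat_eq_subMat]
  refine ⟨_, ((h.tendsto_sub.pow j).inv₀ (pow_ne_zero j h.sub_ne_zero)).smul h1 |>.congr' ?_⟩
  filter_upwards [h.ev_ne_zero, h.ev_sub_ne_zero] with t ht ht2
  rw [homMat_zero_zero_one ht, smul_pow, smul_smul, smul_smul, mul_right_comm,
    inv_mul_cancel₀ (pow_ne_zero j ht2), one_mul]

lemma opEnd_geomProd (r : ℂ) (X : ℂ → Op N L) (j : ℕ) (s : ℂ) :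
    opEnd N L (geomProd r X j s) = geomProd r (fun x => opEnd N L (X x)) j s := by
  rw [geomProd, opEnd_list_prod, List.map_map]; rfl

/-- The matrix elements of the divided powers along a string on an off-shell vector. -/
lemma IsGenericTo.exists_expandsTo_strOp [NeZero N] (h : IsGenericTo t₀ l) (s : Fin R → ℂ)
    (U W : Finset (Fin R)) (τ : Conf N L) : ∃ F, ExpandsTo l (fun t σ =>
      (qFac (t ^ 2) #U)⁻¹ * (strOp (t ^ 2) (homEnd N L t) #U σ (offShell N L t s W)) τ) F ∧
      (U = ∅ → F = C (offShell N L t₀ s W τ)) := by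
  have hΨ : ∀ b, Tendsto (fun t => offShell N L t s W b) l (𝓝 (offShell N L t₀ s W b)) := fun b =>
    h.tendsto (f := fun t => offShell N L t s W b)
      ((continuous_apply b).continuousAt.comp (continuousAt_offShell h.ne_zero h.sub_ne_zero s W))
  by_cases hU : U = ∅
  · subst hU
    refine ⟨_, (expandsTo_of_tendsto (hΨ τ)).congr (Eventually.of_forall fun t =>
      Eventually.of_forall fun σ => ?_), fun _ => rfl⟩
    simp [strOp, qFac_zero]
  · choose F hF using h.expandable_string (N := N) (nodup_reverse_finRange (L := L)) #U
    refine ⟨_, (expandsTo_sum univ fun b _ => (hF τ b).mul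
      (expandsTo_of_tendsto (hΨ b))).congr (Eventually.of_forall fun t =>
      Eventually.of_forall fun σ => ?_), fun h' => absurd h' hU⟩
    have e : strOp (t ^ 2) (homEnd N L t) #U σ = opEnd N L (geomProd ((t ^ 2) ^ 2)⁻¹
        (fun x => subMat N L t (finRange L).reverse x 0 1) #U σ) := by rw [opEnd_geomProd]; rfl
    beta_reduce
    rw [e, opEnd_apply, Matrix.mulVec, dotProduct, mul_sum]
    refine sum_congr rfl fun b _ => ?_
    rw [Matrix.smul_apply, smul_eq_mul, mul_assoc]

lemma chainWeight_left {t : ℂ} (ht : t ≠ 0) (x : ℂ) :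
    (t * (topWeight N t)⁻¹) ^ L * (t⁻¹ * (topWeight N t - x * (topWeight N t)⁻¹)) ^ L =
      chainWeight N L t (((t ^ 2) ^ 2)⁻¹ ^ (N - 1) * x) := by
  have h : t ^ (N - 1) ≠ 0 := pow_ne_zero _ ht
  rw [← mul_pow, chainWeight, topWeight]
  congr 1
  have e : (t ^ 2) ^ (N - 1) = (t ^ (N - 1)) ^ 2 := by rw [← pow_mul, ← pow_mul, mul_comm]
  rw [inv_pow, ← pow_mul (t ^ 2), mul_comm 2, pow_mul (t ^ 2), e]
  field_simp

lemma chainWeight_right {t : ℂ} (ht : t ≠ 0) (x : ℂ) :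
    (t⁻¹ * topWeight N t) ^ L * (t * ((topWeight N t)⁻¹ - x * topWeight N t)) ^ L =
      chainWeight N L t x := by
  have h : t ^ (N - 1) ≠ 0 := pow_ne_zero _ ht
  rw [← mul_pow, chainWeight, topWeight]
  congr 1
  rw [← pow_mul, mul_comm 2 (N - 1), pow_mul t (N - 1) 2]
  field_simp

lemma continuous_geomProd {𝒜 : Type*} [Ring 𝒜] [Algebra ℂ 𝒜] [TopologicalSpace 𝒜]
    [IsTopologicalRing 𝒜] (r : ℂ) {X : ℂ → 𝒜} (hX : Continuous X) (j : ℕ) :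
    Continuous (geomProd r X j) := by
  unfold geomProd
  exact continuous_list_prod _ fun i _ => hX.comp (continuous_const_mul _)

lemma strOp_homEnd (t : ℂ) (j : ℕ) (σ : ℂ) : strOp (t ^ 2) (homEnd N L t) j σ =
    opEnd N L (geomProd ((t ^ 2) ^ 2)⁻¹ (fun x => homMat N L t x 0 1) j σ) := by
  rw [opEnd_geomProd]; rfl

/-- The action of the powers of `C_+` on the powers of `B_+` on an off-shell vector. -/
lemma cInf_pow_bInf_pow [NeZero N] {t : ℂ} (ht : t ≠ 0) (hgen : ∀ n, 1 ≤ n → (t ^ 2) ^ n ≠ 1)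
    (hq1 : 1 ≤ ‖t ^ 2‖) {s : Fin R → ℂ} (hs : ∀ i, s i ≠ 0) (hinj : Injective s) (m : ℕ)
    (τ : Conf N L) {F : Finset (Fin R) → Finset (Fin R) → PowerSeries ℂ}
    {G : Finset (Fin R) → PowerSeries ℂ}
    (hF : ∀ U U₁, Expands (fun σ => stringTerm (t ^ 2) s (chainWeight N L t) (N - 1) m
      univ U U₁ σ) (F U U₁))
    (hG : ∀ U, Expands (fun σ => (qFac (t ^ 2) #U)⁻¹ *
      (strOp (t ^ 2) (homEnd N L t) #U σ (offShell N L t s (univ \ U))) τ) (G U)) :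
    ((qFac (t ^ 2) m)⁻¹ ^ 2 • (cInf N L 1 t ^ m * bInf N L 1 t ^ m).mulVec
      (offShell N L t s univ)) τ = ∑ U ∈ univ.powerset with #U ≤ m,
        ∑ U₁ ∈ U.powerset, ((-1) ^ (m - #U) * (t ^ 2) ^ (#U * (m - #U)) *
          (t ^ 2)⁻¹ ^ (m - #U) * (t ^ 2 - (t ^ 2)⁻¹)⁻¹ ^ #U) *
          coeff (m - #U) (F U U₁ * G U) := by
  have hq : t ^ 2 ≠ 0 := pow_ne_zero 2 ht
  have hq4 : (t ^ 2) ^ 4 ≠ 1 := hgen 4 (by norm_num)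
  have ht2 : t ^ 2 - (t ^ 2)⁻¹ ≠ 0 := fun h => hgen 2 (by norm_num) (by
    field_simp at h; linear_combination h)
  have hfac := fun n => qFac_ne_zero hgen hq n
  have hT := isRTT_homEnd (N := N) (L := L) ht ht2
  have hv : (proj 0 : (Conf N L → ℂ) →ₗ[ℂ] ℂ) (vac N L) = 1 := vac_zero
  have key := C_pow_B_pow (hq := hq) (hq4 := hq4) hgen hq1 (hT := hT)
    (htri := isTriangular_homEnd t) (hv := hv) (isRaising_homEnd ht ht2) hs hinj
    (w := chainWeight N L t) (ν := N - 1)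
    (by unfold chainWeight; fun_prop) (by simp [chainWeight])
    (fun x => chainWeight_left ht x) (fun x => chainWeight_right ht x) univ m
    (proj τ) (F := fun U U₁ => C (qFac (t ^ 2) #U) * (F U U₁ * G U))
    (fun U _ _ U₁ _ => by
      rw [bvec_eq_offShell]
      refine ((expands_const (qFac (t ^ 2) #U)).mul ((hF U U₁).mul (hG U))).congr
        (Eventually.of_forall fun σ => ?_)
      simp only [LinearMap.proj_apply]
      have := hfac #U
      field_simp) (by
      rw [bvec_eq_offShell]
      have hc : Continuous fun σ => ((cInf N L 1 t ^ m * geomProd ((t ^ 2) ^ 2)⁻¹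
          (fun x => homMat N L t x 0 1) m σ).mulVec (offShell N L t s univ)) τ :=
        (continuous_apply τ).comp (Continuous.matrix_mulVec (continuous_const.mul
          (continuous_geomProd _ ((continuous_homMat t).matrix_elem 0 1) m)) continuous_const)
      have h0 := (hc.tendsto 0).mono_left (nhdsWithin_le_nhds (s := {0}ᶜ))
      rw [geomProd_apply_zero] at h0
      have e : homEnd N L t 0 0 1 = opEnd N L (homMat N L t 0 0 1) := rfl
      simp only [strOp_homEnd, e, ← map_pow, ← End.mul_apply, ← map_mul, LinearMap.proj_apply]
      exact h0)
  have e : homEnd N L t 0 0 1 = (t ^ 2 - (t ^ 2)⁻¹) • opEnd N L (bInf N L 1 t) := by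
    rw [← map_smul, ← homMat_zero_zero_one ht]; rfl
  rw [bvec_eq_offShell, e, smul_pow, ← map_pow, ← map_pow, LinearMap.smul_apply, map_smul,
    ← End.mul_apply, ← map_mul, map_smul, smul_eq_mul] at key
  have hcm := pow_ne_zero m ht2
  have key' : ((cInf N L 1 t ^ m * bInf N L 1 t ^ m).mulVec (offShell N L t s univ)) τ =
      ((t ^ 2 - (t ^ 2)⁻¹) ^ m)⁻¹ * _ := (eq_inv_mul_iff_mul_eq₀ hcm).mpr key
  rw [Pi.smul_apply, smul_eq_mul, key']
  simp only [mul_sum]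
  refine sum_congr rfl fun U hU => sum_congr rfl fun U₁ _ => ?_
  rw [coeff_C_mul]
  have hUm : m - #U + #U = m := Nat.sub_add_cancel (mem_filter.mp hU).2
  have h1 := hfac #U
  have h2 := hfac m
  have h3 : (t ^ 2 - (t ^ 2)⁻¹) ^ m = (t ^ 2 - (t ^ 2)⁻¹) ^ (m - #U) *
      (t ^ 2 - (t ^ 2)⁻¹) ^ #U := by rw [← pow_add, hUm]
  rw [h3]
  have h4 := pow_ne_zero (m - #U) ht2
  have h5 := pow_ne_zero #U ht2
  rw [inv_pow _ #U]
  generalize (t ^ 2 - (t ^ 2)⁻¹) ^ (m - #U) = a at *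
  generalize (t ^ 2 - (t ^ 2)⁻¹) ^ #U = b at *
  field_simp

/-- The limit of the divided powers of `C_+ B_+` on a solution of the Bethe equations. -/
lemma IsBetheRoots.tendsto_cInf_pow_bInf_pow [NeZero N] (h : IsGenericTo t₀ l)
    (hl : ∀ᶠ t : ℂ in l, 1 ≤ ‖t ^ 2‖ ∧ ∀ n, 1 ≤ n → (t ^ 2) ^ n ≠ 1) {s : Fin R → ℂ}
    (hs : IsBetheRoots N L t₀ s) {m : ℕ} (hm : (t₀ ^ 2) ^ m = 1) {F₀ : PowerSeries ℂ}
    (hF₀ : Expands (fun σ => stringTerm (t₀ ^ 2) s (chainWeight N L t₀) (N - 1) m univ ∅ ∅ σ) F₀) :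
    Tendsto (fun t => (qFac (t ^ 2) m)⁻¹ ^ 2 • (cInf N L 1 t ^ m * bInf N L 1 t ^ m).mulVec
      (offShell N L t s univ)) l
      (𝓝 (((-1) ^ m * coeff m F₀) • offShell N L t₀ s univ)) := by
  rw [tendsto_pi_nhds]
  intro τ
  choose F hF using fun U U₁ => exists_expandsTo_stringTerm (N := N) (L := L) h.ne_zero s m
    univ U U₁
  choose G hG hG0 using fun U => h.exists_expandsTo_strOp (N := N) s U (univ \ U) τ
  choose Ft hFt1 hFt2 using fun U U₁ => (hF U U₁).mono h.le
  choose Gt hGt1 hGt2 using hG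
  have hq : t₀ ^ 2 ≠ 0 := pow_ne_zero 2 h.ne_zero
  have hsum : ∀ U : Finset (Fin R), U.Nonempty → ∑ U₁ ∈ U.powerset, F U U₁ = 0 := fun U hU =>
    (Expands.sum U.powerset fun U₁ _ => (hF U U₁).expands).eq_zero
      (hs.sum_stringTerm_eq_zero h.ne_zero hm hU)
  have hc : ∀ a b c : ℕ, Tendsto (fun t : ℂ => (-1) ^ a * (t ^ 2) ^ b * (t ^ 2)⁻¹ ^ a *
      (t ^ 2 - (t ^ 2)⁻¹)⁻¹ ^ c) l (𝓝 ((-1) ^ a * (t₀ ^ 2) ^ b * (t₀ ^ 2)⁻¹ ^ a *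
      (t₀ ^ 2 - (t₀ ^ 2)⁻¹)⁻¹ ^ c)) := fun a b c => by
    have := h.sub_ne_zero
    exact h.tendsto (f := fun t : ℂ => (-1) ^ a * (t ^ 2) ^ b * (t ^ 2)⁻¹ ^ a *
      (t ^ 2 - (t ^ 2)⁻¹)⁻¹ ^ c) (by fun_prop (disch := assumption))
  have hlim : Tendsto (fun t => ∑ U ∈ univ.powerset with #U ≤ m,
        ∑ U₁ ∈ U.powerset, ((-1) ^ (m - #U) * (t ^ 2) ^ (#U * (m - #U)) *
          (t ^ 2)⁻¹ ^ (m - #U) * (t ^ 2 - (t ^ 2)⁻¹)⁻¹ ^ #U) *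
          coeff (m - #U) (Ft U U₁ t * Gt U t)) l
      (𝓝 (∑ U ∈ univ.powerset with #U ≤ m,
        ∑ U₁ ∈ U.powerset, ((-1) ^ (m - #U) * (t₀ ^ 2) ^ (#U * (m - #U)) *
          (t₀ ^ 2)⁻¹ ^ (m - #U) * (t₀ ^ 2 - (t₀ ^ 2)⁻¹)⁻¹ ^ #U) *
          coeff (m - #U) (F U U₁ * G U))) := by
    refine tendsto_finsetSum _ fun U _ => tendsto_finsetSum _ fun U₁ _ => (hc _ _ _).mul ?_
    simp only [coeff_mul]
    exact tendsto_finsetSum _ fun p _ => (hFt1 U U₁ p.1).mul (hGt1 U p.2)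
  have hval : (∑ U ∈ univ.powerset with #U ≤ m,
        ∑ U₁ ∈ U.powerset, ((-1) ^ (m - #U) * (t₀ ^ 2) ^ (#U * (m - #U)) *
          (t₀ ^ 2)⁻¹ ^ (m - #U) * (t₀ ^ 2 - (t₀ ^ 2)⁻¹)⁻¹ ^ #U) *
          coeff (m - #U) (F U U₁ * G U)) =
      (((-1) ^ m * coeff m F₀) • offShell N L t₀ s univ) τ := by
    rw [sum_eq_single_of_mem ∅ (by simp)]
    · have e : F ∅ ∅ = F₀ := by
        have h1 := (hF ∅ ∅).expands.add ((expands_const (-1)).mul hF₀)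
        have h2 := h1.eq_zero (Eventually.of_forall fun σ => by simp)
        grind
      have hm' : (t₀ ^ 2)⁻¹ ^ m = 1 := by rw [inv_pow, hm, inv_one]
      rw [powerset_empty, sum_singleton, hG0 ∅ rfl, e]
      simp [hm', coeff_mul_C, mul_assoc]
    · intro U _ hU
      rw [← mul_sum, ← map_sum, ← sum_mul,
        hsum U (nonempty_iff_ne_empty.mpr hU), zero_mul, map_zero, mul_zero]
  rw [hval] at hlim
  refine hlim.congr' ?_
  filter_upwards [h.ev_ne_zero, hl, eventually_all.mpr fun U => eventually_all.mpr (hFt2 U),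
    eventually_all.mpr hGt2] with t ht ht1 h1 h2
  exact (cInf_pow_bInf_pow ht ht1.2 ht1.1 hs.ne_zero hs.injective m τ (F := fun U U₁ => Ft U U₁ t)
    (G := fun U => Gt U t) h1 h2).symm

end DividedLimit

/-! ### The operators at a root of unity -/

section RootOfUnity

variable {N L R : ℕ} {t₀ : ℂ} {l : Filter ℂ}

lemma IsGenericTo.mono (h : IsGenericTo t₀ l) {l' : Filter ℂ} (hl : l' ≤ l) : IsGenericTo t₀ l' :=
  ⟨hl.trans h.le, h.ne_zero, h.sub_ne_zero, hl h.ev_ne_zero, hl h.ev_sub_ne_zero,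
    fun M => hl (h.ev_qNum M)⟩

lemma sub_inv_ne_zero_of_primitive (hN : 3 ≤ N) {q : ℂ} (hq : IsPrimitiveRoot q N) :
    q - q⁻¹ ≠ 0 := by
  intro h
  have h0 := hq.ne_zero (by omega)
  field_simp at h
  have := Nat.le_of_dvd (by omega) (hq.dvd_of_pow_eq_one 2 (by linear_combination h))
  omega

lemma isGenericTo_punctured (hN : 3 ≤ N) (hq : IsPrimitiveRoot (t₀ ^ 2) N) :
    IsGenericTo t₀ (𝓝[≠] t₀) := by
  have ht : t₀ ≠ 0 := fun h => hq.ne_zero (by omega) (by rw [h]; simp)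
  have hsq : Tendsto (fun t : ℂ => t ^ 2) (𝓝[≠] t₀) (𝓝[≠] (t₀ ^ 2)) := by
    refine tendsto_nhdsWithin_iff.mpr ⟨((continuous_pow 2).tendsto t₀).mono_left
      nhdsWithin_le_nhds, ?_⟩
    have h2 : t₀ ≠ -t₀ := fun h => ht (by linear_combination h / 2)
    filter_upwards [self_mem_nhdsWithin, mem_nhdsWithin_of_mem_nhds (isOpen_ne.mem_nhds h2)]
      with t h3 h4 h5
    grind
  have h1 := fun M => hsq.eventually (eventually_qNum_ne_zero (pow_ne_zero 2 ht) M)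
  exact ⟨nhdsWithin_le_nhds, ht, sub_inv_ne_zero_of_primitive hN hq,
    mem_nhdsWithin_of_mem_nhds (isOpen_ne.mem_nhds ht), (h1 0).mono fun t h => h.2.1,
    fun M => (h1 M).mono fun t h => h.2.2⟩

/-- The approach to `t₀` from outside the unit disc. -/
lemma exists_outer_filter (hN : 3 ≤ N) (hq : IsPrimitiveRoot (t₀ ^ 2) N) :
    ∃ l ≤ 𝓝[≠] t₀, l.NeBot ∧ ∀ᶠ t : ℂ in l, 1 ≤ ‖t ^ 2‖ ∧ ∀ n, 1 ≤ n → (t ^ 2) ^ n ≠ 1 := by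
  have hnorm : ‖t₀‖ = 1 := Complex.norm_eq_one_of_pow_eq_one (n := 2 * N)
    (by rw [pow_mul, hq.pow_eq_one]) (by omega)
  refine ⟨𝓝[{t | 1 < ‖t‖}] t₀, nhdsWithin_mono _ fun t ht h => ?_, ?_, ?_⟩
  · grind
  · rw [← mem_closure_iff_nhdsWithin_neBot, Metric.mem_closure_iff]
    intro ε hε
    refine ⟨((1 + ε / 2 : ℝ) : ℂ) * t₀, ?_, ?_⟩
    · rw [Set.mem_setOf_eq, norm_mul, hnorm, mul_one, Complex.norm_real, Real.norm_eq_abs,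
        abs_of_pos (by linarith)]
      linarith
    · have : t₀ - ((1 + ε / 2 : ℝ) : ℂ) * t₀ = ((-(ε / 2) : ℝ) : ℂ) * t₀ := by push_cast; ring
      rw [dist_eq_norm, this, norm_mul, hnorm, mul_one, Complex.norm_real, Real.norm_eq_abs,
        abs_neg, abs_of_pos (by linarith)]
      linarith
  · filter_upwards [self_mem_nhdsWithin] with t ht
    have ht' : 1 < ‖t ^ 2‖ := by rw [norm_pow]; exact one_lt_pow₀ ht two_ne_zero
    refine ⟨ht'.le, fun n hn h => ?_⟩
    have := one_lt_pow₀ ht' (by omega : n ≠ 0)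
    rw [← norm_pow, h, norm_one] at this
    grind

lemma qNum_root_ne_zero (hN : Odd N) {q : ℂ} (hq : IsPrimitiveRoot q N) {n : ℕ}
    (h3 : 3 ≤ N) (h1 : 1 ≤ n) (h2 : n < N) : qNum q n ≠ 0 := by
  refine div_ne_zero (fun h => ?_) (sub_inv_ne_zero_of_primitive h3 hq)
  have h0 : q ^ n ≠ 0 := pow_ne_zero n (hq.ne_zero (by omega))
  field_simp at h
  have h4 := hq.dvd_of_pow_eq_one (n * 2) (by rw [pow_mul]; linear_combination h)
  exact absurd (Nat.le_of_dvd (by omega) (hN.coprime_two_right.dvd_of_dvd_mul_right h4)) (by omega)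

lemma continuousAt_qNum (ht : t₀ ≠ 0) (h2 : t₀ ^ 2 - (t₀ ^ 2)⁻¹ ≠ 0) (n : ℕ) :
    ContinuousAt (fun t => qNum (t ^ 2) n) t₀ := continuousAt_qInt ht h2 n

lemma qFac_add (q : ℂ) (m n : ℕ) :
    qFac q (m + n) = qFac q m * ∏ i ∈ range n, qNum q (m + (i + 1)) := by
  induction n with
  | zero => simp
  | succ n ih => rw [← add_assoc, qFac_succ, ih, prod_range_succ, mul_assoc]; rfl

lemma IsGenericTo.tendsto_qNum_div (h : IsGenericTo t₀ l) (hq : (t₀ ^ 2) ^ N = 1) (hN : 1 ≤ N)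
    (k : ℕ) : Tendsto (fun t => qNum (t ^ 2) (k * N) / qNum (t ^ 2) N) l (𝓝 k) := by
  have h0 := pow_ne_zero 2 h.ne_zero
  induction k with
  | zero => simpa [qNum] using tendsto_const_nhds
  | succ k ih =>
    have h1 : Tendsto (fun t : ℂ => (t ^ 2) ^ (k * N)) l (𝓝 ((t₀ ^ 2) ^ (k * N))) :=
      h.tendsto (f := fun t : ℂ => (t ^ 2) ^ (k * N)) (by fun_prop)
    have h2 : Tendsto (fun t : ℂ => ((t ^ 2) ^ N)⁻¹) l (𝓝 ((t₀ ^ 2) ^ N)⁻¹) :=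
      h.tendsto (f := fun t : ℂ => ((t ^ 2) ^ N)⁻¹) (by
        have := pow_ne_zero N h0; fun_prop (disch := assumption))
    rw [mul_comm k, pow_mul, hq, one_pow] at h1
    rw [hq, inv_one] at h2
    have h3 := h1.add (h2.mul ih)
    rw [one_mul, add_comm] at h3
    rw [Nat.cast_succ]
    refine h3.congr' ?_
    filter_upwards [h.ev_ne_zero, h.ev_qNum N] with t ht hg
    rw [add_mul, one_mul, qNum_add (pow_ne_zero 2 ht)]
    grind

lemma IsGenericTo.tendsto_qFac_div (h : IsGenericTo t₀ l) (hN : Odd N) (h3 : 3 ≤ N)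
    (hq : IsPrimitiveRoot (t₀ ^ 2) N) (k : ℕ) :
    Tendsto (fun t => qFac (t ^ 2) (k * N) / qFac (t ^ 2) N ^ k) l (𝓝 (k.factorial : ℂ)) := by
  induction k with
  | zero => simpa [qFac_zero] using tendsto_const_nhds
  | succ k ih =>
    obtain ⟨M, rfl⟩ : ∃ M, N = M + 1 := ⟨N - 1, by omega⟩
    have h1 : ∀ i ∈ range M, Tendsto (fun t => qNum (t ^ 2) (k * (M + 1) + (i + 1)) /
        qNum (t ^ 2) (i + 1)) l (𝓝 1) := by
      intro i hi
      have hi' := mem_range.mp hi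
      have h4 := qNum_root_ne_zero hN hq h3 (by omega : 1 ≤ i + 1) (by omega)
      have h5 := (h.tendsto (continuousAt_qNum h.ne_zero h.sub_ne_zero (k * (M + 1) + (i + 1)))).div
        (h.tendsto (continuousAt_qNum h.ne_zero h.sub_ne_zero (i + 1))) h4
      have h6 : qNum (t₀ ^ 2) (k * (M + 1) + (i + 1)) = qNum (t₀ ^ 2) (i + 1) := by
        rw [qNum, pow_add, mul_comm k, pow_mul, hq.pow_eq_one, one_pow, one_mul]; rfl
      rwa [h6, div_self h4] at h5
    have h2 := (ih.mul (tendsto_finsetProd (range M) h1)).mul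
      (h.tendsto_qNum_div hq.pow_eq_one (by omega) (k + 1))
    rw [prod_const_one, mul_one, mul_comm (k.factorial : ℂ), ← Nat.cast_mul, ← Nat.factorial_succ] at h2
    refine h2.congr fun t => ?_
    have e := qFac_add (t ^ 2) 0 (M + 1)
    rw [zero_add, qFac_zero, one_mul, prod_range_succ] at e
    simp only [zero_add] at e
    rw [prod_div_distrib, add_mul k, one_mul, qFac_add _ (k * (M + 1)),
      prod_range_succ, pow_succ (qFac (t ^ 2) (M + 1)), mul_div_mul_comm, mul_assoc, div_mul_div_comm, ← e]

lemma tendsto_mulVec {n α : Type*} [Fintype n] {l : Filter α} {X : α → Matrix n n ℂ}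
    {X₀ : Matrix n n ℂ} {v : α → n → ℂ} {v₀ : n → ℂ} (hX : Tendsto X l (𝓝 X₀))
    (hv : Tendsto v l (𝓝 v₀)) : Tendsto (fun t => (X t).mulVec (v t)) l (𝓝 (X₀.mulVec v₀)) :=
  tendsto_pi_nhds.mpr fun i => tendsto_finsetSum _ fun j _ =>
    (((continuous_id.matrix_elem i j).tendsto X₀).comp hX).mul (tendsto_pi_nhds.mp hv j)

lemma qFactorial_eq (t : ℂ) (m : ℕ) : qFactorial t m = qFac (t ^ 2) m := rfl

/-- The powers of the limits of the divided powers on a solution of the Bethe equations. -/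
lemma IsBetheRoots.limit_pow_mulVec (hN : Odd N) (h3 : 3 ≤ N) (hq : IsPrimitiveRoot (t₀ ^ 2) N)
    {s : Fin R → ℂ} (hs : IsBetheRoots N L t₀ s) {X Y : Op N L}
    (hX : Tendsto (divPow N L (bInf N L 1)) (𝓝[≠] t₀) (𝓝 X))
    (hY : Tendsto (divPow N L (cInf N L 1)) (𝓝[≠] t₀) (𝓝 Y)) (k : ℕ) {F₀ : PowerSeries ℂ}
    (hF₀ : Expands (fun σ => stringTerm (t₀ ^ 2) s (chainWeight N L t₀) (N - 1) (k * N)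
      univ ∅ ∅ σ) F₀) :
    (Y ^ k * X ^ k).mulVec (offShell N L t₀ s univ) = ((k.factorial : ℂ) ^ 2 *
      ((-1) ^ k * PowerSeries.coeff (k * N) F₀)) • offShell N L t₀ s univ := by
  have : NeZero N := ⟨by omega⟩
  obtain ⟨l, hl, hbot, hout⟩ := exists_outer_filter h3 hq
  have h := (isGenericTo_punctured h3 hq).mono hl
  have h1 := hs.tendsto_cInf_pow_bInf_pow h hout (m := k * N)
    (by rw [mul_comm, pow_mul, hq.pow_eq_one, one_pow]) hF₀
  have h2 := ((h.tendsto_qFac_div hN h3 hq k).pow 2).smul h1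
  have h4 : Tendsto (fun t => (divPow N L (cInf N L 1) t ^ k *
      divPow N L (bInf N L 1) t ^ k).mulVec (offShell N L t s univ)) l
      (𝓝 ((Y ^ k * X ^ k).mulVec (offShell N L t₀ s univ))) :=
    tendsto_mulVec (((hY.mono_left hl).pow k).mul ((hX.mono_left hl).pow k))
      (h.tendsto (continuousAt_offShell h.ne_zero h.sub_ne_zero s univ))
  have h5 : ((-1 : ℂ)) ^ (k * N) = (-1) ^ k := by rw [mul_comm, pow_mul, hN.neg_one_pow]
  rw [h5, smul_smul] at h2
  refine tendsto_nhds_unique h4 (h2.congr' ?_)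
  filter_upwards [h.ev_qNum (k * N)] with t ht
  have hf : qFac (t ^ 2) (k * N) ≠ 0 := prod_ne_zero_iff.mpr fun i hi => by grind
  simp only [divPow, smul_pow, ← pow_mul, qFactorial_eq]
  rw [smul_mul_smul_comm, smul_mulVec, smul_smul, mul_comm k N]
  congr 1
  rw [mul_comm N k, ← mul_pow, ← mul_pow, div_mul_eq_mul_div, mul_inv_cancel₀ hf]
  simp only [one_div, inv_pow, mul_pow, sq]

/-- The sums over splittings for the homogeneous chain. -/
def chainSplit (N L : ℕ) (s : Fin R → ℂ) (t : ℂ) (T : Finset (Fin R)) : ℂ :=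
  splitSum (t ^ 2) (fun i k => fD (t ^ 2) (s i) (s k))
    (fun i => chainWeight N L t (((t ^ 2) ^ 2)⁻¹ ^ (N - 1) * s i) / s i *
      ∏ k ∈ univ \ T, (t ^ 2 * fD (t ^ 2) (s k) (s i)))
    (fun i => chainWeight N L t (s i) / s i *
      ∏ k ∈ univ \ T, ((t ^ 2)⁻¹ * fD (t ^ 2) (s i) (s k))) T

lemma continuousAt_chainSplit (ht : t₀ ≠ 0) (s : Fin R → ℂ) (T : Finset (Fin R)) :
    ContinuousAt (fun t => chainSplit N L s t T) t₀ := by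
  have hq0 : t₀ ^ 2 ≠ 0 := pow_ne_zero 2 ht
  have hfD : ∀ a b : ℂ, ContinuousAt (fun t : ℂ => fD (t ^ 2) a b) t₀ := fun a b =>
    ContinuousAt.comp (g := fun q => fD q a b) (continuousAt_fD hq0 a b) (by fun_prop)
  have hq2 : (t₀ ^ 2) ^ 2 ≠ 0 := pow_ne_zero 2 hq0
  unfold chainSplit
  refine continuousAt_splitSum (q := fun t : ℂ => t ^ 2) (θ := fun t i k => fD (t ^ 2) (s i) (s k))
    (u := fun t i => chainWeight N L t (((t ^ 2) ^ 2)⁻¹ ^ (N - 1) * s i) / s i *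
      ∏ k ∈ univ \ T, (t ^ 2 * fD (t ^ 2) (s k) (s i)))
    (v := fun t i => chainWeight N L t (s i) / s i *
      ∏ k ∈ univ \ T, ((t ^ 2)⁻¹ * fD (t ^ 2) (s i) (s k)))
    hq0 (by fun_prop) (fun i _ k _ _ => hfD _ _) (fun i _ => ?_) fun i _ => ?_
  · unfold chainWeight
    fun_prop (disch := assumption)
  · unfold chainWeight
    fun_prop (disch := assumption)

/-- Solutions of the Bethe equations are annihilated by the limit of the divided power. -/
lemma IsBetheRoots.limit_mulVec_eq_zero (h3 : 3 ≤ N) (hq : IsPrimitiveRoot (t₀ ^ 2) N)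
    {s : Fin R → ℂ} (hs : IsBetheRoots N L t₀ s) {Y : Op N L}
    (hY : Tendsto (divPow N L (cInf N L 1)) (𝓝[≠] t₀) (𝓝 Y)) :
    Y.mulVec (offShell N L t₀ s univ) = 0 := by
  have : NeZero N := ⟨by omega⟩
  obtain ⟨l, hl, hbot, hout⟩ := exists_outer_filter h3 hq
  have h := (isGenericTo_punctured h3 hq).mono hl
  have hq0 : t₀ ^ 2 ≠ 0 := pow_ne_zero 2 h.ne_zero
  have h4 : Tendsto (fun t => (divPow N L (cInf N L 1) t).mulVec (offShell N L t s univ)) l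
      (𝓝 (Y.mulVec (offShell N L t₀ s univ))) :=
    tendsto_mulVec (hY.mono_left hl)
      (h.tendsto (continuousAt_offShell h.ne_zero h.sub_ne_zero s univ))
  have hSc := continuousAt_chainSplit (N := N) (L := L) h.ne_zero s
  have hS0 : ∀ T ∈ (univ : Finset (Fin R)).powersetCard N, chainSplit N L s t₀ T = 0 := by
    intro T hT
    have hT' := (mem_powersetCard.mp hT).2
    have h5 := splitSum_bethe_eq_zero (Z := univ) hq0 (subset_univ T)
      (card_pos.mp (by omega)) hs.injective.injOn (fun i _ => hs.ne_zero i)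
      (fun i _ k _ hik => hs.regular i k hik) (fun i _ => hs.bethe i) (σ := 0) (fun i _ => by simp)
    rw [hT'] at h5
    simpa [chainSplit, hq.pow_eq_one] using h5
  have h6 : Tendsto (fun t => ∑ T ∈ (univ : Finset (Fin R)).powersetCard N,
      chainSplit N L s t T • offShell N L t s (univ \ T)) l (𝓝 0) := by
    rw [← sum_const_zero (s := (univ : Finset (Fin R)).powersetCard N)]
    refine tendsto_finsetSum _ fun T hT => ?_
    have h7 := h.tendsto (hSc T)
    have h8 : Tendsto (fun t => offShell N L t s (univ \ T)) l _ :=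
      h.tendsto (continuousAt_offShell h.ne_zero h.sub_ne_zero s _)
    rw [hS0 T hT] at h7
    rw [← zero_smul ℂ (offShell N L t₀ s (univ \ T))]
    exact h7.smul h8
  refine tendsto_nhds_unique h4 (h6.congr' ?_)
  filter_upwards [h.ev_ne_zero, h.ev_sub_ne_zero, h.ev_qNum N, hout] with t ht ht2 hg ho
  have hv : (proj 0 : (Conf N L → ℂ) →ₗ[ℂ] ℂ) (vac N L) = 1 := vac_zero
  have key := (isRaising_homEnd (N := N) (L := L) ht ht2).raising (hq := pow_ne_zero 2 ht)
    (hq4 := ho.2 4 (by norm_num)) (hT := isRTT_homEnd ht ht2) (htri := isTriangular_homEnd t)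
    (hv := hv) (hs := hs.ne_zero) |>.C_pow_bvec (pow_ne_zero 2 ht) ht2 hs.injective hs.ne_zero N
    univ
  simp only [bvec_eq_offShell, ← map_pow, opEnd_apply] at key
  rw [divPow, smul_mulVec, key, smul_smul, qFactorial_eq, qFac, inv_mul_cancel₀
    (prod_ne_zero_iff.mpr fun i hi => hg i (mem_Icc.mp hi).1 (mem_Icc.mp hi).2), one_smul]
  refine sum_congr rfl fun T _ => ?_
  simp only [chainSplit, ← chainWeight_left ht, ← chainWeight_right ht]
  rfl

end RootOfUnity

/-! ### Symmetries -/

section Symmetries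

variable {N L R : ℕ} {t₀ : ℂ}

lemma qInt_inv (t : ℂ) (m : ℕ) : qInt t⁻¹ m = qInt t m := by
  rw [qInt_eq, qInt_eq, inv_pow, qNum_inv]

lemma kHalf_inv (t : ℂ) (p : ℤ) : kHalf N t⁻¹ p = kHalf N t (-p) := by
  simp only [kHalf, inv_zpow', neg_mul]

lemma eHat_inv (t : ℂ) : eHat N t⁻¹ = eHat N t := by simp only [eHat, qInt_inv]

lemma fHat_inv (t : ℂ) : fHat N t⁻¹ = fHat N t := by simp only [fHat, qInt_inv]

lemma divPow_intertwine {X Y : ℂ → Op N L} {t : ℂ} {P : Op N L}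
    (h : Y t⁻¹ * P = P * X t) : divPow N L Y t⁻¹ * P = P * divPow N L X t := by
  have h1 : SemiconjBy P (X t) (Y t⁻¹) := h.symm
  have e : qFactorial t⁻¹ N = qFactorial t N := by simp only [qFactorial, qInt_inv]
  rw [divPow, divPow, e, smul_mul_assoc, mul_smul_comm, (h1.pow_right N).eq]

lemma tensorOp_transpose (M : Fin L → LocOp N) : (tensorOp M).transpose = tensorOp fun i =>
    (M i).transpose := rfl

/-- The relative normalization of the raising operator and the transposed lowering operator. -/
def dualWeight (N : ℕ) (t : ℂ) (m : ℕ) : ℂ := ∏ i ∈ range m, qInt t (i + 1) / qInt t (N - (i + 1))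

/-- The operator that intertwines `B_±` with the transposed `C_±`. -/
def dualOp (N L : ℕ) (t : ℂ) : Op N L := tensorOp fun _ => diagonal fun σ => dualWeight N t σ

lemma eHat_mul_dual {t : ℂ} (h : ∀ m, 1 ≤ m → m < N → qInt t m ≠ 0) :
    eHat N t * diagonal (fun σ : Fin N => dualWeight N t σ) =
      diagonal (fun σ : Fin N => dualWeight N t σ) * (fHat N t).transpose := by
  ext τ σ
  rw [mul_diagonal, diagonal_mul, Matrix.transpose_apply, eHat, fHat, of_apply, of_apply]
  split_ifs with h1 h2 h2
  · have := h (N - σ) (by omega) (by omega)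
    rw [← h1, dualWeight, dualWeight, prod_range_succ, h1]
    field_simp
  · grind
  · grind
  · simp

lemma cInf_mul_dualOp {t : ℂ} (h : ∀ m, 1 ≤ m → m < N → qInt t m ≠ 0) (s : ℤ) :
    cInf N L s t⁻¹ * dualOp N L t = dualOp N L t * (bInf N L s t).transpose := by
  rw [cInf, bInf, Matrix.transpose_sum, sum_mul, mul_sum]
  refine sum_congr rfl fun i _ => ?_
  rw [Matrix.transpose_smul, smul_mul_assoc, mul_smul_comm, inv_zpow', neg_sub,
    tensorOp_transpose, dualOp, tensorOp_mul, tensorOp_mul]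
  congr 2
  ext1 j
  have hk : ∀ p, kHalf N t p * diagonal (fun σ : Fin N => dualWeight N t σ) =
      diagonal (fun σ : Fin N => dualWeight N t σ) * (kHalf N t p).transpose := fun p => by
    rw [kHalf, Matrix.diagonal_transpose, diagonal_mul_diagonal, diagonal_mul_diagonal]
    congr 1; ext σ; ring
  split_ifs
  · rw [kHalf_inv, hk]
  · rw [eHat_inv, eHat_mul_dual h]
  · rw [kHalf_inv, neg_neg, hk]

lemma dualOp_mul_inv {t : ℂ} (h : ∀ m, 1 ≤ m → m < N → qInt t m ≠ 0) :
    dualOp N L t * tensorOp (fun _ => diagonal fun σ => (dualWeight N t σ)⁻¹) = 1 := by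
  rw [dualOp, tensorOp_mul, ← tensorOp_one]
  congr 1
  ext1 j
  rw [diagonal_mul_diagonal, ← diagonal_one]
  congr 1
  ext σ
  refine mul_inv_cancel₀ (prod_ne_zero_iff.mpr fun i hi => ?_)
  have := mem_range.mp hi
  exact div_ne_zero (h _ (by omega) (by omega)) (h _ (by omega) (by omega))

lemma continuousAt_dualOp (ht : t₀ ≠ 0) (h2 : t₀ ^ 2 - (t₀ ^ 2)⁻¹ ≠ 0)
    (h : ∀ m, 1 ≤ m → m < N → qInt t₀ m ≠ 0) : ContinuousAt (fun t => dualOp N L t) t₀ := by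
  refine tendsto_matrix fun a b => ?_
  simp only [dualOp, tensorOp, of_apply]
  refine tendsto_finsetProd _ fun i _ => ?_
  simp only [diagonal_apply]
  split_ifs
  · refine tendsto_finsetProd _ fun j hj => ?_
    have := mem_range.mp hj
    exact (continuousAt_qInt ht h2 _).tendsto.div (continuousAt_qInt ht h2 _).tendsto
      (h _ (by omega) (by omega))
  · exact tendsto_const_nhds

lemma tendsto_inv_punctured (ht : t₀ ≠ 0) : Tendsto (fun t : ℂ => t⁻¹) (𝓝[≠] t₀⁻¹) (𝓝[≠] t₀) := by
  refine tendsto_nhdsWithin_iff.mpr ⟨?_, ?_⟩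
  · have := (continuousAt_inv₀ (inv_ne_zero ht)).tendsto
    rw [inv_inv] at this
    exact this.mono_left nhdsWithin_le_nhds
  · filter_upwards [self_mem_nhdsWithin] with t h h'
    grind

lemma isUnit_dualOp {t : ℂ} (h : ∀ m, 1 ≤ m → m < N → qInt t m ≠ 0) : IsUnit (dualOp N L t).det :=
  (Matrix.isUnit_iff_isUnit_det _).mp (IsUnit.of_mul_eq_one _ (dualOp_mul_inv h))

lemma exists_tendsto_divPow (hN : Odd N) (h3 : 3 ≤ N) (hq : IsPrimitiveRoot (t₀ ^ 2) N) :
    (∃ X, Tendsto (divPow N L (bInf N L 1)) (𝓝[≠] t₀) (𝓝 X)) ∧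
    ∃ Y, Tendsto (divPow N L (cInf N L 1)) (𝓝[≠] t₀⁻¹) (𝓝 Y) := by
  have : NeZero N := ⟨by omega⟩
  have h := isGenericTo_punctured h3 hq
  obtain ⟨X, hX⟩ := h.exists_tendsto_bInf (N := N) (L := L) N
  have hn : ∀ m, 1 ≤ m → m < N → qInt t₀ m ≠ 0 := fun m h1 h2 => qNum_root_ne_zero hN hq h3 h1 h2
  have hX' : Tendsto (divPow N L (bInf N L 1)) (𝓝[≠] t₀) (𝓝 X) :=
    hX.congr fun t => by rw [divPow, qFactorial_eq]
  refine ⟨⟨X, hX'⟩, dualOp N L t₀ * X.transpose * (dualOp N L t₀)⁻¹, ?_⟩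
  have hc := (h.tendsto (continuousAt_dualOp (L := L) h.ne_zero h.sub_ne_zero hn))
  have hdet : Tendsto (fun t => (dualOp N L t)⁻¹) (𝓝[≠] t₀) (𝓝 (dualOp N L t₀)⁻¹) := by
    have h0 := (isUnit_dualOp (L := L) hn).ne_zero
    simp only [Matrix.inv_def, Ring.inverse_eq_inv']
    exact ((((continuous_id.matrix_det).tendsto _).comp hc).inv₀ h0).smul
      (((continuous_id.matrix_adjugate).tendsto _).comp hc)
  have h4 := (hc.mul (((continuous_id.matrix_transpose).tendsto X).comp hX')).mul hdet
  refine (h4.comp (tendsto_inv_punctured h.ne_zero)).congr' ?_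
  have h5 := (tendsto_inv_punctured h.ne_zero).eventually (h.ev_qNum N)
  filter_upwards [h5] with t ht
  have hn' : ∀ m, 1 ≤ m → m < N → qInt t⁻¹ m ≠ 0 := fun m h1 h2 => ht m h1 h2.le
  have e := divPow_intertwine (X := fun t => (bInf N L 1 t).transpose) (Y := cInf N L 1)
    (cInf_mul_dualOp (L := L) hn' 1)
  have e2 : divPow N L (fun t => (bInf N L 1 t).transpose) t⁻¹ =
      (divPow N L (bInf N L 1) t⁻¹).transpose := by
    rw [divPow, divPow, Matrix.transpose_smul, Matrix.transpose_pow]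
  rw [inv_inv, e2] at e
  simp only [Function.comp_def, id]
  rw [← e, Matrix.mul_nonsing_inv_cancel_right _ _ (isUnit_dualOp hn')]

/-- The exponent of the gauge transformation at a site. -/
def gaugeExp (L : ℕ) (i : Fin L) : ℤ := 2 * (((L : ℤ) + 1) - 2 * (((i : ℕ) : ℤ) + 1))

/-- The gauge transformation that exchanges `q` and `q⁻¹`. -/
def gauge (N L : ℕ) (t : ℂ) : Op N L :=
  tensorOp fun i => diagonal fun σ : Fin N => (t ^ gaugeExp L i) ^ (σ : ℕ)

lemma gauge_mul_gauge {t : ℂ} (ht : t ≠ 0) : gauge N L t * gauge N L t⁻¹ = 1 := by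
  rw [gauge, gauge, tensorOp_mul, ← tensorOp_one]
  congr 1
  ext1 j
  rw [diagonal_mul_diagonal, ← diagonal_one]
  congr 1
  ext σ
  rw [inv_zpow, inv_pow, mul_inv_cancel₀ (pow_ne_zero _ (zpow_ne_zero _ ht))]

lemma diagonal_mul_fHat (g t : ℂ) : diagonal (fun σ : Fin N => g ^ (σ : ℕ)) * fHat N t =
    g • (fHat N t * diagonal fun σ : Fin N => g ^ (σ : ℕ)) := by
  ext τ σ
  rw [diagonal_mul, Matrix.smul_apply, mul_diagonal, fHat, of_apply]
  split_ifs with h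
  · rw [h, pow_succ, smul_eq_mul]; ring
  · simp

lemma eHat_mul_diagonal (g t : ℂ) : eHat N t * diagonal (fun σ : Fin N => g ^ (σ : ℕ)) =
    g • (diagonal (fun σ : Fin N => g ^ (σ : ℕ)) * eHat N t) := by
  ext τ σ
  rw [mul_diagonal, Matrix.smul_apply, diagonal_mul, eHat, of_apply]
  split_ifs with h
  · rw [← h, pow_succ, smul_eq_mul]; ring
  · simp

lemma diagonal_mul_kHalf (v : Fin N → ℂ) (t : ℂ) (p : ℤ) :
    diagonal v * kHalf N t p = kHalf N t p * diagonal v := by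
  rw [kHalf, diagonal_mul_diagonal, diagonal_mul_diagonal]
  congr 1; ext σ; ring

lemma tensorOp_update_smul (i : Fin L) (c : ℂ) (M : Fin L → LocOp N) :
    (tensorOp fun j => if j = i then c • M j else M j) = c • tensorOp M := by
  have : (fun j => if j = i then c • M j else M j) = fun j => (if j = i then c else 1) • M j := by
    ext1 j; split_ifs <;> simp
  rw [this, smul_tensorOp_prod, prod_ite_eq' univ i, if_pos (mem_univ i)]

lemma tensorOp_mul_gauge {t : ℂ} (i : Fin L) (p r : ℤ) {F F' : LocOp N} {c : ℂ}
    (hF : F' * diagonal (fun σ : Fin N => (t ^ gaugeExp L i) ^ (σ : ℕ)) =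
      c • (diagonal (fun σ : Fin N => (t ^ gaugeExp L i) ^ (σ : ℕ)) * F)) :
    tensorOp (fun j => if j < i then kHalf N t⁻¹ (-p) else if j = i then F' else
      kHalf N t⁻¹ (-r)) * gauge N L t = c • (gauge N L t *
        tensorOp fun j => if j < i then kHalf N t p else if j = i then F else kHalf N t r) := by
  rw [gauge, tensorOp_mul, tensorOp_mul, ← tensorOp_update_smul i]
  congr 1
  ext1 j
  by_cases h : j = i
  · grind
  · simp only [h, if_false, kHalf_inv, neg_neg]
    split_ifs <;> rw [diagonal_mul_kHalf]

lemma bInf_mul_gauge {t : ℂ} (ht : t ≠ 0) (s : ℤ) :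
    bInf N L (-s) t⁻¹ * gauge N L t = gauge N L t * bInf N L s t := by
  rw [bInf, bInf, sum_mul, mul_sum]
  refine sum_congr rfl fun i _ => ?_
  rw [smul_mul_assoc, mul_smul_comm, tensorOp_mul_gauge (c := (t ^ gaugeExp L i)⁻¹) i (-s) s,
    smul_smul, inv_zpow', ← zpow_neg, ← zpow_add₀ ht]
  · congr 2
    rw [gaugeExp]; ring
  · rw [fHat_inv, diagonal_mul_fHat, smul_smul, inv_mul_cancel₀ (zpow_ne_zero _ ht), one_smul]

lemma cInf_mul_gauge {t : ℂ} (ht : t ≠ 0) (s : ℤ) :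
    cInf N L (-s) t⁻¹ * gauge N L t = gauge N L t * cInf N L s t := by
  rw [cInf, cInf, sum_mul, mul_sum]
  refine sum_congr rfl fun i _ => ?_
  rw [smul_mul_assoc, mul_smul_comm, tensorOp_mul_gauge (c := t ^ gaugeExp L i) i s (-s),
    smul_smul, inv_zpow', ← zpow_add₀ ht]
  · congr 2
    rw [gaugeExp]; ring
  · rw [eHat_inv, eHat_mul_diagonal]

lemma continuousAt_gauge (ht : t₀ ≠ 0) : ContinuousAt (fun t => gauge N L t) t₀ := by
  refine tendsto_matrix fun a b => ?_
  simp only [gauge, tensorOp, of_apply]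
  refine tendsto_finsetProd _ fun i _ => ?_
  simp only [diagonal_apply]
  split_ifs
  · exact ((continuousAt_zpow₀ t₀ _ (Or.inl ht)).pow _).tendsto
  · exact tendsto_const_nhds

/-- The limit of divided powers, transported by the gauge transformation. -/
lemma tendsto_divPow_gauge (ht : t₀ ≠ 0) {X Y : ℂ → Op N L} {X₀ : Op N L}
    (h : ∀ t, t ≠ 0 → Y t⁻¹ * gauge N L t = gauge N L t * X t)
    (hX : Tendsto (divPow N L X) (𝓝[≠] t₀⁻¹) (𝓝 X₀)) :
    Tendsto (divPow N L Y) (𝓝[≠] t₀) (𝓝 (gauge N L t₀⁻¹ * X₀ * gauge N L t₀)) := by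
  have hi := tendsto_inv_punctured (inv_ne_zero ht)
  rw [inv_inv] at hi
  have h1 := (continuousAt_gauge (N := N) (L := L) ht).tendsto.mono_left
    (nhdsWithin_le_nhds (s := {t₀}ᶜ))
  have h2 := ((continuousAt_gauge (N := N) (L := L) (inv_ne_zero ht)).tendsto.mono_left
    (nhdsWithin_le_nhds (s := {t₀⁻¹}ᶜ))).comp hi
  refine ((h2.mul (hX.comp hi)).mul h1).congr' ?_
  filter_upwards [mem_nhdsWithin_of_mem_nhds (isOpen_ne.mem_nhds ht)] with t h3
  have e := divPow_intertwine (h t⁻¹ (inv_ne_zero h3))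
  have e2 := gauge_mul_gauge (N := N) (L := L) (inv_ne_zero h3)
  rw [inv_inv] at e e2
  simp only [Function.comp_def]
  rw [← e, mul_assoc, e2, mul_one]

end Symmetries

/-! ### Bethe equations without denominators -/

section PolynomialBethe

variable {N L R : ℕ}

/-- Regular solutions of the Bethe equations in polynomial form. -/
structure IsPolyBethe (L : ℕ) (q : ℂ) (s : Fin R → ℂ) : Prop where
  ne_zero : ∀ i, s i ≠ 0
  injective : Injective s
  regular : ∀ i k, i ≠ k → q * s k - q⁻¹ * s i ≠ 0
  bethe : ∀ i, (1 - q⁻¹ * s i) ^ L * ∏ k ∈ univ.erase i, (q * s k - q⁻¹ * s i) =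
    (1 - q * s i) ^ L * ∏ k ∈ univ.erase i, (q⁻¹ * s k - q * s i)
  left_ne_zero : ∀ i, (1 - q * s i) ^ L ≠ 0

lemma card_erase_univ (i : Fin R) : (univ.erase i).card = R - 1 := by simp

lemma IsPolyBethe.right_ne_zero {q : ℂ} {s : Fin R → ℂ} (h : IsPolyBethe L q s) (i : Fin R) :
    (1 - q⁻¹ * s i) ^ L ≠ 0 := by
  intro h0
  have e := h.bethe i
  rw [h0, zero_mul] at e
  refine mul_ne_zero (h.left_ne_zero i) (prod_ne_zero_iff.mpr ?_) e.symm
  intro k hk hk0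
  exact h.regular k i (ne_of_mem_erase hk) (by linear_combination -hk0)

/-- Inversion of `q` and of the Bethe roots. -/
lemma IsPolyBethe.inv {q : ℂ} (hq : q ≠ 0) (hqL : q ^ L = 1) {s : Fin R → ℂ}
    (h : IsPolyBethe L q s) : IsPolyBethe L q⁻¹ (fun i => (s i)⁻¹) := by
  have hs := h.ne_zero
  refine ⟨fun i => inv_ne_zero (hs i), fun i j hij => h.injective (inv_injective hij),
    fun i k hik h0 => h.regular i k hik ?_, fun i => ?_, fun i => ?_⟩
  · grind
  · have e1 : (1 - q⁻¹⁻¹ * (s i)⁻¹) ^ L * s i ^ L = (-1) ^ L * (1 - q⁻¹ * s i) ^ L := by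
      rw [← mul_pow, ← mul_pow]
      have : (1 - q⁻¹⁻¹ * (s i)⁻¹) * s i = q * ((-1) * (1 - q⁻¹ * s i)) := by grind
      rw [this, mul_pow q, hqL, one_mul]
    have e2 : (1 - q⁻¹ * (s i)⁻¹) ^ L * s i ^ L = (-1) ^ L * (1 - q * s i) ^ L := by
      have hqL' : q⁻¹ ^ L = 1 := by rw [inv_pow, hqL, inv_one]
      rw [← mul_pow, ← mul_pow]
      have : (1 - q⁻¹ * (s i)⁻¹) * s i = q⁻¹ * ((-1) * (1 - q * s i)) := by grind
      rw [this, mul_pow q⁻¹, hqL', one_mul]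
    have e3 : (∏ k ∈ univ.erase i, (q⁻¹ * (s k)⁻¹ - q⁻¹⁻¹ * (s i)⁻¹)) *
        ∏ k ∈ univ.erase i, (-(s k * s i)) =
        ∏ k ∈ univ.erase i, (q * s k - q⁻¹ * s i) := by
      rw [← prod_mul_distrib]
      refine prod_congr rfl fun k _ => ?_
      have := hs i; have := hs k; field_simp; ring
    have e4 : (∏ k ∈ univ.erase i, (q⁻¹⁻¹ * (s k)⁻¹ - q⁻¹ * (s i)⁻¹)) *
        ∏ k ∈ univ.erase i, (-(s k * s i)) =
        ∏ k ∈ univ.erase i, (q⁻¹ * s k - q * s i) := by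
      rw [← prod_mul_distrib]
      refine prod_congr rfl fun k _ => ?_
      have := hs i; have := hs k; field_simp; ring
    have h0 : s i ^ L * ∏ k ∈ univ.erase i, (-(s k * s i)) ≠ 0 :=
      mul_ne_zero (pow_ne_zero _ (hs i)) (prod_ne_zero_iff.mpr fun k _ =>
        neg_ne_zero.mpr (mul_ne_zero (hs k) (hs i)))
    refine mul_right_cancel₀ h0 ?_
    rw [mul_mul_mul_comm, e1, e3, mul_mul_mul_comm, e2, e4, mul_assoc, mul_assoc, h.bethe i]
  · have : 1 - q⁻¹ * (s i)⁻¹ = -(q⁻¹ * (s i)⁻¹) * (1 - q * s i) := by grind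
    rw [this, mul_pow]
    exact mul_ne_zero (pow_ne_zero _ (neg_ne_zero.mpr (mul_ne_zero (inv_ne_zero hq)
      (inv_ne_zero (hs i))))) (h.left_ne_zero i)

lemma IsPolyBethe.isBetheRoots {t : ℂ} (ht : t ≠ 0) (hN : 1 ≤ N) (hqN : (t ^ 2) ^ N = 1)
    (hR : N ∣ R) {s : Fin R → ℂ} (h : IsPolyBethe L (t ^ 2) s) : IsBetheRoots N L t s := by
  have hq : t ^ 2 ≠ 0 := pow_ne_zero 2 ht
  have hp : (t ^ 2) ^ (N - 1) = (t ^ 2)⁻¹ := by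
    refine eq_inv_of_mul_eq_one_left ?_
    rw [← pow_succ, Nat.sub_add_cancel hN, hqN]
  refine ⟨h.ne_zero, h.injective, h.regular, fun i => ?_⟩
  have hR1 : 1 ≤ R := i.pos
  have hqR : (t ^ 2) ^ R = 1 := by
    obtain ⟨m, rfl⟩ := hR
    rw [pow_mul, hqN, one_pow]
  have hq1 : (t ^ 2) ^ (R - 1) = (t ^ 2)⁻¹ := by
    refine eq_inv_of_mul_eq_one_left ?_
    rw [← pow_succ, Nat.sub_add_cancel hR1, hqR]
  have e1 : chainWeight N L t (s i) = (1 - (t ^ 2)⁻¹ * s i) ^ L := by rw [chainWeight, hp]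
  have e2 : chainWeight N L t (((t ^ 2) ^ 2)⁻¹ ^ (N - 1) * s i) = (1 - t ^ 2 * s i) ^ L := by
    rw [chainWeight, inv_pow, pow_right_comm (t ^ 2) 2, hp, inv_pow, inv_inv, ← mul_assoc]
    congr 2; field_simp
  have hD : ∏ k ∈ univ.erase i, (s k - s i) ≠ 0 := prod_ne_zero_iff.mpr fun k hk =>
    sub_ne_zero.mpr fun hk' => ne_of_mem_erase hk (h.injective hk')
  have e3 : ∏ k ∈ univ.erase i, fD (t ^ 2) (s i) (s k) =
      (∏ k ∈ univ.erase i, (t ^ 2 * s k - (t ^ 2)⁻¹ * s i)) / ∏ k ∈ univ.erase i, (s k - s i) := by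
    rw [← prod_div_distrib]; rfl
  have e4 : ∏ k ∈ univ.erase i, fD (t ^ 2) (s k) (s i) =
      (∏ k ∈ univ.erase i, ((t ^ 2)⁻¹ * s k - t ^ 2 * s i)) / ∏ k ∈ univ.erase i, (s k - s i) := by
    rw [← prod_div_distrib]
    refine prod_congr rfl fun k _ => ?_
    rw [fD, ← neg_div_neg_eq, neg_sub, neg_sub]
  rw [prod_mul_distrib, prod_mul_distrib, prod_const, prod_const,
    card_erase_univ, inv_pow, hq1, inv_inv, e1, e2, e3, e4]
  have h0 := h.ne_zero i
  have hb := h.bethe i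
  generalize (∏ k ∈ univ.erase i, (s k - s i)) = D at *
  have e5 : (t ^ 2) ^ 2 * (t ^ 2)⁻¹ = t ^ 2 := by field_simp
  simp only [div_eq_mul_inv]
  linear_combination (t ^ 2 * (s i)⁻¹ * D⁻¹) * hb - ((1 - t ^ 2 * s i) ^ L * (s i)⁻¹ *
    ((∏ k ∈ univ.erase i, ((t ^ 2)⁻¹ * s k - t ^ 2 * s i)) * D⁻¹)) * e5

/-- The nonvanishing of the on-shell Bethe vector of the homogeneous chain. -/
lemma IsPolyBethe.offShell_ne_zero (hN : Odd N) (h3 : 3 ≤ N) {t : ℂ}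
    (hq : IsPrimitiveRoot (t ^ 2) N) (hL : N ∣ L) (hR : N ∣ R) (hLR : 2 * R ≤ L * (N - 1))
    {s : Fin R → ℂ} (h : IsPolyBethe L (t ^ 2) s) :
    ((ofFn fun i => homMat N L t (s i) 0 1).prod).mulVec (vac N L) ≠ 0 := by
  have : NeZero N := ⟨by omega⟩
  have hq0 : t ^ 2 ≠ 0 := hq.ne_zero (by omega)
  have ht : t ≠ 0 := by rintro rfl; simp at hq0
  have ht2 : t ^ 2 - (t ^ 2)⁻¹ ≠ 0 := sub_inv_ne_zero_of_primitive h3 hq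
  have hp : (t ^ 2) ^ (N - 1) = (t ^ 2)⁻¹ := by
    refine eq_inv_of_mul_eq_one_left ?_
    rw [← pow_succ, Nat.sub_add_cancel (by omega), hq.pow_eq_one]
  have hqL : (t ^ 2) ^ L = 1 := (hq.pow_eq_one_iff_dvd L).mpr hL
  have hμ : topWeight N t ≠ 0 := pow_ne_zero _ ht
  have hμ2 : topWeight N t ^ 2 = (t ^ 2)⁻¹ := by rw [topWeight, ← pow_mul, mul_comm, pow_mul, hp]
  have hμi : (topWeight N t)⁻¹ = topWeight N t * t ^ 2 :=
    inv_eq_of_mul_eq_one_right (by rw [← mul_assoc, ← sq, hμ2, inv_mul_cancel₀ hq0])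
  have ha : ∀ x, (t⁻¹ * (topWeight N t - x * (topWeight N t)⁻¹)) ^ L =
      (t⁻¹ * topWeight N t) ^ L * (1 - t ^ 2 * x) ^ L := fun x => by
    rw [← mul_pow]
    congr 1
    rw [hμi]; ring
  have hd : ∀ x, (t * ((topWeight N t)⁻¹ - x * topWeight N t)) ^ L =
      (t⁻¹ * topWeight N t) ^ L * (1 - (t ^ 2)⁻¹ * x) ^ L := fun x => by
    have e : (t⁻¹ * topWeight N t) ^ L = (t * (topWeight N t)⁻¹) ^ L := by
      have : t * (topWeight N t)⁻¹ = (t ^ 2) ^ 2 * (t⁻¹ * topWeight N t) := by grind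
      rw [this, mul_pow ((t ^ 2) ^ 2), pow_right_comm (t ^ 2) 2 L, hqL, one_pow, one_mul]
    rw [e, ← mul_pow, ← hμ2]
    congr 1
    field_simp
  have hax : ∀ i, (t⁻¹ * (topWeight N t - s i * (topWeight N t)⁻¹)) ^ L ≠ 0 := fun i => by
    rw [ha]
    exact mul_ne_zero (pow_ne_zero _ (mul_ne_zero (inv_ne_zero ht) hμ)) (h.left_ne_zero i)
  have key := onShell_ne_zero h3 hN hR rfl hq hLR (isRTT_homEnd (L := L) ht ht2)
    (fun x => isTriangular_homEnd t x) (show (proj 0 : Dual ℂ (Conf N L → ℂ))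
      (vac N L) = 1 from vac_zero) (pow_ne_zero L (mul_ne_zero (inv_ne_zero ht) hμ))
    ha hd h.ne_zero h.injective (fun i j hij h0 => h.regular j i hij.symm (by
      field_simp; linear_combination h0)) hax fun j => by
      rw [ha, hd, mul_assoc, mul_assoc]
      congr 1
      have e1 : ∏ k ∈ univ.erase j, fA (t ^ 2) (s j) (s k) =
          (∏ k ∈ univ.erase j, ((t ^ 2)⁻¹ * s k - t ^ 2 * s j)) /
            ∏ k ∈ univ.erase j, (s k - s j) := by rw [← prod_div_distrib]; rfl
      have e2 : ∏ k ∈ univ.erase j, fD (t ^ 2) (s j) (s k) =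
          (∏ k ∈ univ.erase j, (t ^ 2 * s k - (t ^ 2)⁻¹ * s j)) /
            ∏ k ∈ univ.erase j, (s k - s j) := by rw [← prod_div_distrib]; rfl
      rw [e1, e2, ← mul_div_assoc, ← mul_div_assoc, h.bethe j]
  intro h0
  apply key
  rw [← h0, ← opEnd_apply, opEnd_list_prod, List.map_ofFn]
  rfl

end PolynomialBethe

/-! ### Gauge transformations of the monodromy matrix -/

section Gauge

variable {N L R : ℕ}

/-- The diagonal operator with eigenvalue `∏ i, g i ^ σ i`. -/
def weightOp (N : ℕ) (g : Fin L → ℂ) : Op N L :=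
  tensorOp fun i => diagonal fun σ : Fin N => g i ^ (σ : ℕ)

lemma tensorOp_diagonal (d : Fin L → Fin N → ℂ) :
    tensorOp (fun i => diagonal (d i)) = diagonal fun σ => ∏ i, d i (σ i) := by
  ext σ τ
  rw [tensorOp, of_apply, diagonal_apply]
  split_ifs with h
  · subst h; simp
  · obtain ⟨i, hi⟩ := Function.ne_iff.mp h
    exact prod_eq_zero (mem_univ i) (Matrix.diagonal_apply_ne _ hi)

lemma weightOp_eq (g : Fin L → ℂ) :
    weightOp N g = diagonal fun σ => ∏ i, g i ^ (σ i : ℕ) := tensorOp_diagonal _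

lemma weightOp_one : weightOp N (fun _ : Fin L => 1) = 1 := by
  rw [weightOp_eq, ← diagonal_one]; simp

lemma weightOp_mulVec_vac (g : Fin L → ℂ) : (weightOp N g).mulVec (vac N L) = vac N L := by
  ext σ
  rw [weightOp_eq, mulVec_diagonal, vac]
  split_ifs with h
  · simp [h]
  · simp

lemma siteOp_mul_weightOp (g : Fin L → ℂ) (i : Fin L) {X Y : LocOp N} {a b : ℂ}
    (h : a • (X * diagonal fun σ : Fin N => g i ^ (σ : ℕ)) =
      b • ((diagonal fun σ : Fin N => g i ^ (σ : ℕ)) * Y)) :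
    a • (siteOp i X * weightOp N g) = b • (weightOp N g * siteOp i Y) := by
  have e : ∀ c : ℂ, ∀ Z : LocOp N, c • tensorOp (fun j : Fin L => if j = i then Z else
      diagonal fun σ : Fin N => g j ^ (σ : ℕ)) = tensorOp (fun j : Fin L =>
        if j = i then c • Z else diagonal fun σ : Fin N => g j ^ (σ : ℕ)) := fun c Z => by
    rw [← tensorOp_update_smul i]
    congr 1; ext1 j; split_ifs <;> rfl
  have e1 : siteOp i X * weightOp N g = tensorOp (fun j : Fin L => if j = i then
      X * (diagonal fun σ : Fin N => g i ^ (σ : ℕ)) else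
      diagonal fun σ : Fin N => g j ^ (σ : ℕ)) := by
    rw [weightOp, siteOp_mul_tensorOp]
    congr 1; ext1 j
    by_cases hj : j = i
    · subst hj; simp
    · simp [hj]
  have e2 : weightOp N g * siteOp i Y = tensorOp (fun j : Fin L => if j = i then
      (diagonal fun σ : Fin N => g i ^ (σ : ℕ)) * Y else
      diagonal fun σ : Fin N => g j ^ (σ : ℕ)) := by
    rw [weightOp, siteOp, tensorOp_mul]
    congr 1; ext1 j
    by_cases hj : j = i
    · subst hj; simp
    · simp [hj]
  rw [e1, e2, e, e, h]

lemma telescope {A : Type*} [Monoid A] (v : ℕ → A) (P Q : Fin L → A)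
    (h : ∀ i : Fin L, P i * v i = v (i + 1) * Q i) :
    (ofFn P).reverse.prod * v 0 = v L * (ofFn Q).reverse.prod := by
  induction L with
  | zero => simp
  | succ L ih =>
    have h1 := ih (fun i => P i.castSucc) (fun i => Q i.castSucc) fun i => h i.castSucc
    have h2 := h (Fin.last L)
    rw [Fin.val_last] at h2
    rw [List.ofFn_succ', List.ofFn_succ', List.concat_eq_append, List.concat_eq_append,
      List.reverse_append, List.reverse_append, List.prod_append, List.prod_append, mul_assoc, h1]
    grind

/-- Two chains with gauge equivalent site matrices. -/
lemma monodromy_gauge (P Q : Fin L → M₂ (LocOp N)) (g : Fin L → ℂ)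
    (v : ℕ → Fin 2 → ℂ) (h : ∀ (i : Fin L) (m n : Fin 2),
      v i n • (P i m n * diagonal fun σ : Fin N => g i ^ (σ : ℕ)) =
        v (i + 1) m • ((diagonal fun σ : Fin N => g i ^ (σ : ℕ)) * Q i m n)) (m n : Fin 2) :
    v 0 n • ((ofFn fun i => (P i).map (siteHom N i)).reverse.prod m n * weightOp N g) =
      v L m • (weightOp N g * (ofFn fun i => (Q i).map (siteHom N i)).reverse.prod m n) := by
  have h1 := telescope (fun k => diagonal fun m => v k m • weightOp N g)
    (fun i => (P i).map (siteHom N i)) (fun i => (Q i).map (siteHom N i)) fun i => by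
      ext1 m n
      rw [mul_diagonal, diagonal_mul, map_apply, map_apply,
        siteHom_apply, siteHom_apply, mul_smul_comm, smul_mul_assoc]
      exact siteOp_mul_weightOp g i (h i m n)
  have h2 := congrFun (congrFun h1 m) n
  rwa [mul_diagonal, diagonal_mul, mul_smul_comm, smul_mul_assoc] at h2

/-- The site matrix of the homogeneous chain. -/
def homLoc (N : ℕ) (t x : ℂ) : M₂ (LocOp N) :=
  siteMat t 1 1 (kHalf N t 1) (kHalf N t (-1)) (eHat N t) (fHat N t) x

lemma homMat_eq_homLoc [NeZero N] {t : ℂ} (ht : t ≠ 0) (x : ℂ) :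
    homMat N L t x = (ofFn fun i => (homLoc N t x).map (siteHom N i)).reverse.prod := by
  rw [homMat, chainMat, List.map_reverse, List.ofFn_eq_map]
  congr 3
  ext1 i
  rw [chainSite_eq_map, locK_topWeight ht, locK'_topWeight ht, locE_topWeight ht]
  rfl

lemma opB_eq [NeZero N] {t z : ℂ} (ht : t ≠ 0) (hz : z ≠ 0) :
    opB N L t z = (z⁻¹ * z ^ L) • homMat N L t (z ^ 2)⁻¹ 0 1 := by
  have h := monodromy_gauge (L := L) (N := N)
    (fun _ => !![t⁻¹ • (z • kHalf N t 1 - z⁻¹ • kHalf N t (-1)),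
      (t ^ 2 - (t ^ 2)⁻¹) • fHat N t; (t ^ 2 - (t ^ 2)⁻¹) • eHat N t,
      t • (z • kHalf N t (-1) - z⁻¹ • kHalf N t 1)]) (fun _ => homLoc N t (z ^ 2)⁻¹)
    (fun _ => 1) (fun k m => z ^ k * ![1, z] m) (fun i m n => by
      simp only [one_pow, diagonal_one, mul_one, one_mul]
      fin_cases m <;> fin_cases n <;>
        simp only [homLoc, siteMat, of_apply, cons_val', cons_val_zero,
          cons_val_one, cons_val_fin_one, smul_sub, smul_smul, Fin.mk_zero,
          Fin.isValue, Fin.mk_one] <;> match_scalars <;> field_simp <;> ring) 0 1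
  rw [weightOp_one, mul_one, one_mul, ← homMat_eq_homLoc ht] at h
  have e : opB N L t z = (ofFn fun i : Fin L => (!![t⁻¹ • (z • kHalf N t 1 - z⁻¹ •
      kHalf N t (-1)), (t ^ 2 - (t ^ 2)⁻¹) • fHat N t; (t ^ 2 - (t ^ 2)⁻¹) • eHat N t,
      t • (z • kHalf N t (-1) - z⁻¹ • kHalf N t 1)]).map (siteHom N i)).reverse.prod 0 1 := by
    rw [opB, monodromy]
    refine congrArg (fun l : List (M₂ (Op N L)) => l.reverse.prod 0 1)
      (congrArg ofFn (funext fun i => ?_))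
    refine Matrix.ext fun a b => ?_
    fin_cases a <;> fin_cases b <;> rfl
  rw [← e] at h
  simp only [pow_zero, one_mul, cons_val_one, cons_val_zero, mul_one, cons_val_fin_one] at h
  rw [mul_smul, ← h, smul_smul, inv_mul_cancel₀ hz, one_smul]

lemma weightOp_mul_homMat [NeZero N] {t x g : ℂ} (ht : t ≠ 0) :
    weightOp N (fun _ => g) * homMat N L t x 0 1 =
      g • (homMat N L t x 0 1 * weightOp N fun _ => g) := by
  have h := monodromy_gauge (L := L) (N := N) (fun _ => homLoc N t x) (fun _ => homLoc N t x)
    (fun _ => g) (fun _ m => ![1, g] m) (fun i m n => by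
      have e := eHat_mul_diagonal (N := N) g t
      have f := diagonal_mul_fHat (N := N) g t
      fin_cases m <;> fin_cases n <;>
        simp [homLoc, siteMat, sub_mul, mul_sub, diagonal_mul_kHalf, e, f, smul_comm g]) 0 1
  rw [← homMat_eq_homLoc ht] at h
  simpa using h.symm

lemma gauge_mul_homMat [NeZero N] {t x : ℂ} (ht : t ≠ 0) (hx : x ≠ 0) :
    gauge N L t * homMat N L t x 0 1 =
      (x⁻¹ * (-x) ^ L) • (homMat N L t⁻¹ x⁻¹ 0 1 * gauge N L t) := by
  have h := monodromy_gauge (L := L) (N := N) (fun _ => homLoc N t⁻¹ x⁻¹)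
    (fun _ => homLoc N t x) (fun i => t ^ gaugeExp L i)
    (fun k m => (-x⁻¹) ^ k * ![x * t ^ (2 * (k : ℤ) - L), t ^ ((L : ℤ) - 2 * k)] m) (fun i m n => by
      have e := eHat_mul_diagonal (N := N) (t ^ gaugeExp L i) t
      have f := diagonal_mul_fHat (N := N) (t ^ gaugeExp L i) t
      have e1 : t ^ (2 * ((i : ℤ) + 1) - L) = t ^ 2 * t ^ (2 * (i : ℤ) - L) := by
        rw [← zpow_natCast, ← zpow_add₀ ht]; congr 1; push_cast; ring
      have e2 : t ^ ((L : ℤ) - 2 * i) = t ^ 2 * t ^ ((L : ℤ) - 2 * ((i : ℤ) + 1)) := by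
        rw [← zpow_natCast, ← zpow_add₀ ht]; congr 1; push_cast; ring
      have e4 : t ^ (2 * (i : ℤ) - L) * t ^ gaugeExp L i = t ^ ((L : ℤ) - 2 * ((i : ℤ) + 1)) := by
        rw [← zpow_add₀ ht, gaugeExp]; congr 1; ring
      fin_cases m <;> fin_cases n <;>
        simp [homLoc, siteMat, sub_mul, mul_sub, diagonal_mul_kHalf, e, f, kHalf_inv,
          eHat_inv, fHat_inv, smul_smul, smul_sub]
      all_goals match_scalars <;> rw [← sub_eq_zero] <;> simp only [e1, e2, ← e4, pow_succ (-x⁻¹)] <;>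
        field_simp <;> ring) 0 1
  rw [← homMat_eq_homLoc ht, ← homMat_eq_homLoc (inv_ne_zero ht)] at h
  have e0 : ((2 : ℤ) * L - L) = L := by ring
  have e1 : ((L : ℤ) - 2 * (0 : ℕ)) = L := by simp
  simp only [pow_zero, one_mul, cons_val_one, cons_val_zero, cons_val_fin_one, e0, e1] at h
  have h0 : t ^ (L : ℤ) ≠ 0 := zpow_ne_zero _ ht
  have h1 : (-x⁻¹) ^ L * (x * t ^ (L : ℤ)) ≠ 0 :=
    mul_ne_zero (pow_ne_zero _ (neg_ne_zero.mpr (inv_ne_zero hx))) (mul_ne_zero hx h0)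
  have e2 : (-x) ^ L = ((-x⁻¹) ^ L)⁻¹ := by rw [← inv_pow, inv_neg, inv_inv]
  refine smul_right_injective _ h1 (h.symm.trans ?_)
  change _ = ((-x⁻¹) ^ L * (x * t ^ (L : ℤ))) • _
  rw [smul_smul, e2]
  congr 1
  have h2 : (-x⁻¹) ^ L ≠ 0 := pow_ne_zero _ (neg_ne_zero.mpr (inv_ne_zero hx))
  generalize (-x⁻¹) ^ L = c at h2 ⊢
  field_simp

lemma mul_list_prod {A : Type*} [Ring A] [Algebra ℂ A] (G : A) (X Y : Fin R → A) (c : Fin R → ℂ)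
    (h : ∀ i, G * X i = c i • (Y i * G)) :
    G * (ofFn X).prod = (∏ i, c i) • ((ofFn Y).prod * G) := by
  induction R with
  | zero => simp
  | succ R ih =>
    rw [List.ofFn_succ, List.ofFn_succ, List.prod_cons, List.prod_cons, ← mul_assoc, h,
      smul_mul_assoc, mul_assoc, ih _ _ _ fun i => h i.succ, mul_smul_comm, smul_smul,
      Fin.prod_univ_succ, mul_assoc]

lemma offShell_univ [NeZero N] {t : ℂ} (ht : t ≠ 0) (ht2 : t ^ 2 - (t ^ 2)⁻¹ ≠ 0)
    (ht4 : (t ^ 2) ^ 4 ≠ 1) {s : Fin R → ℂ} (hs : ∀ i, s i ≠ 0) :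
    ((ofFn fun i => homMat N L t (s i) 0 1).prod).mulVec (vac N L) = offShell N L t s univ := by
  rw [← bvec_eq_offShell (hq := pow_ne_zero 2 ht) (hq4 := ht4) (hT := isRTT_homEnd ht ht2)
    (htri := isTriangular_homEnd t) (hv := vac_zero) (hs := hs)]
  have h := (ExchangeSystem.ofRTT (pow_ne_zero 2 ht) ht4 (isRTT_homEnd (N := N) (L := L) ht ht2)
    (isTriangular_homEnd t) vac_zero s hs).list_prod_B_vac (List.nodup_finRange R)
  rw [List.toFinset_finRange] at h
  rw [← h, ← opEnd_apply, opEnd_list_prod, List.ofFn_eq_map, List.map_map]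
  rfl

lemma betheState_eq [NeZero N] {t : ℂ} (ht : t ≠ 0) {z : Fin R → ℂ} (hz : ∀ i, z i ≠ 0) :
    betheState N L t z = (∏ i, ((z i)⁻¹ * z i ^ L)) •
      ((ofFn fun i => homMat N L t (z i ^ 2)⁻¹ 0 1).prod).mulVec (vac N L) := by
  have h := mul_list_prod (1 : Op N L) (fun i => opB N L t (z i))
    (fun i => homMat N L t (z i ^ 2)⁻¹ 0 1) (fun i => (z i)⁻¹ * z i ^ L) fun i => by
      rw [one_mul, mul_one, opB_eq ht (hz i)]
  rw [one_mul, mul_one] at h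
  rw [betheState, h, smul_mulVec]

lemma gauge_mulVec [NeZero N] {t : ℂ} (ht : t ≠ 0) {s : Fin R → ℂ} (hs : ∀ i, s i ≠ 0) :
    (gauge N L t).mulVec (((ofFn fun i => homMat N L t (s i) 0 1).prod).mulVec (vac N L)) =
      (∏ i, ((s i)⁻¹ * (-s i) ^ L)) •
        ((ofFn fun i => homMat N L t⁻¹ (s i)⁻¹ 0 1).prod).mulVec (vac N L) := by
  rw [mulVec_mulVec, mul_list_prod _ _ (fun i => homMat N L t⁻¹ (s i)⁻¹ 0 1) _ fun i =>
    gauge_mul_homMat ht (hs i), smul_mulVec, ← mulVec_mulVec]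
  congr 2
  exact weightOp_mulVec_vac _

/-- The Bethe vectors are supported on the configurations with `R` lowered spins. -/
lemma weight_eq_of_ne_zero [NeZero N] {t : ℂ} (ht : t ≠ 0) {s : Fin R → ℂ} {σ : Conf N L}
    (h : ((ofFn fun i => homMat N L t (s i) 0 1).prod).mulVec (vac N L) σ ≠ 0) :
    ∑ i, (σ i : ℕ) = R := by
  have h1 : (weightOp N fun _ : Fin L => (2 : ℂ)).mulVec
      (((ofFn fun i => homMat N L t (s i) 0 1).prod).mulVec (vac N L)) =
      (2 : ℂ) ^ R • ((ofFn fun i => homMat N L t (s i) 0 1).prod).mulVec (vac N L) := by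
    rw [mulVec_mulVec, mul_list_prod _ _ (fun i => homMat N L t (s i) 0 1) _ fun i =>
      weightOp_mul_homMat ht, smul_mulVec, ← mulVec_mulVec, weightOp_mulVec_vac]
    simp
  have h2 := congrFun h1 σ
  rw [weightOp_eq, mulVec_diagonal, Pi.smul_apply, smul_eq_mul, prod_pow_eq_pow_sum] at h2
  have h3 : (2 : ℂ) ^ (∑ i, (σ i : ℕ)) = 2 ^ R := mul_right_cancel₀ h h2
  exact Nat.pow_right_injective le_rfl (by exact_mod_cast h3)

end Gauge

/-! ### The polynomial of the Bethe state -/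

section DrinfeldPolynomial

open Polynomial

variable {N L R : ℕ}

/-- The polynomial `∏ (1 - x / s_i)`. -/
def rootPoly (s : Fin R → ℂ) : ℂ[X] := ∏ i, (1 - C (s i)⁻¹ * X)

/-- The polynomial `((1 - x ^ N) / (1 - x)) ^ L`. -/
def geomPoly (N L : ℕ) : ℂ[X] := (∑ k ∈ range N, X ^ k) ^ L

lemma geomPoly_mul (N L : ℕ) : geomPoly N L * (1 - X) ^ L = (1 - X ^ N) ^ L := by
  rw [geomPoly, ← mul_pow, geom_sum_mul_neg]

lemma natDegree_geomPoly_le (N L : ℕ) : (geomPoly N L).natDegree ≤ L * (N - 1) := by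
  refine natDegree_pow_le.trans (Nat.mul_le_mul_left L (natDegree_sum_le_of_forall_le _ _ ?_))
  intro k hk
  have := mem_range.mp hk
  rw [natDegree_X_pow]; omega

lemma eval_rootPoly (s : Fin R → ℂ) (x : ℂ) : (rootPoly s).eval x = ∏ i, (1 - (s i)⁻¹ * x) := by
  simp [rootPoly, eval_prod]

lemma one_sub_C_mul_X {a : ℂ} (ha : a ≠ 0) : (1 - C a * X : ℂ[X]) = C (-a) * (X - C a⁻¹) := by
  rw [mul_sub, ← C_mul, neg_mul, mul_inv_cancel₀ ha]
  simp; ring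

lemma dil_one_sub (c a : ℂ) : dil c (1 - C a * X) = 1 - C (a * c) * X := by simp [dil, mul_assoc]

lemma dil_rootPoly (c : ℂ) (s : Fin R → ℂ) :
    dil c (rootPoly s) = ∏ i, (1 - C ((s i)⁻¹ * c) * X) := by
  rw [← prod_congr rfl fun i _ => dil_one_sub c (s i)⁻¹, dil, rootPoly, Polynomial.prod_comp]
  rfl

lemma natDegree_dil_rootPoly {c : ℂ} (hc : c ≠ 0) {s : Fin R → ℂ} (hs : ∀ i, s i ≠ 0) :
    (dil c (rootPoly s)).natDegree = R := by
  have h0 : ∀ i, (s i)⁻¹ * c ≠ 0 := fun i => mul_ne_zero (inv_ne_zero (hs i)) hc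
  rw [dil_rootPoly, natDegree_prod]
  · rw [sum_congr rfl fun i _ => by
      rw [one_sub_C_mul_X (h0 i), natDegree_C_mul (neg_ne_zero.mpr (h0 i)), natDegree_X_sub_C]]
    simp
  · intro i _
    rw [one_sub_C_mul_X (h0 i)]
    exact mul_ne_zero (C_ne_zero.mpr (neg_ne_zero.mpr (h0 i))) (X_sub_C_ne_zero _)

lemma isCoprime_one_sub {a b : ℂ} (hb : b ≠ 0) (hab : a ≠ b) :
    IsCoprime (1 - C a * X : ℂ[X]) (1 - C b * X) := by
  refine ⟨C (b / (b - a)), C (-a / (b - a)), ?_⟩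
  have h : b - a ≠ 0 := sub_ne_zero.mpr hab.symm
  have e : (C (b / (b - a)) * (1 - C a * X) + C (-a / (b - a)) * (1 - C b * X) : ℂ[X]) =
      C (b / (b - a) + -a / (b - a)) + C (-(b / (b - a) * a) - -a / (b - a) * b) * X := by
    simp only [map_add, map_sub, map_mul, map_neg]; ring
  have h1 : b / (b - a) + -a / (b - a) = 1 := by rw [← add_div, ← sub_eq_add_neg, div_self h]
  have h2 : -(b / (b - a) * a) - -a / (b - a) * b = 0 := by ring
  rw [e, h1, h2, map_one, map_zero, zero_mul, add_zero]

/-- The Bethe equations as a divisibility. -/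
lemma IsPolyBethe.dvd {q : ℂ} (hq : q ≠ 0) (hqR : q ^ R = 1) (hqN : q ^ N = 1)
    {s : Fin R → ℂ} (h : IsPolyBethe L q s) :
    dil q⁻¹ (rootPoly s) ∣ geomPoly N L * dil (q⁻¹ ^ 3) (rootPoly s) +
      dil (q⁻¹ ^ 2) (geomPoly N L) * dil q (rootPoly s) := by
  have hs := h.ne_zero
  rw [dil_rootPoly]
  refine prod_dvd_of_coprime (fun i _ j _ hij => isCoprime_one_sub
    (mul_ne_zero (inv_ne_zero (hs j)) (inv_ne_zero hq)) fun e => hij (h.injective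
      (inv_injective (mul_right_cancel₀ (inv_ne_zero hq) e)))) fun i _ => ?_
  rw [one_sub_C_mul_X (mul_ne_zero (inv_ne_zero (hs i)) (inv_ne_zero hq)), ← mul_inv, inv_inv]
  refine (isUnit_C.mpr (isUnit_iff_ne_zero.mpr (neg_ne_zero.mpr (inv_ne_zero
    (mul_ne_zero (hs i) hq))))).mul_left_dvd.mpr (dvd_iff_isRoot.mpr ?_)
  rw [IsRoot.def, eval_add, eval_mul, eval_mul, eval_dil, eval_dil, eval_dil, eval_rootPoly,
    eval_rootPoly]
  have hR1 : 1 ≤ R := i.pos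
  have hq1 : q ^ (R - 1) = q⁻¹ := eq_inv_of_mul_eq_one_left (by
    rw [← pow_succ, Nat.sub_add_cancel hR1, hqR])
  have hq2 : q⁻¹ ^ (R - 1) = q := by rw [inv_pow, hq1, inv_inv]
  have e1 : ∏ k, (1 - (s k)⁻¹ * (q⁻¹ ^ 3 * (s i * q))) = (1 - q⁻¹ ^ 2) *
      (q * ((∏ k ∈ univ.erase i, (s k)⁻¹) * ∏ k ∈ univ.erase i, (q * s k - q⁻¹ * s i))) := by
    rw [← mul_prod_erase _ _ (mem_univ i)]
    congr 1
    · grind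
    · nth_rewrite 3 [← hq2]
      rw [← card_erase_univ i, ← prod_const, ← prod_mul_distrib, ← prod_mul_distrib]
      grind
  have e2 : ∏ k, (1 - (s k)⁻¹ * (q * (s i * q))) = (1 - q ^ 2) *
      (q⁻¹ * ((∏ k ∈ univ.erase i, (s k)⁻¹) * ∏ k ∈ univ.erase i, (q⁻¹ * s k - q * s i))) := by
    rw [← mul_prod_erase _ _ (mem_univ i)]
    congr 1
    · grind
    · nth_rewrite 1 [← hq1]
      rw [← card_erase_univ i, ← prod_const, ← prod_mul_distrib, ← prod_mul_distrib]
      refine prod_congr rfl fun k _ => ?_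
      grind
  have g : ∀ x, (geomPoly N L).eval x * (1 - x) ^ L = (1 - x ^ N) ^ L := fun x => by
    simpa using congrArg (eval x) (geomPoly_mul N L)
  have g1 := g (s i * q)
  have g2 := g (q⁻¹ ^ 2 * (s i * q))
  have e3 : q⁻¹ ^ 2 * (s i * q) = q⁻¹ * s i := by field_simp
  have e4 : (q⁻¹ * s i) ^ N = (s i * q) ^ N := by
    rw [mul_pow, mul_pow, inv_pow, hqN, inv_one, one_mul, mul_one]
  rw [e3, e4, ← g1] at g2
  rw [e1, e2, e3]
  have b := h.bethe i
  refine mul_right_cancel₀ (mul_ne_zero (h.left_ne_zero i) (h.right_ne_zero i)) ?_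
  rw [zero_mul]
  rw [mul_comm q (s i)] at *
  generalize (geomPoly N L).eval (s i * q) = G1 at *
  generalize (geomPoly N L).eval (q⁻¹ * s i) = G2 at *
  generalize (∏ k ∈ univ.erase i, (s k)⁻¹) = c at *
  generalize (∏ k ∈ univ.erase i, (q * s k - q⁻¹ * s i)) = P at *
  generalize (∏ k ∈ univ.erase i, (q⁻¹ * s k - s i * q)) = Q at *
  generalize (1 - s i * q) ^ L = A at *
  generalize (1 - q⁻¹ * s i) ^ L = B at *
  have hqi := mul_inv_cancel₀ hq
  linear_combination (q - q⁻¹) * c * G1 * A * b - (q - q⁻¹) * c * A * Q * g2 -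
    (q⁻¹ * G1 * A * B * c * P + q * G2 * B * A * c * Q) * hqi

/-- The polynomial part of the generating function of the eigenvalues. -/
lemma IsPolyBethe.exists_polynomial {q : ℂ} (hq : q ≠ 0) (hq2 : q ^ 2 ≠ 1) (hqR : q ^ R = 1)
    (hqN : q ^ N = 1) (hN : 1 ≤ N) {s : Fin R → ℂ} (h : IsPolyBethe L q s) :
    ∃ A B T : ℂ[X], geomPoly N L = A * dil q (rootPoly s) + B * dil q⁻¹ (rootPoly s) ∧
      A + dil (q⁻¹ ^ 2) B = dil q⁻¹ (rootPoly s) * T ∧ T.natDegree ≤ L * (N - 1) - 2 * R ∧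
      2 * R ≤ L * (N - 1) := by
  have hs := h.ne_zero
  have hqi := inv_ne_zero hq
  have hd : ∀ c, dil c (rootPoly s) = ∏ i, (1 - C ((s i)⁻¹ * c) * X) := fun c => dil_rootPoly c s
  have hreg : ∀ i j, s i ≠ q ^ 2 * s j := fun i j e => by
    by_cases hij : i = j
    · grind
    · exact h.regular i j hij (by rw [e]; field_simp; ring)
  have hcop : IsCoprime (dil q⁻¹ (rootPoly s)) (dil q (rootPoly s)) := by
    rw [hd, hd]
    refine IsCoprime.prod_left fun i _ => IsCoprime.prod_right fun j _ => isCoprime_one_sub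
      (mul_ne_zero (inv_ne_zero (hs j)) hq) fun e => hreg j i ?_
    grind
  have hcop' : IsCoprime (dil q⁻¹ (rootPoly s)) (dil (q⁻¹ ^ 3) (rootPoly s)) := by
    rw [hd, hd]
    refine IsCoprime.prod_left fun i _ => IsCoprime.prod_right fun j _ => isCoprime_one_sub
      (mul_ne_zero (inv_ne_zero (hs j)) (pow_ne_zero 3 hqi)) fun e => hreg i j ?_
    grind
  have hdd : ∀ c c', dil c (dil c' (rootPoly s)) = dil (c' * c) (rootPoly s) := fun c c' =>
    dil_dil c c' _
  set G := dil q⁻¹ (rootPoly s) with hG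
  have hGdeg : G.natDegree = R := natDegree_dil_rootPoly hqi hs
  have hG1deg : (dil q (rootPoly s)).natDegree = R := natDegree_dil_rootPoly hq hs
  have hev : ∀ c, (dil c (rootPoly s)).eval 0 = 1 := fun c => by rw [eval_dil, eval_rootPoly]; simp
  have hG0 : G ≠ 0 := fun h0 => by have := hev q⁻¹; rw [← hG, h0] at this; simp at this
  obtain ⟨u, v, huv⟩ := hcop
  set c := geomPoly N L with hc
  have hAB : c = (c * v % G) * dil q (rootPoly s) +
      (c * u + (c * v / G) * dil q (rootPoly s)) * G := by
    have e := EuclideanDomain.div_add_mod (c * v) G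
    linear_combination -c * huv - dil q (rootPoly s) * e
  set A := c * v % G with hA
  set B := c * u + (c * v / G) * dil q (rootPoly s) with hB
  have hdiv : G ∣ A + dil (q⁻¹ ^ 2) B := by
    have hc1 : dil (q⁻¹ ^ 2) c = dil (q⁻¹ ^ 2) A * G +
        dil (q⁻¹ ^ 2) B * dil (q⁻¹ ^ 3) (rootPoly s) := by
      conv_lhs => rw [hAB]
      rw [dil_add, dil_mul, dil_mul, hdd, hdd]
      congr 3
      · field_simp
      · ring
    have h1 := h.dvd (N := N) hq hqR hqN
    have h2 : G ∣ (A + dil (q⁻¹ ^ 2) B) * (dil q (rootPoly s) * dil (q⁻¹ ^ 3) (rootPoly s)) := by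
      refine (dvd_add_right (a := G) (b := B * G * dil (q⁻¹ ^ 3) (rootPoly s) +
        dil (q⁻¹ ^ 2) A * G * dil q (rootPoly s)) (Dvd.intro_left
        (B * dil (q⁻¹ ^ 3) (rootPoly s) + dil (q⁻¹ ^ 2) A * dil q (rootPoly s)) (by ring))).mp ?_
      grind
    exact (IsCoprime.mul_right ⟨u, v, huv⟩ hcop').dvd_of_dvd_mul_right h2
  obtain ⟨T, hT⟩ := hdiv
  have hT0 : T.eval 0 = 1 := by
    have e1 := congrArg (eval 0) hT
    have e2 := congrArg (eval 0) hAB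
    have e3 : c.eval 0 = 1 := by
      rw [hc, geomPoly, eval_pow, eval_finsetSum,
        sum_eq_single 0 (fun k _ hk => by simp [hk]) (fun h0 => absurd
        (mem_range.mpr hN) h0)]
      simp
    rw [eval_add, eval_dil, mul_zero, eval_mul, hG, hev, one_mul] at e1
    rw [eval_add, eval_mul, eval_mul, hG, hev, hev, mul_one, mul_one, e3] at e2
    rw [← e1, ← e2]
  have hTne : T ≠ 0 := fun h0 => by rw [h0] at hT0; simp at hT0
  have hdegS : (A + dil (q⁻¹ ^ 2) B).natDegree = R + T.natDegree := by
    rw [hT, natDegree_mul hG0 hTne, hGdeg]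
  have hAdeg : A = 0 ∨ A.natDegree < R := by
    rw [or_iff_not_imp_left]
    intro hA0
    have := degree_mod_lt (c * v) hG0
    rw [← hA, degree_eq_natDegree hA0, degree_eq_natDegree hG0, hGdeg] at this
    exact_mod_cast this
  have hAdeg' : A.natDegree ≤ R := by grind
  have hBG : B = 0 ∨ B.natDegree + R ≤ max (L * (N - 1)) (A.natDegree + R) := by
    rw [or_iff_not_imp_left]
    intro hB0
    have e : (B * G).natDegree = B.natDegree + R := by rw [natDegree_mul hB0 hG0, hGdeg]
    rw [← e, show B * G = c - A * dil q (rootPoly s) by linear_combination -hAB]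
    refine (natDegree_sub_le _ _).trans (max_le_max (natDegree_geomPoly_le N L)
      (natDegree_mul_le.trans ?_))
    rw [hG1deg]
  have hS : (A + dil (q⁻¹ ^ 2) B).natDegree ≤ max A.natDegree B.natDegree :=
    (natDegree_add_le _ _).trans (max_le_max le_rfl (natDegree_dil_le _ _))
  refine ⟨A, B, T, hAB, hT, ?_⟩
  have key : R + T.natDegree + R ≤ L * (N - 1) := by grind
  omega

/-- The coefficients of the generating function at the multiples of `N`. -/
lemma coeff_eq_of_polynomial {q : ℂ} (hq : q ≠ 0) (hqN : q ^ N = 1) {s : Fin R → ℂ}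
    {A B T : ℂ[X]} (hAB : geomPoly N L = A * dil q (rootPoly s) + B * dil q⁻¹ (rootPoly s))
    (hT : A + dil (q⁻¹ ^ 2) B = dil q⁻¹ (rootPoly s) * T) {Φ : PowerSeries ℂ}
    (hΦ : Φ * ((1 - PowerSeries.X) ^ L * (dil q (rootPoly s) : PowerSeries ℂ) *
      (dil q⁻¹ (rootPoly s) : PowerSeries ℂ)) = (1 - PowerSeries.X ^ N) ^ L) (k : ℕ) :
    PowerSeries.coeff (k * N) Φ = T.coeff (k * N) := by
  have hc0 : ∀ c, PowerSeries.constantCoeff (dil c (rootPoly s) : PowerSeries ℂ) = 1 := fun c => by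
    rw [← PowerSeries.coeff_zero_eq_constantCoeff_apply, Polynomial.coeff_coe,
      Polynomial.coeff_zero_eq_eval_zero, eval_dil, eval_rootPoly]
    simp
  have hne : ∀ c, (dil c (rootPoly s) : PowerSeries ℂ) ≠ 0 := fun c h0 => by grind
  have hres : ∀ (c : ℂ) (p : ℂ[X]), PowerSeries.rescale c (p : PowerSeries ℂ) =
      (dil c p : PowerSeries ℂ) := fun c p => by
    ext n
    rw [PowerSeries.coeff_rescale, Polynomial.coeff_coe, Polynomial.coeff_coe, coeff_dil, mul_comm]
  set G1 : PowerSeries ℂ := (dil q (rootPoly s) : PowerSeries ℂ) with hG1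
  set G : PowerSeries ℂ := (dil q⁻¹ (rootPoly s) : PowerSeries ℂ) with hG
  set U : PowerSeries ℂ := (B : PowerSeries ℂ) * G1⁻¹ with hU
  have hU1 : U * G1 = B := by
    rw [hU, mul_assoc, PowerSeries.inv_mul_cancel _ (by rw [hG1, hc0]; exact one_ne_zero), mul_one]
  have hgeom : (geomPoly N L : PowerSeries ℂ) * (1 - PowerSeries.X) ^ L =
      (1 - PowerSeries.X ^ N) ^ L := by
    have := congrArg (fun p : ℂ[X] => (p : PowerSeries ℂ)) (geomPoly_mul N L)
    simpa using this
  have hX : ((1 : PowerSeries ℂ) - PowerSeries.X) ^ L ≠ 0 := pow_ne_zero L fun h0 => by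
    have := congrArg PowerSeries.constantCoeff h0; simp at this
  have h1 : Φ * (G1 * G) = A * G1 + B * G := by
    have e : (geomPoly N L : PowerSeries ℂ) = A * G1 + B * G := by rw [hAB]; simp [hG1, hG]
    rw [← e]
    refine mul_right_cancel₀ hX ?_
    grind
  have h2 : (Φ - U) * G = A := by
    refine mul_right_cancel₀ (hne q) ?_
    grind
  have h3 : PowerSeries.rescale (q⁻¹ ^ 2) U * G = (dil (q⁻¹ ^ 2) B : PowerSeries ℂ) := by
    have := congrArg (PowerSeries.rescale (q⁻¹ ^ 2)) hU1
    rwa [map_mul, hG1, hres, hres, dil_dil, show q * q⁻¹ ^ 2 = q⁻¹ by field_simp] at this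
  have h4 : Φ - U + PowerSeries.rescale (q⁻¹ ^ 2) U = T := by
    refine mul_right_cancel₀ (hne q⁻¹) ?_
    have e := congrArg (fun p : ℂ[X] => (p : PowerSeries ℂ)) hT
    simp only [Polynomial.coe_add, Polynomial.coe_mul] at e
    rw [add_mul, h2, h3, e, mul_comm]
  have h5 := congrArg (PowerSeries.coeff (k * N)) h4
  rw [map_add, map_sub, PowerSeries.coeff_rescale, Polynomial.coeff_coe, ← pow_mul,
    show 2 * (k * N) = N * (2 * k) by ring, pow_mul, inv_pow, hqN, inv_one, one_pow, one_mul,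
    sub_add_cancel] at h5
  exact h5

/-- The sum over the rotations of the argument. -/
lemma sum_rotations {q : ℂ} (hq2 : IsPrimitiveRoot (q ^ 2) N) (hN : 1 ≤ N) {s : Fin R → ℂ}
    {A B T : ℂ[X]} (hAB : geomPoly N L = A * dil q (rootPoly s) + B * dil q⁻¹ (rootPoly s))
    (hT : A + dil (q⁻¹ ^ 2) B = dil q⁻¹ (rootPoly s) * T) {ξ : ℂ}
    (hξ : ∀ j < N, (1 - ξ * (q ^ 2) ^ j) ^ L * (rootPoly s).eval (q⁻¹ * ((q ^ 2) ^ j * ξ)) *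
      (rootPoly s).eval (q * ((q ^ 2) ^ j * ξ)) ≠ 0) :
    ∑ j ∈ range N, (1 - ξ ^ N) ^ L / ((1 - ξ * (q ^ 2) ^ j) ^ L *
      (rootPoly s).eval (q⁻¹ * ((q ^ 2) ^ j * ξ)) * (rootPoly s).eval (q * ((q ^ 2) ^ j * ξ))) =
    ∑ j ∈ range N, T.eval ((q ^ 2) ^ j * ξ) := by
  have hq0 : q ≠ 0 := fun h => hq2.ne_zero (by omega) (by rw [h]; simp)
  set a : ℕ → ℂ := fun j => A.eval ((q ^ 2) ^ j * ξ) /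
    (rootPoly s).eval (q⁻¹ * ((q ^ 2) ^ j * ξ)) with ha
  set b : ℕ → ℂ := fun j => B.eval (q⁻¹ ^ 2 * ((q ^ 2) ^ j * ξ)) /
    (rootPoly s).eval (q⁻¹ * ((q ^ 2) ^ j * ξ)) with hb
  have e : ∀ j, q⁻¹ ^ 2 * ((q ^ 2) ^ (j + 1) * ξ) = (q ^ 2) ^ j * ξ := fun j => by grind
  have e' : ∀ j, q⁻¹ * ((q ^ 2) ^ (j + 1) * ξ) = q * ((q ^ 2) ^ j * ξ) := fun j => by grind
  have h1 : ∀ j ∈ range N, (1 - ξ ^ N) ^ L / ((1 - ξ * (q ^ 2) ^ j) ^ L *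
      (rootPoly s).eval (q⁻¹ * ((q ^ 2) ^ j * ξ)) * (rootPoly s).eval (q * ((q ^ 2) ^ j * ξ))) =
      a j + b (j + 1) := fun j hj => by
    have h0 := hξ j (mem_range.mp hj)
    have hg := congrArg (eval ((q ^ 2) ^ j * ξ)) (geomPoly_mul N L)
    have hc := congrArg (eval ((q ^ 2) ^ j * ξ)) hAB
    simp only [eval_mul, eval_pow, eval_sub, eval_one, eval_X, eval_add, eval_dil] at hg hc
    rw [mul_pow _ _ N, pow_right_comm (q ^ 2) j N, hq2.pow_eq_one, one_pow, one_mul, hc, mul_comm _ ξ] at hg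
    simp only [ha, hb, e, e']
    rw [mul_comm _ ξ] at h0 ⊢
    rw [← hg]
    obtain ⟨⟨h2, h3⟩, h4⟩ : (_ ∧ _) ∧ _ := ⟨mul_ne_zero_iff.mp (mul_ne_zero_iff.mp h0).1,
      (mul_ne_zero_iff.mp h0).2⟩
    generalize (rootPoly s).eval (q * _) = g1 at h4 ⊢
    generalize (rootPoly s).eval (q⁻¹ * _) = g at h3 ⊢
    field_simp
  have h2 : ∀ j ∈ range N, T.eval ((q ^ 2) ^ j * ξ) = a j + b j := fun j hj => by
    have hc := congrArg (eval ((q ^ 2) ^ j * ξ)) hT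
    simp only [eval_mul, eval_add, eval_dil] at hc
    grind
  rw [sum_congr rfl h1, sum_congr rfl h2, sum_add_distrib, sum_add_distrib]
  congr 1
  have h3 : b N = b 0 := by simp only [hb, hq2.pow_eq_one, pow_zero]
  have h4 := sum_range_succ b N
  rw [sum_range_succ', h3] at h4
  exact add_right_cancel h4

/-- The average of a polynomial over the rotations of the argument. -/
lemma sum_eval_rotations {ρ : ℂ} (hρ : IsPrimitiveRoot ρ N) (hN : 1 ≤ N) {T : ℂ[X]} {n : ℕ}
    (hT : T.natDegree ≤ n * N) (ξ : ℂ) : ∑ j ∈ range N, T.eval (ρ ^ j * ξ) =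
      N * ∑ k ∈ range (n + 1), T.coeff (k * N) * ξ ^ (k * N) := by
  have h1 : ∀ f : ℕ → ℂ, (∀ k r, 0 < r → r < N → f (k * N + r) = 0) → ∀ m,
      ∑ i ∈ range (m * N), f i = ∑ k ∈ range m, f (k * N) := fun f hf m => by
    induction m with
    | zero => simp
    | succ m ih =>
      rw [add_mul, one_mul, sum_range_add, ih, sum_range_succ]
      congr 1
      refine (sum_eq_single 0 (fun r hr hr0 => hf m r (Nat.pos_of_ne_zero hr0)
        (mem_range.mp hr)) fun h => absurd (mem_range.mpr hN) h).trans (by simp)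
  have h2 : ∀ j, T.eval (ρ ^ j * ξ) =
      ∑ i ∈ range ((n + 1) * N), T.coeff i * ξ ^ i * (ρ ^ i) ^ j := fun j => by
    rw [eval_eq_sum_range' (n := (n + 1) * N) (by rw [add_mul]; omega)]
    refine sum_congr rfl fun i _ => ?_
    rw [mul_pow, pow_right_comm]; ring
  simp only [h2]
  rw [sum_comm]
  simp only [← mul_sum]
  rw [h1, mul_sum]
  · refine sum_congr rfl fun k _ => ?_
    simp only [mul_comm k N, pow_mul ρ, hρ.pow_eq_one, one_pow]
    simp [mul_comm]
  · intro k r hr0 hr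
    have h3 : ρ ^ (k * N + r) = ρ ^ r := by
      rw [pow_add, pow_mul, pow_right_comm, hρ.pow_eq_one, one_pow, one_mul]
    have h4 : ρ ^ r ≠ 1 := fun h => absurd (Nat.le_of_dvd hr0 (hρ.dvd_of_pow_eq_one r h)) (by omega)
    have h5 := geom_sum_mul (ρ ^ r) N
    rw [pow_right_comm, hρ.pow_eq_one, one_pow, sub_self] at h5
    grind

end DrinfeldPolynomial

/-! ### The generating function of the eigenvalues -/

section GeneratingFunction

variable {N L R : ℕ}

lemma Expands.unique {f : ℂ → ℂ} {F G : PowerSeries ℂ} (hF : Expands f F) (hG : Expands f G) :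
    F = G := by
  have h := hF.add ((expands_const (-1)).mul hG)
  have h1 := h.eq_zero (Eventually.of_forall fun σ => by simp)
  rw [map_neg, map_one, neg_one_mul, ← sub_eq_add_neg] at h1
  exact sub_eq_zero.mp h1

lemma expands_linear (c : ℂ) : Expands (fun σ => 1 - c * σ) (1 - PowerSeries.C c * PowerSeries.X) :=
  (expandsTo_linear (l := 𝓝 0) (c := fun _ => c) tendsto_const_nhds).expands

lemma expands_prod {α : Type*} {f : α → ℂ → ℂ} {F : α → PowerSeries ℂ} (A : Finset α)
    (h : ∀ i, Expands (f i) (F i)) : Expands (fun σ => ∏ i ∈ A, f i σ) (∏ i ∈ A, F i) :=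
  (expandsTo_prod (l := 𝓝 (0 : ℂ)) (φ := fun i _ => f i) A fun i _ => ⟨fun _ => F i,
    fun _ => tendsto_const_nhds, Eventually.of_forall fun _ => h i⟩).expands

lemma expands_pow {f : ℂ → ℂ} {F : PowerSeries ℂ} (h : Expands f F) (n : ℕ) :
    Expands (fun σ => f σ ^ n) (F ^ n) := by simpa using expands_prod (range n) fun _ => h

lemma coe_dil_rootPoly (c : ℂ) (s : Fin R → ℂ) : (dil c (rootPoly s) : PowerSeries ℂ) =
    ∏ i, (1 - PowerSeries.C ((s i)⁻¹ * c) * PowerSeries.X) := by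
  rw [dil_rootPoly, ← Polynomial.coeToPowerSeries.ringHom_apply, map_prod]
  simp

lemma expands_rootPoly (c : ℂ) (s : Fin R → ℂ) :
    Expands (fun x => (rootPoly s).eval (c * x)) (dil c (rootPoly s) : PowerSeries ℂ) := by
  rw [coe_dil_rootPoly]
  refine (expands_prod univ fun i => expands_linear ((s i)⁻¹ * c)).congr
    (Eventually.of_forall fun x => ?_)
  simp only [eval_rootPoly, mul_assoc]

lemma one_sub_pow_eq_prod {ρ : ℂ} (hρ : IsPrimitiveRoot ρ N) (hN : 1 ≤ N) (x : ℂ) :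
    (1 - x) * ∏ i ∈ range (N - 1), (1 - ρ ^ (i + 1) * x) = 1 - x ^ N := by
  have h := congrArg (Polynomial.eval 1) (X_pow_sub_C_eq_prod hρ (α := x) hN rfl)
  obtain ⟨M, rfl⟩ := Nat.exists_eq_add_of_le' hN
  rw [Polynomial.eval_prod, prod_range_succ'] at h
  simp only [Polynomial.eval_sub, Polynomial.eval_pow, Polynomial.eval_X, Polynomial.eval_C,
    one_pow, pow_zero, one_mul] at h
  rw [h, mul_comm]; rfl

/-- The eigenvalues are the coefficients of the generating function. -/
lemma coeff_stringTerm {q : ℂ} (hN : 1 ≤ N) (hq : IsPrimitiveRoot q N)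
    (hq2 : IsPrimitiveRoot (q ^ 2) N) {s : Fin R → ℂ} {F₀ : PowerSeries ℂ} {m : ℕ}
    (hF₀ : Expands (fun σ => stringTerm q s (fun x => (1 - q ^ (N - 1) * x) ^ L) (N - 1) m
      univ ∅ ∅ σ) F₀) :
    PowerSeries.rescale q⁻¹ F₀ * ((1 - PowerSeries.X) ^ L *
      (dil q (rootPoly s) : PowerSeries ℂ) * (dil q⁻¹ (rootPoly s) : PowerSeries ℂ)) =
      (1 - PowerSeries.X ^ N) ^ L := by
  have hq0 : q ≠ 0 := hq.ne_zero (by omega)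
  have hp : q ^ (N - 1) = q⁻¹ := eq_inv_of_mul_eq_one_left (by
    rw [← pow_succ, Nat.sub_add_cancel hN, hq.pow_eq_one])
  have h0 : Tendsto (fun x : ℂ => q⁻¹ * x) (𝓝 0) (𝓝 0) := by
    have h := (continuous_const_mul q⁻¹).tendsto (0 : ℂ)
    grind
  have h1 : Expands (fun x => stringTerm q s (fun x => (1 - q ^ (N - 1) * x) ^ L) (N - 1) m
      univ ∅ ∅ (q⁻¹ * x)) (PowerSeries.rescale q⁻¹ F₀) := by
    filter_upwards [h0.eventually hF₀] with σ hσ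
    simpa only [PowerSeries.coeff_rescale, mul_pow, mul_left_comm, mul_assoc] using hσ
  have hX : Expands (fun x => 1 - x) (1 - PowerSeries.X) := by simpa using expands_linear 1
  have h2 := h1.mul (((expands_pow hX L).mul (expands_rootPoly q s)).mul (expands_rootPoly q⁻¹ s))
  refine h2.unique ((expands_pow ?_ L).congr ?_ (f := fun x => (1 - x ^ N) ^ L))
  · have := (expands_const 1).add (expands_monomial N (-1))
    rw [map_one, map_neg, ← PowerSeries.X_pow_eq, ← sub_eq_add_neg] at this
    grind
  have h3 : ∀ c, ∀ᶠ x in 𝓝 (0 : ℂ), (rootPoly s).eval (c * x) ≠ 0 := fun c => by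
    have : ContinuousAt (fun x => (rootPoly s).eval (c * x)) 0 := by fun_prop
    exact this.eventually_ne (by rw [eval_rootPoly]; simp)
  filter_upwards [h3 q, h3 q⁻¹] with x hx hx'
  have e1 : ∀ i, strFac q (q⁻¹ * x) (s i) (0 + 1) = 1 - (s i)⁻¹ * (q⁻¹ * x) := fun i => by
    rw [strFac_succ hq0]; ring
  have e2 : ∀ i, strFac q (q⁻¹ * x) (s i) 0 = 1 - (s i)⁻¹ * (q * x) := fun i => by
    rw [strFac]; field_simp
  have hρ : IsPrimitiveRoot (q ^ 2)⁻¹ N := hq2.inv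
  rw [← one_sub_pow_eq_prod hρ hN x]
  simp only [stringTerm, splitTerm, card_empty, range_zero, prod_empty,
    sdiff_empty, div_one, e1, e2, prod_inv_distrib, prod_mul_distrib,
    ← eval_rootPoly]
  have e3 : ∀ i, (1 - q ^ (N - 1) * ((q ^ 2)⁻¹ ^ i * (q⁻¹ * x))) ^ L =
      (1 - (q ^ 2)⁻¹ ^ (i + 1) * x) ^ L := fun i => by
    rw [hp, pow_succ (q ^ 2)⁻¹ i]; congr 2; generalize (q ^ 2)⁻¹ ^ i = y; field_simp
  rw [prod_congr rfl fun i _ => e3 i, prod_pow, mul_pow]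
  simp only [mul_inv, pow_zero, Nat.choose_zero_succ, mul_one]
  generalize (rootPoly s).eval (q * x) = a at hx ⊢
  generalize (rootPoly s).eval (q⁻¹ * x) = b at hx' ⊢
  generalize (∏ i ∈ range (N - 1), (1 - (q ^ 2)⁻¹ ^ (i + 1) * x)) = p
  field_simp

end GeneratingFunction

/-! ### The Bethe state as a highest weight vector -/

section HighestWeight

variable {N L R : ℕ}

lemma rootHalf_sq (N : ℕ) : rootHalf N ^ 2 = rootQ N := by
  rw [rootHalf, rootQ, ← Complex.exp_nat_mul]
  grind

lemma IsRegularBetheSolution.isPolyBethe (hN : 1 ≤ N) (hq : IsPrimitiveRoot (rootQ N) N)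
    (hL : N ∣ L) {z : Fin R → ℂ} (h : IsRegularBetheSolution N L z) :
    IsPolyBethe L (rootQ N) (fun i => (z i ^ 2)⁻¹) := by
  obtain ⟨hz, hd, hl, hr, hb⟩ := h
  have hp : rootQ N ^ (N - 1) = (rootQ N)⁻¹ := eq_inv_of_mul_eq_one_left (by
    rw [← pow_succ, Nat.sub_add_cancel hN, hq.pow_eq_one])
  have hq0 : rootQ N ≠ 0 := hq.ne_zero (by omega)
  have hqL : rootQ N ^ L = 1 := (hq.pow_eq_one_iff_dvd L).mpr hL
  generalize rootQ N = q at *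
  have hx : ∀ i, z i ^ 2 ≠ 0 := fun i => pow_ne_zero 2 (hz i)
  have hn : ∀ i k, i ≠ k → z i ^ 2 * q ^ 2 - z k ^ 2 ≠ 0 := fun i k hik h0 =>
    hr k i hik.symm (by linear_combination -h0)
  have e1 : ∀ i, z i ^ 2 * q⁻¹ - 1 = z i ^ 2 * q⁻¹ * (1 - q * (z i ^ 2)⁻¹) := fun i => by grind
  have e2 : ∀ i, z i ^ 2 - q⁻¹ = z i ^ 2 * (1 - q⁻¹ * (z i ^ 2)⁻¹) := fun i => by grind
  have e3 : ∀ i k, z i ^ 2 * q ^ 2 - z k ^ 2 =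
      z i ^ 2 * z k ^ 2 * q * (q * (z k ^ 2)⁻¹ - q⁻¹ * (z i ^ 2)⁻¹) := fun i k => by
    have := hz i; have := hz k; field_simp
  have e4 : ∀ i k, z i ^ 2 - z k ^ 2 * q ^ 2 =
      z i ^ 2 * z k ^ 2 * q * (q⁻¹ * (z k ^ 2)⁻¹ - q * (z i ^ 2)⁻¹) := fun i k => by
    have := hz i; have := hz k; field_simp
  have hb' : ∀ i, ((1 - q * (z i ^ 2)⁻¹) / (1 - q⁻¹ * (z i ^ 2)⁻¹)) ^ L =
      (∏ k ∈ univ.erase i, (q * (z k ^ 2)⁻¹ - q⁻¹ * (z i ^ 2)⁻¹)) /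
        ∏ k ∈ univ.erase i, (q⁻¹ * (z k ^ 2)⁻¹ - q * (z i ^ 2)⁻¹) := fun i => by
    have h1 := hb i
    rw [hp, hqL, one_mul, e1, e2, mul_div_mul_comm, mul_div_cancel_left₀ _ (hx i), mul_pow, inv_pow,
      hqL, inv_one, one_mul] at h1
    rw [h1, ← prod_div_distrib]
    refine prod_congr rfl fun k _ => ?_
    rw [e3, e4, mul_div_mul_left _ _ (mul_ne_zero (mul_ne_zero (hx i) (hx k)) hq0)]
  have hP : ∀ i, ∏ k ∈ univ.erase i, (q * (z k ^ 2)⁻¹ - q⁻¹ * (z i ^ 2)⁻¹) ≠ 0 := fun i =>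
    prod_ne_zero_iff.mpr fun k hk h0 => hn i k (ne_of_mem_erase hk).symm (by rw [e3, h0, mul_zero])
  have hQ : ∀ i, ∏ k ∈ univ.erase i, (q⁻¹ * (z k ^ 2)⁻¹ - q * (z i ^ 2)⁻¹) ≠ 0 := fun i =>
    prod_ne_zero_iff.mpr fun k hk h0 => hr i k (ne_of_mem_erase hk).symm (by rw [e4, h0, mul_zero])
  have hB : ∀ i, 1 - q⁻¹ * (z i ^ 2)⁻¹ ≠ 0 := fun i h0 => hl i (by rw [hp, e2, h0, mul_zero])
  refine ⟨fun i => inv_ne_zero (hx i), fun i j hij => ?_, fun i k hik h0 => hn i k hik (by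
    rw [e3, h0, mul_zero]), fun i => ?_, fun i h0 => ?_⟩
  · grind
  · have h1 := hb' i
    rw [div_pow, div_eq_div_iff (pow_ne_zero L (hB i)) (hQ i)] at h1
    grind
  · have h1 := hb' i
    rw [div_pow, h0, zero_div] at h1
    grind

lemma fSeries_eq (z : Fin R → ℂ) (a : ℂ) :
    fSeries z a = (dil a (rootPoly fun i => (z i ^ 2)⁻¹) : PowerSeries ℂ) := by
  rw [coe_dil_rootPoly, fSeries]
  simp only [inv_inv, mul_comm a]

lemma fFun_eq (z : Fin R → ℂ) (a : ℂ) : fFun z a = (rootPoly fun i => (z i ^ 2)⁻¹).eval a := by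
  rw [eval_rootPoly, fFun]
  grind

/-- The characterization of the generating function of the `χ_m`. -/
lemma coeff_eq_chi {z : Fin R → ℂ} {Φ : PowerSeries ℂ}
    (h : Φ * ((1 - PowerSeries.X) ^ L *
      (dil (rootQ N) (rootPoly fun i => (z i ^ 2)⁻¹) : PowerSeries ℂ) *
      (dil (rootQ N)⁻¹ (rootPoly fun i => (z i ^ 2)⁻¹) : PowerSeries ℂ)) =
      (1 - PowerSeries.X ^ N) ^ L) (m : ℕ) : PowerSeries.coeff m Φ = chi N L z m := by
  rw [chi, fSeries_eq, fSeries_eq, ← h, mul_assoc Φ, PowerSeries.mul_inv_cancel, mul_one]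
  rw [← fSeries_eq, ← fSeries_eq]
  simp [fSeries, map_prod]

lemma opA_sq_mulVec {t : ℂ} (hN : 1 ≤ N) (hq : (t ^ 2) ^ N = 1) (hL : N ∣ L) (hR : N ∣ R)
    {Ω : Conf N L → ℂ} (h : ∀ σ, Ω σ ≠ 0 → ∑ i, (σ i : ℕ) = R) :
    (opA N L t ^ 2).mulVec Ω = Ω := by
  have ht : t ≠ 0 := by rintro rfl; simp [show N ≠ 0 by omega] at hq
  have e : opA N L t = diagonal fun σ => ∏ i : Fin L, t ^ (1 * ((N : ℤ) - 1 - 2 * (σ i : ℕ))) :=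
    tensorOp_diagonal _
  ext σ
  rw [e, Matrix.diagonal_pow, mulVec_diagonal, Pi.pow_apply, ← prod_pow]
  by_cases hσ : Ω σ = 0
  · rw [hσ, mul_zero]
  have e1 : ∀ i, (t ^ (1 * ((N : ℤ) - 1 - 2 * (σ i : ℕ)))) ^ 2 =
      (t ^ 2) ^ (N - 1) * (((t ^ 2) ^ 2)⁻¹) ^ (σ i : ℕ) := fun i => by
    have e2 : (N : ℤ) - 1 - 2 * (σ i : ℕ) = ((N - 1 : ℕ) : ℤ) - ((2 * (σ i : ℕ) : ℕ) : ℤ) := by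
      grind
    rw [one_mul, e2, zpow_sub₀ ht, zpow_natCast, zpow_natCast, div_pow, pow_right_comm,
      ← pow_mul t _ 2, mul_right_comm, pow_mul, ← pow_mul t 2 2, inv_pow, div_eq_mul_inv]
  have hp : ∀ {m}, N ∣ m → (t ^ 2) ^ m = 1 := fun {m} ⟨c, hc⟩ => by rw [hc, pow_mul, hq, one_pow]
  rw [prod_congr rfl fun i _ => e1 i, prod_mul_distrib, prod_const,
    prod_pow_eq_pow_sum, h σ hσ, card_univ, Fintype.card_fin, pow_right_comm, hp hL, one_pow,
    inv_pow, pow_right_comm, hp hR, one_pow, inv_one, one_mul, one_mul]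

lemma hatH1_mulVec {Ω : Conf N L → ℂ} (h : ∀ σ, Ω σ ≠ 0 → ∑ i, (σ i : ℕ) = R) :
    (hatH1 N L).mulVec Ω = (((L : ℂ) * ((N : ℂ) - 1) - 2 * (R : ℂ)) / (N : ℂ)) • Ω := by
  have e : ∀ i : Fin L, siteOp i (hHat N) =
      diagonal fun σ : Conf N L => (N : ℂ) - 1 - 2 * ((σ i : ℕ) : ℂ) := fun i => by
    have := tensorOp_diagonal fun (j : Fin L) (σ : Fin N) =>
      if j = i then (N : ℂ) - 1 - 2 * ((σ : ℕ) : ℂ) else 1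
    simp only [prod_ite_eq', mem_univ, if_true] at this
    rw [← this, siteOp]
    congr 1; ext1 j
    by_cases hj : j = i
    · subst hj; simp [hHat]
    · simp [hj]
  ext σ
  rw [hatH1, smul_mulVec, Matrix.sum_mulVec, Pi.smul_apply, Finset.sum_apply,
    Pi.smul_apply, sum_congr rfl fun i _ => by rw [e, mulVec_diagonal]]
  by_cases hσ : Ω σ = 0
  · simp [hσ]
  rw [← sum_mul, sum_sub_distrib, ← mul_sum, ← Nat.cast_sum, h σ hσ]
  simp only [sum_const, card_univ, Fintype.card_fin, nsmul_eq_mul, smul_eq_mul]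
  ring

end HighestWeight

section Eigenvalues

variable {N L R : ℕ}

lemma IsPolyBethe.limit_eigen (hN : Odd N) (h3 : 3 ≤ N) {t : ℂ} (hq : IsPrimitiveRoot (t ^ 2) N)
    (hR : N ∣ R) {s : Fin R → ℂ} (h : IsPolyBethe L (t ^ 2) s) {X Y : Op N L}
    (hX : Tendsto (divPow N L (bInf N L 1)) (𝓝[≠] t) (𝓝 X))
    (hY : Tendsto (divPow N L (cInf N L 1)) (𝓝[≠] t) (𝓝 Y)) :
    Y.mulVec (((ofFn fun i => homMat N L t (s i) 0 1).prod).mulVec (vac N L)) = 0 ∧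
    ∀ k, ∃ Φ : PowerSeries ℂ, Φ * ((1 - PowerSeries.X) ^ L *
      (dil (t ^ 2) (rootPoly s) : PowerSeries ℂ) *
      (dil (t ^ 2)⁻¹ (rootPoly s) : PowerSeries ℂ)) = (1 - PowerSeries.X ^ N) ^ L ∧
      (Y ^ k * X ^ k).mulVec (((ofFn fun i => homMat N L t (s i) 0 1).prod).mulVec (vac N L)) =
      ((k.factorial : ℂ) ^ 2 * ((-1) ^ k * PowerSeries.coeff (k * N) Φ)) •
        ((ofFn fun i => homMat N L t (s i) 0 1).prod).mulVec (vac N L) := by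
  have : NeZero N := ⟨by omega⟩
  have hq0 : t ^ 2 ≠ 0 := hq.ne_zero (by omega)
  have ht : t ≠ 0 := by rintro rfl; simp at hq0
  have hq2 : IsPrimitiveRoot ((t ^ 2) ^ 2) N := hq.pow_of_coprime 2 (Nat.coprime_two_left.mpr hN)
  have hq4 : (t ^ 2) ^ 4 ≠ 1 := fun h4 => by
    have := Nat.le_of_dvd (by norm_num) (hq2.dvd_of_pow_eq_one 2 (by rw [← pow_mul]; exact h4))
    omega
  have hs := h.isBetheRoots ht (by omega) hq.pow_eq_one hR
  rw [offShell_univ ht (sub_inv_ne_zero_of_primitive h3 hq) hq4 h.ne_zero]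
  refine ⟨hs.limit_mulVec_eq_zero h3 hq hY, fun k => ?_⟩
  obtain ⟨F, hF⟩ := exists_expandsTo_stringTerm (N := N) (L := L) ht s (k * N) univ ∅ ∅
  refine ⟨_, coeff_stringTerm (by omega) hq hq2 hF.expands, ?_⟩
  rw [hs.limit_pow_mulVec hN h3 hq hX hY k hF.expands, PowerSeries.coeff_rescale, inv_pow,
    mul_comm k N, pow_mul, hq.pow_eq_one, one_pow, inv_one, one_mul]

/-- The lowering operators of the other half of the loop algebra. -/
lemma IsPolyBethe.limit_eigen_gauge (hN : Odd N) (h3 : 3 ≤ N) {t : ℂ}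
    (hq : IsPrimitiveRoot (t ^ 2) N) (hL : N ∣ L) (hR : N ∣ R) {s : Fin R → ℂ}
    (h : IsPolyBethe L (t ^ 2) s) {X Y : Op N L}
    (hX : Tendsto (divPow N L (bInf N L 1)) (𝓝[≠] t⁻¹) (𝓝 X))
    (hY : Tendsto (divPow N L (cInf N L 1)) (𝓝[≠] t⁻¹) (𝓝 Y)) :
    (gauge N L t⁻¹ * Y * gauge N L t).mulVec
      (((ofFn fun i => homMat N L t (s i) 0 1).prod).mulVec (vac N L)) = 0 ∧
    ∀ k, ∃ c : ℂ, ((gauge N L t⁻¹ * Y * gauge N L t) ^ k *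
      (gauge N L t⁻¹ * X * gauge N L t) ^ k).mulVec
        (((ofFn fun i => homMat N L t (s i) 0 1).prod).mulVec (vac N L)) =
      c • ((ofFn fun i => homMat N L t (s i) 0 1).prod).mulVec (vac N L) := by
  have : NeZero N := ⟨by omega⟩
  have hq0 : t ^ 2 ≠ 0 := hq.ne_zero (by omega)
  have ht : t ≠ 0 := by rintro rfl; simp at hq0
  have hqi : IsPrimitiveRoot (t⁻¹ ^ 2) N := by rw [inv_pow]; exact hq.inv
  have hi : IsPolyBethe L (t⁻¹ ^ 2) (fun i => (s i)⁻¹) := by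
    rw [inv_pow]; exact h.inv hq0 ((hq.pow_eq_one_iff_dvd L).mpr hL)
  obtain ⟨h1, h2⟩ := hi.limit_eigen hN h3 hqi hR hX hY
  have g1 := gauge_mul_gauge (N := N) (L := L) ht
  have g2 := gauge_mul_gauge (N := N) (L := L) (inv_ne_zero ht)
  rw [inv_inv] at g2
  have hg := gauge_mulVec (N := N) (L := L) ht h.ne_zero
  have hconj : ∀ (Z : Op N L) (k : ℕ), (gauge N L t⁻¹ * Z * gauge N L t) ^ k =
      gauge N L t⁻¹ * Z ^ k * gauge N L t := fun Z k => by
    induction k with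
    | zero => rw [pow_zero, pow_zero, mul_one, g2]
    | succ k ih =>
      grind
  refine ⟨?_, fun k => ?_⟩
  · rw [← mulVec_mulVec, hg, mulVec_smul, ← mulVec_mulVec, h1, Matrix.mulVec_zero, smul_zero]
  · obtain ⟨Φ, -, h4⟩ := h2 k
    have e : (gauge N L t⁻¹ * Y ^ k * gauge N L t) * (gauge N L t⁻¹ * X ^ k * gauge N L t) =
        gauge N L t⁻¹ * (Y ^ k * X ^ k) * gauge N L t := by
      simp only [mul_assoc]
      rw [← mul_assoc (gauge N L t), g1, one_mul]
    refine ⟨(k.factorial : ℂ) ^ 2 * ((-1) ^ k * PowerSeries.coeff (k * N) Φ), ?_⟩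
    rw [hconj, hconj, e, ← mulVec_mulVec, hg, mulVec_smul, ← mulVec_mulVec,
      h4, mulVec_smul, smul_comm, ← mulVec_smul, ← hg, mulVec_mulVec, g2,
      Matrix.one_mulVec]

end Eigenvalues

end NBS

end

theorem proposition2 (N L R : ℕ) (hN : Odd N) (hN3 : 3 ≤ N) (hL : N ∣ L) (hR : N ∣ R)
    (z : Fin R → ℂ) (hz : NBS.IsRegularBetheSolution N L z) :
    -- the limits that define the action of the Chevalley generators exist
    NBS.HasDivPowLim N L (NBS.bInf N L 1) ∧ NBS.HasDivPowLim N L (NBS.bInf N L (-1)) ∧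
    NBS.HasDivPowLim N L (NBS.cInf N L 1) ∧ NBS.HasDivPowLim N L (NBS.cInf N L (-1)) ∧
    -- the Bethe state is a highest weight vector
    NBS.IsHighestWeightVector N L (NBS.betheState N L (NBS.rootHalf N) z) ∧
    -- `n = (L (N - 1) - 2 R) / N` is a natural number
    ∃ n : ℕ, (N : ℤ) * n = (L : ℤ) * ((N : ℤ) - 1) - 2 * (R : ℤ) ∧
      (NBS.hatH1 N L).mulVec (NBS.betheState N L (NBS.rootHalf N) z) =
        (((L : ℂ) * ((N : ℂ) - 1) - 2 * (R : ℂ)) / (N : ℂ)) •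
          NBS.betheState N L (NBS.rootHalf N) z ∧
      (∀ k : ℕ, (NBS.eePow N L k).mulVec (NBS.betheState N L (NBS.rootHalf N) z) =
        ((-1) ^ k * NBS.chi N L z (k * N)) • NBS.betheState N L (NBS.rootHalf N) z) ∧
      ∃ P : Polynomial ℂ, NBS.IsPD N L (NBS.betheState N L (NBS.rootHalf N) z) P ∧
        (∀ ξ : ℂ, P.eval (ξ ^ N) =
          ∑ k ∈ Finset.range (n + 1), NBS.chi N L z (k * N) * ξ ^ (k * N)) ∧
        (∀ ξ : ℂ, (∀ j < N, NBS.pdDenom N L z ξ j ≠ 0) →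
          P.eval (ξ ^ N) =
            (1 / (N : ℂ)) * ∑ j ∈ Finset.range N, (1 - ξ ^ N) ^ L / NBS.pdDenom N L z ξ j) := by
  have hN0 : N ≠ 0 := by omega
  have : NeZero N := ⟨hN0⟩
  have hQ : IsPrimitiveRoot (NBS.rootQ N) N := Complex.isPrimitiveRoot_exp N hN0
  have hq : IsPrimitiveRoot (NBS.rootHalf N ^ 2) N := by rw [NBS.rootHalf_sq]; exact hQ
  have hq2 : IsPrimitiveRoot (NBS.rootQ N ^ 2) N :=
    hQ.pow_of_coprime 2 (Nat.coprime_two_left.mpr hN)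
  have hqi : IsPrimitiveRoot ((NBS.rootHalf N)⁻¹ ^ 2) N := by rw [inv_pow]; exact hq.inv
  have ht : NBS.rootHalf N ≠ 0 := Complex.exp_ne_zero _
  have hQ0 : NBS.rootQ N ≠ 0 := Complex.exp_ne_zero _
  have hp := hz.isPolyBethe (by omega) hQ hL
  have hp' := hp
  rw [← NBS.rootHalf_sq] at hp'
  obtain ⟨⟨X, hX⟩, Y', hY'⟩ := NBS.exists_tendsto_divPow (L := L) hN hN3 hq
  obtain ⟨⟨X', hX'⟩, Y, hY⟩ := NBS.exists_tendsto_divPow (L := L) hN hN3 hqi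
  rw [inv_inv] at hY
  have hXm := NBS.tendsto_divPow_gauge (Y := NBS.bInf N L (-1)) ht
    (fun t h => NBS.bInf_mul_gauge h 1) hX'
  have hYm := NBS.tendsto_divPow_gauge (Y := NBS.cInf N L (-1)) ht
    (fun t h => NBS.cInf_mul_gauge h 1) hY'
  have hE0 : NBS.hatE0 N L = X := hX.limUnder_eq
  have hE1 : NBS.hatE1 N L = Y := hY.limUnder_eq
  have hF1 : NBS.hatF1 N L = _ := hXm.limUnder_eq
  have hF0 : NBS.hatF0 N L = _ := hYm.limUnder_eq
  obtain ⟨hE, hEE⟩ := hp'.limit_eigen hN hN3 hq hR hX hY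
  obtain ⟨hF, hFF⟩ := hp'.limit_eigen_gauge hN hN3 hq hL hR hX' hY'
  obtain ⟨A, B, T, hAB, hT, hdeg, hLR⟩ := hp.exists_polynomial hQ0
    (fun h => by have := Nat.le_of_dvd (by norm_num) (hQ.dvd_of_pow_eq_one 2 h); omega)
    ((hQ.pow_eq_one_iff_dvd R).mpr hR) hQ.pow_eq_one (by omega)
  have hne := hp'.offShell_ne_zero hN hN3 hq hL hR hLR
  have hb := NBS.betheState_eq (N := N) (L := L) ht hz.ne_zero
  have hw : ∀ σ, NBS.betheState N L (NBS.rootHalf N) z σ ≠ 0 → ∑ i, (σ i : ℕ) = R := fun σ h => by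
    rw [hb, Pi.smul_apply] at h
    exact NBS.weight_eq_of_ne_zero ht (right_ne_zero_of_smul h)
  have hH := NBS.hatH1_mulVec hw
  have hee : ∀ k : ℕ, (NBS.hatE1 N L ^ k * NBS.hatE0 N L ^ k).mulVec
      (NBS.betheState N L (NBS.rootHalf N) z) = ((k.factorial : ℂ) ^ 2 * ((-1) ^ k *
        NBS.chi N L z (k * N))) • NBS.betheState N L (NBS.rootHalf N) z := fun k => by
    obtain ⟨Φ, h1, h2⟩ := hEE k
    rw [NBS.rootHalf_sq] at h1
    rw [hE0, hE1, hb, Matrix.mulVec_smul, h2, NBS.coeff_eq_chi h1, smul_comm]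
  have hchi : ∀ k, NBS.chi N L z (k * N) = T.coeff (k * N) := fun k => by
    obtain ⟨Φ, h1, -⟩ := hEE k
    rw [NBS.rootHalf_sq] at h1
    rw [← NBS.coeff_eq_chi h1, NBS.coeff_eq_of_polynomial hQ0 hQ.pow_eq_one hAB hT h1]
  obtain ⟨n, hn⟩ : ∃ n, L * (N - 1) - 2 * R = n * N := by
    obtain ⟨n, hn⟩ := Nat.dvd_sub (hL.mul_right (N - 1)) (hR.mul_left 2)
    exact ⟨n, by rw [hn, mul_comm]⟩
  have hn1 : L * (N - 1) = n * N + 2 * R := by omega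
  have hn2 : (L : ℤ) * ((N : ℤ) - 1) = n * N + 2 * R := by
    have := congrArg (Nat.cast (R := ℤ)) hn1
    push_cast [Nat.cast_sub (show 1 ≤ N by omega)] at this
    exact this
  have hn3 : (((L : ℂ) * ((N : ℂ) - 1) - 2 * (R : ℂ)) / (N : ℂ)) = n := by
    have h1 : (L : ℂ) * ((N : ℂ) - 1) = n * N + 2 * R := by exact_mod_cast hn2
    rw [h1, add_sub_cancel_right, mul_div_cancel_right₀ _ (Nat.cast_ne_zero.mpr hN0)]
  have hee' : ∀ k : ℕ, (NBS.eePow N L k).mulVec (NBS.betheState N L (NBS.rootHalf N) z) =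
      ((-1) ^ k * NBS.chi N L z (k * N)) • NBS.betheState N L (NBS.rootHalf N) z := fun k => by
    rw [NBS.eePow, Matrix.smul_mulVec, hee, smul_smul, inv_mul_cancel_left₀
      (pow_ne_zero 2 (Nat.cast_ne_zero.mpr k.factorial_ne_zero))]
  have hP : ∀ ξ : ℂ, (∑ k ∈ Finset.range (n + 1), Polynomial.C ((-1) ^ k * NBS.chi N L z (k * N)) *
      (-Polynomial.X) ^ k).eval (ξ ^ N) =
      ∑ k ∈ Finset.range (n + 1), NBS.chi N L z (k * N) * ξ ^ (k * N) := fun ξ => by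
    rw [Polynomial.eval_finsetSum]
    refine Finset.sum_congr rfl fun k _ => ?_
    rw [Polynomial.eval_mul, Polynomial.eval_C, Polynomial.eval_pow, Polynomial.eval_neg,
      Polynomial.eval_X, mul_right_comm, ← mul_pow, neg_one_mul, neg_neg, ← pow_mul, mul_comm N k,
      mul_comm]
  refine ⟨tendsto_nhds_limUnder ⟨_, hX⟩, tendsto_nhds_limUnder ⟨_, hXm⟩,
    tendsto_nhds_limUnder ⟨_, hY⟩, tendsto_nhds_limUnder ⟨_, hYm⟩, ⟨?_, ?_, ?_, ?_, ⟨_, hH⟩,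
    fun k => ⟨_, hee k⟩, fun k => ?_⟩, n, by linear_combination -hn2, hH, hee',
    _, ⟨n, _, by rw [hH, hn3], fun k _ => hee' k, rfl⟩, hP, fun ξ hξ => ?_⟩
  · rw [hb]
    exact smul_ne_zero (Finset.prod_ne_zero_iff.mpr fun i _ =>
      mul_ne_zero (inv_ne_zero (hz.ne_zero i)) (pow_ne_zero _ (hz.ne_zero i))) hne
  · exact NBS.opA_sq_mulVec (by omega) hq.pow_eq_one hL hR hw
  · rw [hE1, hb, Matrix.mulVec_smul, hE, smul_zero]
  · rw [hF0, hb, Matrix.mulVec_smul, hF, smul_zero]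
  · obtain ⟨c, hc⟩ := hFF k
    exact ⟨c, by rw [hF0, hF1, hb, Matrix.mulVec_smul, hc, smul_comm]⟩
  · have e : ∀ j, NBS.pdDenom N L z ξ j = (1 - ξ * (NBS.rootQ N ^ 2) ^ j) ^ L *
        (NBS.rootPoly fun i => (z i ^ 2)⁻¹).eval ((NBS.rootQ N)⁻¹ * ((NBS.rootQ N ^ 2) ^ j * ξ)) *
        (NBS.rootPoly fun i => (z i ^ 2)⁻¹).eval (NBS.rootQ N * ((NBS.rootQ N ^ 2) ^ j * ξ)) :=
      fun j => by
        have e1 : NBS.rootQ N ^ (2 * (j : ℤ)) = (NBS.rootQ N ^ 2) ^ j := by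
          rw [zpow_mul, zpow_natCast]; norm_cast
        have e2 : ∀ x : ℂ, ξ * ((NBS.rootQ N ^ 2) ^ j * x) = x * ((NBS.rootQ N ^ 2) ^ j * ξ) :=
          fun x => by ring
        rw [NBS.pdDenom, NBS.fFun_eq, NBS.fFun_eq, pow_mul, zpow_sub_one₀ hQ0, zpow_add_one₀ hQ0,
          e1, e2, e2]
    simp only [e] at hξ ⊢
    rw [hP, NBS.sum_rotations hq2 (by omega) hAB hT hξ, NBS.sum_eval_rotations hq2 (by omega)
      (hdeg.trans hn.le), one_div, inv_mul_cancel_left₀ (Nat.cast_ne_zero.mpr hN0)]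
    exact Finset.sum_congr rfl fun k _ => by rw [hchi]
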